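/- Let $n\ge 1$ be an integer, let $\Lambda\le 0$ and $K\ne 0$ be real numbers, and consider the system $$a_u=\tfrac12 a(b^2+c^2-a^2),\qquad b_u=\tfrac12 b(c^2+a^2-b^2),\qquad c_u=\tfrac12 nc\Big(a^2+b^2-c^2-\tfrac{2\Lambda}{n}a^2b^2\Big),$$ for which $(0,K,K)$ is a critical point. An unstable curve of $(0,K,K)$ is a nonconstant solution $(a,b,c)$ on a maximal interval $(-\infty,\eta)$, $\eta\le\infty$, with $(a,b,c)\to(0,K,K)$ as $u\to-\infty$. For $i<j$ let $X_{i,j}\in\mathfrak{so}(n+2)$ have $(i,j)$ entry $1$, $(j,i)$ entry $-1$ and all other entries $0$. Let $\mathfrak p_1=\mathrm{span}\{X_{i,n+1}:i\le n\}$, $\mathfrak p_2=\mathrm{span}\{X_{i,n+2}:i\le n\}$, $\mathfrak p_3=\mathrm{span}\{X_{n+1,n+2}\}$, so that $\mathfrak p_1\oplus\mathfrak p_2\oplus\mathfrak p_3$ is identified with the tangent space of $SO(n+2)/SO(n)$ at the base point, and let $B(X,Y)=-\tfrac12\operatorname{Tr}XY$. Identify the complement of the zero section of $TS^{n+1}$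 with $(0,\infty)\times SO(n+2)/SO(n)$ by letting $(t,A)$ correspond to the tangent vector $tAe_{n+1}$ at the point $Ae_{n+2}$ of $S^{n+1}\subset\mathbb R^{n+2}$. Then an unstable curve of $(0,K,K)$ exists, and every unstable curve $(a,b,c)$ of $(0,K,K)$ has the following property. The arclength $t$, defined by $dt=|abc|\,du$ and $t\to0$ as $u\to-\infty$, maps $(-\infty,\eta)$ bijectively onto $(0,\infty)$, and the $SO(n+2)$-invariant cohomogeneity-one metric $dt^2+g_t$ on $(0,\infty)\times SO(n+2)/SO(n)$ with $$g_t=a^2\,B|_{\mathfrak p_1}\oplus b^2\,B|_{\mathfrak p_2}\oplus c^2\,B|_{\mathfrak p_3}$$ extends smoothly over the zero section $S^{n+1}$ (the bolt) to an $SO(n+2)$-invariant $C^\infty$ Riemannian metric on the total space of $TS^{n+1}$. This metric is complete, it is Einstein with $\mathrm{Ric}=\Lambda g$, and it is Kähler with respect to some globally defined smooth complex structure. -/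

import Mathlib

set_option maxSynthPendingDepth 3

open Set Filter Topology Bundle
open scoped Manifold ContDiff ENNReal Matrix

noncomputable section

namespace TSphere

/-! ### Riemannian geometry in coordinates -/

section Coordinates

variable {E : Type*} [NormedAddCommGroup E] [NormedSpace ℝ E]

/-- The lowered Christoffel symbols of a coordinate metric `G`:
`2 * lowChristoffel G x u v z = D_u G(v, z) + D_v G(u, z) - D_z G(u, v)`. -/
def lowChristoffel (G : E → E →L[ℝ] E →L[ℝ] ℝ) (x : E) : E →L[ℝ] E →L[ℝ] E →L[ℝ] ℝ :=
  let D : E →L[ℝ] E →L[ℝ] E →L[ℝ] ℝ := fderiv ℝ G x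
  let flip : (E →L[ℝ] E →L[ℝ] ℝ) →L[ℝ] (E →L[ℝ] E →L[ℝ] ℝ) :=
    (ContinuousLinearMap.flipₗᵢ ℝ E E ℝ).toContinuousLinearEquiv
  (1 / 2 : ℝ) • (D + D.flip - flip ∘L D.flip)

theorem lowChristoffel_apply (G : E → E →L[ℝ] E →L[ℝ] ℝ) (x u v z : E) :
    lowChristoffel G x u v z = (1 / 2 : ℝ) *
      (fderiv ℝ G x u v z + fderiv ℝ G x v u z - fderiv ℝ G x z u v) := by
  simp [lowChristoffel]

/-- The Christoffel symbols of a coordinate metric `G`: `G x (christoffel G x u v) = lowChristoffel G x u v`,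
so that `∇_u V = D_u V + christoffel G x u V` is the Levi-Civita connection. -/
def christoffel (G : E → E →L[ℝ] E →L[ℝ] ℝ) (x : E) : E →L[ℝ] E →L[ℝ] E :=
  (ContinuousLinearMap.compL ℝ E (E →L[ℝ] ℝ) E (G x).inverse) ∘L (lowChristoffel G x)

theorem christoffel_apply (G : E → E →L[ℝ] E →L[ℝ] ℝ) (x u v : E) :
    christoffel G x u v = (G x).inverse (lowChristoffel G x u v) := rfl

/-- The linear map `u ↦ R(u, v) w`, where `R` is the Riemann curvature tensor of `G`. -/
def curvature (G : E → E →L[ℝ] E →L[ℝ] ℝ) (x v w : E) : E →L[ℝ] E :=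
  ((fderiv ℝ (christoffel G) x).flip v).flip w - (fderiv ℝ (christoffel G) x v).flip w
    + (christoffel G x).flip (christoffel G x v w)
    - (christoffel G x v) ∘L ((christoffel G x).flip w)

theorem curvature_apply (G : E → E →L[ℝ] E →L[ℝ] ℝ) (x u v w : E) :
    curvature G x v w u =
      fderiv ℝ (christoffel G) x u v w - fderiv ℝ (christoffel G) x v u w
        + christoffel G x u (christoffel G x v w) - christoffel G x v (christoffel G x u w) := by
  simp [curvature]

/-- The Ricci tensor of a coordinate metric: `Ric(v, w)` is the trace of `u ↦ R(u, v) w`. -/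
def coordRicci (G : E → E →L[ℝ] E →L[ℝ] ℝ) (x v w : E) : ℝ :=
  LinearMap.trace ℝ E (curvature G x v w : E →ₗ[ℝ] E)

end Coordinates

/-! ### Riemannian geometry on a manifold without boundary -/

section Manifold

variable {E : Type*} [NormedAddCommGroup E] [NormedSpace ℝ E]
  {H : Type*} [TopologicalSpace H] {I : ModelWithCorners ℝ E H}
  {M : Type*} [TopologicalSpace M] [ChartedSpace H M] [IsManifold I 1 M]

variable (I M) in
/-- Smooth Riemannian metrics on `M`. -/
abbrev SmoothMetric :=
  ContMDiffRiemannianMetric I ∞ E (fun p : M => TangentSpace I p)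

/-- The metric `g` written in the preferred chart at `p`. -/
def chartMetric (g : SmoothMetric I M) (p : M) (y : E) : E →L[ℝ] E →L[ℝ] ℝ :=
  let D := mfderiv 𝓘(ℝ, E) I (extChartAt I p).symm y
  (ContinuousLinearMap.precomp ℝ D) ∘L (g.inner ((extChartAt I p).symm y)) ∘L D

/-- The Ricci tensor of `g` at `p`, computed in the preferred chart at `p`. -/
def ricci (g : SmoothMetric I M) (p : M) (v w : TangentSpace I p) : ℝ :=
  coordRicci (chartMetric g p) (extChartAt I p p)
    (mfderiv I 𝓘(ℝ, E) (extChartAt I p) p v) (mfderiv I 𝓘(ℝ, E) (extChartAt I p) p w)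

/-- `Ric_g = Λ g`. -/
def IsEinstein (g : SmoothMetric I M) (Λ : ℝ) : Prop :=
  ∀ (p : M) (v w : TangentSpace I p), ricci g p v w = Λ * g.inner p v w

/-- `M` is complete for the Riemannian distance of `g` (the infimum of lengths of `C^1` paths). -/
def IsCompleteMetric (g : SmoothMetric I M) : Prop :=
  letI : RiemannianBundle (fun p : M => TangentSpace I p) := ⟨g.toRiemannianMetric⟩
  ∀ s : ℕ → M,
    (∀ ε : ℝ≥0∞, 0 < ε → ∃ N : ℕ, ∀ i ≥ N, ∀ j ≥ N, Manifold.riemannianEDist I (s i) (s j) < ε) →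
    ∃ p : M, Tendsto (fun i => Manifold.riemannianEDist I (s i) p) atTop (𝓝 0)

/-- A field of endomorphisms of the tangent bundle, written in the preferred chart at `p`. -/
def chartEndo (J : ∀ p : M, TangentSpace I p →L[ℝ] TangentSpace I p) (p : M) (y : E) : E →L[ℝ] E :=
  (mfderiv I 𝓘(ℝ, E) (extChartAt I p) ((extChartAt I p).symm y)) ∘L
    (J ((extChartAt I p).symm y)) ∘L (mfderiv 𝓘(ℝ, E) I (extChartAt I p).symm y)

/-- `g` is Kähler with respect to `J`: `J` is a smooth `g`-orthogonal almost complex structure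
which is parallel for the Levi-Civita connection (equivalently, `J` is integrable and the
fundamental form `g(J ·, ·)` is closed). -/
structure IsKahler (g : SmoothMetric I M)
    (J : ∀ p : M, TangentSpace I p →L[ℝ] TangentSpace I p) : Prop where
  smooth : ContMDiff I (I.prod 𝓘(ℝ, E →L[ℝ] E)) ∞
    (fun p => TotalSpace.mk' (E →L[ℝ] E) (E := fun p : M => TangentSpace I p →L[ℝ] TangentSpace I p)
      p (J p))
  sq (p : M) (v : TangentSpace I p) : J p (J p v) = -v
  orthogonal (p : M) (v w : TangentSpace I p) : g.inner p (J p v) (J p w) = g.inner p v w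
  parallel (p : M) (u v : E) :
    let x := extChartAt I p p
    fderiv ℝ (chartEndo J p) x u v + christoffel (chartMetric g p) x u (chartEndo J p x v)
      - chartEndo J p x (christoffel (chartMetric g p) x u v) = 0

end Manifold

/-! ### The tangent bundle of the sphere and the action of `SO(n+2)` -/

/-- The Euclidean space `ℝ^(n+2)`. -/
abbrev V (n : ℕ) := EuclideanSpace ℝ (Fin (n + 2))

/-- The unit sphere `S^(n+1)` in `ℝ^(n+2)`. -/
abbrev S (n : ℕ) := Metric.sphere (0 : V n) 1

/-- The total space of the tangent bundle of `S^(n+1)`. -/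
abbrev TS (n : ℕ) := TangentBundle (𝓡 (n + 1)) (S n)

/-- The model with corners of the `(2n+2)`-dimensional manifold `TS n`. -/
abbrev TI (n : ℕ) := (𝓡 (n + 1)).tangent

/-- The group `SO(n+2)`. -/
abbrev SO (n : ℕ) := Matrix.specialOrthogonalGroup (Fin (n + 2)) ℝ

/-- The action of a matrix on `ℝ^(n+2)`. -/
def act {n : ℕ} (A : Matrix (Fin (n + 2)) (Fin (n + 2)) ℝ) (x : V n) : V n :=
  WithLp.toLp 2 (A *ᵥ x.ofLp)

theorem norm_act {n : ℕ} (A : SO n) (x : V n) : ‖act A.1 x‖ = ‖x‖ := by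
  have h : A.1ᵀ * A.1 = 1 :=
    (Matrix.mem_orthogonalGroup_iff' _ _).1 (Matrix.mem_specialOrthogonalGroup_iff.1 A.2).1
  have e : ∀ y : V n, ‖y‖ ^ 2 = y.ofLp ⬝ᵥ y.ofLp := fun y => by
    rw [EuclideanSpace.real_norm_sq_eq]
    simp [dotProduct, sq]
  rw [← sq_eq_sq₀ (norm_nonneg _) (norm_nonneg _), e, e]
  simp only [act]
  rw [Matrix.dotProduct_mulVec, Matrix.vecMul_mulVec, h, Matrix.vecMul_one]

/-- The action of `SO(n+2)` on the sphere. -/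
def rotateSphere {n : ℕ} (A : SO n) (x : S n) : S n :=
  ⟨act A.1 x.1, by simp [norm_act]⟩

/-- The action of `SO(n+2)` on the tangent bundle of the sphere, by differentials. -/
def rotate {n : ℕ} (A : SO n) : TS n → TS n :=
  tangentMap (𝓡 (n + 1)) (𝓡 (n + 1)) (rotateSphere A)

/-- `g` is invariant under the action of `SO(n+2)`. -/
def IsInvariant {n : ℕ} (g : SmoothMetric (TI n) (TS n)) : Prop :=
  ∀ (A : SO n) (p : TS n) (v w : TangentSpace (TI n) p),
    g.inner (rotate A p) (mfderiv (TI n) (TI n) (rotate A) p v)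
      (mfderiv (TI n) (TI n) (rotate A) p w) = g.inner p v w

/-- The embedding `TS^(n+1) → ℝ^(n+2) × ℝ^(n+2)`, which sends a tangent vector `w` at `x` to
`(x, w)`, with `w` viewed as a vector of `ℝ^(n+2)`. Its image is `{(x, w) : |x| = 1, x ⟂ w}`. -/
def ambient {n : ℕ} (p : TS n) : V n × V n :=
  (p.1.1, mfderiv (𝓡 (n + 1)) 𝓘(ℝ, V n) (fun x : S n => (x : V n)) p.1 p.2)

/-- The matrix `X_{i,j}`. -/
def X {n : ℕ} (i j : Fin (n + 2)) : Matrix (Fin (n + 2)) (Fin (n + 2)) ℝ :=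
  Matrix.single i j 1 - Matrix.single j i 1

/-- The invariant form `B(X, Y) = -(1/2) Tr(XY)` on `so(n+2)`. -/
def B {n : ℕ} (Y Z : Matrix (Fin (n + 2)) (Fin (n + 2)) ℝ) : ℝ := -(1 / 2) * (Y * Z).trace

/-- The index `n+1` in `{1, …, n+2}`. -/
abbrev i₁ (n : ℕ) : Fin (n + 2) := (Fin.last n).castSucc

/-- The index `n+2` in `{1, …, n+2}`. -/
abbrev i₂ (n : ℕ) : Fin (n + 2) := Fin.last (n + 1)

/-- Elements of `𝔭₁`, the span of the `X_{i,n+1}`, `1 ≤ i ≤ n`. -/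
def p₁ {n : ℕ} (x : Fin n → ℝ) : Matrix (Fin (n + 2)) (Fin (n + 2)) ℝ :=
  ∑ i, x i • X i.castSucc.castSucc (i₁ n)

/-- Elements of `𝔭₂`, the span of the `X_{i,n+2}`, `1 ≤ i ≤ n`. -/
def p₂ {n : ℕ} (y : Fin n → ℝ) : Matrix (Fin (n + 2)) (Fin (n + 2)) ℝ :=
  ∑ i, y i • X i.castSucc.castSucc (i₂ n)

/-- Elements of `𝔭₃`, the span of `X_{n+1,n+2}`. -/
def p₃ {n : ℕ} (z : ℝ) : Matrix (Fin (n + 2)) (Fin (n + 2)) ℝ := z • X (i₁ n) (i₂ n)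

/-- The point `A e_{n+2}` of the sphere, in `ℝ^(n+2)`. -/
def base {n : ℕ} (A : Matrix (Fin (n + 2)) (Fin (n + 2)) ℝ) : V n :=
  act A (EuclideanSpace.single (i₂ n) 1)

/-- The vector `A e_{n+1}` of `ℝ^(n+2)`, tangent to the sphere at `base A` if `A ∈ SO(n+2)`. -/
def dir {n : ℕ} (A : Matrix (Fin (n + 2)) (Fin (n + 2)) ℝ) : V n :=
  act A (EuclideanSpace.single (i₁ n) 1)

/-- For `t > 0`, the principal orbit `{(x, w) ∈ TS^(n+1) : |w| = t}` is identified with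
`SO(n+2)/SO(n)` by `A ↦ (A e_{n+2}, t A e_{n+1})`. A tangent vector at this point of `TS^(n+1)` is
`σ ∂_t + Y` with `Y ∈ 𝔭 = 𝔭₁ ⊕ 𝔭₂ ⊕ 𝔭₃`, the velocity of
`ε ↦ (A exp(εY) e_{n+2}, (t + εσ) A exp(εY) e_{n+1})`. The definition says that along this orbit `g`
is `dt² + a² B|𝔭₁ + b² B|𝔭₂ + c² B|𝔭₃`. -/
def HasOrbitForm {n : ℕ} (g : SmoothMetric (TI n) (TS n)) (t a b c : ℝ) : Prop :=
  ∀ (A : SO n) (p : TS n), ambient p = (base A.1, t • dir A.1) →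
    ∀ (ξ : TangentSpace (TI n) p) (σ : ℝ) (x y : Fin n → ℝ) (z : ℝ),
      mfderiv (TI n) 𝓘(ℝ, V n × V n) ambient p ξ =
        (base (A.1 * (p₁ x + p₂ y + p₃ z)),
          σ • dir A.1 + t • dir (A.1 * (p₁ x + p₂ y + p₃ z))) →
      g.inner p ξ ξ =
        σ ^ 2 + a ^ 2 * B (p₁ x) (p₁ x) + b ^ 2 * B (p₂ y) (p₂ y) + c ^ 2 * B (n := n) (p₃ z) (p₃ z)

/-! ### The first-order system and its unstable curves -/

/-- `(a, b, c)` solves the first-order system on `(-∞, η)`. -/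
def IsSolution (n : ℕ) (Λ : ℝ) (η : EReal) (a b c : ℝ → ℝ) : Prop :=
  ∀ u : ℝ, (u : EReal) < η →
    HasDerivAt a (1 / 2 * a u * (b u ^ 2 + c u ^ 2 - a u ^ 2)) u ∧
    HasDerivAt b (1 / 2 * b u * (c u ^ 2 + a u ^ 2 - b u ^ 2)) u ∧
    HasDerivAt c (1 / 2 * n * c u *
      (a u ^ 2 + b u ^ 2 - c u ^ 2 - 2 * Λ / n * a u ^ 2 * b u ^ 2)) u

/-- `(a, b, c)` is an unstable curve of the critical point `(0, K, K)`, with maximal interval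
`(-∞, η)`: a nonconstant solution which tends to `(0, K, K)` at `-∞`. -/
structure IsUnstableCurve (n : ℕ) (Λ K : ℝ) (η : EReal) (a b c : ℝ → ℝ) : Prop where
  bot_lt : ⊥ < η
  solution : IsSolution n Λ η a b c
  tendsto : Tendsto (fun u => (a u, b u, c u)) atBot (𝓝 (0, K, K))
  nonconstant : ∃ u : ℝ, (u : EReal) < η ∧ (a u, b u, c u) ≠ (0, K, K)
  maximal : ∀ (η' : EReal) (a' b' c' : ℝ → ℝ), η < η' → IsSolution n Λ η' a' b' c' →
    ¬ ∀ u : ℝ, (u : EReal) < η → a' u = a u ∧ b' u = b u ∧ c' u = c u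

end TSphere

end

set_option maxSynthPendingDepth 3
set_option linter.unusedSectionVars false

open Set Filter Topology Bundle
open scoped Manifold ContDiff ENNReal Matrix

noncomputable section

namespace TSphere

/-! ### Naturality of the Christoffel symbols and of the Ricci tensor -/

section Naturality

variable {E : Type*} [NormedAddCommGroup E] [NormedSpace ℝ E]
  {F : Type*} [NormedAddCommGroup F] [NormedSpace ℝ F]

/-! An unstable curve is a Kähler potential in disguise. Along it `a` never vanishes and b² > a², so
q = a²/(b² - a²) is positive; since q' = 2b²q it increases strictly and can replace the variable u.
Put w = b² - a² as a function of q, and P(q) = ∫₀^q w. Then a² = q w and b² = (1 + q) w, the first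
two equations combine into c² = (1 + 2q) w + 2q(1 + q) w', and the third one integrates to w^n c² =
K^(2(n+1)) exp(-Λ P) (`IsRadialSolution.volume`).

These are the data of a metric on the affine quadric z·z = 1 in ℂ^(n+2). With ρ = (|z|² - 1)/2, the
Levi form of P(ρ) on the quadric is w⟨·,·⟩ + (w'/2)⟨·,z⟩⟨z,·⟩ (`leviForm_potential`). It is positive
because w and c² are (`kform_pos`), it is Kähler for the complex structure of the quadric, and its
determinant relative to the holomorphic volume form is a constant times w^n c² (`det_kmat`,
`det_gram_eq`). The Ricci tensor of a Kähler metric is minus the Levi form of the logarithm of this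
determinant (`coordRicci_leviForm`), so the integrated third equation is a complex Monge–Ampère
equation that says Ric = Λ g (`coordRicci_potential`). The computation takes place in complex
stereographic coordinates; naturality of the Christoffel symbols and of the Ricci tensor carries it
to the real charts of the tangent bundle (`quadricMetric`).

The tangent bundle becomes an open part of the quadric through (x, v) ↦ √(1+q) x + i√q v/|v|, where
q is the function of |v| for which |v| is the arclength t. On principal orbits the induced metric is
then the prescribed one (`kform_orbit`). One has t = √q m(q), and the map is smooth and immersive
across the zero section as soon as m and w are smooth up to q = 0. The equation for w is singular
there. After elimination of c² it is linear, q Y' + αY = r with Y = (w√(1+q))^(n+1), and r depends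
on P only, so it is one derivative smoother than w; continuous solutions of such equations inherit
the regularity of r (`contDiffOn_of_singular`, `IsRadialSolution.w_smooth`).

Completeness holds because √(1+t²) is proper with slope at most one, once t takes all positive
values. If t were bounded, a Grönwall estimate in t would bound a, b, c (here Λ ≤ 0 enters), so by
maximality the curve would exist for all u; but then c⁴(a²b²)^n grows at least linearly, a
contradiction (`IsUnstableCurve.arclength_unbounded`).

For existence, the integrated equations in the variable x = √q are a fixed point problem for P. The
operator is monotone because -Λ ≥ 0, so Knaster–Tarski applies (`exists_local_radial`). The scalar
equation x' = √(1+x²) ab restores the parameter u, and Zorn's lemma yields the maximal curve. -/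

theorem contDiffAt_fderiv_infty {f : E → F} {x : E} (hf : ContDiffAt ℝ ∞ f x) :
    ContDiffAt ℝ ∞ (fderiv ℝ f) x :=
  hf.fderiv_right (m := ∞) (by simp)

theorem fderiv_apply₂ {G : E → E →L[ℝ] E →L[ℝ] ℝ} {x : E} (hG : DifferentiableAt ℝ G x)
    (u v w : E) : fderiv ℝ G x u v w = fderiv ℝ (fun y => G y v w) x u := by
  have h := ((hG.hasFDerivAt.clm_apply (hasFDerivAt_const v x)).clm_apply
    (hasFDerivAt_const w x)).fderiv
  rw [h]; simp

theorem christoffel_spec {G : E → E →L[ℝ] E →L[ℝ] ℝ} {x : E} (hG : (G x).IsInvertible) (u v : E) :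
    G x (christoffel G x u v) = lowChristoffel G x u v := by
  rw [christoffel_apply]
  obtain ⟨e, he⟩ := hG
  rw [← he, ContinuousLinearMap.inverse_equiv]
  simp

set_option synthInstance.maxHeartbeats 200000 in
theorem contDiffAt_lowChristoffel {G : E → E →L[ℝ] E →L[ℝ] ℝ} {x : E} (hG : ContDiffAt ℝ ∞ G x) :
    ContDiffAt ℝ ∞ (lowChristoffel G) x := by
  have h := contDiffAt_fderiv_infty hG
  let L : (E →L[ℝ] E →L[ℝ] E →L[ℝ] ℝ) →L[ℝ] (E →L[ℝ] E →L[ℝ] E →L[ℝ] ℝ) :=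
    (ContinuousLinearMap.flipₗᵢ ℝ E E (E →L[ℝ] ℝ)).toContinuousLinearEquiv
  let fl : (E →L[ℝ] E →L[ℝ] ℝ) →L[ℝ] (E →L[ℝ] E →L[ℝ] ℝ) :=
    (ContinuousLinearMap.flipₗᵢ ℝ E E ℝ).toContinuousLinearEquiv
  have e : lowChristoffel G = fun y => (1 / 2 : ℝ) • (fderiv ℝ G y + L (fderiv ℝ G y) -
      fl ∘L (L (fderiv ℝ G y))) := rfl
  rw [e]
  have h1 : ContDiffAt ℝ ∞ (fun y => L (fderiv ℝ G y)) x := L.contDiff.contDiffAt.comp x h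
  exact ((h.add h1).sub (contDiffAt_const.clm_comp h1)).const_smul _

theorem contDiffAt_christoffel [CompleteSpace E] {G : E → E →L[ℝ] E →L[ℝ] ℝ} {x : E}
    (hG : ContDiffAt ℝ ∞ G x) (hi : (G x).IsInvertible) : ContDiffAt ℝ ∞ (christoffel G) x := by
  have h1 : ContDiffAt ℝ ∞ (fun y => (G y).inverse) x := by
    obtain ⟨e, he⟩ := hi
    have := contDiffAt_map_inverse (𝕜 := ℝ) (n := ∞) e
    rw [he] at this
    exact this.comp x hG
  have h2 := contDiffAt_lowChristoffel hG
  have h3 := ((ContinuousLinearMap.compL ℝ E (E →L[ℝ] ℝ) E).contDiff (n := ∞)).contDiffAt.comp x h1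
  exact h3.clm_comp h2

/-- The pullback of a coordinate metric. -/
def pull (κ : E → F) (G : F → F →L[ℝ] F →L[ℝ] ℝ) (x : E) : E →L[ℝ] E →L[ℝ] ℝ :=
  (ContinuousLinearMap.precomp ℝ (fderiv ℝ κ x)) ∘L (G (κ x)) ∘L (fderiv ℝ κ x)

theorem pull_apply (κ : E → F) (G : F → F →L[ℝ] F →L[ℝ] ℝ) (x u v : E) :
    pull κ G x u v = G (κ x) (fderiv ℝ κ x u) (fderiv ℝ κ x v) := rfl

theorem contDiffAt_pull {κ : E → F} {G : F → F →L[ℝ] F →L[ℝ] ℝ} {x : E}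
    (hκ : ContDiffAt ℝ ∞ κ x) (hG : ContDiffAt ℝ ∞ G (κ x)) : ContDiffAt ℝ ∞ (pull κ G) x := by
  have h1 := contDiffAt_fderiv_infty hκ
  have h2 : ContDiffAt ℝ ∞ (fun y => ContinuousLinearMap.precomp ℝ (fderiv ℝ κ y)) x :=
    ((ContinuousLinearMap.compL ℝ E F ℝ).flip.contDiff (n := ∞)).contDiffAt.comp x h1
  exact h2.clm_comp ((hG.comp x hκ).clm_comp h1)

theorem fderiv_pull {κ : E → F} {G : F → F →L[ℝ] F →L[ℝ] ℝ} {x : E}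
    (hκ : ContDiffAt ℝ ∞ κ x) (hG : ContDiffAt ℝ ∞ G (κ x)) (u v w : E) :
    fderiv ℝ (pull κ G) x u v w =
      fderiv ℝ G (κ x) (fderiv ℝ κ x u) (fderiv ℝ κ x v) (fderiv ℝ κ x w)
      + G (κ x) (fderiv ℝ (fderiv ℝ κ) x u v) (fderiv ℝ κ x w)
      + G (κ x) (fderiv ℝ κ x v) (fderiv ℝ (fderiv ℝ κ) x u w) := by
  have hκ1 := (hκ.differentiableAt (by simp)).hasFDerivAt
  have hκ2 := ((contDiffAt_fderiv_infty hκ).differentiableAt (by simp)).hasFDerivAt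
  have hG1 := (hG.differentiableAt (by simp)).hasFDerivAt
  rw [fderiv_apply₂ ((contDiffAt_pull hκ hG).differentiableAt (by simp))]
  have h : HasFDerivAt (fun y => G (κ y) (fderiv ℝ κ y v) (fderiv ℝ κ y w)) _ x :=
    ((hG1.comp x hκ1).clm_apply (hκ2.clm_apply (hasFDerivAt_const v x))).clm_apply
    (hκ2.clm_apply (hasFDerivAt_const w x))
  have e : (fun y => pull κ G y v w) = fun y => G (κ y) (fderiv ℝ κ y v) (fderiv ℝ κ y w) := rfl
  rw [e, h.fderiv]
  simp
  ring

theorem symm_second {κ : E → F} {x : E} (hκ : ContDiffAt ℝ ∞ κ x) (u v : E) :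
    fderiv ℝ (fderiv ℝ κ) x u v = fderiv ℝ (fderiv ℝ κ) x v u :=
  (hκ.isSymmSndFDerivAt (by simp; exact WithTop.coe_le_coe.2 le_top)) u v

theorem lowChristoffel_pull {κ : E → F} {G : F → F →L[ℝ] F →L[ℝ] ℝ} {x : E}
    (hκ : ContDiffAt ℝ ∞ κ x) (hG : ContDiffAt ℝ ∞ G (κ x))
    (hs : ∀ a b, G (κ x) a b = G (κ x) b a) (u v w : E) :
    lowChristoffel (pull κ G) x u v w =
      lowChristoffel G (κ x) (fderiv ℝ κ x u) (fderiv ℝ κ x v) (fderiv ℝ κ x w)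
      + G (κ x) (fderiv ℝ (fderiv ℝ κ) x u v) (fderiv ℝ κ x w) := by
  simp only [lowChristoffel_apply, fderiv_pull hκ hG]
  rw [symm_second hκ w u, symm_second hκ w v, symm_second hκ v u,
    hs (fderiv ℝ κ x v) (fderiv ℝ (fderiv ℝ κ) x u w),
    hs (fderiv ℝ κ x u) (fderiv ℝ (fderiv ℝ κ) x v w)]
  ring

theorem isInvertible_pull {κ : E → F} {G : F → F →L[ℝ] F →L[ℝ] ℝ} {x : E}
    (hi : (fderiv ℝ κ x).IsInvertible) (hG : (G (κ x)).IsInvertible) :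
    (pull κ G x).IsInvertible := by
  obtain ⟨e, he⟩ := hi
  obtain ⟨f, hf⟩ := hG
  refine ⟨(e.trans f).trans (e.symm.arrowCongr (ContinuousLinearEquiv.refl ℝ ℝ)), ?_⟩
  ext u v
  simp [pull_apply, ← he, ← hf]

/-- The transformation law of a connection. The inhomogeneous term is the Hessian of the coordinate
change. -/
theorem christoffel_pull {κ : E → F} {G : F → F →L[ℝ] F →L[ℝ] ℝ} {x : E}
    (hκ : ContDiffAt ℝ ∞ κ x) (hG : ContDiffAt ℝ ∞ G (κ x))
    (hs : ∀ a b, G (κ x) a b = G (κ x) b a)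
    (hi : (fderiv ℝ κ x).IsInvertible) (hGi : (G (κ x)).IsInvertible) (u v : E) :
    fderiv ℝ κ x (christoffel (pull κ G) x u v) =
      christoffel G (κ x) (fderiv ℝ κ x u) (fderiv ℝ κ x v) + fderiv ℝ (fderiv ℝ κ) x u v := by
  apply (hGi.bijective).1
  ext w
  obtain ⟨w, rfl⟩ := hi.bijective.2 w
  have h := congrArg (fun l => l w) (christoffel_spec (isInvertible_pull hi hGi) u v)
  simp only [pull_apply] at h
  rw [h, map_add, christoffel_spec hGi, lowChristoffel_pull hκ hG hs]
  simp

/-- Differentiate the transformation law of the Christoffel symbols and antisymmetrize in `u`, `v`.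
The third derivatives of `κ` drop out by symmetry, and the terms with second derivatives cancel
against those from the quadratic part of the curvature. -/
theorem curvature_pull [CompleteSpace E] [CompleteSpace F]
    {κ : E → F} {G : F → F →L[ℝ] F →L[ℝ] ℝ} {x : E}
    (hκ : ContDiffAt ℝ ∞ κ x) (hG : ContDiffAt ℝ ∞ G (κ x))
    (hs : ∀ᶠ y in 𝓝 (κ x), ∀ a b, G y a b = G y b a)
    (hi : ∀ᶠ y in 𝓝 x, (fderiv ℝ κ y).IsInvertible)
    (hGi : ∀ᶠ y in 𝓝 (κ x), (G y).IsInvertible)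
    (hκe : ∀ᶠ y in 𝓝 x, ContDiffAt ℝ ∞ κ y) (hGe : ∀ᶠ y in 𝓝 (κ x), ContDiffAt ℝ ∞ G y)
    (u v w : E) :
    fderiv ℝ κ x (curvature (pull κ G) x v w u) =
      curvature G (κ x) (fderiv ℝ κ x v) (fderiv ℝ κ x w) (fderiv ℝ κ x u) := by
  have hκ1 := (hκ.differentiableAt (by simp)).hasFDerivAt
  have hκ2c := contDiffAt_fderiv_infty hκ
  have hκ2 := (hκ2c.differentiableAt (by simp)).hasFDerivAt
  have hκ3 := ((contDiffAt_fderiv_infty hκ2c).differentiableAt (by simp)).hasFDerivAt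
  have hΓE := ((contDiffAt_christoffel (contDiffAt_pull hκ hG)
    (isInvertible_pull hi.self_of_nhds hGi.self_of_nhds)).differentiableAt (by simp)).hasFDerivAt
  have hΓF := ((contDiffAt_christoffel hG hGi.self_of_nhds).differentiableAt (by simp)).hasFDerivAt
  have hx := hκ.continuousAt
  -- The law is needed on a neighbourhood, because it is differentiated next.
  have law : ∀ᶠ y in 𝓝 x, ∀ v w : E, fderiv ℝ κ y (christoffel (pull κ G) y v w) =
      christoffel G (κ y) (fderiv ℝ κ y v) (fderiv ℝ κ y w) + fderiv ℝ (fderiv ℝ κ) y v w := by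
    filter_upwards [hκe, hx.eventually hGe, hx.eventually hs, hi, hx.eventually hGi]
      with y h1 h2 h3 h4 h5 v w using christoffel_pull h1 h2 h3 h4 h5 v w
  have law0 := law.self_of_nhds
  -- The derivative at `x` in the direction `u` of the law for constant `v` and `w`.
  have key : ∀ u v w : E,
      fderiv ℝ (fderiv ℝ κ) x u (christoffel (pull κ G) x v w)
        + fderiv ℝ κ x (fderiv ℝ (christoffel (pull κ G)) x u v w) =
      fderiv ℝ (christoffel G) (κ x) (fderiv ℝ κ x u) (fderiv ℝ κ x v) (fderiv ℝ κ x w)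
      + christoffel G (κ x) (fderiv ℝ (fderiv ℝ κ) x u v) (fderiv ℝ κ x w)
      + christoffel G (κ x) (fderiv ℝ κ x v) (fderiv ℝ (fderiv ℝ κ) x u w)
      + fderiv ℝ (fderiv ℝ (fderiv ℝ κ)) x u v w := by
    intro u v w
    have h1 := hκ2.clm_apply ((hΓE.clm_apply (hasFDerivAt_const v x)).clm_apply
      (hasFDerivAt_const w x))
    have h2 := (((hΓF.comp x hκ1).clm_apply (hκ2.clm_apply (hasFDerivAt_const v x))).clm_apply
      (hκ2.clm_apply (hasFDerivAt_const w x))).add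
      ((hκ3.clm_apply (hasFDerivAt_const v x)).clm_apply (hasFDerivAt_const w x))
    have h3 := h1.unique (h2.congr_of_eventuallyEq (law.mono fun y hy => hy v w))
    have h4 := congrArg (fun l => l u) h3
    simp at h4
    rw [add_comm, h4]
    abel
  have k1 := key u v w
  have k2 := key v u w
  have s3 : fderiv ℝ (fderiv ℝ (fderiv ℝ κ)) x u v = fderiv ℝ (fderiv ℝ (fderiv ℝ κ)) x v u :=
    symm_second hκ2c u v
  have s2 := symm_second hκ u v
  rw [curvature_apply, curvature_apply]
  simp only [map_add, map_sub]
  have e1 := law0 u (christoffel (pull κ G) x v w)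
  have e2 := law0 v (christoffel (pull κ G) x u w)
  rw [law0 v w, map_add] at e1
  rw [law0 u w, map_add] at e2
  rw [e1, e2]
  rw [s3, s2] at k1
  have k4 : fderiv ℝ κ x (fderiv ℝ (christoffel (pull κ G)) x u v w)
      - fderiv ℝ κ x (fderiv ℝ (christoffel (pull κ G)) x v u w) =
      fderiv ℝ (christoffel G) (κ x) (fderiv ℝ κ x u) (fderiv ℝ κ x v) (fderiv ℝ κ x w)
      - fderiv ℝ (christoffel G) (κ x) (fderiv ℝ κ x v) (fderiv ℝ κ x u) (fderiv ℝ κ x w)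
      + christoffel G (κ x) (fderiv ℝ κ x v) (fderiv ℝ (fderiv ℝ κ) x u w)
      - christoffel G (κ x) (fderiv ℝ κ x u) (fderiv ℝ (fderiv ℝ κ) x v w)
      - fderiv ℝ (fderiv ℝ κ) x u (christoffel (pull κ G) x v w)
      + fderiv ℝ (fderiv ℝ κ) x v (christoffel (pull κ G) x u w) := by
    have a1 := eq_sub_of_add_eq' k1
    have a2 := eq_sub_of_add_eq' k2
    rw [a1, a2]
    abel
  rw [k4]
  abel

theorem coordRicci_pull [CompleteSpace E] [CompleteSpace F]
    {κ : E → F} {G : F → F →L[ℝ] F →L[ℝ] ℝ} {x : E}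
    (hκ : ContDiffAt ℝ ∞ κ x) (hG : ContDiffAt ℝ ∞ G (κ x))
    (hs : ∀ᶠ y in 𝓝 (κ x), ∀ a b, G y a b = G y b a)
    (hi : ∀ᶠ y in 𝓝 x, (fderiv ℝ κ y).IsInvertible)
    (hGi : ∀ᶠ y in 𝓝 (κ x), (G y).IsInvertible)
    (hκe : ∀ᶠ y in 𝓝 x, ContDiffAt ℝ ∞ κ y) (hGe : ∀ᶠ y in 𝓝 (κ x), ContDiffAt ℝ ∞ G y)
    (v w : E) :
    coordRicci (pull κ G) x v w = coordRicci G (κ x) (fderiv ℝ κ x v) (fderiv ℝ κ x w) := by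
  obtain ⟨e, he⟩ := hi.self_of_nhds
  unfold coordRicci
  rw [← LinearMap.trace_conj' _ e.toLinearEquiv]
  congr 1
  ext y
  obtain ⟨u, rfl⟩ := e.surjective y
  have h := curvature_pull hκ hG hs hi hGi hκe hGe u v w
  rw [← he] at h ⊢
  simpa [LinearEquiv.conj_apply] using h

theorem lowChristoffel_congr {G G' : E → E →L[ℝ] E →L[ℝ] ℝ} {x : E} (h : G =ᶠ[𝓝 x] G') :
    lowChristoffel G x = lowChristoffel G' x := by
  unfold lowChristoffel
  rw [h.fderiv_eq]

theorem christoffel_congr {G G' : E → E →L[ℝ] E →L[ℝ] ℝ} {x : E} (h : G =ᶠ[𝓝 x] G') :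
    christoffel G x = christoffel G' x := by
  unfold christoffel
  rw [lowChristoffel_congr h, h.eq_of_nhds]

theorem coordRicci_congr {G G' : E → E →L[ℝ] E →L[ℝ] ℝ} {x : E} (h : G =ᶠ[𝓝 x] G') :
    coordRicci G x = coordRicci G' x := by
  have h1 : christoffel G =ᶠ[𝓝 x] christoffel G' :=
    h.eventually_nhds.mono fun y hy => christoffel_congr hy
  funext v w
  unfold coordRicci curvature
  rw [h1.fderiv_eq, h1.eq_of_nhds]

theorem isInvertible_of_pos [FiniteDimensional ℝ E] {G : E →L[ℝ] E →L[ℝ] ℝ}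
    (h : ∀ u, u ≠ 0 → 0 < G u u) : G.IsInvertible := by
  have inj : Function.Injective (G : E →ₗ[ℝ] E →L[ℝ] ℝ) := by
    rw [← LinearMap.ker_eq_bot, LinearMap.ker_eq_bot']
    intro u hu
    by_contra hne
    have := h u hne
    have e : G u = 0 := hu
    simp [e] at this
  have hd : Module.finrank ℝ E = Module.finrank ℝ (E →L[ℝ] ℝ) := by
    rw [← (LinearMap.toContinuousLinearMap (𝕜 := ℝ) (E := E) (F' := ℝ)).finrank_eq]
    exact (Subspace.dual_finrank_eq (K := ℝ) (V := E)).symm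
  exact ⟨(LinearEquiv.ofInjectiveOfFinrankEq (G : E →ₗ[ℝ] E →L[ℝ] ℝ) inj hd).toContinuousLinearEquiv,
    by ext; rfl⟩

/-- In the coordinates `κ` the complex structure is the constant map `i`, and a constant tensor is
parallel exactly when the Christoffel symbols commute with it. -/
theorem parallel_pull {κ : E → F} {G : F → F →L[ℝ] F →L[ℝ] ℝ} {x : E} {J : E → E →L[ℝ] E}
    {i : F →L[ℝ] F}
    (hκ : ContDiffAt ℝ ∞ κ x) (hG : ContDiffAt ℝ ∞ G (κ x))
    (hs : ∀ a b, G (κ x) a b = G (κ x) b a)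
    (hi : (fderiv ℝ κ x).IsInvertible) (hGi : (G (κ x)).IsInvertible)
    (hJ : ∀ᶠ y in 𝓝 x, ∀ v, fderiv ℝ κ y (J y v) = i (fderiv ℝ κ y v))
    (hJd : DifferentiableAt ℝ J x)
    (hp : ∀ a b, christoffel G (κ x) a (i b) = i (christoffel G (κ x) a b)) (u v : E) :
    fderiv ℝ J x u v + christoffel (pull κ G) x u (J x v) - J x (christoffel (pull κ G) x u v)
      = 0 := by
  have hκ2 := ((contDiffAt_fderiv_infty hκ).differentiableAt (by simp)).hasFDerivAt
  apply hi.bijective.1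
  have h1 := hκ2.clm_apply (hJd.hasFDerivAt.clm_apply (hasFDerivAt_const v x))
  have h2 := (i.hasFDerivAt (x := fderiv ℝ κ x v)).comp x
    (hκ2.clm_apply (hasFDerivAt_const v x))
  have h3 := h1.unique (h2.congr_of_eventuallyEq (hJ.mono fun y hy => hy v))
  have h4 := congrArg (fun l => l u) h3
  simp at h4
  have hJ0 := hJ.self_of_nhds
  simp only [map_add, map_sub, christoffel_pull hκ hG hs hi hGi, hJ0, hp, map_zero]
  rw [← h4]
  abel

end Naturality

/-! ### Kähler metrics in holomorphic coordinates -/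

section Kahler

variable {F : Type*} [NormedAddCommGroup F] [NormedSpace ℂ F]

/-- Multiplication by `i`, as a real linear map. -/
def mulI : F →L[ℝ] F := (Complex.I • ContinuousLinearMap.id ℂ F).restrictScalars ℝ

@[simp] theorem mulI_apply (v : F) : mulI v = Complex.I • v := rfl

theorem I_smul_I_smul (v : F) : Complex.I • Complex.I • v = -v := by
  rw [smul_smul, Complex.I_mul_I, neg_one_smul]

/-- The real part of the Levi form of `P`: the bilinear form `(D²P + D²P(i·, i·)) / 2`. -/
def leviForm (P : F → ℝ) (x : F) : F →L[ℝ] F →L[ℝ] ℝ :=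
  (1 / 2 : ℝ) • (fderiv ℝ (fderiv ℝ P) x + pull mulI (fun _ => fderiv ℝ (fderiv ℝ P) x) x)

theorem leviForm_apply (P : F → ℝ) (x u v : F) :
    leviForm P x u v = (1 / 2 : ℝ) * (fderiv ℝ (fderiv ℝ P) x u v +
      fderiv ℝ (fderiv ℝ P) x (Complex.I • u) (Complex.I • v)) := by
  have h : fderiv ℝ (mulI : F → F) x = mulI := mulI.fderiv
  simp [leviForm, pull_apply, h]
  ring

variable {P : F → ℝ} {x : F}

theorem contDiffAt_leviForm (hP : ContDiffAt ℝ ∞ P x) : ContDiffAt ℝ ∞ (leviForm P) x := by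
  have h2 := contDiffAt_fderiv_infty (contDiffAt_fderiv_infty hP)
  have h : leviForm P = fun x => (1 / 2 : ℝ) • (fderiv ℝ (fderiv ℝ P) x +
      (ContinuousLinearMap.precomp ℝ mulI) ∘L (fderiv ℝ (fderiv ℝ P) x) ∘L mulI) := by
    ext x u v
    rw [leviForm_apply]
    simp
    ring
  rw [h]
  exact (h2.add (contDiffAt_const.clm_comp (h2.clm_comp contDiffAt_const))).const_smul _

theorem leviForm_symm (hP : ContDiffAt ℝ ∞ P x) (u v : F) :
    leviForm P x u v = leviForm P x v u := by
  simp only [leviForm_apply, symm_second hP u, symm_second hP (Complex.I • u)]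

theorem leviForm_I (P : F → ℝ) (x u v : F) :
    leviForm P x (Complex.I • u) (Complex.I • v) = leviForm P x u v := by
  simp [leviForm_apply, I_smul_I_smul, add_comm]

theorem leviForm_I_left (P : F → ℝ) (x u v : F) :
    leviForm P x (Complex.I • u) v = -leviForm P x u (Complex.I • v) := by
  rw [← leviForm_I P x u, I_smul_I_smul, map_neg, neg_neg]

theorem fderiv_leviForm (hP : ContDiffAt ℝ ∞ P x) (u v w : F) :
    fderiv ℝ (leviForm P) x u v w = (1 / 2 : ℝ) * (fderiv ℝ (fderiv ℝ (fderiv ℝ P)) x u v w +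
      fderiv ℝ (fderiv ℝ (fderiv ℝ P)) x u (Complex.I • v) (Complex.I • w)) := by
  have h2 := contDiffAt_fderiv_infty (contDiffAt_fderiv_infty hP)
  have h3 := (h2.differentiableAt (by simp)).hasFDerivAt
  rw [fderiv_apply₂ ((contDiffAt_leviForm hP).differentiableAt (by simp))]
  simp only [leviForm_apply]
  have h4 := ((((h3.clm_apply (hasFDerivAt_const v x)).clm_apply (hasFDerivAt_const w x)).add
    ((h3.clm_apply (hasFDerivAt_const (Complex.I • v) x)).clm_apply
      (hasFDerivAt_const (Complex.I • w) x))).const_mul (1 / 2 : ℝ)).fderiv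
  refine (congrArg (fun l => l u) h4).trans ?_
  simp
  ring

theorem third_symm (hP : ContDiffAt ℝ ∞ P x) (u v w : F) :
    fderiv ℝ (fderiv ℝ (fderiv ℝ P)) x u v w = fderiv ℝ (fderiv ℝ (fderiv ℝ P)) x v u w := by
  rw [symm_second (contDiffAt_fderiv_infty hP) u v]

theorem third_symm' (hP : ContDiffAt ℝ ∞ P x) (hP' : ∀ᶠ y in 𝓝 x, ContDiffAt ℝ ∞ P y) (u v w : F) :
    fderiv ℝ (fderiv ℝ (fderiv ℝ P)) x u v w = fderiv ℝ (fderiv ℝ (fderiv ℝ P)) x u w v := by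
  have h2 := contDiffAt_fderiv_infty (contDiffAt_fderiv_infty hP)
  have hd := h2.differentiableAt (n := ∞) (by simp)
  rw [fderiv_apply₂ hd, fderiv_apply₂ hd]
  have : (fun y => fderiv ℝ (fderiv ℝ P) y v w) =ᶠ[𝓝 x] fun y => fderiv ℝ (fderiv ℝ P) y w v :=
    hP'.mono fun y hy => symm_second hy v w
  rw [this.fderiv_eq]

/-- By the symmetry of third derivatives, only the real part of a form that is complex linear in `u`
and `v` and antilinear in `w` survives. This type is what makes the connection complex linear. -/
theorem lowChristoffel_leviForm (hP : ContDiffAt ℝ ∞ P x)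
    (hP' : ∀ᶠ y in 𝓝 x, ContDiffAt ℝ ∞ P y) (u v w : F) :
    lowChristoffel (leviForm P) x u v w = (1 / 4 : ℝ) *
      (fderiv ℝ (fderiv ℝ (fderiv ℝ P)) x u v w
      + fderiv ℝ (fderiv ℝ (fderiv ℝ P)) x u (Complex.I • v) (Complex.I • w)
      + fderiv ℝ (fderiv ℝ (fderiv ℝ P)) x (Complex.I • u) v (Complex.I • w)
      - fderiv ℝ (fderiv ℝ (fderiv ℝ P)) x (Complex.I • u) (Complex.I • v) w) := by
  have s1 := third_symm hP
  have s2 := third_symm' hP hP'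
  rw [lowChristoffel_apply]
  simp only [fderiv_leviForm hP]
  rw [s1 v u w, s1 w u v, s2 u w v, s1 w (Complex.I • u), s2 (Complex.I • u) w,
    s1 v (Complex.I • u) (Complex.I • w)]
  ring

theorem christoffel_leviForm_I (hP : ContDiffAt ℝ ∞ P x) (hP' : ∀ᶠ y in 𝓝 x, ContDiffAt ℝ ∞ P y)
    (hi : (leviForm P x).IsInvertible) (u v : F) :
    christoffel (leviForm P) x u (Complex.I • v) = Complex.I • christoffel (leviForm P) x u v := by
  apply hi.bijective.1
  ext w
  rw [christoffel_spec hi, leviForm_I_left, christoffel_spec hi, lowChristoffel_leviForm hP hP',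
    lowChristoffel_leviForm hP hP']
  simp only [I_smul_I_smul, map_neg, _root_.neg_apply]
  ring

/-- Let m be multiplication by `I`. Anticommutation gives m T m = T, while cyclicity of the trace
gives tr (m T m) = tr (T m²) = -tr T. -/
theorem trace_eq_zero_of_antilinear (T : F →ₗ[ℝ] F)
    (h : ∀ u, T (Complex.I • u) = -(Complex.I • T u)) : LinearMap.trace ℝ F T = 0 := by
  let m : F →ₗ[ℝ] F := (mulI : F →L[ℝ] F)
  have h1 : T * m = -(m * T) := by ext u; exact h u
  have h2 : m * m = -1 := by ext u; exact I_smul_I_smul u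
  have h3 : LinearMap.trace ℝ F (m * (T * m)) = LinearMap.trace ℝ F ((T * m) * m) :=
    LinearMap.trace_mul_comm ℝ _ _
  rw [mul_assoc T, h2, h1, mul_neg, ← mul_assoc, h2] at h3
  simp at h3
  linarith

variable [FiniteDimensional ℂ F]

/-- The `(2, 0)` part of the curvature of a Kähler metric vanishes. -/
theorem christoffel_leviForm_holo (hP : ContDiffAt ℝ ∞ P x)
    (hP' : ∀ᶠ y in 𝓝 x, ContDiffAt ℝ ∞ P y)
    (hi : ∀ᶠ y in 𝓝 x, (leviForm P y).IsInvertible) (u v w : F) :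
    let Γ := christoffel (leviForm P)
    let H : F → F → F → F := fun u v w =>
      fderiv ℝ Γ x u v w - Complex.I • fderiv ℝ Γ x (Complex.I • u) v w
        + (2 : ℝ) • Γ x u (Γ x v w)
    H u v w = H v u w := by
  intro Γ H
  have hi0 := hi.self_of_nhds
  have hΓ := ((contDiffAt_christoffel (contDiffAt_leviForm hP) hi0).differentiableAt
    (by simp)).hasFDerivAt
  have hG := ((contDiffAt_leviForm hP).differentiableAt (by simp)).hasFDerivAt
  have h3c := contDiffAt_fderiv_infty (contDiffAt_fderiv_infty (contDiffAt_fderiv_infty hP))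
  have h3 := (h3c.differentiableAt (by simp)).hasFDerivAt
  set P4 := fderiv ℝ (fderiv ℝ (fderiv ℝ (fderiv ℝ P))) x with hP4
  -- Obtained by differentiating the formula of `lowChristoffel_leviForm` in a neighbourhood of `x`.
  have dlow : ∀ u v w z : F, leviForm P x (fderiv ℝ Γ x u v w) z
      + fderiv ℝ (leviForm P) x u (Γ x v w) z = (1 / 4 : ℝ) *
      (P4 u v w z + P4 u v (Complex.I • w) (Complex.I • z)
      + P4 u (Complex.I • v) w (Complex.I • z) - P4 u (Complex.I • v) (Complex.I • w) z) := by
    intro u v w z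
    have e : ∀ᶠ y in 𝓝 x, leviForm P y (Γ y v w) z = (1 / 4 : ℝ) *
      (fderiv ℝ (fderiv ℝ (fderiv ℝ P)) y v w z
      + fderiv ℝ (fderiv ℝ (fderiv ℝ P)) y v (Complex.I • w) (Complex.I • z)
      + fderiv ℝ (fderiv ℝ (fderiv ℝ P)) y (Complex.I • v) w (Complex.I • z)
      - fderiv ℝ (fderiv ℝ (fderiv ℝ P)) y (Complex.I • v) (Complex.I • w) z) := by
      filter_upwards [hP', hP'.eventually_nhds, hi] with y h1 h2 h3
      rw [christoffel_spec h3, lowChristoffel_leviForm h1 h2]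
    have l := (hG.clm_apply ((hΓ.clm_apply (hasFDerivAt_const v x)).clm_apply
      (hasFDerivAt_const w x))).clm_apply (hasFDerivAt_const z x)
    have t : ∀ a b c : F, HasFDerivAt (fun y => fderiv ℝ (fderiv ℝ (fderiv ℝ P)) y a b c) _ x :=
      fun a b c => ((h3.clm_apply (hasFDerivAt_const a x)).clm_apply
        (hasFDerivAt_const b x)).clm_apply (hasFDerivAt_const c x)
    have r := ((((t v w z).add (t v (Complex.I • w) (Complex.I • z))).add
      (t (Complex.I • v) w (Complex.I • z))).sub
      (t (Complex.I • v) (Complex.I • w) z)).const_mul (1 / 4 : ℝ)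
    have q := congrArg (fun l => l u) (l.unique (r.congr_of_eventuallyEq e))
    simp at q
    simp only [hP4]
    linarith
  have s4 : ∀ a b c d : F, P4 a b c d = P4 b a c d := fun a b c d => by
    rw [hP4, symm_second (contDiffAt_fderiv_infty (contDiffAt_fderiv_infty hP)) a b]
  -- The products of Christoffel symbols cancel against derivatives of the metric. Only fourth
  -- derivatives of `P` remain, and their symmetry gives the symmetry of `H`.
  have main : ∀ u v z : F, leviForm P x (H u v w) z = (1 / 4 : ℝ) *
      ((P4 u v w z + P4 u v (Complex.I • w) (Complex.I • z)
      + P4 u (Complex.I • v) w (Complex.I • z) - P4 u (Complex.I • v) (Complex.I • w) z)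
      + (P4 (Complex.I • u) v w (Complex.I • z) - P4 (Complex.I • u) v (Complex.I • w) z
      - P4 (Complex.I • u) (Complex.I • v) w z
      - P4 (Complex.I • u) (Complex.I • v) (Complex.I • w) (Complex.I • z))) := by
    intro u v z
    have d1 := dlow u v w z
    have d2 := dlow (Complex.I • u) v w (Complex.I • z)
    have d3 : leviForm P x (Γ x u (Γ x v w)) z = _ :=
      (congrArg (fun l => l z) (christoffel_spec hi0 u (Γ x v w))).trans
        (lowChristoffel_leviForm hP hP' u _ z)
    rw [fderiv_leviForm hP] at d1 d2
    simp only [I_smul_I_smul, map_neg] at d2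
    simp only [H, map_add, map_sub, _root_.add_apply, _root_.sub_apply,
      leviForm_I_left, map_smul, _root_.smul_apply, smul_eq_mul]
    rw [d3]
    linarith
  apply hi0.bijective.1
  ext z
  rw [main, main, s4 u v, s4 u v, s4 u (Complex.I • v), s4 u (Complex.I • v),
    s4 (Complex.I • u) v, s4 (Complex.I • u) v, s4 (Complex.I • u) (Complex.I • v),
    s4 (Complex.I • u) (Complex.I • v)]
  ring

/-- The Kähler formula Ric = -i∂∂̄ log det in real terms. Since the (2,0) part of the curvature
vanishes, twice the map u ↦ R(u, v)w is an antilinear map, which has no trace, minus a map whose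
trace is D²L(v, w) + D²L(iv, iw). -/
theorem coordRicci_leviForm (hP : ContDiffAt ℝ ∞ P x)
    (hP' : ∀ᶠ y in 𝓝 x, ContDiffAt ℝ ∞ P y)
    (hi : ∀ᶠ y in 𝓝 x, (leviForm P y).IsInvertible) {L : F → ℝ} (hL : ContDiffAt ℝ ∞ L x)
    (hLt : ∀ᶠ y in 𝓝 x, ∀ w, fderiv ℝ L y w = LinearMap.trace ℝ F
      ((christoffel (leviForm P) y).flip w : F →ₗ[ℝ] F)) (v w : F) :
    coordRicci (leviForm P) x v w = -leviForm L x v w := by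
  have : CompleteSpace F := FiniteDimensional.complete ℂ F
  have : FiniteDimensional ℝ F := FiniteDimensional.complexToReal F
  have hi0 := hi.self_of_nhds
  set Γ := christoffel (leviForm P) with hΓdef
  have hΓ := ((contDiffAt_christoffel (contDiffAt_leviForm hP) hi0).differentiableAt
    (by simp)).hasFDerivAt
  let tr : (F →L[ℝ] F) →L[ℝ] ℝ :=
    LinearMap.toContinuousLinearMap ((LinearMap.trace ℝ F) ∘ₗ (ContinuousLinearMap.coeLM ℝ))
  have tr_apply : ∀ T : F →L[ℝ] F, tr T = LinearMap.trace ℝ F (T : F →ₗ[ℝ] F) := fun T => rfl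
  have hL1 := ((contDiffAt_fderiv_infty hL).differentiableAt (by simp)).hasFDerivAt
  have eI : ∀ᶠ y in 𝓝 x, ∀ u v, Γ y u (Complex.I • v) = Complex.I • Γ y u v := by
    filter_upwards [hP', hP'.eventually_nhds, hi] with y h1 h2 h3 u v
      using christoffel_leviForm_I h1 h2 h3 u v
  have dI : ∀ u a b, fderiv ℝ Γ x u a (Complex.I • b) = Complex.I • fderiv ℝ Γ x u a b := by
    intro u a b
    have h1 := (hΓ.clm_apply (hasFDerivAt_const a x)).clm_apply
      (hasFDerivAt_const (Complex.I • b) x)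
    have h2 := ((mulI : F →L[ℝ] F).hasFDerivAt (x := Γ x a b)).comp x
      ((hΓ.clm_apply (hasFDerivAt_const a x)).clm_apply (hasFDerivAt_const b x))
    have h3 := congrArg (fun l => l u)
      (h1.unique (h2.congr_of_eventuallyEq (eI.mono fun y hy => hy a b)))
    simpa using h3
  have trD : ∀ a b, fderiv ℝ (fderiv ℝ L) x a b = tr ((fderiv ℝ Γ x a).flip b) := by
    intro a b
    let fl : (F →L[ℝ] F →L[ℝ] F) →L[ℝ] F →L[ℝ] F :=
      ((ContinuousLinearMap.flipₗᵢ ℝ F F F).toContinuousLinearEquiv :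
        (F →L[ℝ] F →L[ℝ] F) →L[ℝ] F →L[ℝ] F →L[ℝ] F).flip b
    have h1 := hL1.clm_apply (hasFDerivAt_const b x)
    have h2 := ((tr ∘L fl).hasFDerivAt (x := Γ x)).comp x hΓ
    have h3 := congrArg (fun l => l a)
      (h1.unique (h2.congr_of_eventuallyEq (hLt.mono fun y hy => hy b)))
    simpa [fl] using h3
  let A : F →L[ℝ] F := ((fderiv ℝ Γ x).flip v).flip w
  have hA : LinearMap.trace ℝ F ((A + mulI ∘L A ∘L mulI : F →L[ℝ] F) : F →ₗ[ℝ] F) = 0 := by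
    apply trace_eq_zero_of_antilinear
    intro u
    simp [A, I_smul_I_smul, smul_add]
  have hR : (2 : ℝ) • curvature (leviForm P) x v w = (A + mulI ∘L A ∘L mulI) -
      ((fderiv ℝ Γ x v).flip w + (fderiv ℝ Γ x (Complex.I • v)).flip (Complex.I • w)) := by
    ext u
    have h := christoffel_leviForm_holo hP hP' hi u v w
    simp only [← hΓdef] at h
    have h' := sub_eq_zero.2 h
    simp only [_root_.smul_apply, curvature_apply, _root_.sub_apply, _root_.add_apply, A,
      ContinuousLinearMap.comp_apply, mulI_apply, ContinuousLinearMap.flip_apply, dI, ← hΓdef]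
    rw [← sub_eq_zero, ← h']
    module
  have h2 : (2 : ℝ) * coordRicci (leviForm P) x v w = tr ((2 : ℝ) • curvature (leviForm P) x v w) := by
    rw [map_smul]; rfl
  rw [hR, map_sub, tr_apply, hA, map_add, ← trD, ← trD] at h2
  rw [leviForm_apply]
  linarith

end Kahler

/-! ### The volume form of a Kähler metric -/

section Volume

variable {F : Type*} [NormedAddCommGroup F] [NormedSpace ℂ F]
  {ι : Type*} [Fintype ι] [DecidableEq ι]

/-- Each complex basis vector e contributes the two real ones e and ie, with the same diagonal
entry. -/
theorem trace_restrictScalars_complex (b : Module.Basis ι ℂ F) (T : F →ₗ[ℂ] F) :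
    LinearMap.trace ℝ F (T.restrictScalars ℝ) = 2 * (LinearMap.trace ℂ F T).re := by
  let b' := Complex.basisOneI.smulTower b
  rw [LinearMap.trace_eq_matrix_trace ℝ b', LinearMap.trace_eq_matrix_trace ℂ b]
  simp only [Matrix.trace, Matrix.diag_apply, LinearMap.toMatrix_apply]
  rw [Fintype.sum_prod_type, Fin.sum_univ_two, Complex.re_sum, two_mul]
  congr 1 <;> refine Finset.sum_congr rfl fun i _ => ?_
  · simp [b', Module.Basis.smulTower_repr, Module.Basis.smulTower_apply]
  · simp [b', Module.Basis.smulTower_repr, Module.Basis.smulTower_apply]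

/-- The sesquilinear form whose real part is `G`. -/
def hermForm (G : F →L[ℝ] F →L[ℝ] ℝ) (u v : F) : ℂ := G u v - Complex.I * G (Complex.I • u) v

theorem hermForm_add (G : F →L[ℝ] F →L[ℝ] ℝ) (u u' v : F) :
    hermForm G (u + u') v = hermForm G u v + hermForm G u' v := by
  simp [hermForm]; ring

theorem hermForm_smul (G : F →L[ℝ] F →L[ℝ] ℝ) (c : ℂ) (u v : F) :
    hermForm G (c • u) v = c * hermForm G u v := by
  have e1 : c • u = c.re • u + c.im • (Complex.I • u) := by
    conv_lhs => rw [← Complex.re_add_im c]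
    rw [add_smul, mul_smul]
    rfl
  have e2 : Complex.I • c • u = c.re • (Complex.I • u) - c.im • u := by
    rw [e1, smul_add, smul_comm Complex.I c.re, smul_comm Complex.I c.im, I_smul_I_smul]
    simp [sub_eq_add_neg]
  rw [hermForm, e2, e1, hermForm]
  simp only [map_add, map_sub, map_smul, _root_.add_apply, _root_.sub_apply, _root_.smul_apply,
    smul_eq_mul]
  apply Complex.ext <;> simp <;> ring

theorem hermForm_sum (G : F →L[ℝ] F →L[ℝ] ℝ) {κ : Type*} (s : Finset κ) (f : κ → F) (v : F) :
    hermForm G (∑ i ∈ s, f i) v = ∑ i ∈ s, hermForm G (f i) v := by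
  classical
  induction s using Finset.induction_on with
  | empty => simp [hermForm]
  | insert a s ha ih => rw [Finset.sum_insert ha, Finset.sum_insert ha, hermForm_add, ih]

/-- The Gram matrix of the sesquilinear form whose real part is `G`. -/
def gram (b : Module.Basis ι ℂ F) (G : F →L[ℝ] F →L[ℝ] ℝ) : Matrix ι ι ℂ :=
  Matrix.of fun i j => hermForm G (b i) (b j)

theorem gram_eq_mul {b : Module.Basis ι ℂ F} {G D : F →L[ℝ] F →L[ℝ] ℝ} (T : F →ₗ[ℂ] F)
    (h : ∀ u v, D u v = G (T u) v) : gram b D = (LinearMap.toMatrix b b T)ᵀ * gram b G := by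
  ext j k
  have h1 : hermForm D (b j) (b k) = hermForm G (T (b j)) (b k) := by
    simp [hermForm, h]
  rw [Matrix.mul_apply, gram, Matrix.of_apply, h1, ← b.sum_repr (T (b j)), hermForm_sum]
  refine Finset.sum_congr rfl fun i _ => ?_
  rw [hermForm_smul]
  simp [LinearMap.toMatrix_apply, gram]

/-- A row relation of the Gram matrix is a vector orthogonal to all basis vectors and to their
multiples by `I`, hence to itself. -/
theorem gram_det_ne_zero (b : Module.Basis ι ℂ F) {G : F →L[ℝ] F →L[ℝ] ℝ}
    (hJ : ∀ u v, G (Complex.I • u) (Complex.I • v) = G u v)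
    (hpos : ∀ u, u ≠ 0 → 0 < G u u) : (gram b G).det ≠ 0 := by
  intro h0
  obtain ⟨c, hc, h⟩ := Matrix.exists_vecMul_eq_zero_iff.2 h0
  set u := ∑ i, c i • b i with hu
  have hk : ∀ k, hermForm G u (b k) = 0 := by
    intro k
    have := congrFun h k
    simp only [Matrix.vecMul, dotProduct, gram, Matrix.of_apply, Pi.zero_apply] at this
    rw [hu, hermForm_sum]
    simpa [hermForm_smul] using this
  have hu0 : u ≠ 0 := by
    intro h0
    apply hc
    funext i
    exact Fintype.linearIndependent_iff.1 b.linearIndependent c h0 i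
  have h1 : ∀ k, G u (b k) = 0 ∧ G u (Complex.I • b k) = 0 := by
    intro k
    have h2 := hk k
    have h3 := congrArg Complex.re h2
    have h4 := congrArg Complex.im h2
    simp [hermForm] at h3 h4
    refine ⟨h3, ?_⟩
    rw [← hJ, I_smul_I_smul, map_neg, h4, neg_zero]
  have h2 : ∀ v, G u v = 0 := by
    intro v
    rw [← b.sum_repr v, map_sum]
    refine Finset.sum_eq_zero fun i _ => ?_
    have e1 : b.repr v i • b i = (b.repr v i).re • b i + (b.repr v i).im • (Complex.I • b i) := by
      conv_lhs => rw [← Complex.re_add_im (b.repr v i)]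
      rw [add_smul, mul_smul]
      rfl
    rw [e1, map_add, map_smul, map_smul, (h1 i).1, (h1 i).2]
    simp
  exact absurd (hpos u hu0) (by rw [h2]; simp)

/-- Under the isomorphism with the dual space given by `G`, the transpose of `S` corresponds to -S,
and a map and its transpose have the same trace. -/
theorem trace_skew [FiniteDimensional ℝ F] {G : F →L[ℝ] F →L[ℝ] ℝ}
    (hpos : ∀ u, u ≠ 0 → 0 < G u u) (hs : ∀ u v, G u v = G v u) (S : F →ₗ[ℝ] F)
    (hS : ∀ u v, G (S u) v = -G (S v) u) : LinearMap.trace ℝ F S = 0 := by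
  let e₀ : F →ₗ[ℝ] Module.Dual ℝ F :=
    (ContinuousLinearMap.coeLM ℝ : (F →L[ℝ] ℝ) →ₗ[ℝ] (F →ₗ[ℝ] ℝ)) ∘ₗ (G : F →ₗ[ℝ] F →L[ℝ] ℝ)
  have inj : Function.Injective e₀ := by
    rw [← LinearMap.ker_eq_bot, LinearMap.ker_eq_bot']
    intro u hu
    by_contra hne
    have h1 : G u u = 0 := congrArg (fun l : Module.Dual ℝ F => l u) hu
    exact (hpos u hne).ne' h1
  let e := LinearEquiv.ofInjectiveOfFinrankEq e₀ inj (Subspace.dual_finrank_eq (K := ℝ) (V := F)).symm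
  have he : ∀ u v, e u v = G u v := fun u v => rfl
  have h1 : Module.Dual.transpose (R := ℝ) S = -(e.conj S) := by
    ext l v
    obtain ⟨u, rfl⟩ := e.surjective l
    simp only [Module.Dual.transpose_apply, LinearMap.comp_apply, LinearMap.neg_apply,
      LinearEquiv.conj_apply, LinearEquiv.coe_coe, LinearEquiv.symm_apply_apply, he]
    rw [hs, hS]
  have h2 := LinearMap.trace_transpose' (R := ℝ) S
  rw [h1, map_neg, LinearMap.trace_conj'] at h2
  linarith

/-- Jacobi's formula: factor out `A₀` and use det(1 + tN) = 1 + t tr N + O(t²). -/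
theorem fderiv_det {A₀ A₁ : ι → ι → ℂ} (h : (Matrix.of A₀).det ≠ 0) :
    fderiv ℝ (fun A : ι → ι → ℂ => (Matrix.of A).det) A₀ A₁ =
      (Matrix.of A₀).det * ((Matrix.of A₀)⁻¹ * Matrix.of A₁).trace := by
  have hd : ContDiff ℝ ∞ (fun A : ι → ι → ℂ => (Matrix.of A).det) := by
    simp only [Matrix.det_apply, Matrix.of_apply]
    refine ContDiff.sum fun σ _ => ?_
    refine ContDiff.const_smul _ (contDiff_prod fun i _ => ?_)
    exact contDiff_apply_apply ℝ ℂ _ _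
  have h1 : HasDerivAt (fun t : ℝ => (Matrix.of (A₀ + t • A₁)).det)
      (fderiv ℝ (fun A : ι → ι → ℂ => (Matrix.of A).det) A₀ A₁) 0 := by
    have h2 : HasDerivAt (fun t : ℝ => A₀ + t • A₁) A₁ 0 := by
      simpa using ((hasDerivAt_id (0 : ℝ)).smul_const A₁).const_add A₀
    have h3 := ((hd.differentiable (by simp)) (A₀ + (0 : ℝ) • A₁)).hasFDerivAt
    have := h3.comp_hasDerivAt (0 : ℝ) h2
    simp only [zero_smul, add_zero] at this
    exact this
  set N := (Matrix.of A₀)⁻¹ * Matrix.of A₁ with hN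
  -- The quotient of the polynomial det(1 + tN) by t², so that the remainder term is q(t)t².
  set q := (Matrix.det (1 + (Polynomial.X : Polynomial ℂ) • N.map Polynomial.C)).divX.divX
  have h4 : (fun t : ℝ => (Matrix.of (A₀ + t • A₁)).det) = fun t : ℝ =>
      (Matrix.of A₀).det * (1 + N.trace * (t : ℂ) + q.eval (t : ℂ) * (t : ℂ) ^ 2) := by
    funext t
    rw [← Matrix.det_one_add_smul, ← Matrix.det_mul, Matrix.mul_add, hN, mul_one,
      Matrix.mul_smul, ← mul_assoc, Matrix.mul_nonsing_inv _ (isUnit_iff_ne_zero.2 h), one_mul]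
    congr 1
  have h5 : HasDerivAt (fun t : ℝ => (Matrix.of A₀).det *
      (1 + N.trace * (t : ℂ) + q.eval (t : ℂ) * (t : ℂ) ^ 2)) ((Matrix.of A₀).det * N.trace) 0 := by
    have ht : HasDerivAt (fun t : ℝ => (t : ℂ)) 1 0 := Complex.ofRealCLM.hasDerivAt
    have hq : HasDerivAt (fun t : ℝ => q.eval (t : ℂ)) (q.derivative.eval ((0 : ℝ) : ℂ) * 1) 0 :=
      HasDerivAt.comp (h := fun t : ℝ => (t : ℂ)) (0 : ℝ) (q.hasDerivAt ((0 : ℝ) : ℂ)) ht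
    have := (((ht.const_mul N.trace).const_add 1).add (hq.mul (ht.pow 2))).const_mul (Matrix.of A₀).det
    simpa using this
  rw [h4] at h1
  exact h1.unique h5

theorem fderiv_log_norm {f : F → ℂ} {x : F} (hf : DifferentiableAt ℝ f x) (h0 : f x ≠ 0) (w : F) :
    fderiv ℝ (fun y => Real.log ‖f y‖) x w = ((f x)⁻¹ * fderiv ℝ f x w).re := by
  have e : (fun y => Real.log ‖f y‖) = fun y => (1 / 2 : ℝ) * Real.log (‖f y‖ ^ 2) := by
    funext y; rw [Real.log_pow]; push_cast; ring
  have h1 := hf.hasFDerivAt.norm_sq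
  have h2 := (h1.log (by simp [h0])).const_mul (1 / 2 : ℝ)
  rw [e, h2.fderiv]
  simp only [_root_.smul_apply, smul_eq_mul, ContinuousLinearMap.comp_apply, innerSL_apply_apply,
    Complex.inner, Complex.inv_def, nsmul_eq_mul]
  rw [Complex.normSq_eq_norm_sq]
  obtain ⟨r, hr⟩ : ∃ r, r = ‖f x‖ ^ 2 := ⟨_, rfl⟩
  rw [← hr]
  simp [-Complex.ofReal_inv]
  ring

theorem contDiffAt_log_norm {f : F → ℂ} {x : F} (hf : ContDiffAt ℝ ∞ f x) (h0 : f x ≠ 0) :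
    ContDiffAt ℝ ∞ (fun y => Real.log ‖f y‖) x :=
  (hf.norm ℝ h0).log (by simp [h0])

theorem eventually_isInvertible_leviForm [FiniteDimensional ℂ F] {P : F → ℝ} {x : F}
    (hpos : ∀ᶠ y in 𝓝 x, ∀ u, u ≠ 0 → 0 < leviForm P y u u) :
    ∀ᶠ y in 𝓝 x, (leviForm P y).IsInvertible := by
  have : FiniteDimensional ℝ F := FiniteDimensional.complexToReal F
  exact hpos.mono fun y hy => isInvertible_of_pos hy

theorem fderiv_apply_symm {P : F → ℝ} {x : F} (hP : ContDiffAt ℝ ∞ P x)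
    (hP' : ∀ᶠ y in 𝓝 x, ContDiffAt ℝ ∞ P y) (a u v : F) :
    fderiv ℝ (leviForm P) x a u v = fderiv ℝ (leviForm P) x a v u := by
  rw [fderiv_leviForm hP, fderiv_leviForm hP, third_symm' hP hP' a u v,
    third_symm' hP hP' a (Complex.I • u)]

variable [FiniteDimensional ℂ F] {P : F → ℝ} {x : F}

/-- The Gram matrix, as a linear function of the metric. -/
def gramL (b : Module.Basis ι ℂ F) : (F →L[ℝ] F →L[ℝ] ℝ) →L[ℝ] (ι → ι → ℂ) :=
  haveI : FiniteDimensional ℝ F := FiniteDimensional.complexToReal F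
  haveI : FiniteDimensional ℝ (F →L[ℝ] F →L[ℝ] ℝ) := inferInstance
  LinearMap.toContinuousLinearMap
    { toFun := fun G i j => gram b G i j
      map_add' := fun G G' => by
        funext i j
        simp [gram, hermForm]; ring
      map_smul' := fun r G => by
        funext i j
        simp [gram, hermForm]; ring }

theorem contDiffAt_det_gram (b : Module.Basis ι ℂ F) (hP : ContDiffAt ℝ ∞ P x) :
    ContDiffAt ℝ ∞ (fun y => (gram b (leviForm P y)).det) x := by
  have hd : ContDiff ℝ ∞ (fun A : ι → ι → ℂ => (Matrix.of A).det) := by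
    simp only [Matrix.det_apply, Matrix.of_apply]
    refine ContDiff.sum fun σ _ => ?_
    refine ContDiff.const_smul _ (contDiff_prod fun i _ => ?_)
    exact contDiff_apply_apply ℝ ℂ _ _
  exact hd.contDiffAt.comp x ((gramL b).contDiff.contDiffAt.comp x (contDiffAt_leviForm hP))

theorem fderiv_det_gram (b : Module.Basis ι ℂ F) (hP : ContDiffAt ℝ ∞ P x)
    (h : (gram b (leviForm P x)).det ≠ 0) (w : F) :
    fderiv ℝ (fun y => (gram b (leviForm P y)).det) x w =
      (gram b (leviForm P x)).det *
        ((gram b (leviForm P x))⁻¹ * gram b (fderiv ℝ (leviForm P) x w)).trace := by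
  have hd : ContDiff ℝ ∞ (fun A : ι → ι → ℂ => (Matrix.of A).det) := by
    simp only [Matrix.det_apply, Matrix.of_apply]
    refine ContDiff.sum fun σ _ => ?_
    refine ContDiff.const_smul _ (contDiff_prod fun i _ => ?_)
    exact contDiff_apply_apply ℝ ℂ _ _
  have h1 := ((contDiffAt_leviForm hP).differentiableAt (by simp)).hasFDerivAt
  have h2 := ((gramL b).hasFDerivAt (x := leviForm P x)).comp x h1
  have h3 := ((hd.differentiable (by simp)) (gramL b (leviForm P x))).hasFDerivAt.comp x h2
  have h4 : fderiv ℝ (fun y => (gram b (leviForm P y)).det) x w = _ :=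
    congrArg (fun l => l w) h3.fderiv
  rw [h4]
  exact fderiv_det (A₀ := gramL b (leviForm P x)) h

/-- Write D_wG = G(T·, ·) with T complex linear. Jacobi's formula gives d log|det|(w) = Re tr_ℂ T =
½ tr_ℝ T, and 2Γ(·, w) - T is skew for the metric, so it has no trace. -/
theorem fderiv_log_det_gram (b : Module.Basis ι ℂ F) (hP : ContDiffAt ℝ ∞ P x)
    (hP' : ∀ᶠ y in 𝓝 x, ContDiffAt ℝ ∞ P y)
    (hpos : ∀ u, u ≠ 0 → 0 < leviForm P x u u) (w : F) :
    fderiv ℝ (fun y => Real.log ‖(gram b (leviForm P y)).det‖) x w =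
      LinearMap.trace ℝ F ((christoffel (leviForm P) x).flip w : F →ₗ[ℝ] F) := by
  have : FiniteDimensional ℝ F := FiniteDimensional.complexToReal F
  have hdet := gram_det_ne_zero b (leviForm_I P x) hpos
  have hi := isInvertible_of_pos hpos
  obtain ⟨e, he⟩ := hi
  have hi : (leviForm P x).IsInvertible := ⟨e, he⟩
  have heu : ∀ l v, leviForm P x (e.symm l) v = l v := fun l v => by rw [← he]; simp
  set D := fderiv ℝ (leviForm P) x w with hD
  have DI : ∀ u v, D (Complex.I • u) v = -D u (Complex.I • v) := by
    intro u v
    rw [hD, fderiv_leviForm hP, fderiv_leviForm hP]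
    simp only [I_smul_I_smul, map_neg, _root_.neg_apply]
    ring
  -- Complex linearity holds because the derivative of the metric is again invariant under `I`.
  let T : F →ₗ[ℂ] F :=
    { toFun := fun u => e.symm (D u)
      map_add' := fun u v => by simp
      map_smul' := fun c u => by
        apply hi.bijective.1
        ext v
        have e1 : ∀ z : F, c • z = c.re • z + c.im • (Complex.I • z) := fun z => by
          conv_lhs => rw [← Complex.re_add_im c]
          rw [add_smul, mul_smul]
          rfl
        rw [heu, RingHom.id_apply, e1 u, e1 (e.symm (D u))]
        simp only [map_add, map_smul, _root_.add_apply, _root_.smul_apply, heu, leviForm_I_left, DI] }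
  have hT : ∀ u v, D u v = leviForm P x (T u) v := fun u v => (heu _ v).symm
  let Γw : F →ₗ[ℝ] F := ((christoffel (leviForm P) x).flip w : F →L[ℝ] F)
  let S : F →ₗ[ℝ] F := (2 : ℝ) • Γw - T.restrictScalars ℝ
  have hS : ∀ u v, leviForm P x (S u) v = fderiv ℝ (leviForm P) x u w v - fderiv ℝ (leviForm P) x v u w := by
    intro u v
    have h1 : S u = (2 : ℝ) • christoffel (leviForm P) x u w - T u := rfl
    rw [h1, map_sub, map_smul, _root_.sub_apply, _root_.smul_apply, christoffel_spec hi, ← hT,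
      lowChristoffel_apply, smul_eq_mul]
    ring
  have hsym := fderiv_apply_symm hP hP'
  have tS : LinearMap.trace ℝ F S = 0 := by
    refine trace_skew hpos (leviForm_symm hP) S fun u v => ?_
    rw [hS, hS, hsym v u w, hsym u v w]
    ring
  have h2 : LinearMap.trace ℝ F Γw = (1 / 2 : ℝ) * LinearMap.trace ℝ F (T.restrictScalars ℝ) := by
    have : LinearMap.trace ℝ F S = 2 * LinearMap.trace ℝ F Γw
        - LinearMap.trace ℝ F (T.restrictScalars ℝ) := by
      simp [S]
    linarith
  change _ = LinearMap.trace ℝ F Γw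
  rw [h2, trace_restrictScalars_complex b,
    fderiv_log_norm ((contDiffAt_det_gram b hP).differentiableAt (by simp)) hdet,
    fderiv_det_gram b hP hdet, ← mul_assoc, inv_mul_cancel₀ hdet, one_mul, ← hD, gram_eq_mul T hT,
    Matrix.trace_mul_comm, mul_assoc, Matrix.mul_nonsing_inv _ (isUnit_iff_ne_zero.2 hdet), mul_one,
    Matrix.trace_transpose, ← LinearMap.trace_eq_matrix_trace ℂ b]
  ring

/-- The real part of a holomorphic function is pluriharmonic. -/
theorem leviForm_re {f : F → ℂ} (hf : ContDiffAt ℂ 2 f x) (u v : F) :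
    leviForm (fun y => (f y).re) x u v = 0 := by
  have hev : ∀ᶠ y in 𝓝 x, DifferentiableAt ℂ f y :=
    (hf.eventually (by simp)).mono fun y hy => hy.differentiableAt (by simp)
  have h1 : fderiv ℝ (fun y => (f y).re) =ᶠ[𝓝 x]
      fun y => Complex.reCLM ∘L ((fderiv ℂ f y).restrictScalars ℝ) := by
    filter_upwards [hev] with y hy
    exact ((Complex.reCLM.hasFDerivAt).comp y (hy.hasFDerivAt.restrictScalars ℝ)).fderiv
  have h2 : HasFDerivAt (fderiv ℂ f) (fderiv ℂ (fderiv ℂ f) x) x :=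
    ((hf.fderiv_right (m := 1) (by norm_num)).differentiableAt (by simp)).hasFDerivAt
  have h3 : ∀ a b, fderiv ℝ (fderiv ℝ (fun y => (f y).re)) x a b =
      (fderiv ℂ (fderiv ℂ f) x a b).re := by
    intro a b
    rw [h1.fderiv_eq]
    have d : HasFDerivAt (fun y => (Complex.reCLM ∘L ((fderiv ℂ f y).restrictScalars ℝ) : F →L[ℝ] ℝ))
        (((ContinuousLinearMap.compL ℝ F ℂ ℝ Complex.reCLM) ∘L
          (ContinuousLinearMap.restrictScalarsL ℂ F ℂ ℝ ℝ)) ∘L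
          (fderiv ℂ (fderiv ℂ f) x).restrictScalars ℝ) x :=
      (((ContinuousLinearMap.compL ℝ F ℂ ℝ Complex.reCLM) ∘L
        (ContinuousLinearMap.restrictScalarsL ℂ F ℂ ℝ ℝ)).hasFDerivAt).comp x
        (h2.restrictScalars ℝ)
    rw [d.fderiv]
    rfl
  rw [leviForm_apply, h3, h3, map_smul, map_smul, _root_.smul_apply, smul_smul, Complex.I_mul_I]
  simp

theorem leviForm_congr {P Q : F → ℝ} (h : P =ᶠ[𝓝 x] Q) : leviForm P x = leviForm Q x := by
  ext u v
  rw [leviForm_apply, leviForm_apply, (h.fderiv).fderiv_eq]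

theorem leviForm_add {P Q : F → ℝ} (hP : ContDiffAt ℝ ∞ P x) (hP' : ∀ᶠ y in 𝓝 x, ContDiffAt ℝ ∞ P y)
    (hQ : ContDiffAt ℝ ∞ Q x) (hQ' : ∀ᶠ y in 𝓝 x, ContDiffAt ℝ ∞ Q y) (c : ℝ) (u v : F) :
    leviForm (fun y => P y + c * Q y) x u v = leviForm P x u v + c * leviForm Q x u v := by
  have h1 : fderiv ℝ (fun y => P y + c * Q y) =ᶠ[𝓝 x] fun y => fderiv ℝ P y + c • fderiv ℝ Q y := by
    filter_upwards [hP', hQ'] with y h1 h2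
    exact ((h1.differentiableAt (by simp)).hasFDerivAt.add
      ((h2.differentiableAt (by simp)).hasFDerivAt.const_mul c)).fderiv
  have h2 := ((contDiffAt_fderiv_infty hP).differentiableAt (by simp)).hasFDerivAt
  have h3 := ((contDiffAt_fderiv_infty hQ).differentiableAt (by simp)).hasFDerivAt
  have h4 : fderiv ℝ (fun y => fderiv ℝ P y + c • fderiv ℝ Q y) x = _ :=
    (h2.add (h3.const_smul c)).fderiv
  simp only [leviForm_apply, h1.fderiv_eq, h4, _root_.add_apply,
    _root_.smul_apply, smul_eq_mul]
  ring

/-- If the volume form of the Kähler metric `leviForm P` is `exp (-Λ P)`, up to a pluriharmonic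
factor, then the metric is Einstein. -/
theorem coordRicci_of_log_det (b : Module.Basis ι ℂ F) (hP : ContDiffAt ℝ ∞ P x)
    (hP' : ∀ᶠ y in 𝓝 x, ContDiffAt ℝ ∞ P y)
    (hpos : ∀ᶠ y in 𝓝 x, ∀ u, u ≠ 0 → 0 < leviForm P y u u) {f : F → ℂ}
    (hf : ContDiffAt ℂ ω f x) {Λ : ℝ}
    (hdet : ∀ᶠ y in 𝓝 x, Real.log ‖(gram b (leviForm P y)).det‖ = (f y).re + (-Λ) * P y) (v w : F) :
    coordRicci (leviForm P) x v w = Λ * leviForm P x v w := by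
  have hL : ContDiffAt ℝ ∞ (fun y => Real.log ‖(gram b (leviForm P y)).det‖) x :=
    contDiffAt_log_norm (contDiffAt_det_gram b hP)
      (gram_det_ne_zero b (leviForm_I P x) hpos.self_of_nhds)
  rw [coordRicci_leviForm hP hP' (eventually_isInvertible_leviForm hpos) hL
    (by filter_upwards [hP', hP'.eventually_nhds, hpos] with y h1 h2 h3 w
      using fderiv_log_det_gram b h1 h2 h3 w),
    leviForm_congr hdet, leviForm_add _ _ hP hP', leviForm_re (hf.of_le le_top)]
  · ring
  · exact Complex.reCLM.contDiff.contDiffAt.comp x ((hf.restrict_scalars ℝ).of_le le_top)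
  · filter_upwards [hf.eventually (by simp)] with y hy
    exact Complex.reCLM.contDiff.contDiffAt.comp y ((hy.restrict_scalars ℝ).of_le le_top)

end Volume

/-! ### The affine quadric -/

/-- The complex space `ℂ^(n+2)`. -/
def CV (n : ℕ) : Type := EuclideanSpace ℂ (Fin (n + 2))

instance (n : ℕ) : NormedAddCommGroup (CV n) :=
  inferInstanceAs (NormedAddCommGroup (EuclideanSpace ℂ (Fin (n + 2))))
instance (n : ℕ) : InnerProductSpace ℂ (CV n) :=
  inferInstanceAs (InnerProductSpace ℂ (EuclideanSpace ℂ (Fin (n + 2))))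
instance (n : ℕ) : FiniteDimensional ℂ (CV n) :=
  inferInstanceAs (FiniteDimensional ℂ (EuclideanSpace ℂ (Fin (n + 2))))

section Quadric

variable {n : ℕ}

/-- The coordinates of `ℂ^(n+2)`. -/
def coord (i : Fin (n + 2)) : CV n →L[ℂ] ℂ :=
  (EuclideanSpace.proj i : EuclideanSpace ℂ (Fin (n + 2)) →L[ℂ] ℂ)

/-- The bilinear form of `ℂ^(n+2)`. -/
def dot : CV n →L[ℂ] CV n →L[ℂ] ℂ := ∑ i, (coord i).smulRight (coord i)

theorem dot_apply (u v : CV n) : dot u v = ∑ i, coord i u * coord i v := by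
  simp [dot]

theorem dot_comm (u v : CV n) : dot u v = dot v u := by
  simp only [dot_apply, mul_comm]

theorem inner_eq_sum (u v : CV n) : inner ℂ u v = ∑ i, (starRingEnd ℂ) (coord i u) * coord i v := by
  have h : ∀ u v : EuclideanSpace ℂ (Fin (n + 2)),
      inner ℂ u v = ∑ i, (starRingEnd ℂ) (u i) * v i := fun u v => by
    simp [PiLp.inner_apply, mul_comm]
  exact h u v

theorem inner_self_eq (z : CV n) : inner ℂ z z = ((‖z‖ ^ 2 : ℝ) : ℂ) := by
  rw [inner_self_eq_norm_sq_to_K]; push_cast; rfl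

/-- The complex conjugation of `ℂ^(n+2)`. -/
def conjV (z : CV n) : CV n := WithLp.toLp 2 (fun i => (starRingEnd ℂ) (coord i z))

theorem coord_conjV (z : CV n) (i : Fin (n + 2)) : coord i (conjV z) = (starRingEnd ℂ) (coord i z) := rfl

theorem inner_conjV (u v : CV n) : inner ℂ (conjV u) v = dot u v := by
  simp [inner_eq_sum, coord_conjV, dot_apply]

theorem norm_conjV (z : CV n) : ‖conjV z‖ = ‖z‖ := by
  have h : ((‖conjV z‖ ^ 2 : ℝ) : ℂ) = ((‖z‖ ^ 2 : ℝ) : ℂ) := by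
    rw [← inner_self_eq, ← inner_self_eq, inner_eq_sum, inner_eq_sum]
    simp [coord_conjV, mul_comm]
  have h' : ‖conjV z‖ ^ 2 = ‖z‖ ^ 2 := by exact_mod_cast h
  exact (sq_eq_sq₀ (norm_nonneg _) (norm_nonneg _)).1 h'

theorem norm_dot_le (u v : CV n) : ‖dot u v‖ ≤ ‖u‖ * ‖v‖ := by
  rw [← inner_conjV, ← norm_conjV u]
  exact norm_inner_le_norm _ _

theorem one_le_norm_sq {z : CV n} (hz : dot z z = 1) : 1 ≤ ‖z‖ ^ 2 := by
  have := norm_dot_le z z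
  rw [hz] at this
  simpa [sq] using this

/-- On the tangent space `{u | z·u = 0}` of the quadric, Cauchy–Schwarz improves. -/
theorem inner_sq_le {z u : CV n} (hz : dot z z = 1) (hu : dot z u = 0) :
    ‖z‖ ^ 2 * ‖inner ℂ z u‖ ^ 2 ≤ (‖z‖ ^ 4 - 1) * ‖u‖ ^ 2 := by
  set N := ‖z‖ ^ 2 with hN
  have hN1 : 1 ≤ N := one_le_norm_sq hz
  -- Up to the factor `N`, this is the orthogonal projection of `z` to the tangent space, whose
  -- hermitian normal is `conjV z`. Cauchy–Schwarz is applied to `p` in place of `z`.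
  let p : CV n := (N : ℂ) • z - conjV z
  have h1 : inner ℂ p u = N * inner ℂ z u := by
    simp only [p, inner_sub_left, inner_smul_left, inner_conjV, hu]
    simp
  have h2 : ((‖p‖ ^ 2 : ℝ) : ℂ) = ((N * (N ^ 2 - 1) : ℝ) : ℂ) := by
    have e1 : inner ℂ (conjV z) z = 1 := by rw [inner_conjV, hz]
    have e2 : inner ℂ z (conjV z) = 1 := by rw [← inner_conj_symm, e1, map_one]
    rw [← inner_self_eq]
    simp only [p, inner_sub_left, inner_smul_left, inner_sub_right, inner_smul_right, inner_self_eq,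
      norm_conjV, e1, e2, ← hN, Complex.conj_ofReal]
    push_cast
    ring
  have h2' : ‖p‖ ^ 2 = N * (N ^ 2 - 1) := by exact_mod_cast h2
  have h3 := norm_inner_le_norm (𝕜 := ℂ) p u
  have h4 : ‖inner ℂ p u‖ ^ 2 ≤ ‖p‖ ^ 2 * ‖u‖ ^ 2 := by
    rw [← mul_pow]; exact pow_le_pow_left₀ (norm_nonneg _) h3 2
  rw [h1, h2', norm_mul, mul_pow, Complex.norm_real, Real.norm_of_nonneg (by linarith)] at h4
  have h5 : N * (N * ‖inner ℂ z u‖ ^ 2) ≤ N * ((N ^ 2 - 1) * ‖u‖ ^ 2) := by nlinarith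
  have h6 := le_of_mul_le_mul_left h5 (by linarith)
  calc _ ≤ (N ^ 2 - 1) * ‖u‖ ^ 2 := h6
    _ = _ := by rw [hN]; ring

/-- The hermitian form `w ⟨u, v⟩ + (w₁ / 2) ⟨u, z⟩ ⟨z, v⟩`. -/
def kform (w w₁ : ℝ) (z u v : CV n) : ℂ :=
  w * inner ℂ v u + (w₁ / 2 : ℝ) * (inner ℂ z u * inner ℂ v z)

theorem kform_self_re (w w₁ : ℝ) (z u : CV n) :
    (kform w w₁ z u u).re = w * ‖u‖ ^ 2 + w₁ / 2 * ‖inner ℂ z u‖ ^ 2 := by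
  rw [kform, inner_self_eq, ← inner_conj_symm u z, Complex.mul_conj, Complex.normSq_eq_norm_sq,
    ← Complex.ofReal_mul, ← Complex.ofReal_mul, ← Complex.ofReal_add, Complex.ofReal_re]

/-- The coefficient `c²` as a function of `q = (|z|² - 1) / 2`. -/
def csq (w w₁ q : ℝ) : ℝ := (1 + 2 * q) * w + 2 * q * (1 + q) * w₁

/-- With q = (|z|² - 1)/2 one has 1 + 2q = |z|² and 4q(1 + q) = |z|⁴ - 1. Inserting `inner_sq_le` in
the term with `w` therefore leaves exactly the coefficient c². The bound serves both positivity and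
completeness. -/
theorem kform_lower {w w₁ : ℝ} (hw : 0 < w) {z u : CV n} (hz : dot z z = 1) (hu : dot z u = 0) :
    csq w w₁ ((‖z‖ ^ 2 - 1) / 2) * ‖inner ℂ z u‖ ^ 2 ≤
      (‖z‖ ^ 4 - 1) * (kform w w₁ z u u).re := by
  have h := inner_sq_le hz hu
  have h1 := one_le_norm_sq hz
  rw [kform_self_re, csq]
  set N := ‖z‖ ^ 2 with hN
  have e : ‖z‖ ^ 4 = N ^ 2 := by rw [hN]; ring
  rw [e] at h ⊢
  nlinarith [mul_le_mul_of_nonneg_left h hw.le]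

/-- If ⟨z, u⟩ = 0 only the term w|u|² is left; otherwise `kform_lower` decides. -/
theorem kform_pos {w w₁ : ℝ} (hw : 0 < w) {z u : CV n} (hz : dot z z = 1) (hu : dot z u = 0)
    (hc : 0 < csq w w₁ ((‖z‖ ^ 2 - 1) / 2)) (hu0 : u ≠ 0) : 0 < (kform w w₁ z u u).re := by
  have h := kform_lower (w₁ := w₁) hw hz hu
  have h0 := inner_sq_le hz hu
  have h1 := one_le_norm_sq hz
  have hu1 : 0 < ‖u‖ ^ 2 := by positivity
  have e : ‖z‖ ^ 4 = (‖z‖ ^ 2) ^ 2 := by ring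
  rw [e] at h h0
  set N := ‖z‖ ^ 2 with hN
  have hB : 0 ≤ ‖inner ℂ z u‖ ^ 2 := by positivity
  rcases hB.eq_or_lt with h2 | h2
  · rw [kform_self_re, ← h2]; nlinarith
  · have h3 : 0 < (N ^ 2 - 1) * (kform w w₁ z u u).re := lt_of_lt_of_le (by positivity) h
    have h4 : 0 ≤ N ^ 2 - 1 := by nlinarith
    exact pos_of_mul_pos_right h3 h4

/-! ### The determinant of the metric -/

/-- The extension of `kform` by the conormal direction. -/
def kext (w w₁ : ℝ) (z u v : CV n) : ℂ :=
  kform w w₁ z (u - dot z u • z) (v - dot z v • z) + dot z u * (starRingEnd ℂ) (dot z v)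

/-- The coefficients of the rank two part of the matrix of `kext`. -/
def kcoef (w w₁ N : ℝ) : Matrix (Fin 2) (Fin 2) ℂ :=
  !![((w₁ / 2 : ℝ) : ℂ), ((-w - w₁ / 2 * N : ℝ) : ℂ);
     ((-w - w₁ / 2 * N : ℝ) : ℂ), ((w * N + w₁ / 2 * N ^ 2 + 1 : ℝ) : ℂ)]

def kleft (z : CV n) : Matrix (Fin (n + 2)) (Fin 2) ℂ :=
  Matrix.of fun i j => ![(starRingEnd ℂ) (coord i z), coord i z] j

def kright (z : CV n) : Matrix (Fin 2) (Fin (n + 2)) ℂ :=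
  Matrix.of fun j i => ![coord i z, (starRingEnd ℂ) (coord i z)] j

/-- The matrix of `kext`. -/
def kmat (w w₁ : ℝ) (z : CV n) : Matrix (Fin (n + 2)) (Fin (n + 2)) ℂ :=
  (w : ℂ) • 1 + kleft z * (kcoef w w₁ (‖z‖ ^ 2) * kright z)

def row (u : CV n) : Fin (n + 2) → ℂ := fun i => coord i u

theorem kext_eq (w w₁ : ℝ) (z u v : CV n) :
    kext w w₁ z u v = row u ⬝ᵥ (kmat w w₁ z *ᵥ (star (row v))) := by
  have a : row u ᵥ* kleft z = ![inner ℂ z u, dot z u] := by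
    funext j
    fin_cases j
    · simp [Matrix.vecMul, dotProduct, row, kleft, inner_eq_sum, mul_comm]
    · simp [Matrix.vecMul, dotProduct, row, kleft, dot_apply, mul_comm]
  have b : kright z *ᵥ star (row v) = ![inner ℂ v z, (starRingEnd ℂ) (dot z v)] := by
    funext j
    fin_cases j
    · simp [Matrix.mulVec, dotProduct, row, kright, inner_eq_sum, mul_comm]
    · simp [Matrix.mulVec, dotProduct, row, kright, dot_apply]
  have c : row u ⬝ᵥ star (row v) = inner ℂ v u := by
    simp [dotProduct, row, inner_eq_sum, mul_comm]
  rw [kmat, Matrix.add_mulVec, dotProduct_add, Matrix.smul_mulVec, Matrix.one_mulVec,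
    dotProduct_smul, c, ← Matrix.mulVec_mulVec, Matrix.dotProduct_mulVec, a, ← Matrix.mulVec_mulVec,
    b]
  have e1 : inner ℂ v z = (starRingEnd ℂ) (inner ℂ z v) := (inner_conj_symm v z).symm
  simp only [kext, kform, inner_sub_left, inner_sub_right, inner_smul_left, inner_smul_right,
    inner_self_eq, kcoef, Matrix.mulVec, dotProduct, Fin.sum_univ_two]
  simp
  ring

/-- The matrix is w plus a term of rank two, so det(1 + AB) = det(1 + BA) reduces the determinant to
size two. Of the factor w^(n+2), the 2 × 2 determinant consumes w². -/
theorem det_kmat {w w₁ : ℝ} (hw : 0 < w) {z : CV n} (hz : dot z z = 1) :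
    (kmat w w₁ z).det = ((w ^ n * csq w w₁ ((‖z‖ ^ 2 - 1) / 2) : ℝ) : ℂ) := by
  have hw' : (w : ℂ) ≠ 0 := by exact_mod_cast hw.ne'
  set N := ‖z‖ ^ 2 with hN
  have hQP : kright z * kleft z = !![(N : ℂ), 1; 1, (N : ℂ)] := by
    have h1 : ∑ i, coord i z * (starRingEnd ℂ) (coord i z) = N := by
      rw [hN, ← inner_self_eq, inner_eq_sum]; simp only [mul_comm]
    have h2 : ∑ i, coord i z * coord i z = 1 := by rw [← hz, dot_apply]
    have h3 : ∑ i, (starRingEnd ℂ) (coord i z) * (starRingEnd ℂ) (coord i z) = 1 := by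
      rw [← map_one (starRingEnd ℂ), ← h2, map_sum]; simp
    have h4 : ∑ i, (starRingEnd ℂ) (coord i z) * coord i z = N := by
      rw [hN, ← inner_self_eq, inner_eq_sum]
    ext i j
    fin_cases i <;> fin_cases j <;> simp [Matrix.mul_apply, kright, kleft, h1, h2, h3, h4]
  have e1 : kmat w w₁ z = (w : ℂ) • (1 + kleft z * ((w : ℂ)⁻¹ • (kcoef w w₁ N * kright z))) := by
    rw [kmat, smul_add, Matrix.mul_smul, smul_smul, mul_inv_cancel₀ hw', one_smul]
  rw [e1, Matrix.det_smul, Matrix.det_one_add_mul_comm, Matrix.smul_mul, Matrix.mul_assoc, hQP,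
    Fintype.card_fin, Matrix.det_fin_two]
  simp [kcoef, csq]
  field_simp
  ring

end Quadric

/-! ### The Levi form of a function of |z|² -/

section LeviComp

instance (n : ℕ) : InnerProductSpace ℝ (CV n) := InnerProductSpace.rclikeToReal ℂ (CV n)

variable {n : ℕ} {F : Type*} [NormedAddCommGroup F] [NormedSpace ℂ F]

/-- Functions `P`, `w = P'`, `w₁ = P''` on a relatively open subset `D` of `[0, ∞)`. -/
structure IsPotential (D : Set ℝ) (P w w₁ : ℝ → ℝ) : Prop where
  subset : D ⊆ Ici 0
  mem_nhds : ∀ q ∈ D, D ∈ 𝓝[Ici 0] q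
  smooth : ContDiffOn ℝ ∞ P D
  deriv : ∀ q ∈ D, HasDerivWithinAt P (w q) D q
  deriv₂ : ∀ q ∈ D, HasDerivWithinAt w (w₁ q) D q

variable {D : Set ℝ} {P w w₁ : ℝ → ℝ}

theorem real_inner_eq (a b : CV n) : inner ℝ a b = (inner ℂ a b).re := rfl

/-- The function `q = (|z|² - 1) / 2` along a map to `ℂ^(n+2)`. -/
def rho {X : Type*} (ψ : X → CV n) (y : X) : ℝ := (‖ψ y‖ ^ 2 - 1) / 2

theorem hasFDerivAt_rho {X : Type*} [NormedAddCommGroup X] [NormedSpace ℝ X] {ψ : X → CV n} {x : X}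
    {ψ' : X →L[ℝ] CV n} (h : HasFDerivAt ψ ψ' x) :
    HasFDerivAt (rho ψ) ((innerSL ℝ (ψ x)) ∘L ψ') x := by
  have h1 := (h.norm_sq.sub_const 1).const_mul (1 / 2 : ℝ)
  have e : (fun y => 1 / 2 * (‖ψ y‖ ^ 2 - 1)) = rho ψ := by funext y; simp only [rho]; ring
  rw [e] at h1
  refine h1.congr_fderiv ?_
  ext v
  simp

theorem IsPotential.eventually_mem (h : IsPotential D P w w₁) {X : Type*} [TopologicalSpace X]
    {f : X → ℝ} {x : X} (hf : ContinuousAt f x) (hx : f x ∈ D) (h0 : ∀ᶠ y in 𝓝 x, 0 ≤ f y) :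
    ∀ᶠ y in 𝓝 x, f y ∈ D :=
  (tendsto_nhdsWithin_iff.2 ⟨hf, h0⟩).eventually (h.mem_nhds _ hx)

/-- `D` need not be a neighbourhood of f x: it is enough that `f` takes its values in `D`. In this
way potentials defined only for q ≥ 0 give smooth functions also at the points with q = 0, that is
at the bolt. -/
theorem contDiffAt_of_contDiffOn {X : Type*} [NormedAddCommGroup X] [NormedSpace ℝ X]
    {f : X → ℝ} {x : X} {g : ℝ → ℝ}
    (hg : ContDiffOn ℝ ∞ g D) (hf : ContDiffAt ℝ ∞ f x) (hm : ∀ᶠ y in 𝓝 x, f y ∈ D) :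
    ContDiffAt ℝ ∞ (fun y => g (f y)) x := by
  have h1 : ContDiffWithinAt ℝ ∞ f {y | f y ∈ D} x := hf.contDiffWithinAt
  have h2 := (hg (f x) hm.self_of_nhds).comp x h1 (fun y hy => hy)
  exact h2.contDiffAt hm

/-- The second derivatives of ψ cancel, since D²ψ(iu, iv) = -D²ψ(u, v) for holomorphic ψ. The rest
is the chain rule. -/
theorem leviForm_potential (h : IsPotential D P w w₁) {ψ : F → CV n} {x : F}
    (hψ : ContDiffAt ℂ ω ψ x) (hm : ∀ᶠ y in 𝓝 x, rho ψ y ∈ D) (u v : F) :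
    leviForm (fun y => P (rho ψ y)) x u v =
      (kform (w (rho ψ x)) (w₁ (rho ψ x)) (ψ x) (fderiv ℂ ψ x u) (fderiv ℂ ψ x v)).re := by
  have hev : ∀ᶠ y in 𝓝 x, HasFDerivAt ψ ((fderiv ℂ ψ y).restrictScalars ℝ) y :=
    (hψ.eventually (by simp)).mono fun y hy =>
      (hy.differentiableAt (by simp)).hasFDerivAt.restrictScalars ℝ
  have h1 : fderiv ℝ (fun y => P (rho ψ y)) =ᶠ[𝓝 x] fun y => w (rho ψ y) •
      ((innerSL ℝ (ψ y)) ∘L ((fderiv ℂ ψ y).restrictScalars ℝ)) := by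
    filter_upwards [hev, hm.eventually_nhds] with y hy hm
    exact ((h.deriv _ hm.self_of_nhds).comp_hasFDerivAt y (hasFDerivAt_rho hy) hm).fderiv
  have h2 : HasFDerivAt (fderiv ℂ ψ) (fderiv ℂ (fderiv ℂ ψ) x) x :=
    ((hψ.fderiv_right (m := 1) (by norm_cast)).differentiableAt (by simp)).hasFDerivAt
  have h2' : HasFDerivAt (fun y => (fderiv ℂ ψ y).restrictScalars ℝ)
      ((ContinuousLinearMap.restrictScalarsL ℂ F (CV n) ℝ ℝ) ∘L
        (fderiv ℂ (fderiv ℂ ψ) x).restrictScalars ℝ) x :=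
    ((ContinuousLinearMap.restrictScalarsL ℂ F (CV n) ℝ ℝ).hasFDerivAt).comp x
      (h2.restrictScalars ℝ)
  have hψ1 := hev.self_of_nhds
  have hw : HasFDerivAt (fun y => w (rho ψ y)) _ x :=
    (h.deriv₂ _ hm.self_of_nhds).comp_hasFDerivAt x (hasFDerivAt_rho hψ1) hm
  have h3 : ∀ a b, fderiv ℝ (fderiv ℝ (fun y => P (rho ψ y))) x a b =
      w₁ (rho ψ x) * inner ℝ (ψ x) (fderiv ℂ ψ x a) * inner ℝ (ψ x) (fderiv ℂ ψ x b)
      + w (rho ψ x) * (inner ℝ (fderiv ℂ ψ x a) (fderiv ℂ ψ x b)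
        + inner ℝ (ψ x) (fderiv ℂ (fderiv ℂ ψ) x a b)) := by
    intro a b
    rw [h1.fderiv_eq]
    have d := hw.smul ((((innerSL ℝ).hasFDerivAt (x := ψ x)).comp x hψ1).clm_comp h2')
    have d' : fderiv ℝ (fun y => w (rho ψ y) •
      ((innerSL ℝ (ψ y)) ∘L ((fderiv ℂ ψ y).restrictScalars ℝ))) x = _ := d.fderiv
    rw [d']
    simp
    change w (rho ψ x) * inner ℝ (ψ x) (fderiv ℂ (fderiv ℂ ψ) x a b) +
      w (rho ψ x) * inner ℝ (fderiv ℂ ψ x a) (fderiv ℂ ψ x b) +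
      w₁ (rho ψ x) * inner ℝ (ψ x) (fderiv ℂ ψ x a) * inner ℝ (ψ x) (fderiv ℂ ψ x b) = _
    ring
  rw [leviForm_apply, h3, h3]
  simp only [map_smul, _root_.smul_apply, smul_smul, Complex.I_mul_I]
  set a := fderiv ℂ ψ x u
  set b := fderiv ℂ ψ x v
  have e1 : inner ℂ (Complex.I • a) (Complex.I • b) = inner ℂ a b := by
    rw [inner_smul_left, inner_smul_right, ← mul_assoc]; simp
  have e2 : inner ℂ b a = (starRingEnd ℂ) (inner ℂ a b) := (inner_conj_symm b a).symm
  have e3 : inner ℂ b (ψ x) = (starRingEnd ℂ) (inner ℂ (ψ x) b) := (inner_conj_symm b (ψ x)).symm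
  simp only [real_inner_eq, kform, e1, e2, e3, inner_smul_right]
  simp [-inner_conj_symm]
  ring

theorem contDiffAt_rho {ψ : F → CV n} {x : F} (hψ : ContDiffAt ℂ ω ψ x) :
    ContDiffAt ℝ ∞ (rho ψ) x := by
  have h1 : ContDiffAt ℝ ∞ ψ x := (hψ.restrict_scalars ℝ).of_le le_top
  have h2 : ContDiffAt ℝ ∞ (fun y => (‖ψ y‖ ^ 2 - 1) * (1 / 2 : ℝ)) x :=
    ((h1.norm_sq ℝ).sub contDiffAt_const).mul contDiffAt_const
  have e : rho ψ = fun y => (‖ψ y‖ ^ 2 - 1) * (1 / 2 : ℝ) := by funext y; simp only [rho]; ring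
  rw [e]; exact h2

end LeviComp

/-! ### Holomorphic coordinates on the quadric -/

section Stereographic

variable {n : ℕ} {F : Type*} [NormedAddCommGroup F] [NormedSpace ℂ F]

/-- The square `ι y · ι y`. -/
def qsq (ι : F →L[ℂ] CV n) (y : F) : ℂ := dot (ι y) (ι y)

/-- The complex stereographic parametrization of the quadric, centered at `z₀`. -/
def psi (ι : F →L[ℂ] CV n) (z₀ : CV n) (y : F) : CV n :=
  (1 + qsq ι y)⁻¹ • ((1 - qsq ι y) • z₀ + (2 : ℂ) • ι y)

/-- The complex reflection in `c`. -/
def refl (c : CV n) : CV n →ₗ[ℂ] CV n :=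
  LinearMap.id - ((2 * (dot c c)⁻¹) • (dot c : CV n →ₗ[ℂ] ℂ)).smulRight c

theorem refl_apply (c u : CV n) : refl c u = u - (2 * (dot c c)⁻¹ * dot c u) • c := by
  simp [refl]

theorem dot_refl {c : CV n} (hc : dot c c ≠ 0) (u v : CV n) :
    dot (refl c u) (refl c v) = dot u v := by
  simp only [refl_apply, map_sub, map_smul, _root_.sub_apply, _root_.smul_apply, smul_eq_mul,
    dot_comm u c]
  field_simp
  ring

theorem refl_refl {c : CV n} (hc : dot c c ≠ 0) (u : CV n) : refl c (refl c u) = u := by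
  have : dot c (refl c u) = -dot c u := by
    rw [refl_apply, map_sub, map_smul, smul_eq_mul]
    field_simp
    ring
  rw [refl_apply, this, refl_apply]
  module

variable {ι : F →L[ℂ] CV n} {z₀ : CV n}

theorem dot_center (h0 : dot z₀ z₀ = 1) (hι : ∀ u, dot z₀ (ι u) = 0) (y : F) :
    dot (z₀ + ι y) (z₀ + ι y) = 1 + qsq ι y := by
  simp only [map_add, _root_.add_apply, h0, hι, dot_comm (ι y) z₀, qsq]
  ring

/-- This form shows at once that the parametrization lands on the quadric; its differential turns
out to be a scalar multiple of the same complex reflection (`fderiv_psi`), which makes the volume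
form explicit. -/
theorem psi_eq_refl (h0 : dot z₀ z₀ = 1) (hι : ∀ u, dot z₀ (ι u) = 0) {y : F}
    (hy : 1 + qsq ι y ≠ 0) : psi ι z₀ y = -refl (z₀ + ι y) z₀ := by
  have e : dot (z₀ + ι y) z₀ = 1 := by
    rw [map_add, _root_.add_apply, h0, dot_comm, hι, add_zero]
  have e2 : (1 + qsq ι y)⁻¹ * (1 - qsq ι y) = 2 * (1 + qsq ι y)⁻¹ - 1 := by field_simp; ring
  rw [refl_apply, dot_center h0 hι, e, psi, smul_add, smul_smul, smul_smul, e2]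
  module

theorem dot_psi (h0 : dot z₀ z₀ = 1) (hι : ∀ u, dot z₀ (ι u) = 0) {y : F}
    (hy : 1 + qsq ι y ≠ 0) : dot (psi ι z₀ y) (psi ι z₀ y) = 1 := by
  rw [psi_eq_refl h0 hι hy, map_neg, map_neg, _root_.neg_apply, neg_neg,
    dot_refl (by rwa [dot_center h0 hι]), h0]

theorem dot_psi_refl (h0 : dot z₀ z₀ = 1) (hι : ∀ u, dot z₀ (ι u) = 0) {y : F}
    (hy : 1 + qsq ι y ≠ 0) (u : F) : dot (psi ι z₀ y) (refl (z₀ + ι y) (ι u)) = 0 := by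
  rw [psi_eq_refl h0 hι hy, map_neg, _root_.neg_apply, dot_refl (by rwa [dot_center h0 hι]), hι,
    neg_zero]

theorem hasFDerivAt_qsq (ι : F →L[ℂ] CV n) (y : F) :
    HasFDerivAt (qsq ι) ((2 : ℂ) • (dot (ι y) ∘L ι)) y := by
  have h := ((dot (n := n)).hasFDerivAt.comp y ι.hasFDerivAt).clm_apply (ι.hasFDerivAt (x := y))
  refine h.congr_fderiv ?_
  ext u
  simp [dot_comm (ι u) (ι y)]
  ring

theorem contDiff_qsq (ι : F →L[ℂ] CV n) : ContDiff ℂ ω (qsq ι) :=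
  ((dot (n := n)).contDiff.comp ι.contDiff).clm_apply ι.contDiff

theorem contDiffAt_psi (ι : F →L[ℂ] CV n) (z₀ : CV n) {y : F} (hy : 1 + qsq ι y ≠ 0) :
    ContDiffAt ℂ ω (psi ι z₀) y := by
  have h := (contDiff_qsq ι).contDiffAt (x := y)
  exact ((contDiffAt_const.add h).inv hy).smul
    (((contDiffAt_const.sub h).smul contDiffAt_const).add (ι.contDiff.contDiffAt.const_smul _))

theorem fderiv_psi (h0 : dot z₀ z₀ = 1) (hι : ∀ u, dot z₀ (ι u) = 0) {y : F}
    (hy : 1 + qsq ι y ≠ 0) (u : F) :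
    fderiv ℂ (psi ι z₀) y u = (2 * (1 + qsq ι y)⁻¹) • refl (z₀ + ι y) (ι u) := by
  have hq := hasFDerivAt_qsq ι y
  have h1 := (hasDerivAt_inv hy).comp_hasFDerivAt y (hq.const_add 1)
  have h2 := ((hq.const_sub 1).smul_const z₀).add (ι.hasFDerivAt.const_smul (2 : ℂ))
  have h3 : fderiv ℂ (psi ι z₀) y = _ := (h1.smul h2).fderiv
  have e : dot (z₀ + ι y) (ι u) = dot (ι y) (ι u) := by
    rw [map_add, _root_.add_apply, hι, zero_add]
  rw [h3, refl_apply, e, dot_center h0 hι]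
  simp
  set q := qsq ι y
  set d := dot (ι y) (ι u)
  have e1 : (1 + q)⁻¹ * (-(2 * d)) + -(2 * d) * ((1 + q) ^ 2)⁻¹ * (1 - q) =
      -(2 * (1 + q)⁻¹ * (2 * (1 + q)⁻¹ * d)) := by field_simp; ring
  have e2 : -(2 * d) * ((1 + q) ^ 2)⁻¹ * 2 = -(2 * (1 + q)⁻¹ * (2 * (1 + q)⁻¹ * d)) := by
    field_simp
  trans ((1 + q)⁻¹ * (-(2 * d)) + -(2 * d) * ((1 + q) ^ 2)⁻¹ * (1 - q)) • z₀
    + (-(2 * d) * ((1 + q) ^ 2)⁻¹ * 2) • ι y + (2 * (1 + q)⁻¹) • ι u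
  · module
  · rw [e1, e2]; module

end Stereographic

/-! ### The determinant of the metric in stereographic coordinates -/

section Einstein

variable {n : ℕ} {F : Type*} [NormedAddCommGroup F] [NormedSpace ℂ F]
  {ι : F →L[ℂ] CV n} {z₀ : CV n}

/-- The matrix of the reflection `refl c`. -/
def reflMat (c : CV n) : Matrix (Fin (n + 2)) (Fin (n + 2)) ℂ :=
  1 - (2 * (dot c c)⁻¹) • Matrix.vecMulVec (row c) (row c)

theorem row_refl (c u : CV n) : row (refl c u) = row u ᵥ* reflMat c := by
  have h : row u ᵥ* Matrix.vecMulVec (row c) (row c) = (dot c u) • row c := by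
    rw [Matrix.vecMul_vecMulVec]
    congr 1
    rw [dot_apply]
    simp [dotProduct, row, mul_comm]
  rw [reflMat, Matrix.vecMul_sub, Matrix.vecMul_one, Matrix.vecMul_smul, h, refl_apply]
  funext i
  simp [row, mul_assoc]

/-- A reflection is an involution, so its determinant has square one. -/
theorem norm_det_reflMat {c : CV n} (hc : dot c c ≠ 0) : ‖(reflMat c).det‖ = 1 := by
  have h : reflMat c * reflMat c = 1 := by
    have e : ∑ i, row c i * row c i = dot c c := by rw [dot_apply]; rfl
    have e1 : Matrix.vecMulVec (row c) (row c) * Matrix.vecMulVec (row c) (row c) =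
        dot c c • Matrix.vecMulVec (row c) (row c) := by
      rw [Matrix.vecMulVec_mul_vecMulVec, ← e]
      ext i j
      simp [Matrix.vecMulVec_apply, dotProduct]
      ring
    simp only [reflMat, sub_mul, mul_sub, one_mul, mul_one, Matrix.smul_mul, Matrix.mul_smul, e1,
      smul_smul]
    rw [show 2 * (dot c c)⁻¹ * (2 * (dot c c)⁻¹ * dot c c) = 2 * (dot c c)⁻¹ + 2 * (dot c c)⁻¹ by
      field_simp; ring]
    module
  have h2 : ‖(reflMat c).det‖ * ‖(reflMat c).det‖ = 1 := by
    rw [← norm_mul, ← Matrix.det_mul, h, Matrix.det_one, norm_one]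
  nlinarith [norm_nonneg (reflMat c).det]

/-- The rows are the images of a basis of the tangent space at `z₀`, and `z₀`. -/
def frameVec (ι : F →L[ℂ] CV n) (z₀ : CV n) (b : Fin (n + 1) → F) :
    Fin (n + 1) ⊕ Fin 1 → CV n :=
  Sum.elim (fun i => ι (b i)) (fun _ => z₀)

def frameMat (ι : F →L[ℂ] CV n) (z₀ : CV n) (b : Fin (n + 1) → F) :
    Matrix (Fin (n + 2)) (Fin (n + 2)) ℂ :=
  Matrix.of fun i => row (frameVec ι z₀ b ((finSumFinEquiv (m := n + 1) (n := 1)).symm i))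

theorem kext_add_smul_zero (w w₁ : ℝ) (z u v : CV n) (hu : dot z u = 0) (hv : dot z v = 0) :
    kext w w₁ z u v = kform w w₁ z u v := by
  simp [kext, hu, hv]

/-- By `fderiv_psi` the coordinate frame at `y` is λ = 2(1 + y·y)⁻¹ times the reflection of a fixed
frame. Completed by the normal vector, it is a frame of ℂ^(n+2) in which `kext` is block diagonal.
The determinant is thus that of `kmat`, times a constant and a power of |λ|, whose logarithm is
pluriharmonic. -/
theorem det_gram_eq (b : Module.Basis (Fin (n + 1)) ℂ F) (h0 : dot z₀ z₀ = 1)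
    (hι : ∀ u, dot z₀ (ι u) = 0) {y : F} (hy : 1 + qsq ι y ≠ 0) {w w₁ : ℝ} (hw : 0 < w)
    {G : F →L[ℝ] F →L[ℝ] ℝ}
    (hG : ∀ u v, hermForm G u v =
      kform w w₁ (psi ι z₀ y) (fderiv ℂ (psi ι z₀) y u) (fderiv ℂ (psi ι z₀) y v)) :
    ‖(gram b G).det‖ = ‖2 * (1 + qsq ι y)⁻¹‖ ^ (2 * (n + 1)) * ‖(frameMat ι z₀ b).det‖ ^ 2 *
      |w ^ n * csq w w₁ (rho (psi ι z₀) y)| := by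
  set c := z₀ + ι y with hc
  set z := psi ι z₀ y with hz
  set lam := 2 * (1 + qsq ι y)⁻¹ with hlam
  have hlam0 : lam ≠ 0 := by simp [hlam, hy]
  have hcc : dot c c ≠ 0 := by rw [hc, dot_center h0 hι]; exact hy
  have hzz : dot z z = 1 := dot_psi h0 hι hy
  have hz0 : refl c z₀ = -z := by rw [hz, psi_eq_refl h0 hι hy, neg_neg]
  set Gr := frameMat ι z₀ b * reflMat c * kmat w w₁ z * (frameMat ι z₀ b * reflMat c)ᴴ with hGr
  have hrow : ∀ i, (frameMat ι z₀ b * reflMat c) i =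
      row (refl c (frameVec ι z₀ b ((finSumFinEquiv (m := n + 1) (n := 1)).symm i))) := fun i => by
    rw [row_refl]; rfl
  have hent : ∀ i j, Gr i j = kext w w₁ z (refl c (frameVec ι z₀ b ((finSumFinEquiv (m := n + 1) (n := 1)).symm i)))
      (refl c (frameVec ι z₀ b ((finSumFinEquiv (m := n + 1) (n := 1)).symm j))) := by
    intro i j
    rw [kext_eq, ← hrow, ← hrow, hGr, Matrix.mul_apply, Matrix.dotProduct_mulVec]
    rfl
  -- The normal block is 1 because the reflection sends `z₀` to -z, and `kext` was extended so that
  -- z is a unit vector orthogonal to the tangent space.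
  have hblock : Gr.submatrix (finSumFinEquiv (m := n + 1) (n := 1)) (finSumFinEquiv (m := n + 1) (n := 1)) =
      Matrix.fromBlocks ((Complex.normSq lam : ℂ)⁻¹ • gram b G) 0 0 1 := by
    have hk : ∀ u v : F, kform w w₁ z (refl c (ι u)) (refl c (ι v)) =
        (Complex.normSq lam : ℂ)⁻¹ * hermForm G u v := by
      intro u v
      rw [hG, fderiv_psi h0 hι hy, fderiv_psi h0 hι hy, ← hlam, ← hc]
      simp only [kform, inner_smul_left, inner_smul_right, Complex.normSq_eq_conj_mul_self]
      have : (starRingEnd ℂ) lam ≠ 0 := by simpa using hlam0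
      field_simp
    have hd : ∀ u, dot z (refl c (ι u)) = 0 := dot_psi_refl h0 hι hy
    ext i j
    rcases i with i | i <;> rcases j with j | j
    · simp only [Matrix.submatrix_apply, hent, Equiv.symm_apply_apply, frameVec, Sum.elim_inl,
        Matrix.fromBlocks_apply₁₁, Matrix.smul_apply, smul_eq_mul, gram, Matrix.of_apply]
      rw [kext_add_smul_zero _ _ _ _ _ (hd _) (hd _), hk]
    · simp [hent, frameVec, hz0, kext, hd, kform, hzz]
    · simp [hent, frameVec, hz0, kext, hd, kform, hzz]
    · have : i = j := Subsingleton.elim _ _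
      simp [hent, frameVec, hz0, kext, kform, hzz, this]
  have h1 : Gr.det = ((Complex.normSq lam : ℂ)⁻¹) ^ (n + 1) * (gram b G).det := by
    rw [← Matrix.det_submatrix_equiv_self (finSumFinEquiv (m := n + 1) (n := 1)) Gr, hblock, Matrix.det_fromBlocks_zero₂₁,
      Matrix.det_smul, Matrix.det_one, mul_one, Fintype.card_fin]
  have h2 : ‖Gr.det‖ = ‖(frameMat ι z₀ b).det‖ ^ 2 * |w ^ n * csq w w₁ (rho (psi ι z₀) y)| := by
    rw [hGr, Matrix.det_mul, Matrix.det_mul, Matrix.det_conjTranspose, Matrix.det_mul, norm_mul,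
      norm_mul, norm_mul, norm_star, norm_mul, norm_det_reflMat hcc, det_kmat hw hzz,
      Complex.norm_real, Real.norm_eq_abs, rho]
    ring
  have h3 : ‖((Complex.normSq lam : ℂ)⁻¹) ^ (n + 1)‖ = (‖lam‖ ^ (2 * (n + 1)))⁻¹ := by
    rw [norm_pow, norm_inv, Complex.norm_real, Complex.normSq_eq_norm_sq, inv_pow, norm_pow,
      norm_norm, ← pow_mul]
  rw [h1, norm_mul, h3] at h2
  have h4 : ‖lam‖ ^ (2 * (n + 1)) ≠ 0 := by positivity
  field_simp at h2
  rw [h2]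

end Einstein

/-- Potentials whose associated metric on the quadric is a Kähler-Einstein metric. -/
structure IsEinsteinPotential (n : ℕ) (C Λ : ℝ) (D : Set ℝ) (P w w₁ : ℝ → ℝ) : Prop extends
    IsPotential D P w w₁ where
  pos : ∀ q ∈ D, 0 < w q
  csq_pos : ∀ q ∈ D, 0 < csq (w q) (w₁ q) q
  volume : ∀ q ∈ D, w q ^ n * csq (w q) (w₁ q) q = C * Real.exp (-Λ * P q)

/-! ### Einstein and Kähler conditions near a point of the quadric -/

section Local

variable {n : ℕ} {F : Type*} [NormedAddCommGroup F] [NormedSpace ℂ F]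
  {ι : F →L[ℂ] CV n} {z₀ : CV n} {D : Set ℝ} {P w w₁ : ℝ → ℝ} {C Λ : ℝ}

theorem qsq_zero : qsq ι 0 = 0 := by simp [qsq]

theorem psi_zero : psi ι z₀ 0 = z₀ := by simp [psi, qsq_zero]

theorem eventually_qsq : ∀ᶠ y in 𝓝 (0 : F), 1 + qsq ι y ≠ 0 := by
  have h : ContinuousAt (fun y => 1 + qsq ι y) 0 :=
    continuousAt_const.add (contDiff_qsq ι).continuous.continuousAt
  exact h.eventually_ne (by simp [qsq_zero])

theorem eventually_rho_mem (hD : IsPotential D P w w₁) (h0 : dot z₀ z₀ = 1)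
    (hι : ∀ u, dot z₀ (ι u) = 0) (hz : (‖z₀‖ ^ 2 - 1) / 2 ∈ D) :
    ∀ᶠ y in 𝓝 (0 : F), rho (psi ι z₀) y ∈ D := by
  have hq : 1 + qsq ι 0 ≠ 0 := by simp [qsq_zero]
  refine hD.eventually_mem (contDiffAt_rho (contDiffAt_psi ι z₀ hq)).continuousAt ?_ ?_
  · simpa only [rho, psi_zero] using hz
  · filter_upwards [eventually_qsq] with y hy
    have := one_le_norm_sq (dot_psi h0 hι hy)
    unfold rho
    linarith

theorem eventually_contDiffAt_potential (hD : IsPotential D P w w₁) (h0 : dot z₀ z₀ = 1)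
    (hι : ∀ u, dot z₀ (ι u) = 0) (hz : (‖z₀‖ ^ 2 - 1) / 2 ∈ D) :
    ∀ᶠ y in 𝓝 (0 : F), ContDiffAt ℝ ∞ (fun y => P (rho (psi ι z₀) y)) y := by
  filter_upwards [eventually_qsq, (eventually_rho_mem hD h0 hι hz).eventually_nhds] with y hy hm
  exact contDiffAt_of_contDiffOn hD.smooth (contDiffAt_rho (contDiffAt_psi ι z₀ hy)) hm

theorem fderiv_psi_ne_zero (h0 : dot z₀ z₀ = 1) (hι : ∀ u, dot z₀ (ι u) = 0)
    (hinj : Function.Injective ι) {y : F} (hy : 1 + qsq ι y ≠ 0) {u : F} (hu : u ≠ 0) :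
    fderiv ℂ (psi ι z₀) y u ≠ 0 := by
  rw [fderiv_psi h0 hι hy]
  have hc : dot (z₀ + ι y) (z₀ + ι y) ≠ 0 := by rwa [dot_center h0 hι]
  refine smul_ne_zero (by simp [hy]) fun h => hu (hinj ?_)
  rw [← refl_refl hc (ι u), h, map_zero, map_zero]

theorem eventually_leviForm_potential (hD : IsPotential D P w w₁) (h0 : dot z₀ z₀ = 1)
    (hι : ∀ u, dot z₀ (ι u) = 0) (hz : (‖z₀‖ ^ 2 - 1) / 2 ∈ D) :
    ∀ᶠ y in 𝓝 (0 : F), ∀ u v, leviForm (fun y => P (rho (psi ι z₀) y)) y u v =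
      (kform (w (rho (psi ι z₀) y)) (w₁ (rho (psi ι z₀) y)) (psi ι z₀ y)
        (fderiv ℂ (psi ι z₀) y u) (fderiv ℂ (psi ι z₀) y v)).re := by
  filter_upwards [eventually_qsq, (eventually_rho_mem hD h0 hι hz).eventually_nhds] with y hy hm u v
  exact leviForm_potential hD (contDiffAt_psi ι z₀ hy) hm u v

theorem kform_smul_left (a b : ℝ) (z u v : CV n) (c : ℂ) :
    kform a b z (c • u) v = c * kform a b z u v := by
  simp only [kform, inner_smul_right]
  ring

theorem eventually_leviForm_pos (hD : IsEinsteinPotential n C Λ D P w w₁) (h0 : dot z₀ z₀ = 1)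
    (hι : ∀ u, dot z₀ (ι u) = 0) (hinj : Function.Injective ι) (hz : (‖z₀‖ ^ 2 - 1) / 2 ∈ D) :
    ∀ᶠ y in 𝓝 (0 : F), ∀ u, u ≠ 0 → 0 < leviForm (fun y => P (rho (psi ι z₀) y)) y u u := by
  filter_upwards [eventually_qsq, eventually_rho_mem hD.toIsPotential h0 hι hz,
    eventually_leviForm_potential hD.toIsPotential h0 hι hz] with y hy hm hl u hu
  rw [hl]
  refine kform_pos (hD.pos _ hm) (dot_psi h0 hι hy) ?_ (hD.csq_pos _ hm)
    (fderiv_psi_ne_zero h0 hι hinj hy hu)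
  rw [fderiv_psi h0 hι hy, map_smul, dot_psi_refl h0 hι hy, smul_zero]

/-- The field `volume` is the Monge–Ampère equation: it turns the determinant of `det_gram_eq` into
exp(-Λ P) times the modulus of a nonvanishing holomorphic function. -/
theorem coordRicci_potential [FiniteDimensional ℂ F] (b : Module.Basis (Fin (n + 1)) ℂ F)
    (hD : IsEinsteinPotential n C Λ D P w w₁) (h0 : dot z₀ z₀ = 1)
    (hι : ∀ u, dot z₀ (ι u) = 0) (hinj : Function.Injective ι) (hz : (‖z₀‖ ^ 2 - 1) / 2 ∈ D)
    (u v : F) :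
    coordRicci (leviForm (fun y => P (rho (psi ι z₀) y))) 0 u v =
      Λ * leviForm (fun y => P (rho (psi ι z₀) y)) 0 u v := by
  have hev := eventually_contDiffAt_potential hD.toIsPotential h0 hι hz
  have hpos := eventually_leviForm_pos hD h0 hι hinj hz
  set c : ℝ := 2 * (n + 1) * Real.log 2 + 2 * Real.log ‖(frameMat ι z₀ b).det‖ + Real.log C
  have hcont : ContinuousAt (fun y => 1 + qsq ι y) (0 : F) :=
    continuousAt_const.add (contDiff_qsq ι).continuous.continuousAt
  -- The holomorphic function is read off from `det_gram_eq`: `c` collects the constants, and the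
  -- factor |1 + y·y|^(-2(n+1)) gives the logarithm, which is holomorphic near 0 because its
  -- argument is near 1.
  refine coordRicci_of_log_det b hev.self_of_nhds hev hpos
    (f := fun y => (c : ℂ) - 2 * (n + 1) * Complex.log (1 + qsq ι y)) ?_ ?_ u v
  · exact contDiffAt_const.sub (contDiffAt_const.mul
      ((Complex.contDiffAt_log (by simp [qsq_zero])).comp (0 : F)
        (contDiffAt_const.add (contDiff_qsq ι).contDiffAt)))
  · filter_upwards [eventually_qsq, eventually_rho_mem hD.toIsPotential h0 hι hz,
      eventually_leviForm_potential hD.toIsPotential h0 hι hz, hpos] with y hy hm hl hp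
    have hdet := gram_det_ne_zero b (leviForm_I (fun y => P (rho (psi ι z₀) y)) y) hp
    have hG := det_gram_eq b h0 hι hy (hD.pos _ hm)
      (G := leviForm (fun y => P (rho (psi ι z₀) y)) y) (w₁ := w₁ (rho (psi ι z₀) y)) (by
        intro u v
        rw [hermForm, hl, hl, map_smul, kform_smul_left]
        apply Complex.ext <;> simp)
    rw [hD.volume _ hm] at hG
    have hC : 0 < C := by
      have := hD.volume _ hm
      have h1 : 0 < C * Real.exp (-Λ * P (rho (psi ι z₀) y)) := by
        rw [← this]; exact mul_pos (pow_pos (hD.pos _ hm) _) (hD.csq_pos _ hm)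
      exact pos_of_mul_pos_left h1 (Real.exp_pos _).le
    have hne := (norm_ne_zero_iff.2 hdet)
    rw [hG] at hne ⊢
    have h1 : ‖(frameMat ι z₀ b).det‖ ≠ 0 := fun h => hne (by rw [h]; ring)
    have h2 : ‖1 + qsq ι y‖ ≠ 0 := norm_ne_zero_iff.2 hy
    rw [abs_of_pos (mul_pos hC (Real.exp_pos _)), norm_mul, norm_inv, Real.log_mul (by
      simp [hy, h1]) (by positivity), Real.log_mul (by simp [hy]) (by positivity), Real.log_pow,
      Real.log_pow, Real.log_mul (by simp) (by simpa using hy), Real.log_inv, Real.log_mul hC.ne'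
      (Real.exp_pos _).ne', Real.log_exp]
    have h3 : (Complex.log (1 + qsq ι y)).re = Real.log ‖1 + qsq ι y‖ := Complex.log_re _
    have h4 : ((c : ℂ) - 2 * (n + 1) * Complex.log (1 + qsq ι y)).re =
        c - 2 * (n + 1) * (Complex.log (1 + qsq ι y)).re := by
      rw [Complex.sub_re, Complex.ofReal_re]
      congr 1
      rw [show (2 * (n + 1) : ℂ) = ((2 * (n + 1) : ℝ) : ℂ) by push_cast; ring, Complex.re_ofReal_mul]
    have h5 : ‖(2 : ℂ)‖ = 2 := by simp
    rw [h4, h3, h5]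
    simp only [c]
    push_cast
    ring

theorem christoffel_potential_I [FiniteDimensional ℂ F]
    (hD : IsEinsteinPotential n C Λ D P w w₁) (h0 : dot z₀ z₀ = 1)
    (hι : ∀ u, dot z₀ (ι u) = 0) (hinj : Function.Injective ι) (hz : (‖z₀‖ ^ 2 - 1) / 2 ∈ D)
    (u v : F) :
    christoffel (leviForm (fun y => P (rho (psi ι z₀) y))) 0 u (Complex.I • v) =
      Complex.I • christoffel (leviForm (fun y => P (rho (psi ι z₀) y))) 0 u v :=
  have hev := eventually_contDiffAt_potential hD.toIsPotential h0 hι hz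
  christoffel_leviForm_I hev.self_of_nhds hev
    (eventually_isInvertible_leviForm (eventually_leviForm_pos hD h0 hι hinj hz)).self_of_nhds u v

end Local

/-! ### Metrics pulled back from the quadric to a real vector space -/

section Charts

variable {n : ℕ} {F : Type*} [NormedAddCommGroup F] [NormedSpace ℂ F]
  {ι : F →L[ℂ] CV n} {pr : CV n →L[ℂ] F} {z₀ : CV n}

/-- The inverse of `psi ι z₀`, where `pr` is the projection along `z₀`. -/
def psiInv (pr : CV n →L[ℂ] F) (z₀ z : CV n) : F := (1 + dot z₀ z)⁻¹ • pr z

theorem psi_psiInv (h0 : dot z₀ z₀ = 1) (hpr : ∀ z, ι (pr z) = z - dot z₀ z • z₀) {z : CV n}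
    (hz : dot z z = 1) (h : 1 + dot z₀ z ≠ 0) : psi ι z₀ (psiInv pr z₀ z) = z := by
  set s := dot z₀ z with hs
  have e1 : ι (psiInv pr z₀ z) = (1 + s)⁻¹ • (z - s • z₀) := by rw [psiInv, map_smul, hpr]
  have e2 : qsq ι (psiInv pr z₀ z) = (1 - s) * (1 + s)⁻¹ := by
    simp only [qsq, e1, map_smul, map_sub, _root_.smul_apply, _root_.sub_apply, smul_eq_mul, hz, h0,
      dot_comm z z₀, ← hs]
    field_simp
    ring
  have e3 : (1 + (1 - s) * (1 + s)⁻¹)⁻¹ = (1 + s) / 2 := by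
    rw [show 1 + (1 - s) * (1 + s)⁻¹ = 2 / (1 + s) by field_simp; ring, inv_div]
  rw [psi, e2, e3, e1, smul_add, smul_smul, smul_smul, smul_smul]
  rw [show (1 + s) / 2 * (1 - (1 - s) * (1 + s)⁻¹) = s by field_simp; ring,
    show (1 + s) / 2 * 2 * (1 + s)⁻¹ = 1 by field_simp]
  module

theorem psiInv_self (h0 : dot z₀ z₀ = 1) (hinj : Function.Injective ι)
    (hpr : ∀ z, ι (pr z) = z - dot z₀ z • z₀) : psiInv pr z₀ z₀ = 0 := by
  have : pr z₀ = 0 := hinj (by rw [hpr, h0, one_smul, sub_self, map_zero])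
  rw [psiInv, this, smul_zero]

theorem contDiffAt_psiInv {z : CV n} (h : 1 + dot z₀ z ≠ 0) :
    ContDiffAt ℝ ∞ (psiInv pr z₀) z := by
  have h1 : ContDiffAt ℂ ω (psiInv pr z₀) z :=
    ((contDiffAt_const.add (dot z₀).contDiff.contDiffAt).inv h).smul pr.contDiff.contDiffAt
  exact (h1.restrict_scalars ℝ).of_le le_top

variable {E : Type*} [NormedAddCommGroup E] [NormedSpace ℝ E]
  {ζ : E → CV n} {x : E} {D : Set ℝ} {P w w₁ : ℝ → ℝ} {C Λ : ℝ}

omit [NormedSpace ℝ E] in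
theorem eventually_one_add_dot (hζ : ContinuousAt ζ x) (h : dot (ζ x) (ζ x) = 1) :
    ∀ᶠ y in 𝓝 x, 1 + dot (ζ x) (ζ y) ≠ 0 := by
  have hc : ContinuousAt (fun y => 1 + dot (ζ x) (ζ y)) x :=
    continuousAt_const.add ((dot (ζ x)).continuous.continuousAt.comp hζ)
  exact hc.eventually_ne (by rw [h]; norm_num)

/-- The metric which `ζ : E → ℂ^(n+2)` pulls back from the quadric. -/
def IsQuadricMetric (w w₁ : ℝ → ℝ) (ζ : E → CV n) (G : E → E →L[ℝ] E →L[ℝ] ℝ) (x : E) : Prop :=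
  ∀ᶠ y in 𝓝 x, ∀ u v, G y u v = (kform (w (rho ζ y)) (w₁ (rho ζ y)) (ζ y)
    (fderiv ℝ ζ y u) (fderiv ℝ ζ y v)).re

/-- Near `x` the map ζ factors through the holomorphic chart centred at ζ x, which supplies the
coordinate change for the naturality results. -/
theorem coord_pull (hζ : ∀ᶠ y in 𝓝 x, ContDiffAt ℝ ∞ ζ y) (h1 : ∀ᶠ y in 𝓝 x, dot (ζ y) (ζ y) = 1)
    (hpr : ∀ z, ι (pr z) = z - dot (ζ x) z • ζ x) :
    ∀ᶠ y in 𝓝 x, ContDiffAt ℝ ∞ (fun y => psiInv pr (ζ x) (ζ y)) y ∧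
      psi ι (ζ x) (psiInv pr (ζ x) (ζ y)) = ζ y ∧
      (1 + qsq ι (psiInv pr (ζ x) (ζ y)) ≠ 0 →
      ∀ u, fderiv ℝ ζ y u = fderiv ℂ (psi ι (ζ x)) (psiInv pr (ζ x) (ζ y))
        (fderiv ℝ (fun y => psiInv pr (ζ x) (ζ y)) y u)) := by
  have h0 := h1.self_of_nhds
  have hd := eventually_one_add_dot hζ.self_of_nhds.continuousAt h0
  have he : ∀ᶠ y in 𝓝 x, psi ι (ζ x) (psiInv pr (ζ x) (ζ y)) = ζ y := by
    filter_upwards [h1, hd] with y hy hy' using psi_psiInv h0 hpr hy hy'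
  filter_upwards [hζ, hd, he, he.eventually_nhds] with y h2 h3 h4 h5
  have h6 : ContDiffAt ℝ ∞ (fun y => psiInv pr (ζ x) (ζ y)) y := (contDiffAt_psiInv h3).comp y h2
  refine ⟨h6, h4, fun h7 u => ?_⟩
  have h8 := (((contDiffAt_psi ι (ζ x) h7).differentiableAt (by simp)).hasFDerivAt.restrictScalars
    ℝ).comp y (h6.differentiableAt (by simp)).hasFDerivAt
  have h9 := h8.congr_of_eventuallyEq (h5.mono fun z hz => hz.symm)
  rw [h9.fderiv]
  rfl

/-- `G` is the pullback of a Levi form under κ = `psiInv` ∘ ζ, so both conclusions follow by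
naturality from the holomorphic chart. -/
theorem quadricMetric_aux [FiniteDimensional ℂ F] [FiniteDimensional ℝ E] (b : Module.Basis (Fin (n + 1)) ℂ F)
    (hζ : ∀ᶠ y in 𝓝 x, ContDiffAt ℝ ∞ ζ y) (h1 : ∀ᶠ y in 𝓝 x, dot (ζ y) (ζ y) = 1)
    (hinj : Function.Injective ι) (hι : ∀ u, dot (ζ x) (ι u) = 0)
    (hpr : ∀ z, ι (pr z) = z - dot (ζ x) z • ζ x)
    (hE : Module.finrank ℝ E = 2 * (n + 1))
    (hζi : ∀ᶠ y in 𝓝 x, ∀ u, fderiv ℝ ζ y u = 0 → u = 0)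
    (hD : IsEinsteinPotential n C Λ D P w w₁) (hx : rho ζ x ∈ D)
    {G : E → E →L[ℝ] E →L[ℝ] ℝ} (hG : IsQuadricMetric w w₁ ζ G x) :
    (∀ u v, coordRicci G x u v = Λ * G x u v) ∧
    ∀ J : E → E →L[ℝ] E, (∀ᶠ y in 𝓝 x, ∀ v, fderiv ℝ ζ y (J y v) = Complex.I • fderiv ℝ ζ y v) →
      DifferentiableAt ℝ J x → ∀ u v,
      fderiv ℝ J x u v + christoffel G x u (J x v) - J x (christoffel G x u v) = 0 := by
  have : FiniteDimensional ℝ F := FiniteDimensional.complexToReal F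
  have : CompleteSpace E := FiniteDimensional.complete ℝ E
  have : CompleteSpace F := FiniteDimensional.complete ℂ F
  have h0 := h1.self_of_nhds
  set κ : E → F := fun y => psiInv pr (ζ x) (ζ y) with hκdef
  set L := leviForm (fun y => P (rho (psi ι (ζ x)) y)) with hL
  have hκ := coord_pull hζ h1 hpr
  have hκx : κ x = 0 := psiInv_self h0 hinj hpr
  have hκc : Tendsto κ (𝓝 x) (𝓝 0) := by
    have := hκ.self_of_nhds.1.continuousAt.tendsto
    exact hκx ▸ this
  have hq : ∀ᶠ y in 𝓝 x, 1 + qsq ι (κ y) ≠ 0 := hκc.eventually eventually_qsq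
  have hdk : ∀ᶠ y in 𝓝 x, ∀ u, fderiv ℝ ζ y u =
      fderiv ℂ (psi ι (ζ x)) (κ y) (fderiv ℝ κ y u) := by
    filter_upwards [hκ, hq] with y h2 h3 using h2.2.2 h3
  -- κ is a local diffeomorphism: dζ is injective and factors through dκ, and the dimensions agree.
  have hki : ∀ᶠ y in 𝓝 x, (fderiv ℝ κ y).IsInvertible := by
    filter_upwards [hdk, hζi] with y h2 h3
    have inj : Function.Injective (fderiv ℝ κ y : E →ₗ[ℝ] F) := by
      rw [← LinearMap.ker_eq_bot, LinearMap.ker_eq_bot']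
      intro u hu
      have hu' : fderiv ℝ κ y u = 0 := hu
      exact h3 u (by rw [h2, hu', map_zero])
    have hf : Module.finrank ℝ E = Module.finrank ℝ F := by
      rw [hE, finrank_real_of_complex, Module.finrank_eq_card_basis b, Fintype.card_fin]
    exact ⟨(LinearEquiv.ofInjectiveOfFinrankEq (fderiv ℝ κ y : E →ₗ[ℝ] F) inj
      hf).toContinuousLinearEquiv, by ext; rfl⟩
  have hP := eventually_contDiffAt_potential hD.toIsPotential h0 hι hx
  have hpos := eventually_leviForm_pos hD h0 hι hinj hx
  have hLc : ∀ᶠ y in 𝓝 (κ x), ContDiffAt ℝ ∞ L y := by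
    rw [hκx]; exact hP.mono fun y hy => contDiffAt_leviForm hy
  have hLs : ∀ᶠ y in 𝓝 (κ x), ∀ u v, L y u v = L y v u := by
    rw [hκx]; exact hP.mono fun y hy => leviForm_symm hy
  have hLi : ∀ᶠ y in 𝓝 (κ x), (L y).IsInvertible := by
    rw [hκx]; exact eventually_isInvertible_leviForm hpos
  have hGe : G =ᶠ[𝓝 x] pull κ L := by
    filter_upwards [hG, hκ, hdk,
      hκc.eventually (eventually_leviForm_potential hD.toIsPotential h0 hι hx)] with y h2 h3 h4 h5
    have e : rho (psi ι (ζ x)) (κ y) = rho ζ y := by simp only [rho, h3.2.1, hκdef]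
    ext u v
    rw [h2, pull_apply, hL, h5, e, ← h4, ← h4, h3.2.1]
  have hκs : ∀ᶠ y in 𝓝 x, ContDiffAt ℝ ∞ κ y := hκ.mono fun y hy => hy.1
  constructor
  · intro u v
    rw [coordRicci_congr hGe, coordRicci_pull hκs.self_of_nhds hLc.self_of_nhds hLs hki hLi hκs hLc,
      hGe.eq_of_nhds, pull_apply, hκx]
    exact coordRicci_potential b hD h0 hι hinj hx _ _
  · intro J hJ hJd u v
    rw [christoffel_congr hGe]
    refine parallel_pull (i := mulI) hκs.self_of_nhds hLc.self_of_nhds hLs.self_of_nhds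
      hki.self_of_nhds hLi.self_of_nhds ?_ hJd ?_ u v
    · filter_upwards [hJ, hdk, hq] with y h2 h3 h4 v
      have h5 := h2 v
      rw [h3, h3, ← map_smul] at h5
      by_contra hne
      refine fderiv_psi_ne_zero h0 hι hinj h4 (sub_ne_zero.2 hne) ?_
      rw [map_sub, h5, mulI_apply, sub_self]
    · intro a c
      rw [hκx, mulI_apply, mulI_apply]
      exact christoffel_potential_I hD h0 hι hinj hx a c

theorem finrank_ker_dot {z : CV n} (hz : dot z z = 1) :
    Module.finrank ℂ (LinearMap.ker (dot z : CV n →ₗ[ℂ] ℂ)) = n + 1 := by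
  have h : Function.Surjective (dot z : CV n →ₗ[ℂ] ℂ) := fun c => ⟨c • z, by simp [hz]⟩
  have h1 := LinearMap.finrank_range_add_finrank_ker (dot z : CV n →ₗ[ℂ] ℂ)
  rw [LinearMap.range_eq_top.2 h, finrank_top] at h1
  have h2 : Module.finrank ℂ (CV n) = n + 2 := finrank_euclideanSpace_fin (𝕜 := ℂ) (n := n + 2)
  have h3 : Module.finrank ℂ ℂ = 1 := Module.finrank_self ℂ
  omega

/-- The metric pulled back from the quadric is Einstein and Kähler. -/
theorem quadricMetric [FiniteDimensional ℝ E] (hζ : ∀ᶠ y in 𝓝 x, ContDiffAt ℝ ∞ ζ y)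
    (h1 : ∀ᶠ y in 𝓝 x, dot (ζ y) (ζ y) = 1)
    (hE : Module.finrank ℝ E = 2 * (n + 1))
    (hζi : ∀ᶠ y in 𝓝 x, ∀ u, fderiv ℝ ζ y u = 0 → u = 0)
    (hD : IsEinsteinPotential n C Λ D P w w₁) (hx : rho ζ x ∈ D)
    {G : E → E →L[ℝ] E →L[ℝ] ℝ} (hG : IsQuadricMetric w w₁ ζ G x) :
    (∀ u v, coordRicci G x u v = Λ * G x u v) ∧
    ∀ J : E → E →L[ℝ] E, (∀ᶠ y in 𝓝 x, ∀ v, fderiv ℝ ζ y (J y v) = Complex.I • fderiv ℝ ζ y v) →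
      DifferentiableAt ℝ J x → ∀ u v,
      fderiv ℝ J x u v + christoffel G x u (J x v) - J x (christoffel G x u v) = 0 := by
  have h0 := h1.self_of_nhds
  -- The model space of the chart is the tangent space of the quadric at ζ x, and `p` is the
  -- projection onto it along ζ x.
  set W := LinearMap.ker (dot (ζ x) : CV n →ₗ[ℂ] ℂ) with hW
  have : FiniteDimensional ℂ W := inferInstance
  let p : CV n →L[ℂ] CV n := ContinuousLinearMap.id ℂ _ - (dot (ζ x)).smulRight (ζ x)
  have hp : ∀ z, p z = z - dot (ζ x) z • ζ x := fun z => by simp [p]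
  have hp' : ∀ z, p z ∈ W := fun z => by
    rw [hW, LinearMap.mem_ker, hp]
    simp [h0]
  exact quadricMetric_aux (F := W) (ι := W.subtypeL) (pr := p.codRestrict W hp')
    (Module.finBasisOfFinrankEq ℂ W (finrank_ker_dot h0)) hζ h1 Subtype.val_injective
    (fun u => u.2) hp hE hζi hD hx hG

end Charts

/-- On the compact unit sphere the form has a positive minimum, which bounds the norm on its unit
ball. -/
theorem isVonNBounded_of_pos {E : Type*} [NormedAddCommGroup E] [NormedSpace ℝ E]
    [FiniteDimensional ℝ E] (G : E →L[ℝ] E →L[ℝ] ℝ) (h : ∀ u, u ≠ 0 → 0 < G u u) :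
    Bornology.IsVonNBounded ℝ {u : E | G u u < 1} := by
  rw [NormedSpace.isVonNBounded_iff, isBounded_iff_forall_norm_le]
  have : ProperSpace E := FiniteDimensional.proper ℝ E
  have hc : Continuous fun u => G u u := by fun_prop
  rcases (Metric.sphere (0 : E) 1).eq_empty_or_nonempty with he | hne
  · refine ⟨0, fun u _ => ?_⟩
    by_contra hu
    have hu' : ‖u‖ ≠ 0 := fun h => hu h.le
    have : ‖u‖⁻¹ • u ∈ Metric.sphere (0 : E) 1 := by simp [norm_smul, hu']
    simp [he] at this
  · obtain ⟨v, hv, hm⟩ := (isCompact_sphere (0 : E) 1).exists_isMinOn hne hc.continuousOn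
    have hv0 : v ≠ 0 := by rintro rfl; simp at hv
    refine ⟨√(1 / G v v), fun u hu => Real.le_sqrt_of_sq_le ?_⟩
    rw [le_div_iff₀ (h v hv0)]
    rcases eq_or_ne u 0 with rfl | hu0
    · simp
    have hu' : ‖u‖ ≠ 0 := norm_ne_zero_iff.2 hu0
    have h1 : ‖u‖⁻¹ • u ∈ Metric.sphere (0 : E) 1 := by simp [norm_smul, hu']
    have h2 : G v v ≤ G (‖u‖⁻¹ • u) (‖u‖⁻¹ • u) := hm h1
    simp only [map_smul, _root_.smul_apply, smul_eq_mul] at h2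
    have h3 : ‖u‖ ^ 2 * G v v ≤ ‖u‖ ^ 2 * (‖u‖⁻¹ * (‖u‖⁻¹ * G u u)) :=
      mul_le_mul_of_nonneg_left h2 (sq_nonneg _)
    have h4 : ‖u‖ ^ 2 * (‖u‖⁻¹ * (‖u‖⁻¹ * G u u)) = G u u := by field_simp
    have h5 : G u u < 1 := hu
    linarith

/-! ### Smoothness of tensor fields in the preferred charts -/

section Sections

variable {E : Type*} [NormedAddCommGroup E] [NormedSpace ℝ E]
  {H : Type*} [TopologicalSpace H] {I : ModelWithCorners ℝ E H} [I.Boundaryless]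
  {M : Type*} [TopologicalSpace M] [ChartedSpace H M] [IsManifold I 1 M]

/-- A field of bilinear forms in the preferred chart at `p`. -/
def chartForm (β : ∀ p : M, TangentSpace I p →L[ℝ] TangentSpace I p →L[ℝ] ℝ) (p : M) (y : E) :
    E →L[ℝ] E →L[ℝ] ℝ :=
  let D := mfderiv 𝓘(ℝ, E) I (extChartAt I p).symm y
  (ContinuousLinearMap.precomp ℝ D) ∘L (β ((extChartAt I p).symm y)) ∘L D

theorem symmL_eq_mfderiv {p q : M} (hq : q ∈ (extChartAt I p).source) :
    (trivializationAt E (TangentSpace I) p).symmL ℝ q =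
      mfderiv 𝓘(ℝ, E) I (extChartAt I p).symm (extChartAt I p q) := by
  rw [TangentBundle.symmL_trivializationAt (by simpa using hq), I.range_eq_univ, mfderivWithin_univ]

/-- Smoothness at `p` is tested in the trivialization centred at `p`, where the coordinates of the
section are given by the chart form. Hence only the centre of each chart has to be examined. -/
theorem contMDiff_form {β : ∀ p : M, TangentSpace I p →L[ℝ] TangentSpace I p →L[ℝ] ℝ}
    (h : ∀ p, ContDiffAt ℝ ∞ (chartForm β p) (extChartAt I p p)) :
    ContMDiff I (I.prod 𝓘(ℝ, E →L[ℝ] E →L[ℝ] ℝ)) ∞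
      (fun p => TotalSpace.mk' (E →L[ℝ] E →L[ℝ] ℝ)
        (E := fun p : M => TangentSpace I p →L[ℝ] TangentSpace I p →L[ℝ] ℝ) p (β p)) := by
  intro p
  rw [contMDiffAt_hom_bundle]
  refine ⟨contMDiffAt_id, ?_⟩
  have h1 : ContMDiffAt I 𝓘(ℝ, E →L[ℝ] E →L[ℝ] ℝ) ∞
      (fun q => chartForm β p (extChartAt I p q)) p :=
    (h p).contMDiffAt.comp p contMDiffAt_extChartAt
  refine h1.congr_of_eventuallyEq ?_
  filter_upwards [extChartAt_source_mem_nhds (I := I) p] with q hq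
  ext u v
  have hb : q ∈ (trivializationAt E (TangentSpace I) p).baseSet := by simpa using hq
  refine (inCoordinates_apply_eq₂ (F₁ := E) (E₁ := fun p : M => TangentSpace I p)
    (F₂ := E) (E₂ := fun p : M => TangentSpace I p) (F₃ := ℝ) (E₃ := Bundle.Trivial M ℝ)
    hb hb (mem_univ _)).trans ?_
  have e : (extChartAt I p).symm (extChartAt I p q) = q := (extChartAt I p).left_inv hq
  have es : ∀ u : E, (show E from (trivializationAt E (TangentSpace I) p).symm q u) =
      (show E →L[ℝ] E from mfderiv 𝓘(ℝ, E) I (extChartAt I p).symm (extChartAt I p q)) u := fun u =>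
    ((trivializationAt E (TangentSpace I) p).symmL_apply hb u).symm.trans
      (congrArg (fun l : E →L[ℝ] E => l u) (symmL_eq_mfderiv hq))
  have et : ∀ c : ℝ, (trivializationAt ℝ (Bundle.Trivial M ℝ) p).linearMapAt ℝ q c = c := by
    intro c; simp
  have eβ : ∀ q' (_ : q' = q) (a b a' b' : E), a = a' → b = b' → β q a b = β q' a' b' := by
    rintro _ rfl a b _ _ rfl rfl; rfl
  exact (et _).trans (eβ _ e _ _ _ _ (es u) (es v))

theorem contMDiff_endo {J : ∀ p : M, TangentSpace I p →L[ℝ] TangentSpace I p}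
    (h : ∀ p, ContDiffAt ℝ ∞ (chartEndo J p) (extChartAt I p p)) :
    ContMDiff I (I.prod 𝓘(ℝ, E →L[ℝ] E)) ∞
      (fun p => TotalSpace.mk' (E →L[ℝ] E)
        (E := fun p : M => TangentSpace I p →L[ℝ] TangentSpace I p) p (J p)) := by
  intro p
  rw [contMDiffAt_hom_bundle]
  refine ⟨contMDiffAt_id, ?_⟩
  have h1 : ContMDiffAt I 𝓘(ℝ, E →L[ℝ] E) ∞
      (fun q => chartEndo J p (extChartAt I p q)) p :=
    (h p).contMDiffAt.comp p contMDiffAt_extChartAt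
  refine h1.congr_of_eventuallyEq ?_
  filter_upwards [extChartAt_source_mem_nhds (I := I) p] with q hq
  have e : (extChartAt I p).symm (extChartAt I p q) = q := (extChartAt I p).left_inv hq
  simp only [ContinuousLinearMap.inCoordinates, chartEndo]
  rw [TangentBundle.continuousLinearMapAt_trivializationAt (by simpa using hq),
    symmL_eq_mfderiv hq]
  have eJ : ∀ q' (_ : q' = q) (D : E →L[ℝ] E),
      (show E →L[ℝ] E from mfderiv I 𝓘(ℝ, E) (extChartAt I p) q) ∘L (show E →L[ℝ] E from J q) ∘L D =
      (show E →L[ℝ] E from mfderiv I 𝓘(ℝ, E) (extChartAt I p) q') ∘L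
        (show E →L[ℝ] E from J q') ∘L D := by rintro _ rfl D; rfl
  exact eJ _ e _

theorem chartForm_self (β : ∀ p : M, TangentSpace I p →L[ℝ] TangentSpace I p →L[ℝ] ℝ) (p : M)
    (v w : TangentSpace I p) :
    chartForm β p (extChartAt I p p) (mfderiv I 𝓘(ℝ, E) (extChartAt I p) p v)
      (mfderiv I 𝓘(ℝ, E) (extChartAt I p) p w) = β p v w := by
  have e : ∀ q' (_ : q' = p) (a b a' b' : E), a = a' → b = b' → β q' a b = β p a' b' := by
    rintro _ rfl a b _ _ rfl rfl; rfl
  have h1 := mfderivWithin_range_extChartAt_symm (I := I) (x := p)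
  rw [I.range_eq_univ, mfderivWithin_univ] at h1
  have h2 := mfderiv_extChartAt_self (I := I) (x := p)
  have h3 : ∀ v : TangentSpace I p, mfderiv 𝓘(ℝ, E) I (extChartAt I p).symm (extChartAt I p p)
      (mfderiv I 𝓘(ℝ, E) (extChartAt I p) p v) = v := fun v =>
    (congrArg (fun l : E →L[ℝ] E => l _) h1).trans (congrArg (fun l : E →L[ℝ] E => l v) h2)
  exact e _ (extChartAt_to_inv p) _ _ _ _ (h3 v) (h3 w)

theorem mfderiv_symm_mfderiv (p : M) {y : E} (hy : y ∈ (extChartAt I p).target)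
    (v : TangentSpace I ((extChartAt I p).symm y)) :
    mfderiv 𝓘(ℝ, E) I (extChartAt I p).symm y
      (mfderiv I 𝓘(ℝ, E) (extChartAt I p) ((extChartAt I p).symm y) v) = v := by
  have h1 := mfderivWithin_extChartAt_symm_comp_mfderiv_extChartAt (I := I) hy
  rw [I.range_eq_univ, mfderivWithin_univ] at h1
  exact congrArg (fun l : E →L[ℝ] E => l v) h1

/-- Nothing is assumed about the regularity of `J`. It is recovered as β⁻¹ ∘ γ from two smooth
forms, the first of which is invertible. -/
theorem contDiffAt_chartEndo [CompleteSpace E]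
    {β γ : ∀ p : M, TangentSpace I p →L[ℝ] TangentSpace I p →L[ℝ] ℝ}
    {J : ∀ p : M, TangentSpace I p →L[ℝ] TangentSpace I p} {p : M}
    (hβ : ContDiffAt ℝ ∞ (chartForm β p) (extChartAt I p p))
    (hω : ContDiffAt ℝ ∞ (chartForm γ p) (extChartAt I p p))
    (hi : ∀ y ∈ (extChartAt I p).target, (chartForm β p y).IsInvertible)
    (h : ∀ q u v, β q (J q u) v = γ q u v) :
    ContDiffAt ℝ ∞ (chartEndo J p) (extChartAt I p p) := by
  have h3 : ContDiffAt ℝ ∞ (fun y => (chartForm β p y).inverse) (extChartAt I p p) := by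
    obtain ⟨e, he⟩ := hi _ (mem_extChartAt_target p)
    have := contDiffAt_map_inverse (𝕜 := ℝ) (n := ∞) e
    rw [he] at this
    exact this.comp (extChartAt I p p) hβ
  refine (h3.clm_comp hω).congr_of_eventuallyEq ?_
  filter_upwards [extChartAt_target_mem_nhds (I := I) p] with y hy
  obtain ⟨e, he⟩ := hi y hy
  have h4 : ∀ u v, chartForm β p y (chartEndo J p y u) v = chartForm γ p y u v := by
    intro u v
    refine Eq.trans ?_ (h _ _ _)
    exact congrArg (fun a => β ((extChartAt I p).symm y) a
      (mfderiv 𝓘(ℝ, E) I (extChartAt I p).symm y v)) (mfderiv_symm_mfderiv p hy _)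
  ext u
  rw [ContinuousLinearMap.comp_apply, ← he, ContinuousLinearMap.inverse_equiv]
  apply e.injective
  ext v
  have h5 := h4 u v
  rw [← he] at h5
  refine h5.trans ?_
  exact congrArg (fun l : E →L[ℝ] ℝ => l v) (e.apply_symm_apply _).symm

end Sections

/-! ### Regularity of the potential and of the real form -/

section Potential

variable {D : Set ℝ} {P w w₁ : ℝ → ℝ}

theorem IsPotential.uniqueDiffOn (h : IsPotential D P w w₁) : UniqueDiffOn ℝ D := fun q hq =>
  ((uniqueDiffOn_Ici (0 : ℝ)) q (h.subset hq)).mono_nhds (nhdsWithin_le_iff.2 (h.mem_nhds q hq))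

theorem contDiffOn_deriv_within {f f' : ℝ → ℝ} (hu : UniqueDiffOn ℝ D) (hf : ContDiffOn ℝ ∞ f D)
    (hd : ∀ q ∈ D, HasDerivWithinAt f (f' q) D q) : ContDiffOn ℝ ∞ f' D :=
  (hf.derivWithin hu (by simp)).congr fun q hq => ((hd q hq).derivWithin (hu q hq)).symm

theorem IsPotential.smooth₁ (h : IsPotential D P w w₁) : ContDiffOn ℝ ∞ w D :=
  contDiffOn_deriv_within h.uniqueDiffOn h.smooth h.deriv

theorem IsPotential.smooth₂ (h : IsPotential D P w w₁) : ContDiffOn ℝ ∞ w₁ D :=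
  contDiffOn_deriv_within h.uniqueDiffOn h.smooth₁ h.deriv₂

/-- The real inner product. -/
def innerR {n : ℕ} : CV n →L[ℝ] CV n →L[ℝ] ℝ := innerSL ℝ

theorem innerR_apply {n : ℕ} (u v : CV n) : innerR u v = inner ℝ u v := rfl

/-- The real part of `kform`. -/
def realForm {n : ℕ} (a b : ℝ) (z : CV n) : CV n →L[ℝ] CV n →L[ℝ] ℝ :=
  a • innerR + (b / 2) • ((innerR z).smulRight (innerR z) +
    (innerR (Complex.I • z)).smulRight (innerR (Complex.I • z)))

theorem realForm_apply {n : ℕ} (a b : ℝ) (z u v : CV n) :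
    realForm a b z u v = (kform a b z u v).re := by
  have e1 : inner ℂ v u = (starRingEnd ℂ) (inner ℂ u v) := (inner_conj_symm v u).symm
  have e2 : inner ℂ v z = (starRingEnd ℂ) (inner ℂ z v) := (inner_conj_symm v z).symm
  have e3 : ∀ u, inner ℝ (Complex.I • z) u = (inner ℂ z u).im := fun u => by
    rw [real_inner_eq, inner_smul_left]; simp
  have h : realForm a b z u v = a * inner ℝ u v + b / 2 * (inner ℝ z u * inner ℝ z v +
      inner ℝ (Complex.I • z) u * inner ℝ (Complex.I • z) v) := rfl
  rw [h, e3, e3, kform, e1, e2, Complex.add_re, Complex.re_ofReal_mul,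
    Complex.re_ofReal_mul]
  simp [real_inner_eq, -inner_conj_symm]

theorem realForm_symm {n : ℕ} (a b : ℝ) (z u v : CV n) : realForm a b z u v = realForm a b z v u := by
  simp only [realForm, _root_.add_apply, _root_.smul_apply, ContinuousLinearMap.smulRight_apply,
    smul_eq_mul, innerR_apply, real_inner_comm u v]
  ring

theorem contDiffAt_realForm {n : ℕ} {X : Type*} [NormedAddCommGroup X] [NormedSpace ℝ X]
    {a b : X → ℝ} {ζ : X → CV n} {x : X} (ha : ContDiffAt ℝ ∞ a x) (hb : ContDiffAt ℝ ∞ b x)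
    (hζ : ContDiffAt ℝ ∞ ζ x) : ContDiffAt ℝ ∞ (fun y => realForm (a y) (b y) (ζ y)) x := by
  have h1 : ContDiffAt ℝ ∞ (fun y => innerR (ζ y)) x :=
    (innerR.contDiff (n := ∞)).contDiffAt.comp x hζ
  have h2 : ContDiffAt ℝ ∞ (fun y => innerR (Complex.I • ζ y)) x :=
    (innerR.contDiff (n := ∞)).contDiffAt.comp x
      ((((Complex.I • ContinuousLinearMap.id ℂ (CV n)).restrictScalars ℝ).contDiff
        (n := ∞)).contDiffAt.comp x hζ)
  exact (ha.smul (contDiffAt_const (c := innerR))).add ((hb.div_const 2).smul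
    ((h1.smulRight h1).add (h2.smulRight h2)))

end Potential

/-! ### The Kähler–Einstein metric of an immersion into the quadric -/

section Immersion

variable {E : Type*} [NormedAddCommGroup E] [NormedSpace ℝ E]
  {H : Type*} [TopologicalSpace H] {I : ModelWithCorners ℝ E H}
  {M : Type*} [TopologicalSpace M] [ChartedSpace H M] {n : ℕ}

variable (I) in
/-- Immersions into the quadric `z · z = 1` as open subsets. -/
structure IsQuadricImmersion (Z : M → CV n) : Prop where
  smooth : ContMDiff I 𝓘(ℝ, CV n) ∞ Z
  dot_self (p : M) : dot (Z p) (Z p) = 1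
  injective (p : M) (v : TangentSpace I p) : mfderiv I 𝓘(ℝ, CV n) Z p v = 0 → v = 0
  finrank : Module.finrank ℝ E = 2 * (n + 1)

variable (I) in
/-- The differential of a map to `ℂ^(n+2)`. -/
def differential (Z : M → CV n) (p : M) : TangentSpace I p →L[ℝ] CV n :=
  mfderiv I 𝓘(ℝ, CV n) Z p

variable (I) in
/-- A map in the preferred chart at `p`. -/
def localMap (Z : M → CV n) (p : M) : E → CV n := Z ∘ (extChartAt I p).symm

variable (I) in
/-- The pullback of `kform` by an immersion into the quadric. -/
def quadricForm (w w₁ : ℝ → ℝ) (Z : M → CV n) (p : M) :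
    TangentSpace I p →L[ℝ] TangentSpace I p →L[ℝ] ℝ :=
  (ContinuousLinearMap.precomp ℝ (differential I Z p)) ∘L
    (realForm (w (rho Z p)) (w₁ (rho Z p)) (Z p)) ∘L (differential I Z p)

theorem quadricForm_apply (w w₁ : ℝ → ℝ) (Z : M → CV n) (p : M) (u v : TangentSpace I p) :
    quadricForm I w w₁ Z p u v = (kform (w (rho Z p)) (w₁ (rho Z p)) (Z p)
      (differential I Z p u) (differential I Z p v)).re :=
  realForm_apply _ _ _ _ _

variable [I.Boundaryless] [IsManifold I 1 M] [IsManifold I ∞ M] {Z : M → CV n}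
  {D : Set ℝ} {P w w₁ : ℝ → ℝ} {C Λ : ℝ}

theorem contDiffAt_localMap (hZ : IsQuadricImmersion I Z) (p : M) {y : E}
    (hy : y ∈ (extChartAt I p).target) : ContDiffAt ℝ ∞ (localMap I Z p) y :=
  (hZ.smooth.contMDiffAt.comp y ((contMDiffOn_extChartAt_symm p).contMDiffAt
    (extChartAt_target_mem_nhds' hy))).contDiffAt

theorem fderiv_localMap (hZ : IsQuadricImmersion I Z) (p : M) {y : E}
    (hy : y ∈ (extChartAt I p).target) (u : E) : fderiv ℝ (localMap I Z p) y u =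
      differential I Z ((extChartAt I p).symm y)
        (mfderiv 𝓘(ℝ, E) I (extChartAt I p).symm y u) := by
  have h1 : MDifferentiableAt 𝓘(ℝ, E) I (extChartAt I p).symm y :=
    ((contMDiffOn_extChartAt_symm (n := ∞) p).contMDiffAt
      (extChartAt_target_mem_nhds' hy)).mdifferentiableAt (by simp)
  have h2 : MDifferentiableAt I 𝓘(ℝ, CV n) Z ((extChartAt I p).symm y) :=
    hZ.smooth.contMDiffAt.mdifferentiableAt (by simp)
  rw [localMap, ← mfderiv_eq_fderiv, mfderiv_comp y h2 h1]
  rfl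

theorem isQuadricMetric_chartForm (hZ : IsQuadricImmersion I Z) (p : M) {y : E}
    (hy : y ∈ (extChartAt I p).target) (u v : E) : chartForm (quadricForm I w w₁ Z) p y u v =
      (kform (w (rho (localMap I Z p) y)) (w₁ (rho (localMap I Z p) y)) (localMap I Z p y)
        (fderiv ℝ (localMap I Z p) y u) (fderiv ℝ (localMap I Z p) y v)).re := by
  rw [fderiv_localMap hZ p hy, fderiv_localMap hZ p hy]
  change quadricForm I w w₁ Z ((extChartAt I p).symm y)
    (mfderiv 𝓘(ℝ, E) I (extChartAt I p).symm y u)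
    (mfderiv 𝓘(ℝ, E) I (extChartAt I p).symm y v) = _
  rw [quadricForm_apply]
  rfl

theorem mem_target (p : M) : ∀ᶠ y in 𝓝 (extChartAt I p p), y ∈ (extChartAt I p).target :=
  extChartAt_target_mem_nhds p

theorem injective_mfderiv_symm (p : M) {y : E} (hy : y ∈ (extChartAt I p).target) {u : E}
    (h : mfderiv 𝓘(ℝ, E) I (extChartAt I p).symm y u = 0) : u = 0 := by
  have h1 := mfderiv_extChartAt_comp_mfderivWithin_extChartAt_symm (I := I) hy
  rw [I.range_eq_univ, mfderivWithin_univ] at h1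
  have h2 := congrArg (fun l : E →L[ℝ] E => l u) h1
  refine h2.symm.trans ?_
  exact (congrArg (mfderiv I 𝓘(ℝ, E) (extChartAt I p) ((extChartAt I p).symm y)) h).trans
    (map_zero _)

theorem eventually_localMap_injective (hZ : IsQuadricImmersion I Z) (p : M) :
    ∀ᶠ y in 𝓝 (extChartAt I p p), ∀ u, fderiv ℝ (localMap I Z p) y u = 0 → u = 0 := by
  filter_upwards [mem_target p] with y hy u hu
  rw [fderiv_localMap hZ p hy] at hu
  exact injective_mfderiv_symm p hy (hZ.injective _ _ hu)

theorem contDiffAt_pull_realForm {ζ : E → CV n} {x : E} {a b : E → ℝ}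
    (ha : ContDiffAt ℝ ∞ a x) (hb : ContDiffAt ℝ ∞ b x) (hζ : ContDiffAt ℝ ∞ ζ x)
    (T : CV n →L[ℝ] CV n) :
    ContDiffAt ℝ ∞ (fun y => (ContinuousLinearMap.precomp ℝ (fderiv ℝ ζ y)) ∘L
      (realForm (a y) (b y) (ζ y)) ∘L T ∘L (fderiv ℝ ζ y)) x := by
  have h1 := contDiffAt_fderiv_infty hζ
  have h2 : ContDiffAt ℝ ∞ (fun y => ContinuousLinearMap.precomp ℝ (fderiv ℝ ζ y)) x :=
    ((ContinuousLinearMap.compL ℝ E (CV n) ℝ).flip.contDiff (n := ∞)).contDiffAt.comp x h1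
  exact h2.clm_comp ((contDiffAt_realForm ha hb hζ).clm_comp (contDiffAt_const.clm_comp h1))

theorem contDiffAt_rho_real {ζ : E → CV n} {x : E} (h1 : ContDiffAt ℝ ∞ ζ x) :
    ContDiffAt ℝ ∞ (rho ζ) x := by
  have h2 : ContDiffAt ℝ ∞ (fun y => (‖ζ y‖ ^ 2 - 1) / (2 : ℝ)) x :=
    ((h1.norm_sq ℝ).sub contDiffAt_const).div_const _
  exact h2

theorem contDiffAt_chartForm (hZ : IsQuadricImmersion I Z) (hD : IsPotential D P w w₁)
    (hm : ∀ p, rho Z p ∈ D) (p : M) :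
    ContDiffAt ℝ ∞ (chartForm (quadricForm I w w₁ Z) p) (extChartAt I p p) := by
  have hζ := contDiffAt_localMap hZ p (mem_extChartAt_target p)
  have hr := contDiffAt_rho_real hζ
  have hm' : ∀ᶠ y in 𝓝 (extChartAt I p p), rho (localMap I Z p) y ∈ D :=
    Eventually.of_forall fun y => hm _
  refine (contDiffAt_pull_realForm (contDiffAt_of_contDiffOn hD.smooth₁ hr hm')
    (contDiffAt_of_contDiffOn hD.smooth₂ hr hm') hζ (.id ℝ _)).congr_of_eventuallyEq ?_
  filter_upwards [mem_target p] with y hy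
  ext u v
  rw [isQuadricMetric_chartForm hZ p hy, ← realForm_apply]
  rfl

variable [FiniteDimensional ℝ E]

theorem dot_mfderiv (hZ : IsQuadricImmersion I Z) (p : M) (v : TangentSpace I p) :
    dot (Z p) (differential I Z p v) = 0 := by
  have h1 : HasFDerivAt (fun z : CV n => dot z z) _ (Z p) :=
    (((dot (n := n)).hasFDerivAt (x := Z p)).clm_apply (hasFDerivAt_id (Z p))).restrictScalars ℝ
  have h2 := h1.hasMFDerivAt.comp p
    (hZ.smooth.contMDiffAt.mdifferentiableAt (by simp) : MDifferentiableAt I _ Z p).hasMFDerivAt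
  have h3 : HasMFDerivAt I 𝓘(ℝ, ℂ) ((fun z : CV n => dot z z) ∘ Z) p
      (0 : TangentSpace I p →L[ℝ] ℂ) := by
    have e : ((fun z : CV n => dot z z) ∘ Z) = fun _ => 1 := funext fun q => hZ.dot_self q
    rw [e]
    exact hasMFDerivAt_const _ _
  have h4 := congrArg (fun l : TangentSpace I p →L[ℝ] ℂ => l v) (hasMFDerivAt_unique h2 h3)
  set d : CV n := differential I Z p v with hd
  have h5 : dot (Z p) d + dot d (Z p) = 0 := h4
  rw [dot_comm d] at h5
  have h6 : (2 : ℂ) * dot (Z p) d = 0 := by rw [two_mul]; exact h5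
  simpa using h6

theorem quadricForm_pos (hZ : IsQuadricImmersion I Z) (hD : IsEinsteinPotential n C Λ D P w w₁)
    (hm : ∀ p, rho Z p ∈ D) (p : M) (v : TangentSpace I p) (hv : v ≠ 0) :
    0 < quadricForm I w w₁ Z p v v := by
  rw [quadricForm_apply]
  exact kform_pos (hD.pos _ (hm p)) (hZ.dot_self p) (dot_mfderiv hZ p v) (hD.csq_pos _ (hm p))
    fun h => hv (hZ.injective p v h)

/-- The Riemannian metric induced by an immersion into the quadric. -/
def inducedMetric (hZ : IsQuadricImmersion I Z) (hD : IsEinsteinPotential n C Λ D P w w₁)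
    (hm : ∀ p, rho Z p ∈ D) : SmoothMetric I M where
  inner := quadricForm I w w₁ Z
  symm _ _ _ := realForm_symm _ _ _ _ _
  pos p v hv := quadricForm_pos hZ hD hm p v hv
  isVonNBounded p :=
    isVonNBounded_of_pos (E := E) (quadricForm I w w₁ Z p) (quadricForm_pos hZ hD hm p)
  contMDiff := contMDiff_form (contDiffAt_chartForm hZ hD.toIsPotential hm)

theorem inducedMetric_inner (hZ : IsQuadricImmersion I Z)
    (hD : IsEinsteinPotential n C Λ D P w w₁) (hm : ∀ p, rho Z p ∈ D) (p : M)
    (u v : TangentSpace I p) : (inducedMetric hZ hD hm).inner p u v =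
      (kform (w (rho Z p)) (w₁ (rho Z p)) (Z p)
      (differential I Z p u) (differential I Z p v)).re :=
  quadricForm_apply _ _ _ _ _ _

theorem isQuadricMetric_inducedMetric (hZ : IsQuadricImmersion I Z)
    (hD : IsEinsteinPotential n C Λ D P w w₁) (hm : ∀ p, rho Z p ∈ D) (p : M) :
    IsQuadricMetric w w₁ (localMap I Z p) (chartMetric (inducedMetric hZ hD hm) p)
      (extChartAt I p p) := by
  filter_upwards [mem_target p] with y hy u v
  exact isQuadricMetric_chartForm hZ p hy u v

theorem quadricMetric_inducedMetric (hZ : IsQuadricImmersion I Z)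
    (hD : IsEinsteinPotential n C Λ D P w w₁) (hm : ∀ p, rho Z p ∈ D) (p : M) :
    (∀ u v, coordRicci (chartMetric (inducedMetric hZ hD hm) p) (extChartAt I p p) u v =
      Λ * chartMetric (inducedMetric hZ hD hm) p (extChartAt I p p) u v) ∧
    ∀ J : E → E →L[ℝ] E, (∀ᶠ y in 𝓝 (extChartAt I p p), ∀ v,
        fderiv ℝ (localMap I Z p) y (J y v) = Complex.I • fderiv ℝ (localMap I Z p) y v) →
      DifferentiableAt ℝ J (extChartAt I p p) → ∀ u v,
      fderiv ℝ J (extChartAt I p p) u v +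
        christoffel (chartMetric (inducedMetric hZ hD hm) p) (extChartAt I p p) u
          (J (extChartAt I p p) v) - J (extChartAt I p p)
          (christoffel (chartMetric (inducedMetric hZ hD hm) p) (extChartAt I p p) u v) = 0 :=
  quadricMetric ((mem_target p).mono fun _ hy => contDiffAt_localMap hZ p hy)
    (Eventually.of_forall fun _ => hZ.dot_self _) hZ.finrank (eventually_localMap_injective hZ p)
    hD (hm _) (isQuadricMetric_inducedMetric hZ hD hm p)

theorem isEinstein_inducedMetric (hZ : IsQuadricImmersion I Z)
    (hD : IsEinsteinPotential n C Λ D P w w₁) (hm : ∀ p, rho Z p ∈ D) :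
    IsEinstein (inducedMetric hZ hD hm) Λ := fun p v v' =>
  ((quadricMetric_inducedMetric hZ hD hm p).1 _ _).trans
    (congrArg (Λ * ·) (chartForm_self (quadricForm I w w₁ Z) p v v'))

omit [FiniteDimensional ℝ E] in
theorem finrank_real_ker_dot {z : CV n} (hz : dot z z = 1) :
    Module.finrank ℝ ((LinearMap.ker (dot z : CV n →ₗ[ℂ] ℂ)).restrictScalars ℝ) =
      2 * (n + 1) := by
  rw [← finrank_ker_dot hz, ← finrank_real_of_complex]
  rfl

/-- By a dimension count the image of `d` is the whole of {u | z·u = 0}, a complex subspace, so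
multiplication by `I` can be pulled back. -/
theorem exists_lift_I {d : E →L[ℝ] CV n} {z : CV n} (hz : dot z z = 1)
    (hd : ∀ v, d v = 0 → v = 0) (hdz : ∀ v, dot z (d v) = 0)
    (hE : Module.finrank ℝ E = 2 * (n + 1)) :
    ∃ J : E →L[ℝ] E, ∀ v, d (J v) = Complex.I • d v := by
  have hinj : LinearMap.ker (d : E →ₗ[ℝ] CV n) = ⊥ := LinearMap.ker_eq_bot'.2 fun v hv => hd v hv
  have hr : LinearMap.range (d : E →ₗ[ℝ] CV n) =
      (LinearMap.ker (dot z : CV n →ₗ[ℂ] ℂ)).restrictScalars ℝ := by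
    refine Submodule.eq_of_le_of_finrank_eq ?_ ?_
    · rintro _ ⟨v, rfl⟩
      exact hdz v
    · rw [finrank_real_ker_dot hz, LinearMap.finrank_range_of_inj (LinearMap.ker_eq_bot.1 hinj), hE]
  obtain ⟨f, hf⟩ := (d : E →ₗ[ℝ] CV n).exists_leftInverse_of_injective hinj
  refine ⟨LinearMap.toContinuousLinearMap
    (f ∘ₗ ((mulI : CV n →L[ℝ] CV n) : CV n →ₗ[ℝ] CV n) ∘ₗ (d : E →ₗ[ℝ] CV n)), fun v => ?_⟩
  have hm : Complex.I • d v ∈ LinearMap.range (d : E →ₗ[ℝ] CV n) := by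
    rw [hr]
    exact (LinearMap.ker (dot z : CV n →ₗ[ℂ] ℂ)).smul_mem Complex.I (hdz v)
  obtain ⟨u, hu⟩ := hm
  have e : f (Complex.I • d v) = u := by
    rw [← hu]
    exact congrArg (fun l : E →ₗ[ℝ] E => l u) hf
  change d (f (Complex.I • d v)) = Complex.I • d v
  rw [e, ← hu]
  rfl

theorem exists_almostComplex (hZ : IsQuadricImmersion I Z) (p : M) :
    ∃ J : TangentSpace I p →L[ℝ] TangentSpace I p, ∀ v,
      differential I Z p (J v) = Complex.I • differential I Z p v :=
  exists_lift_I (E := E) (hZ.dot_self p) (hZ.injective p) (dot_mfderiv hZ p) hZ.finrank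

omit [FiniteDimensional ℝ E] in
theorem kform_I (a b : ℝ) (z u v : CV n) :
    kform a b z (Complex.I • u) (Complex.I • v) = kform a b z u v := by
  simp only [kform, inner_smul_left, inner_smul_right, Complex.conj_I]
  linear_combination (-(a : ℂ) * inner ℂ v u - ((b / 2 : ℝ) : ℂ) * inner ℂ z u * inner ℂ v z) * Complex.I_sq

theorem isInvertible_chartForm (hZ : IsQuadricImmersion I Z)
    (hD : IsEinsteinPotential n C Λ D P w w₁) (hm : ∀ p, rho Z p ∈ D) (p : M) {y : E}
    (hy : y ∈ (extChartAt I p).target) : (chartForm (quadricForm I w w₁ Z) p y).IsInvertible := by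
  refine isInvertible_of_pos fun u hu => ?_
  rw [isQuadricMetric_chartForm hZ p hy]
  refine kform_pos (hD.pos _ (hm _)) (hZ.dot_self _) ?_ (hD.csq_pos _ (hm _)) fun h => hu ?_
  · rw [fderiv_localMap hZ p hy]
    exact dot_mfderiv hZ _ _
  · rw [fderiv_localMap hZ p hy] at h
    exact injective_mfderiv_symm p hy (hZ.injective _ _ h)

variable (I) in
/-- The bilinear form `quadricForm (I ·) ·`. -/
def quadricFormI (w w₁ : ℝ → ℝ) (Z : M → CV n) (p : M) :
    TangentSpace I p →L[ℝ] TangentSpace I p →L[ℝ] ℝ :=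
  (ContinuousLinearMap.precomp ℝ (differential I Z p)) ∘L
    (realForm (w (rho Z p)) (w₁ (rho Z p)) (Z p)) ∘L mulI ∘L (differential I Z p)

theorem contDiffAt_chartForm_I (hZ : IsQuadricImmersion I Z) (hD : IsPotential D P w w₁)
    (hm : ∀ p, rho Z p ∈ D) (p : M) :
    ContDiffAt ℝ ∞ (chartForm (quadricFormI I w w₁ Z) p) (extChartAt I p p) := by
  have hζ := contDiffAt_localMap hZ p (mem_extChartAt_target p)
  have hr := contDiffAt_rho_real hζ
  have hm' : ∀ᶠ y in 𝓝 (extChartAt I p p), rho (localMap I Z p) y ∈ D :=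
    Eventually.of_forall fun y => hm _
  refine (contDiffAt_pull_realForm (contDiffAt_of_contDiffOn hD.smooth₁ hr hm')
    (contDiffAt_of_contDiffOn hD.smooth₂ hr hm') hζ mulI).congr_of_eventuallyEq ?_
  filter_upwards [mem_target p] with y hy
  ext u v
  change realForm _ _ (localMap I Z p y) (Complex.I • differential I Z ((extChartAt I p).symm y)
    (mfderiv 𝓘(ℝ, E) I (extChartAt I p).symm y u)) (differential I Z ((extChartAt I p).symm y)
    (mfderiv 𝓘(ℝ, E) I (extChartAt I p).symm y v)) = _
  rw [← fderiv_localMap hZ p hy, ← fderiv_localMap hZ p hy]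
  rfl

/-- `J` is multiplication by `I` pulled back pointwise along the differential. Its smoothness comes
from that of the metric and of `quadricFormI`. -/
theorem exists_isKahler_inducedMetric (hZ : IsQuadricImmersion I Z)
    (hD : IsEinsteinPotential n C Λ D P w w₁) (hm : ∀ p, rho Z p ∈ D) :
    ∃ J, IsKahler (inducedMetric hZ hD hm) J := by
  have : CompleteSpace E := FiniteDimensional.complete ℝ E
  choose J hJ using exists_almostComplex hZ
  have hs : ∀ p, ContDiffAt ℝ ∞ (chartEndo J p) (extChartAt I p p) := fun p =>
    contDiffAt_chartEndo (contDiffAt_chartForm hZ hD.toIsPotential hm p)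
      (contDiffAt_chartForm_I hZ hD.toIsPotential hm p)
      (fun y hy => isInvertible_chartForm hZ hD hm p hy) fun q u v =>
        congrArg (fun a => realForm (w (rho Z q)) (w₁ (rho Z q)) (Z q) a (differential I Z q v))
          (hJ q u)
  refine ⟨J, contMDiff_endo hs, ?_, ?_, ?_⟩
  · intro p v
    refine sub_eq_zero.1 (hZ.injective p _ ?_)
    change differential I Z p _ = 0
    rw [map_sub, map_neg, hJ, hJ, I_smul_I_smul, sub_neg_eq_add, neg_add_cancel]
  · intro p u v
    rw [inducedMetric_inner, inducedMetric_inner, hJ, hJ, kform_I]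
  · intro p u v
    refine (quadricMetric_inducedMetric hZ hD hm p).2 (chartEndo J p) ?_
      ((hs p).differentiableAt (by simp)) u v
    filter_upwards [mem_target p] with y hy v
    rw [fderiv_localMap hZ p hy, fderiv_localMap hZ p hy]
    exact (congrArg (differential I Z _) (mfderiv_symm_mfderiv p hy _)).trans (hJ _ _)

end Immersion

/-! ### The embedding of the tangent bundle in Euclidean space -/

section Ambient

variable {n : ℕ}

instance (n : ℕ) : Fact (Module.finrank ℝ (V n) = n + 1 + 1) := ⟨finrank_euclideanSpace_fin⟩

theorem contMDiff_coe_S : ContMDiff (𝓡 (n + 1)) 𝓘(ℝ, V n) ∞ (fun x : S n => (x : V n)) :=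
  contMDiff_coe_sphere

theorem contMDiff_ambient : ContMDiff (TI n) 𝓘(ℝ, V n × V n) ∞ (ambient (n := n)) := by
  have h1 : ContMDiff (TI n) 𝓘(ℝ, V n) ∞ (fun p : TS n => (p.1 : V n)) :=
    contMDiff_coe_S.comp (contMDiff_proj (TangentSpace (𝓡 (n + 1))))
  have h2 : ContMDiff (TI n) 𝓘(ℝ, V n).tangent ∞
      (tangentMap (𝓡 (n + 1)) 𝓘(ℝ, V n) (fun x : S n => (x : V n))) :=
    contMDiff_coe_S.contMDiff_tangentMap (by simp)
  have h3 : ContMDiff (TI n) 𝓘(ℝ, V n) ∞ (fun p : TS n => (ambient p).2) :=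
    (contMDiff_snd_tangentBundle_modelSpace (V n) 𝓘(ℝ, V n)).comp h2
  exact h1.prodMk_space h3

/-- A smooth extension of the stereographic chart at `x₀` to an open subset of `ℝ^(n+2)`. -/
theorem exists_chart_extension (x₀ : S n) : ∃ R : V n → EuclideanSpace ℝ (Fin (n + 1)),
    ∀ x ∈ (chartAt (EuclideanSpace ℝ (Fin (n + 1))) x₀).source,
      (∀ᶠ y in 𝓝 (x : V n), ContDiffAt ℝ ∞ R y) ∧ extChartAt (𝓡 (n + 1)) x₀ x = R x := by
  let U : _ ≃ₗᵢ[ℝ] _ := (OrthonormalBasis.fromOrthogonalSpanSingleton (𝕜 := ℝ) (n + 1)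
    (ne_zero_of_mem_unit_sphere (-x₀))).repr
  refine ⟨fun x => U (stereoToFun ((-x₀ : S n) : V n) x), fun x hx => ⟨?_, ?_⟩⟩
  · have ho : IsOpen {x : V n | innerSL ℝ ((-x₀ : S n) : V n) x ≠ (1 : ℝ)} :=
      isOpen_ne_fun (innerSL ℝ ((-x₀ : S n) : V n)).continuous continuous_const
    have hx' : x ≠ -x₀ := by
      simpa [chartAt, ChartedSpace.chartAt] using hx
    have hm : (x : V n) ∈ {x : V n | innerSL ℝ ((-x₀ : S n) : V n) x ≠ (1 : ℝ)} := by
      intro h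
      apply hx'
      rw [sphere_ext_iff, real_inner_comm]
      exact h
    filter_upwards [ho.mem_nhds hm] with y hy
    exact U.contDiff.contDiffAt.comp y (contDiffOn_stereoToFun.contDiffAt (ho.mem_nhds hy))
  · rw [extChartAt, OpenPartialHomeomorph.extend]
    rfl

theorem extChartAt_TS (p q : TS n)
    (hq : q.1 ∈ (chartAt (EuclideanSpace ℝ (Fin (n + 1))) p.1).source) :
    extChartAt (TI n) p q = (extChartAt (𝓡 (n + 1)) p.1 q.1,
      mfderiv (𝓡 (n + 1)) 𝓘(ℝ, EuclideanSpace ℝ (Fin (n + 1))) (extChartAt (𝓡 (n + 1)) p.1) q.1 q.2)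
      := by
  have hb : q.1 ∈ (trivializationAt (EuclideanSpace ℝ (Fin (n + 1)))
    (TangentSpace (𝓡 (n + 1))) p.1).baseSet := by simpa using hq
  rw [← TangentBundle.continuousLinearMapAt_trivializationAt hq]
  have e := FiberBundle.extChartAt (𝕜 := ℝ) (F := EuclideanSpace ℝ (Fin (n + 1)))
    (E := (TangentSpace (𝓡 (n + 1)) : S n → Type _)) (IB := 𝓡 (n + 1)) p
  refine (congrArg (fun φ => φ q) e).trans (Prod.ext ?_ ?_)
  · exact congrArg (extChartAt (𝓡 (n + 1)) p.1) (Trivialization.coe_fst' _ hb)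
  · exact (Trivialization.continuousLinearMapAt_apply_of_mem (R := ℝ) _ hb q.2).symm

/-- In a neighbourhood of each point, the chart of the tangent bundle is a smooth function of the
embedding `ambient`. -/
theorem exists_extChartAt_eq (p : TS n) :
    ∃ L : V n × V n → EuclideanSpace ℝ (Fin (n + 1)) × EuclideanSpace ℝ (Fin (n + 1)),
      ContDiffAt ℝ ∞ L (ambient p) ∧
      ∀ q : TS n, q.1 ∈ (chartAt (EuclideanSpace ℝ (Fin (n + 1))) p.1).source →
        extChartAt (TI n) p q = L (ambient q) := by
  obtain ⟨R, hR⟩ := exists_chart_extension p.1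
  refine ⟨fun a => (R a.1, fderiv ℝ R a.1 a.2), ?_, fun q hq => ?_⟩
  · have h1 : ContDiffAt ℝ ∞ R (ambient p).1 := (hR p.1 (mem_chart_source _ _)).1.self_of_nhds
    exact (h1.comp (ambient p) contDiffAt_fst).prodMk
      (((contDiffAt_fderiv_infty h1).comp (ambient p) contDiffAt_fst).clm_apply contDiffAt_snd)
  · rw [extChartAt_TS p q hq]
    refine Prod.ext (hR _ hq).2 ?_
    have hev : extChartAt (𝓡 (n + 1)) p.1 =ᶠ[𝓝 q.1] R ∘ (fun x : S n => (x : V n)) := by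
      filter_upwards [(chartAt (EuclideanSpace ℝ (Fin (n + 1))) p.1).open_source.mem_nhds hq] with x hx
      exact (hR x hx).2
    have h1 : DifferentiableAt ℝ R (q.1 : V n) :=
      (hR _ hq).1.self_of_nhds.differentiableAt (by simp)
    have h2 := h1.hasFDerivAt.hasMFDerivAt.comp q.1
      (contMDiff_coe_S.mdifferentiableAt (by simp)).hasMFDerivAt
    have h3 := h2.congr_of_eventuallyEq hev
    simp only [h3.mfderiv]
    rfl

/-- The chart at `p` factors smoothly through `ambient`, and its differential is injective. -/
theorem mfderiv_ambient_injective (p : TS n) (ξ : TangentSpace (TI n) p)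
    (h : mfderiv (TI n) 𝓘(ℝ, V n × V n) ambient p ξ = 0) : ξ = 0 := by
  obtain ⟨L, hL, hLq⟩ := exists_extChartAt_eq p
  have h1 := (hL.differentiableAt (by simp)).hasFDerivAt.hasMFDerivAt.comp p
    (contMDiff_ambient.mdifferentiableAt (by simp)).hasMFDerivAt
  have hev : extChartAt (TI n) p =ᶠ[𝓝 p] L ∘ ambient := by
    have ho : ∀ᶠ q : TS n in 𝓝 p, q.1 ∈ (chartAt (EuclideanSpace ℝ (Fin (n + 1))) p.1).source :=
      (FiberBundle.continuous_proj (EuclideanSpace ℝ (Fin (n + 1)))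
        (TangentSpace (𝓡 (n + 1)))).continuousAt.eventually
        ((chartAt (EuclideanSpace ℝ (Fin (n + 1))) p.1).open_source.mem_nhds (mem_chart_source _ _))
    filter_upwards [ho] with q hq using hLq q hq
  have h3 := (h1.congr_of_eventuallyEq hev).mfderiv
  rw [mfderiv_extChartAt_self] at h3
  have h4 := congrArg (fun l => l ξ) h3
  refine h4.trans ?_
  exact (congrArg (fderiv ℝ L (ambient p)) h).trans (map_zero _)

theorem norm_ambient_fst (p : TS n) : ‖(ambient p).1‖ = 1 := norm_eq_of_mem_sphere p.1

theorem inner_ambient (p : TS n) : inner ℝ (ambient p).1 (ambient p).2 = 0 := by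
  have h : (ambient p).2 ∈ (ℝ ∙ ((p.1 : S n) : V n))ᗮ := by
    rw [← range_mvfderiv_subtypeVal (n := n + 1)]
    exact ⟨p.2, rfl⟩
  exact (Submodule.mem_orthogonal_singleton_iff_inner_right.1 h)

theorem exists_ambient_eq {x v : V n} (hx : ‖x‖ = 1) (hv : inner ℝ x v = 0) :
    ∃ p : TS n, ambient p = (x, v) := by
  let x' : S n := ⟨x, by simp [hx]⟩
  have h : v ∈ (ℝ ∙ (x' : V n))ᗮ := Submodule.mem_orthogonal_singleton_iff_inner_right.2 hv
  rw [← range_mvfderiv_subtypeVal (n := n + 1)] at h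
  obtain ⟨u, hu⟩ := h
  exact ⟨⟨x', u⟩, Prod.ext rfl hu⟩

/-- `ambient` is also a topological embedding, for the same reason: it determines base point and
chart coordinates continuously. -/
theorem tendsto_of_ambient {ι : Type*} {l : Filter ι} {s : ι → TS n} {p : TS n}
    (h : Tendsto (fun i => ambient (s i)) l (𝓝 (ambient p))) : Tendsto s l (𝓝 p) := by
  obtain ⟨L, hL, hLq⟩ := exists_extChartAt_eq p
  have h1 : Tendsto (fun i => (s i).1) l (𝓝 p.1) := by
    rw [tendsto_subtype_rng]
    exact (continuous_fst.tendsto _).comp h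
  have h2 : ∀ᶠ i in l, (s i).1 ∈ (chartAt (EuclideanSpace ℝ (Fin (n + 1))) p.1).source :=
    h1.eventually ((chartAt (EuclideanSpace ℝ (Fin (n + 1))) p.1).open_source.mem_nhds
      (mem_chart_source _ _))
  have h3 : Tendsto (fun i => extChartAt (TI n) p (s i)) l (𝓝 (extChartAt (TI n) p p)) := by
    rw [hLq p (mem_chart_source _ _)]
    refine (hL.continuousAt.tendsto.comp h).congr' ?_
    filter_upwards [h2] with i hi using (hLq _ hi).symm
  have h4 := (continuousAt_extChartAt_symm (I := TI n) p).tendsto.comp h3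
  rw [extChartAt_to_inv] at h4
  refine h4.congr' ?_
  filter_upwards [h2] with i hi
  refine (extChartAt (TI n) p).left_inv ?_
  rw [extChartAt_source, TangentBundle.mem_chart_source_iff]
  exact hi

end Ambient

/-! ### Real and imaginary parts in ℂ^(n+2) -/

section Complexification

variable {n : ℕ}

/-- The inclusion of `ℝ^(n+2)` in `ℂ^(n+2)`. -/
def emb : V n →L[ℝ] CV n :=
  LinearMap.toContinuousLinearMap
    { toFun := fun x => (WithLp.toLp 2 (fun i => (x i : ℂ)) : EuclideanSpace ℂ (Fin (n + 2)))
      map_add' := fun x y => by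
        refine PiLp.ext fun i => ?_
        exact Complex.ofReal_add _ _
      map_smul' := fun c x => by
        refine PiLp.ext fun i => ?_
        exact Complex.ofReal_mul _ _ }

theorem coord_emb (x : V n) (i : Fin (n + 2)) : coord i (emb x) = (x i : ℂ) := rfl

/-- The real part of a vector. -/
def rePart : CV n →L[ℝ] V n :=
  LinearMap.toContinuousLinearMap
    { toFun := fun z => WithLp.toLp 2 (fun i => (coord i z).re)
      map_add' := fun x y => by
        refine PiLp.ext fun i => ?_
        simp
      map_smul' := fun c x => by
        refine PiLp.ext fun i => ?_
        exact Complex.re_ofReal_mul c (coord i x) }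

/-- The imaginary part of a vector. -/
def imPart : CV n →L[ℝ] V n :=
  LinearMap.toContinuousLinearMap
    { toFun := fun z => WithLp.toLp 2 (fun i => (coord i z).im)
      map_add' := fun x y => by
        refine PiLp.ext fun i => ?_
        simp
      map_smul' := fun c x => by
        refine PiLp.ext fun i => ?_
        exact Complex.im_ofReal_mul c (coord i x) }

theorem rePart_emb (x y : V n) : rePart (emb x + Complex.I • emb y) = x := by
  refine PiLp.ext fun i => ?_
  change (coord i (emb x + Complex.I • emb y)).re = x i
  simp [coord_emb]

theorem imPart_emb (x y : V n) : imPart (emb x + Complex.I • emb y) = y := by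
  refine PiLp.ext fun i => ?_
  change (coord i (emb x + Complex.I • emb y)).im = y i
  simp [coord_emb]

theorem dot_emb (x y : V n) : dot (emb x) (emb y) = ((inner ℝ x y : ℝ) : ℂ) := by
  rw [dot_apply, PiLp.inner_apply]
  simp [coord_emb, mul_comm]

theorem inner_emb (x y : V n) : inner ℂ (emb x) (emb y) = ((inner ℝ x y : ℝ) : ℂ) := by
  rw [inner_eq_sum, PiLp.inner_apply]
  simp [coord_emb, mul_comm]

theorem dot_emb_self (x y : V n) : dot (emb x + Complex.I • emb y) (emb x + Complex.I • emb y) =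
    ((‖x‖ ^ 2 - ‖y‖ ^ 2 : ℝ) : ℂ) + 2 * Complex.I * ((inner ℝ x y : ℝ) : ℂ) := by
  simp only [map_add, map_smul, _root_.add_apply, _root_.smul_apply, smul_eq_mul, dot_emb,
    real_inner_self_eq_norm_sq, real_inner_comm x y]
  push_cast
  linear_combination ((‖y‖ : ℂ) ^ 2) * Complex.I_sq

theorem inner_emb_add (x y x' y' : V n) :
    inner ℂ (emb x + Complex.I • emb y) (emb x' + Complex.I • emb y') =
      ((inner ℝ x x' + inner ℝ y y' : ℝ) : ℂ) +
        Complex.I * ((inner ℝ x y' - inner ℝ y x' : ℝ) : ℂ) := by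
  simp only [inner_add_left, inner_add_right, inner_smul_left, inner_smul_right, inner_emb,
    Complex.conj_I]
  push_cast
  linear_combination -((inner ℝ y y' : ℝ) : ℂ) * Complex.I_sq

theorem norm_sq_emb_add (x y : V n) : ‖emb x + Complex.I • emb y‖ ^ 2 = ‖x‖ ^ 2 + ‖y‖ ^ 2 := by
  have h := inner_emb_add x y x y
  rw [inner_self_eq] at h
  have h2 := congrArg Complex.re h
  simp only [Complex.add_re, Complex.ofReal_re, Complex.mul_re, Complex.I_re, Complex.I_im,
    Complex.ofReal_im, real_inner_self_eq_norm_sq] at h2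
  linarith

end Complexification

/-- A profile: a Kähler-Einstein potential, with the change of variables `s = q * m q ^ 2` between
`q` and the square `s` of the arclength. -/
structure IsProfile (n : ℕ) (C Λ : ℝ) (D : Set ℝ) (P w w₁ m m₁ σ : ℝ → ℝ) : Prop extends
    IsEinsteinPotential n C Λ D P w w₁ where
  m_pos : ∀ q ∈ D, 0 < m q
  m_smooth : ContDiffOn ℝ ∞ m D
  m_deriv : ∀ q ∈ D, HasDerivWithinAt m (m₁ q) D q
  m_eq : ∀ q ∈ D, m q + 2 * q * m₁ q = √(csq (w q) (w₁ q) q / (1 + q))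
  σ_smooth : ContDiffOn ℝ ∞ σ (Ici 0)
  σ_mem : ∀ s, 0 ≤ s → σ s ∈ D
  σ_eq : ∀ s, 0 ≤ s → σ s * m (σ s) ^ 2 = s
  σ_inv : ∀ q ∈ D, σ (q * m q ^ 2) = q

/-! ### The tangent bundle as an open part of the quadric -/

section Zmap

variable {n : ℕ} {C Λ : ℝ} {D : Set ℝ} {P w w₁ m m₁ σ : ℝ → ℝ}

/-- The map to the quadric, on `ℝ^(n+2) × ℝ^(n+2)`. -/
def zmap (m σ : ℝ → ℝ) (a : V n × V n) : CV n :=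
  emb (√(1 + σ (‖a.2‖ ^ 2)) • a.1) + Complex.I • emb ((m (σ (‖a.2‖ ^ 2)))⁻¹ • a.2)

/-- The map to the quadric. -/
def Zmap (m σ : ℝ → ℝ) (p : TS n) : CV n := zmap m σ (ambient p)

/-- A left inverse of `zmap` on the image of `ambient`. -/
def wmap (m : ℝ → ℝ) (z : CV n) : V n × V n :=
  (‖rePart z‖⁻¹ • rePart z, m (‖imPart z‖ ^ 2) • imPart z)

theorem contDiffAt_zmap (h : IsProfile n C Λ D P w w₁ m m₁ σ) (a : V n × V n) :
    ContDiffAt ℝ ∞ (zmap m σ) a := by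
  have h1 : ContDiffAt ℝ ∞ (fun a : V n × V n => ‖a.2‖ ^ 2) a := contDiffAt_snd.norm_sq ℝ
  have h2 : ContDiffAt ℝ ∞ (fun a : V n × V n => σ (‖a.2‖ ^ 2)) a :=
    contDiffAt_of_contDiffOn h.σ_smooth h1 (Eventually.of_forall fun a => mem_Ici.2 (sq_nonneg _))
  have hm : ∀ a : V n × V n, σ (‖a.2‖ ^ 2) ∈ D := fun a => h.σ_mem _ (sq_nonneg _)
  have h3 : ContDiffAt ℝ ∞ (fun a : V n × V n => (m (σ (‖a.2‖ ^ 2)))⁻¹) a :=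
    (contDiffAt_of_contDiffOn h.m_smooth h2 (Eventually.of_forall hm)).inv (h.m_pos _ (hm a)).ne'
  have h0 : 0 ≤ σ (‖a.2‖ ^ 2) := h.subset (hm a)
  have h4 : ContDiffAt ℝ ∞ (fun a : V n × V n => √(1 + σ (‖a.2‖ ^ 2))) a :=
    (contDiffAt_const.add h2).sqrt (by positivity)
  exact (emb.contDiff.contDiffAt.comp a (h4.smul contDiffAt_fst)).add
    ((((Complex.I • ContinuousLinearMap.id ℂ (CV n)).restrictScalars ℝ).contDiff
      (n := ∞)).contDiffAt.comp a (emb.contDiff.contDiffAt.comp a (h3.smul contDiffAt_snd)))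

theorem norm_sq_eq (h : IsProfile n C Λ D P w w₁ m m₁ σ) (v : V n) :
    ‖(m (σ (‖v‖ ^ 2)))⁻¹ • v‖ ^ 2 = σ (‖v‖ ^ 2) := by
  have h1 := h.σ_eq (‖v‖ ^ 2) (sq_nonneg _)
  have h2 := h.m_pos _ (h.σ_mem (‖v‖ ^ 2) (sq_nonneg _))
  rw [norm_smul, mul_pow, norm_inv, Real.norm_eq_abs, inv_pow, sq_abs]
  nth_rw 2 [← h1]
  field_simp

theorem norm_sq_eq' (h : IsProfile n C Λ D P w w₁ m m₁ σ) (p : TS n) :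
    ‖√(1 + σ (‖(ambient p).2‖ ^ 2)) • (ambient p).1‖ ^ 2 = 1 + σ (‖(ambient p).2‖ ^ 2) := by
  have h0 : 0 ≤ σ (‖(ambient p).2‖ ^ 2) := h.subset (h.σ_mem _ (sq_nonneg _))
  rw [norm_smul, mul_pow, norm_ambient_fst, Real.norm_eq_abs, sq_abs, Real.sq_sqrt (by positivity)]
  ring

theorem rho_Zmap (h : IsProfile n C Λ D P w w₁ m m₁ σ) (p : TS n) :
    rho (Zmap m σ) p = σ (‖(ambient p).2‖ ^ 2) := by
  rw [rho, Zmap, zmap, norm_sq_emb_add, norm_sq_eq h, norm_sq_eq' h]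
  ring

theorem rho_Zmap_mem (h : IsProfile n C Λ D P w w₁ m m₁ σ) (p : TS n) :
    rho (Zmap m σ) p ∈ D := by
  rw [rho_Zmap h]
  exact h.σ_mem _ (sq_nonneg _)

theorem wmap_Zmap (h : IsProfile n C Λ D P w w₁ m m₁ σ) (p : TS n) :
    wmap m (Zmap m σ p) = ambient p := by
  have h0 : 0 ≤ σ (‖(ambient p).2‖ ^ 2) := h.subset (h.σ_mem _ (sq_nonneg _))
  have h1 := h.m_pos _ (h.σ_mem (‖(ambient p).2‖ ^ 2) (sq_nonneg _))
  have h2 : 0 < √(1 + σ (‖(ambient p).2‖ ^ 2)) := Real.sqrt_pos.2 (by positivity)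
  refine Prod.ext ?_ ?_
  · simp only [wmap, Zmap, zmap, rePart_emb]
    rw [norm_smul, norm_ambient_fst, Real.norm_eq_abs, abs_of_pos h2, mul_one, smul_smul,
      inv_mul_cancel₀ h2.ne', one_smul]
  · simp only [wmap, Zmap, zmap, imPart_emb]
    rw [norm_sq_eq h, smul_smul, mul_inv_cancel₀ h1.ne', one_smul]

theorem contDiffAt_wmap (h : IsProfile n C Λ D P w w₁ m m₁ σ) (p : TS n) :
    ContDiffAt ℝ ∞ (wmap m) (Zmap m σ p) := by
  have h0 : 0 ≤ σ (‖(ambient p).2‖ ^ 2) := h.subset (h.σ_mem _ (sq_nonneg _))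
  have hr : ContDiffAt ℝ ∞ (rePart : CV n → V n) (Zmap m σ p) := rePart.contDiff.contDiffAt
  have hi : ContDiffAt ℝ ∞ (imPart : CV n → V n) (Zmap m σ p) := imPart.contDiff.contDiffAt
  have hr0 : rePart (Zmap m σ p) ≠ 0 := by
    intro h'
    have := norm_sq_eq' h p
    simp only [Zmap, zmap, rePart_emb] at h'
    rw [h', norm_zero] at this
    linarith
  have h1 : ContDiffAt ℝ ∞ (fun z : CV n => ‖imPart z‖ ^ 2) (Zmap m σ p) := hi.norm_sq ℝ
  have h2 : ∀ᶠ z in 𝓝 (Zmap m σ p), ‖imPart z‖ ^ 2 ∈ D := by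
    refine h.toIsPotential.eventually_mem h1.continuousAt ?_
      (Eventually.of_forall fun z => sq_nonneg _)
    simp only [Zmap, zmap, imPart_emb, norm_sq_eq h]
    exact h.σ_mem _ (sq_nonneg _)
  exact (((hr.norm ℝ hr0).inv (norm_ne_zero_iff.2 hr0)).smul hr).prodMk
    ((contDiffAt_of_contDiffOn h.m_smooth h1 h2).smul hi)

theorem contMDiff_Zmap (h : IsProfile n C Λ D P w w₁ m m₁ σ) :
    ContMDiff (TI n) 𝓘(ℝ, CV n) ∞ (Zmap (n := n) m σ) := fun p =>
  (contDiffAt_zmap h (ambient p)).contMDiffAt.comp p contMDiff_ambient.contMDiffAt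

/-- The point is immersivity at the zero section too: the smooth map `wmap` recovers `ambient`,
which is an immersion. -/
theorem isQuadricImmersion_Zmap (h : IsProfile n C Λ D P w w₁ m m₁ σ) :
    IsQuadricImmersion (TI n) (Zmap (n := n) m σ) where
  smooth := contMDiff_Zmap h
  dot_self p := by
    rw [Zmap, zmap, dot_emb_self, norm_sq_eq h, norm_sq_eq' h, inner_smul_left, inner_smul_right,
      inner_ambient]
    simp
  injective p ξ hξ := by
    refine mfderiv_ambient_injective p ξ ?_
    have h1 := ((contDiffAt_wmap h p).differentiableAt (by simp)).hasFDerivAt.hasMFDerivAt.comp p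
      ((contMDiff_Zmap h).mdifferentiableAt (x := p) (by simp)).hasMFDerivAt
    have e : wmap m ∘ Zmap m σ = ambient (n := n) := funext fun p => wmap_Zmap h p
    rw [e] at h1
    rw [h1.mfderiv]
    exact (congrArg (fderiv ℝ (wmap m) (Zmap m σ p)) hξ).trans (map_zero _)
  finrank := by
    simp [Module.finrank_prod]
    ring

theorem differential_Zmap (h : IsProfile n C Λ D P w w₁ m m₁ σ) (p : TS n)
    (ξ : TangentSpace (TI n) p) : differential (TI n) (Zmap m σ) p ξ =
      fderiv ℝ (zmap m σ) (ambient p) (mfderiv (TI n) 𝓘(ℝ, V n × V n) ambient p ξ) := by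
  have h1 := ((contDiffAt_zmap h (ambient p)).differentiableAt (by simp)).hasFDerivAt.hasMFDerivAt.comp p
      ((contMDiff_ambient (n := n)).mdifferentiableAt (x := p) (by simp)).hasMFDerivAt
  exact congrArg (fun l => l ξ) h1.mfderiv

end Zmap

/-! ### The induced metric and its radial direction -/

section Metric

variable {n : ℕ} {C Λ : ℝ} {D : Set ℝ} {P w w₁ m m₁ σ : ℝ → ℝ}

theorem hasFDerivAt_norm_sq_snd (a : V n × V n) :
    HasFDerivAt (fun a : V n × V n => ‖a.2‖ ^ 2)
      ((2 : ℝ) • (innerSL ℝ a.2 ∘L ContinuousLinearMap.snd ℝ (V n) (V n))) a := by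
  refine (hasFDerivAt_snd (𝕜 := ℝ) (p := a)).norm_sq.congr_fderiv ?_
  ext <;> simp

/-- Derivative of the relation σ m(σ)² = s. By `m_eq` the factor m + 2q m₁, which is dt/d√q for t =
√q m, equals the square root. -/
theorem IsProfile.deriv_mul (h : IsProfile n C Λ D P w w₁ m m₁ σ) {s σ' : ℝ} (hs : 0 ≤ s)
    (hd : HasDerivWithinAt σ σ' (Ici 0) s) :
    σ' * (m (σ s) * √(csq (w (σ s)) (w₁ (σ s)) (σ s) / (1 + σ s))) = 1 := by
  have hm : MapsTo σ (Ici 0) D := fun s hs => h.σ_mem s hs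
  have h1 := hd.mul ((HasDerivWithinAt.scomp s (h.m_deriv _ (h.σ_mem s hs)) hd hm).pow 2)
  have h2 : HasDerivWithinAt (fun s : ℝ => s) 1 (Ici 0) s := hasDerivWithinAt_id _ _
  have h3 := (h1.congr (fun x hx => (h.σ_eq x hx).symm) (h.σ_eq s hs).symm)
  have h4 := (uniqueDiffOn_Ici (0 : ℝ) s hs).eq_deriv _ h3 h2
  rw [← h.m_eq _ (h.σ_mem s hs), ← h4]
  simp
  ring

/-- κ is the variation of q = σ(|v|²) in the direction `d`. It is characterized without reference to
the derivative of σ, which is convenient for comparing two points. -/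
theorem fderiv_zmap (h : IsProfile n C Λ D P w w₁ m m₁ σ) (a d : V n × V n) :
    ∃ κ : ℝ, κ * (m (σ (‖a.2‖ ^ 2)) * √(csq (w (σ (‖a.2‖ ^ 2))) (w₁ (σ (‖a.2‖ ^ 2)))
        (σ (‖a.2‖ ^ 2)) / (1 + σ (‖a.2‖ ^ 2)))) = 2 * inner ℝ a.2 d.2 ∧
      fderiv ℝ (zmap m σ) a d =
        emb ((κ / (2 * √(1 + σ (‖a.2‖ ^ 2)))) • a.1 + √(1 + σ (‖a.2‖ ^ 2)) • d.1) +
        Complex.I • emb ((-(m₁ (σ (‖a.2‖ ^ 2)) * κ / m (σ (‖a.2‖ ^ 2)) ^ 2)) • a.2 +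
          (m (σ (‖a.2‖ ^ 2)))⁻¹ • d.2) := by
  set s := ‖a.2‖ ^ 2 with hs
  have hs0 : 0 ≤ s := sq_nonneg _
  have hσ : HasDerivWithinAt σ (derivWithin σ (Ici 0) s) (Ici 0) s :=
    ((h.σ_smooth s hs0).differentiableWithinAt (by simp)).hasDerivWithinAt
  set σ' := derivWithin σ (Ici 0) s
  have hq0 : 0 ≤ σ s := h.subset (h.σ_mem s hs0)
  have hmp := h.m_pos _ (h.σ_mem s hs0)
  refine ⟨σ' * (2 * inner ℝ a.2 d.2), ?_, ?_⟩
  · have := h.deriv_mul hs0 hσ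
    linear_combination (2 * inner ℝ a.2 d.2) * this
  have h1 := hasFDerivAt_norm_sq_snd a
  have h2 := hσ.comp_hasFDerivAt_of_eq a h1 (Eventually.of_forall fun a => mem_Ici.2 (sq_nonneg _)) hs
  have h3 := (h.m_deriv _ (h.σ_mem s hs0)).comp_hasFDerivAt_of_eq a h2
    (Eventually.of_forall fun a => h.σ_mem _ (sq_nonneg _)) rfl
  have h4 := (hasDerivAt_inv hmp.ne').comp_hasFDerivAt_of_eq a h3 rfl
  have h5 := (h2.const_add 1).sqrt (by simp only [Function.comp]; positivity)
  have h6 := (emb.hasFDerivAt.comp a (h5.smul hasFDerivAt_fst)).add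
    (((Complex.I • ContinuousLinearMap.id ℂ (CV n)).restrictScalars ℝ).hasFDerivAt.comp a
      (emb.hasFDerivAt.comp a (h4.smul hasFDerivAt_snd)))
  have h7 : fderiv ℝ (zmap m σ) a = _ := h6.fderiv
  rw [h7]
  simp [← hs]
  rw [show (√(1 + σ s))⁻¹ * 2⁻¹ * (σ' * (2 * inner ℝ a.2 d.2)) =
      σ' * (2 * inner ℝ a.2 d.2) / (2 * √(1 + σ s)) by field_simp,
    show (m (σ s) ^ 2)⁻¹ * (m₁ (σ s) * (σ' * (2 * inner ℝ a.2 d.2))) =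
      m₁ (σ s) * (σ' * (2 * inner ℝ a.2 d.2)) / m (σ s) ^ 2 by field_simp,
    smul_comm (m (σ s))⁻¹ Complex.I]
  abel

theorem inner_mfderiv_ambient (p : TS n) (ξ : TangentSpace (TI n) p) (d : V n × V n)
    (hd : mfderiv (TI n) 𝓘(ℝ, V n × V n) ambient p ξ = d) : inner ℝ (ambient p).1 d.1 = 0 := by
  have h1 : HasFDerivAt (fun a : V n × V n => ‖a.1‖ ^ 2)
      ((2 : ℝ) • (innerSL ℝ (ambient p).1 ∘L ContinuousLinearMap.fst ℝ (V n) (V n))) (ambient p) := by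
    refine (hasFDerivAt_fst (𝕜 := ℝ) (p := ambient p)).norm_sq.congr_fderiv ?_
    ext <;> simp
  have h2 := h1.hasMFDerivAt.comp p
    ((contMDiff_ambient (n := n)).mdifferentiableAt (x := p) (by simp)).hasMFDerivAt
  have h3 : HasMFDerivAt (TI n) 𝓘(ℝ, ℝ) ((fun a : V n × V n => ‖a.1‖ ^ 2) ∘ ambient) p
      (0 : TangentSpace (TI n) p →L[ℝ] ℝ) := by
    have e : ((fun a : V n × V n => ‖a.1‖ ^ 2) ∘ ambient (n := n)) = fun _ => 1 :=
      funext fun q => by simp [norm_ambient_fst]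
    rw [e]
    exact hasMFDerivAt_const _ _
  have h4 := congrArg (fun l : TangentSpace (TI n) p →L[ℝ] ℝ => l ξ) (hasMFDerivAt_unique h2 h3)
  have h5 : (2 : ℝ) * inner ℝ (ambient p).1
      (show V n × V n from mfderiv (TI n) 𝓘(ℝ, V n × V n) ambient p ξ).1 = 0 := h4
  rw [← hd]
  simpa using h5

/-- The metric of a profile. -/
def profileMetric (h : IsProfile n C Λ D P w w₁ m m₁ σ) : SmoothMetric (TI n) (TS n) :=
  inducedMetric (isQuadricImmersion_Zmap h) h.toIsEinsteinPotential (rho_Zmap_mem h)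

/-- The quantities which enter the metric. -/
theorem profileMetric_inner_self (h : IsProfile n C Λ D P w w₁ m m₁ σ) (p : TS n)
    (ξ : TangentSpace (TI n) p) : (profileMetric h).inner p ξ ξ =
      (kform (w (rho (Zmap m σ) p)) (w₁ (rho (Zmap m σ) p)) (Zmap m σ p)
        (differential (TI n) (Zmap m σ) p ξ) (differential (TI n) (Zmap m σ) p ξ)).re :=
  inducedMetric_inner _ _ _ _ _ _

/-- The inequality dt² ≤ g for t = |v|, in a form that also makes sense at the zero section. As dq =
Re⟨z, dz⟩, `kform_lower` gives c² dq² ≤ 4q(1 + q) g, and (dt/dq)² = c²/(4q(1 + q)). -/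
theorem inner_sq_le_kform (h : IsProfile n C Λ D P w w₁ m m₁ σ) (a d : V n × V n)
    (ha : ‖a.1‖ = 1) (hx : inner ℝ a.1 d.1 = 0) (hn : ‖zmap m σ a‖ ^ 2 = 1 + 2 * σ (‖a.2‖ ^ 2))
    (hz : dot (zmap m σ a) (zmap m σ a) = 1)
    (hzd : dot (zmap m σ a) (fderiv ℝ (zmap m σ) a d) = 0) :
    inner ℝ a.2 d.2 ^ 2 ≤ ‖a.2‖ ^ 2 * (kform (w (σ (‖a.2‖ ^ 2))) (w₁ (σ (‖a.2‖ ^ 2))) (zmap m σ a)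
      (fderiv ℝ (zmap m σ) a d) (fderiv ℝ (zmap m σ) a d)).re := by
  obtain ⟨κ, hκ, hdz⟩ := fderiv_zmap h a d
  have hs := h.σ_eq (‖a.2‖ ^ 2) (sq_nonneg _)
  have hD := h.σ_mem (‖a.2‖ ^ 2) (sq_nonneg _)
  have hr := h.m_eq _ hD
  have hcs := h.csq_pos _ hD
  have hq1 : 0 ≤ σ (‖a.2‖ ^ 2) := h.subset hD
  have hmp := h.m_pos _ hD
  have hlow := kform_lower (w₁ := w₁ (σ (‖a.2‖ ^ 2))) (h.pos _ hD) hz hzd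
  rw [hn, show (1 + 2 * σ (‖a.2‖ ^ 2) - 1) / 2 = σ (‖a.2‖ ^ 2) by ring] at hlow
  obtain ⟨X, hX⟩ : ∃ X : CV n, fderiv ℝ (zmap m σ) a d = X := ⟨_, rfl⟩
  have e : ‖zmap m σ a‖ ^ 4 - 1 = 4 * σ (‖a.2‖ ^ 2) * (1 + σ (‖a.2‖ ^ 2)) := by
    rw [show ‖zmap m σ a‖ ^ 4 = (‖zmap m σ a‖ ^ 2) ^ 2 by ring, hn]; ring
  rw [e, hX] at hlow
  rw [hX] at hdz ⊢
  set g := (kform (w (σ (‖a.2‖ ^ 2))) (w₁ (σ (‖a.2‖ ^ 2))) (zmap m σ a) X X).re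
  obtain ⟨z, hzz⟩ : ∃ z : CV n, zmap m σ a = z := ⟨_, rfl⟩
  -- Since ρ = (|z|² - 1)/2, the real part of ⟨z, dz⟩ is the variation of q.
  have hre : (inner ℂ z X).re = κ := by
    rw [hdz, ← hzz, zmap, inner_emb_add]
    generalize σ (‖a.2‖ ^ 2) = q at *
    have hsq : √(1 + q) ≠ 0 := by positivity
    simp only [Complex.add_re, Complex.ofReal_re, Complex.mul_re, Complex.I_re, Complex.I_im,
      Complex.ofReal_im, inner_add_right, inner_smul_left, inner_smul_right, hx,
      real_inner_self_eq_norm_sq, ha, ← hs]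
    rw [← hr] at hκ
    simp
    field_simp
    linear_combination -hκ
  rw [hzz] at hlow
  clear_value g
  clear hzz hn hz hzd hX hdz e ha hx
  rw [← hs]
  generalize σ (‖a.2‖ ^ 2) = q at *
  set c := csq (w q) (w₁ q) q
  have h1 : c * κ ^ 2 ≤ 4 * q * (1 + q) * g := by
    have h2 : κ ^ 2 ≤ ‖inner ℂ z X‖ ^ 2 := by
      rw [← sq_abs, ← hre]
      exact pow_le_pow_left₀ (abs_nonneg _) (Complex.abs_re_le_norm _) 2
    exact (mul_le_mul_of_nonneg_left h2 hcs.le).trans hlow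
  have h4 : (κ * (m q * √(c / (1 + q)))) ^ 2 = m q ^ 2 * (c * κ ^ 2) / (1 + q) := by
    rw [mul_pow, mul_pow, Real.sq_sqrt (by positivity)]
    field_simp
  rw [hκ] at h4
  have h5 : m q ^ 2 * (c * κ ^ 2) / (1 + q) ≤ m q ^ 2 * (4 * q * g) := by
    rw [div_le_iff₀ (by positivity)]
    nlinarith [mul_le_mul_of_nonneg_left h1 (sq_nonneg (m q))]
  nlinarith


theorem inner_sq_le_profileMetric (h : IsProfile n C Λ D P w w₁ m m₁ σ) (p : TS n)
    (ξ : TangentSpace (TI n) p) (d : V n × V n)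
    (hd : mfderiv (TI n) 𝓘(ℝ, V n × V n) ambient p ξ = d) :
    inner ℝ (ambient p).2 d.2 ^ 2 ≤ ‖(ambient p).2‖ ^ 2 * (profileMetric h).inner p ξ ξ := by
  have hZ := isQuadricImmersion_Zmap (n := n) h
  have hrho := rho_Zmap h p
  have hd0 := dot_mfderiv hZ p ξ
  rw [profileMetric_inner_self, hrho]
  rw [differential_Zmap h, hd] at hd0 ⊢
  refine inner_sq_le_kform h (ambient p) d (norm_ambient_fst p) (inner_mfderiv_ambient p ξ d hd) ?_
    (hZ.dot_self p) hd0
  rw [← hrho, rho]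
  change ‖zmap m σ (ambient p)‖ ^ 2 = 1 + 2 * ((‖zmap m σ (ambient p)‖ ^ 2 - 1) / 2)
  ring

end Metric

/-! ### The metric on the principal orbits -/

section Orbits

variable {n : ℕ}

theorem X_apply (i j k l : Fin (n + 2)) :
    X i j k l = (if i = k ∧ j = l then 1 else 0) - (if j = k ∧ i = l then 1 else 0) := by
  simp [X, Matrix.single_apply]

theorem p₁_apply (x : Fin n → ℝ) (k l : Fin (n + 2)) :
    p₁ x k l = ∑ i, x i * X i.castSucc.castSucc (i₁ n) k l := by
  simp [p₁, Matrix.sum_apply]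

theorem p₂_apply (x : Fin n → ℝ) (k l : Fin (n + 2)) :
    p₂ x k l = ∑ i, x i * X i.castSucc.castSucc (i₂ n) k l := by
  simp [p₂, Matrix.sum_apply]

theorem B_X (i j : Fin (n + 2)) (Z : Matrix (Fin (n + 2)) (Fin (n + 2)) ℝ) :
    B (X i j) Z = (Z i j - Z j i) / 2 := by
  rw [B, X, Matrix.sub_mul, Matrix.trace_sub, Matrix.trace_single_mul, Matrix.trace_single_mul]
  simp
  ring

theorem B_sum {ι : Type*} (s : Finset ι) (c : ι → ℝ)
    (Y : ι → Matrix (Fin (n + 2)) (Fin (n + 2)) ℝ) (Z : Matrix (Fin (n + 2)) (Fin (n + 2)) ℝ) :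
    B (∑ i ∈ s, c i • Y i) Z = ∑ i ∈ s, c i * B (Y i) Z := by
  simp only [B, Matrix.sum_mul, Matrix.trace_sum, Matrix.smul_mul, Matrix.trace_smul,
    Finset.mul_sum, smul_eq_mul]
  exact Finset.sum_congr rfl fun i _ => by ring

theorem ne_i₁ (i : Fin n) : i.castSucc.castSucc ≠ i₁ n := by
  simp [i₁, Fin.ext_iff, i.2.ne]

theorem ne_i₂ (i : Fin n) : i.castSucc.castSucc ≠ i₂ n := by
  have := i.2
  simp [i₂, Fin.ext_iff]
  omega

theorem i₁_ne_i₂ : i₁ n ≠ i₂ n := by simp [i₁, i₂, Fin.ext_iff]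

theorem B_p₁ (x : Fin n → ℝ) : B (p₁ x) (p₁ x) = ∑ i, x i ^ 2 := by
  conv_lhs => arg 1; rw [p₁]
  rw [B_sum]
  refine Finset.sum_congr rfl fun i _ => ?_
  rw [B_X, p₁_apply, p₁_apply]
  simp [X_apply, (ne_i₁ _).symm]
  ring

theorem B_p₂ (x : Fin n → ℝ) : B (p₂ x) (p₂ x) = ∑ i, x i ^ 2 := by
  conv_lhs => arg 1; rw [p₂]
  rw [B_sum]
  refine Finset.sum_congr rfl fun i _ => ?_
  rw [B_X, p₂_apply, p₂_apply]
  simp [X_apply, (ne_i₂ _).symm]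
  ring

theorem B_p₃ (z : ℝ) : B (n := n) (p₃ z) (p₃ z) = z ^ 2 := by
  have h : B (n := n) (p₃ z) (p₃ z) = z * B (X (i₁ n) (i₂ n)) (p₃ z) := by
    simp [p₃, B]
    ring
  rw [h, B_X]
  simp [p₃, X_apply, i₁_ne_i₂.symm]
  ring

/-- The vector with coordinates `(x, s, t)`. -/
def vec (x : Fin n → ℝ) (s t : ℝ) : V n := WithLp.toLp 2 (Fin.snoc (Fin.snoc x s) t)

theorem inner_vec (x x' : Fin n → ℝ) (s s' t t' : ℝ) :
    inner ℝ (vec x s t) (vec x' s' t') = ∑ i, x i * x' i + s * s' + t * t' := by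
  rw [PiLp.inner_apply, Fin.sum_univ_castSucc, Fin.sum_univ_castSucc]
  simp [vec, mul_comm]

theorem vec_eq (x : Fin n → ℝ) (s t : ℝ) (u : V n) (h : ∀ i : Fin n, u i.castSucc.castSucc = x i)
    (hs : u (i₁ n) = s) (ht : u (i₂ n) = t) : u = vec x s t := by
  refine PiLp.ext fun k => ?_
  refine Fin.lastCases ?_ (fun k => Fin.lastCases ?_ (fun k => ?_) k) k
  · simpa [vec] using ht
  · simpa [vec] using hs
  · simpa [vec] using h k

theorem act_apply (A : Matrix (Fin (n + 2)) (Fin (n + 2)) ℝ) (u : V n) (i : Fin (n + 2)) :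
    act A u i = ∑ j, A i j * u j := rfl

theorem act_single (A : Matrix (Fin (n + 2)) (Fin (n + 2)) ℝ) (i j : Fin (n + 2)) :
    act A (EuclideanSpace.single j 1) i = A i j := by
  simp [act_apply]

theorem act_mul (A A' : Matrix (Fin (n + 2)) (Fin (n + 2)) ℝ) (u : V n) :
    act (A * A') u = act A (act A' u) := by
  simp [act, Matrix.mulVec_mulVec]

theorem inner_act (A : SO n) (u v : V n) : inner ℝ (act A.1 u) (act A.1 v) = inner ℝ u v := by
  have h : A.1ᵀ * A.1 = 1 :=
    (Matrix.mem_orthogonalGroup_iff' _ _).1 (Matrix.mem_specialOrthogonalGroup_iff.1 A.2).1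
  have e : ∀ u v : V n, inner ℝ u v = u.ofLp ⬝ᵥ v.ofLp := fun u v => by
    rw [PiLp.inner_apply]
    simp [dotProduct, mul_comm]
  rw [e, e]
  simp only [act]
  rw [Matrix.dotProduct_mulVec, Matrix.vecMul_mulVec, h, Matrix.vecMul_one]

theorem base_eq (A : Matrix (Fin (n + 2)) (Fin (n + 2)) ℝ) : base A = act A (vec 0 0 1) := by
  rw [base]
  congr 1
  refine vec_eq _ _ _ _ (fun i => ?_) ?_ ?_ <;> simp [ne_i₂, i₁_ne_i₂]

theorem dir_eq (A : Matrix (Fin (n + 2)) (Fin (n + 2)) ℝ) : dir A = act A (vec 0 1 0) := by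
  rw [dir]
  congr 1
  refine vec_eq _ _ _ _ (fun i => ?_) ?_ ?_ <;> simp [ne_i₁, i₁_ne_i₂.symm]

theorem base_mul (A : Matrix (Fin (n + 2)) (Fin (n + 2)) ℝ) (x y : Fin n → ℝ) (z : ℝ) :
    base (A * (p₁ x + p₂ y + p₃ z)) = act A (vec y z 0) := by
  rw [base, act_mul]
  congr 1
  refine vec_eq _ _ _ _ (fun i => ?_) ?_ ?_ <;> rw [act_single] <;>
    simp [p₁_apply, p₂_apply, p₃, X_apply, ne_i₁, ne_i₂, i₁_ne_i₂, i₁_ne_i₂.symm, (ne_i₁ _).symm,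
      (ne_i₂ _).symm]

theorem dir_mul (A : Matrix (Fin (n + 2)) (Fin (n + 2)) ℝ) (x y : Fin n → ℝ) (z : ℝ) :
    dir (A * (p₁ x + p₂ y + p₃ z)) = act A (vec x 0 (-z)) := by
  rw [dir, act_mul]
  congr 1
  refine vec_eq _ _ _ _ (fun i => ?_) ?_ ?_ <;> rw [act_single] <;>
    simp [p₁_apply, p₂_apply, p₃, X_apply, ne_i₁, ne_i₂, i₁_ne_i₂, i₁_ne_i₂.symm, (ne_i₁ _).symm,
      (ne_i₂ _).symm]

variable {C Λ : ℝ} {D : Set ℝ} {P w w₁ m m₁ σ : ℝ → ℝ}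

/-- Here f₁ = A e_{n+1}, f₂ = A e_{n+2}, and (dx, dv) is the velocity with radial part τ and
components x, y, z in 𝔭, where xx = |x|² and yy = |y|². The hypotheses list the inner products that
enter the hermitian form. With r = dt/d√q, the relation r²(1 + q) = c² normalizes the radial
coefficient to one. -/
theorem kform_orbit (h : IsProfile n C Λ D P w w₁ m m₁ σ) {q : ℝ} (hq : q ∈ D) (hq0 : 0 < q)
    {f₁ f₂ dx dv : V n} {τ t xx yy z : ℝ} (ht : t = √q * m q)
    (h11 : inner ℝ f₁ f₁ = 1) (h22 : inner ℝ f₂ f₂ = 1) (h12 : inner ℝ f₁ f₂ = 0)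
    (h2x : inner ℝ f₂ dx = 0) (h1x : inner ℝ f₁ dx = z) (hxx : inner ℝ dx dx = yy + z ^ 2)
    (h1v : inner ℝ f₁ dv = τ) (h2v : inner ℝ f₂ dv = -t * z)
    (hvv : inner ℝ dv dv = τ ^ 2 + t ^ 2 * (xx + z ^ 2)) :
    (kform (w (σ (‖t • f₁‖ ^ 2))) (w₁ (σ (‖t • f₁‖ ^ 2))) (zmap m σ (f₂, t • f₁))
      (fderiv ℝ (zmap m σ) (f₂, t • f₁) (dx, dv)) (fderiv ℝ (zmap m σ) (f₂, t • f₁) (dx, dv))).re =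
      τ ^ 2 + q * w q * xx + (1 + q) * w q * yy + csq (w q) (w₁ q) q * z ^ 2 := by
  obtain ⟨κ, hκ, hdz⟩ := fderiv_zmap h (f₂, t • f₁) (dx, dv)
  have hn : ‖t • f₁‖ ^ 2 = q * m q ^ 2 := by
    rw [← real_inner_self_eq_norm_sq, inner_smul_left, inner_smul_right, h11, ht]
    simp only [conj_trivial]
    linear_combination (m q ^ 2) * Real.mul_self_sqrt hq0.le
  have hmp := h.m_pos _ hq
  have hcs := h.csq_pos _ hq
  have hr := h.m_eq _ hq
  simp only [hn, h.σ_inv q hq, inner_smul_left, conj_trivial, h1v] at hκ hdz ⊢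
  have hz : zmap m σ (f₂, t • f₁) = emb (√(1 + q) • f₂) + Complex.I • emb ((m q)⁻¹ • t • f₁) := by
    simp only [zmap, hn, h.σ_inv q hq]
  set r := √(csq (w q) (w₁ q) q / (1 + q)) with hrdef
  have hr2 : r ^ 2 * (1 + q) = csq (w q) (w₁ q) q := by
    rw [hrdef, Real.sq_sqrt (by positivity)]
    field_simp
  have hr0 : r ≠ 0 := by positivity
  have hs0 : √(1 + q) ≠ 0 := by positivity
  have hs2 : √(1 + q) ^ 2 = 1 + q := Real.sq_sqrt (by positivity)
  have ht2 : t ^ 2 = q * m q ^ 2 := by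
    rw [ht, mul_pow, Real.sq_sqrt hq0.le]
  have hκr : κ * r = 2 * √q * τ := by
    have : κ * (m q * r) = (2 * √q * τ) * m q := by rw [hκ, ht]; ring
    apply mul_right_cancel₀ hmp.ne'
    linear_combination this
  have hsq : √q ^ 2 = q := Real.sq_sqrt hq0.le
  have hX : ‖emb ((κ / (2 * √(1 + q))) • f₂ + √(1 + q) • dx) +
      Complex.I • emb ((-(m₁ q * κ / m q ^ 2)) • t • f₁ + (m q)⁻¹ • dv)‖ ^ 2 =
      κ ^ 2 / (4 * (1 + q)) + (1 + q) * (yy + z ^ 2) + τ ^ 2 / r ^ 2 + q * (xx + z ^ 2) := by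
    rw [norm_sq_emb_add, ← real_inner_self_eq_norm_sq, ← real_inner_self_eq_norm_sq]
    simp only [inner_add_left, inner_add_right, inner_smul_left, inner_smul_right, conj_trivial,
      h11, h22, h2x, hxx, h1v, hvv, real_inner_comm f₂ dx, real_inner_comm f₁ dv]
    -- The radial component of the velocity of v/m, a vector of length √q, is d√q = τ/r.
    have hβ : -(m₁ q * κ / m q ^ 2) * t + (m q)⁻¹ * τ = τ / r := by
      rw [eq_div_iff hr0]
      field_simp
      rw [ht]
      linear_combination (-m₁ q * √q * m q) * hκr - 2 * m₁ q * m q * τ * hsq - τ * m q * hr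
    have hγ : (m q)⁻¹ * (m q)⁻¹ * t ^ 2 = q := by
      rw [ht2]
      field_simp
    have hA : κ / (2 * √(1 + q)) * (κ / (2 * √(1 + q))) = κ ^ 2 / (4 * (1 + q)) := by
      have : κ / (2 * √(1 + q)) * (κ / (2 * √(1 + q))) = κ ^ 2 / (4 * √(1 + q) ^ 2) := by
        field_simp
        ring
      rw [this, hs2]
    have hβ2 : τ ^ 2 / r ^ 2 = (τ / r) ^ 2 := by rw [div_pow]
    rw [hβ2, ← hβ, ← hA]
    linear_combination (yy + z ^ 2) * hs2 + (xx + z ^ 2) * hγ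
  -- The real part is dq, the imaginary part comes from the rotation in the plane of f₁ and f₂. The
  -- latter brings the coefficient of z² to c².
  have hI : inner ℂ (emb (√(1 + q) • f₂) + Complex.I • emb ((m q)⁻¹ • t • f₁))
      (emb ((κ / (2 * √(1 + q))) • f₂ + √(1 + q) • dx) +
      Complex.I • emb ((-(m₁ q * κ / m q ^ 2)) • t • f₁ + (m q)⁻¹ • dv)) =
      (κ : ℂ) + Complex.I * ((-2 * √q * √(1 + q) * z : ℝ) : ℂ) := by
    rw [inner_emb_add]
    have h21 : inner ℝ f₂ f₁ = 0 := by rw [real_inner_comm, h12]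
    simp only [inner_add_right, inner_smul_left, inner_smul_right, conj_trivial,
      h11, h22, h12, h21, h2x, h1x, h1v, h2v]
    have h1 : √(1 + q) * (κ / (2 * √(1 + q))) = κ / 2 := by field_simp
    have h2 : (m q)⁻¹ * t = √q := by rw [ht]; field_simp
    have hβ : -(m₁ q * κ / m q ^ 2) * t + (m q)⁻¹ * τ = τ / r := by
      rw [eq_div_iff hr0]
      field_simp
      rw [ht]
      linear_combination (-m₁ q * √q * m q) * hκr - 2 * m₁ q * m q * τ * hsq - τ * m q * hr
    have h3 : √q * (τ / r) = κ / 2 := by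
      field_simp
      linear_combination -hκr
    generalize κ / (2 * √(1 + q)) = α at h1 ⊢
    generalize -(m₁ q * κ / m q ^ 2) = β at hβ ⊢
    generalize (m q)⁻¹ = μ at hβ h2 ⊢
    apply Complex.ext
    · simp
      linear_combination h1 + h3 + √q * hβ + (β * t + μ * τ) * h2
    · simp
      linear_combination (-2 * √(1 + q) * z) * h2
  have hI2 : ‖(κ : ℂ) + Complex.I * ((-2 * √q * √(1 + q) * z : ℝ) : ℂ)‖ ^ 2 =
      κ ^ 2 + 4 * q * (1 + q) * z ^ 2 := by
    rw [mul_comm, ← Complex.normSq_eq_norm_sq, Complex.normSq_add_mul_I]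
    linear_combination 4 * √(1 + q) ^ 2 * z ^ 2 * hsq + 4 * q * z ^ 2 * hs2
  rw [kform_self_re, hdz, hz, hX, hI, hI2]
  have hk2 : κ ^ 2 = 4 * q * τ ^ 2 / r ^ 2 := by
    field_simp
    rw [← mul_pow, hκr]
    linear_combination 4 * τ ^ 2 * hsq
  have hφ : (1 + q) * (1 + q)⁻¹ = 1 := mul_inv_cancel₀ (by positivity)
  have hθ : r ^ 2 * (τ ^ 2 / r ^ 2) = τ ^ 2 := by field_simp
  have e1 : κ ^ 2 / (4 * (1 + q)) = q * (1 + q)⁻¹ * (τ ^ 2 / r ^ 2) := by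
    rw [hk2]; field_simp
  rw [e1, show κ ^ 2 = 4 * q * (τ ^ 2 / r ^ 2) by rw [hk2]; ring]
  rw [csq] at hr2 ⊢
  generalize τ ^ 2 / r ^ 2 = θ at hθ ⊢
  generalize (1 + q)⁻¹ = φ at hφ ⊢
  linear_combination (-φ * θ) * hr2 + hθ + (r ^ 2 * θ - w q * θ - 2 * q * w₁ q * θ) * hφ

end Orbits

/-! ### Orbit form and invariance under SO(n+2) -/

section Action

variable {n : ℕ} {C Λ : ℝ} {D : Set ℝ} {P w w₁ m m₁ σ : ℝ → ℝ}

theorem hasOrbitForm_profileMetric (h : IsProfile n C Λ D P w w₁ m m₁ σ) {q a b c : ℝ} (hq : q ∈ D)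
    (hq0 : 0 < q) (ha : a ^ 2 = q * w q) (hb : b ^ 2 = (1 + q) * w q)
    (hc : c ^ 2 = csq (w q) (w₁ q) q) :
    HasOrbitForm (profileMetric (n := n) h) (√q * m q) a b c := by
  intro A p hp ξ τ x y z hξ
  obtain ⟨t, ht⟩ : ∃ t, t = √q * m q := ⟨_, rfl⟩
  rw [← ht] at hp hξ
  rw [base_mul, dir_mul] at hξ
  rw [profileMetric_inner_self, rho_Zmap h, differential_Zmap h, hξ, Zmap, hp]
  rw [kform_orbit h hq hq0 (xx := ∑ i, x i ^ 2) (yy := ∑ i, y i ^ 2) (τ := τ) (z := z) ht, B_p₁,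
    B_p₂, B_p₃, ha, hb, hc]
  all_goals
    simp only [base_eq, dir_eq, inner_add_left, inner_add_right, inner_smul_left,
      inner_smul_right, inner_act, inner_vec, conj_trivial]
    simp [← pow_two]
  try ring

/-- The action of a matrix, as a continuous linear map. -/
def actL (A : Matrix (Fin (n + 2)) (Fin (n + 2)) ℝ) : V n →L[ℝ] V n :=
  LinearMap.toContinuousLinearMap
    { toFun := act A
      map_add' := fun x y => by simp [act, Matrix.mulVec_add]
      map_smul' := fun c x => by simp [act, Matrix.mulVec_smul] }

theorem actL_apply (A : Matrix (Fin (n + 2)) (Fin (n + 2)) ℝ) (x : V n) : actL A x = act A x := rfl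

theorem contMDiff_rotateSphere (A : SO n) :
    ContMDiff (𝓡 (n + 1)) (𝓡 (n + 1)) ∞ (rotateSphere A) :=
  ContMDiff.codRestrict_sphere
    ((actL A.1).contDiff.contMDiff.comp contMDiff_coe_S) fun x => (rotateSphere A x).2

theorem contMDiff_rotate (A : SO n) : ContMDiff (TI n) (TI n) ∞ (rotate A) :=
  (contMDiff_rotateSphere A).contMDiff_tangentMap (m := ∞) (by simp)

theorem ambient_rotate (A : SO n) (p : TS n) :
    ambient (rotate A p) = (actL A.1).prodMap (actL A.1) (ambient p) := by
  refine Prod.ext rfl ?_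
  have h1 := (contMDiff_coe_S.mdifferentiableAt (x := rotateSphere A p.1) (by simp)).hasMFDerivAt.comp
    p.1 ((contMDiff_rotateSphere A).mdifferentiableAt (x := p.1) (by simp)).hasMFDerivAt
  have h2 := ((actL A.1).hasFDerivAt (x := (p.1 : V n))).hasMFDerivAt.comp p.1
    (contMDiff_coe_S.mdifferentiableAt (x := p.1) (by simp)).hasMFDerivAt
  have h3 := hasMFDerivAt_unique h1 h2
  exact congrArg (fun l => l p.2) h3

theorem mfderiv_ambient_rotate (A : SO n) (p : TS n) (ξ : TangentSpace (TI n) p) (d : V n × V n)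
    (hd : mfderiv (TI n) 𝓘(ℝ, V n × V n) ambient p ξ = d) :
    mfderiv (TI n) 𝓘(ℝ, V n × V n) ambient (rotate A p)
      (mfderiv (TI n) (TI n) (rotate A) p ξ) = (actL A.1).prodMap (actL A.1) d := by
  have h1 := (contMDiff_ambient.mdifferentiableAt (x := rotate A p) (by simp)).hasMFDerivAt.comp
    p ((contMDiff_rotate A).mdifferentiableAt (x := p) (by simp)).hasMFDerivAt
  have h2 := (((actL A.1).prodMap (actL A.1)).hasFDerivAt (x := ambient p)).hasMFDerivAt.comp p
    (contMDiff_ambient.mdifferentiableAt (x := p) (by simp)).hasMFDerivAt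
  have h3 := hasMFDerivAt_unique h1 (h2.congr_of_eventuallyEq
    (Eventually.of_forall fun p => ambient_rotate A p))
  rw [← hd]
  exact congrArg (fun l => l ξ) h3

/-- The map to the quadric commutes with real orthogonal matrices, and the metric depends only on
inner products that these preserve. -/
theorem kform_act (h : IsProfile n C Λ D P w w₁ m m₁ σ) (A : SO n) (a d : V n × V n) :
    (kform (w (σ (‖(act A.1 a.2)‖ ^ 2))) (w₁ (σ (‖act A.1 a.2‖ ^ 2)))
      (zmap m σ (act A.1 a.1, act A.1 a.2))
      (fderiv ℝ (zmap m σ) (act A.1 a.1, act A.1 a.2) (act A.1 d.1, act A.1 d.2))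
      (fderiv ℝ (zmap m σ) (act A.1 a.1, act A.1 a.2) (act A.1 d.1, act A.1 d.2))).re =
    (kform (w (σ (‖a.2‖ ^ 2))) (w₁ (σ (‖a.2‖ ^ 2))) (zmap m σ a)
      (fderiv ℝ (zmap m σ) a d) (fderiv ℝ (zmap m σ) a d)).re := by
  obtain ⟨κ, hκ, hdz⟩ := fderiv_zmap h a d
  obtain ⟨κ', hκ', hdz'⟩ := fderiv_zmap h (act A.1 a.1, act A.1 a.2) (act A.1 d.1, act A.1 d.2)
  simp only [norm_act, inner_act] at hκ' hdz' ⊢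
  have hm := h.σ_mem (‖a.2‖ ^ 2) (sq_nonneg _)
  have h0 := h.subset hm
  have : κ' = κ := by
    rw [← hκ] at hκ'
    refine mul_right_cancel₀ (mul_pos (h.m_pos _ hm) (Real.sqrt_pos.2 ?_)).ne' hκ'
    exact div_pos (h.csq_pos _ hm) (by rw [mem_Ici] at h0; linarith)
  subst this
  rw [kform_self_re, kform_self_re, hdz, hdz']
  simp only [zmap, ← actL_apply, ← map_smul, ← map_add]
  simp only [actL_apply, norm_sq_emb_add, inner_emb_add, inner_act, norm_act]

/-- Polarization: invariance is computed for the quadratic form only. -/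
theorem form_eq_of_self {E F : Type*} [AddCommGroup E] [Module ℝ E]
    [TopologicalSpace E] [AddCommGroup F] [Module ℝ F] [TopologicalSpace F] (b : E →L[ℝ] E →L[ℝ] ℝ) (b' : F →L[ℝ] F →L[ℝ] ℝ)
    (L : E →L[ℝ] F) (hb : ∀ v w, b v w = b w v) (hb' : ∀ v w, b' v w = b' w v)
    (key : ∀ v, b' (L v) (L v) = b v v) (v w : E) : b' (L v) (L w) = b v w := by
  have h1 := key (v + w)
  have h2 := hb v w
  have h3 := hb' (L v) (L w)
  simp only [map_add, _root_.add_apply] at h1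
  linarith [key v, key w]

theorem profileMetric_rotate (h : IsProfile n C Λ D P w w₁ m m₁ σ) (A : SO n) (p : TS n)
    (v : TangentSpace (TI n) p) :
    (profileMetric h).inner (rotate A p) (mfderiv (TI n) (TI n) (rotate A) p v)
      (mfderiv (TI n) (TI n) (rotate A) p v) = (profileMetric h).inner p v v := by
  obtain ⟨d, hd⟩ : ∃ d, mfderiv (TI n) 𝓘(ℝ, V n × V n) ambient p v = d := ⟨_, rfl⟩
  rw [profileMetric_inner_self, profileMetric_inner_self, rho_Zmap h, rho_Zmap h,
    differential_Zmap h, differential_Zmap h, mfderiv_ambient_rotate A p v d hd, hd, Zmap, Zmap,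
    ambient_rotate]
  exact kform_act h A (ambient p) d

theorem isInvariant_profileMetric (h : IsProfile n C Λ D P w w₁ m m₁ σ) :
    IsInvariant (profileMetric (n := n) h) := fun A p v v' =>
  form_eq_of_self ((profileMetric h).inner p) ((profileMetric h).inner (rotate A p))
    (mfderiv (TI n) (TI n) (rotate A) p) ((profileMetric h).symm p)
    ((profileMetric h).symm (rotate A p)) (profileMetric_rotate h A p) v v'

end Action

/-! ### Completeness from a proper function of bounded slope -/

section Completeness

variable {E : Type*} [NormedAddCommGroup E] [NormedSpace ℝ E]
  {H : Type*} [TopologicalSpace H] {I : ModelWithCorners ℝ E H}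
  {M : Type*} [TopologicalSpace M] [ChartedSpace H M] [IsManifold I 1 M]

/-- Integrate the derivative of `f` along a path that nearly realizes the distance. -/
theorem edist_le_riemannianEDist [RiemannianBundle (fun p : M => TangentSpace I p)] {f : M → ℝ}
    (hf : ContMDiff I 𝓘(ℝ, ℝ) 1 f)
    (hg : ∀ (p : M) (ξ : TangentSpace I p) (r : ℝ), mfderiv I 𝓘(ℝ, ℝ) f p ξ = r → |r| ≤ ‖ξ‖) (x y : M) :
    edist (f x) (f y) ≤ Manifold.riemannianEDist I x y := by
  refine le_of_forall_gt fun r hr => ?_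
  obtain ⟨γ, h0, h1, hγ, hl, -⟩ :=
    Manifold.exists_lt_locally_constant_of_riemannianEDist_lt hr (zero_lt_one (α := ℝ))
  have hc : ContDiff ℝ 1 (f ∘ γ) := (hf.comp hγ).contDiff
  refine lt_of_le_of_lt ?_ hl
  rw [edist_comm, edist_eq_enorm_sub, ← h0, ← h1,
    Manifold.pathELength_eq_lintegral_mfderiv_Icc]
  refine (enorm_sub_le_lintegral_deriv_of_contDiffOn_Icc (f := f ∘ γ) hc.contDiffOn
    zero_le_one).trans (MeasureTheory.lintegral_mono fun t => ?_)
  have h2 : HasMFDerivAt 𝓘(ℝ, ℝ) 𝓘(ℝ, ℝ) (f ∘ γ) t _ :=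
    (hf.mdifferentiableAt (x := γ t) (by simp)).hasMFDerivAt.comp t
    (hγ.mdifferentiableAt (x := t) (by simp)).hasMFDerivAt
  have h3 : mfderiv I 𝓘(ℝ, ℝ) f (γ t) (mfderiv 𝓘(ℝ, ℝ) I γ t 1) = deriv (f ∘ γ) t := by
    rw [← fderiv_apply_one_eq_deriv, ← mfderiv_eq_fderiv, h2.mfderiv]
    rfl
  rw [← ofReal_norm, ← ofReal_norm]
  exact ENNReal.ofReal_le_ofReal (hg _ _ _ h3)

/-- A metric with a proper function of slope at most one is complete. -/
theorem isCompleteMetric_of_proper (g : SmoothMetric I M) {f : M → ℝ}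
    (hf : ContMDiff I 𝓘(ℝ, ℝ) 1 f)
    (hg : ∀ (p : M) (ξ : TangentSpace I p) (r : ℝ), mfderiv I 𝓘(ℝ, ℝ) f p ξ = r →
      r ^ 2 ≤ g.inner p ξ ξ)
    (hp : ∀ (s : ℕ → M) (R : ℝ), (∀ i, f (s i) ≤ R) →
      ∃ (p : M) (φ : ℕ → ℕ), StrictMono φ ∧ Tendsto (s ∘ φ) atTop (𝓝 p)) :
    IsCompleteMetric g := by
  let _ : RiemannianBundle (fun p : M => TangentSpace I p) := ⟨g.toRiemannianMetric⟩
  have _ : IsContinuousRiemannianBundle E (fun p : M => TangentSpace I p) :=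
    ⟨g.inner, g.contMDiff.continuous, fun _ _ _ => rfl⟩
  intro s hs
  have hLip := edist_le_riemannianEDist hf fun p ξ r hr => by
    refine abs_le_of_sq_le_sq ((hg p ξ r hr).trans_eq ?_) (norm_nonneg _)
    rw [← real_inner_self_eq_norm_sq]
    rfl
  obtain ⟨N, hN⟩ := hs 1 one_pos
  have hb : ∀ i, f (s (N + i)) ≤ f (s N) + 1 := fun i => by
    have := (hLip (s (N + i)) (s N)).trans_lt (hN (N + i) (by omega) N le_rfl)
    rw [edist_dist, ← ENNReal.ofReal_one, ENNReal.ofReal_lt_ofReal_iff one_pos, Real.dist_eq] at this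
    linarith [le_abs_self (f (s (N + i)) - f (s N))]
  obtain ⟨p, φ, hφ, hlim⟩ := hp (fun i => s (N + i)) _ hb
  refine ⟨p, ENNReal.tendsto_nhds_zero.2 fun ε hε => ?_⟩
  have hε2 : 0 < ε / 2 := ENNReal.half_pos hε.ne'
  obtain ⟨N₁, hN₁⟩ := hs _ hε2
  -- Near `p` the manifold topology controls the Riemannian distance, so the subsequence converges
  -- for the distance, and a Cauchy sequence follows its convergent subsequence.
  obtain ⟨j, hj, hj1⟩ := ((hlim.eventually (eventually_riemannianEDist_lt I p hε2)).and
    (eventually_ge_atTop N₁)).exists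
  filter_upwards [eventually_ge_atTop N₁] with i hi
  calc Manifold.riemannianEDist I (s i) p
      ≤ Manifold.riemannianEDist I (s i) (s (N + φ j)) +
        Manifold.riemannianEDist I (s (N + φ j)) p := Manifold.riemannianEDist_triangle
    _ ≤ ε / 2 + ε / 2 := by
        refine add_le_add (hN₁ i hi _ ?_).le ?_
        · exact hj1.trans ((hφ.id_le j).trans (Nat.le_add_left _ _))
        · rw [Manifold.riemannianEDist_comm]
          exact hj.le
    _ = ε := ENNReal.add_halves ε

end Completeness

/-! ### Completeness of the profile metric -/

section Profile

variable {n : ℕ} {C Λ : ℝ} {D : Set ℝ} {P w w₁ m m₁ σ : ℝ → ℝ}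

/-- The image of `ambient` is closed in Euclidean space, being given by two equations. -/
theorem exists_subseq_tendsto (s : ℕ → TS n) (R : ℝ) (hR : ∀ i, ‖(ambient (s i)).2‖ ≤ R) :
    ∃ (p : TS n) (φ : ℕ → ℕ), StrictMono φ ∧ Tendsto (s ∘ φ) atTop (𝓝 p) := by
  have hb : ∀ i, ambient (s i) ∈ Metric.closedBall (0 : V n × V n) (max 1 R) := fun i => by
    rw [mem_closedBall_zero_iff, Prod.norm_def, norm_ambient_fst]
    exact max_le_max le_rfl (hR i)
  obtain ⟨a, -, φ, hφ, hlim⟩ := (isCompact_closedBall _ _).tendsto_subseq hb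
  have h1 : ‖a.1‖ = 1 := by
    refine tendsto_nhds_unique ((continuous_norm.comp continuous_fst).continuousAt.tendsto.comp hlim)
      ?_
    refine tendsto_const_nhds.congr fun i => ?_
    exact (norm_ambient_fst (s (φ i))).symm
  have h2 : inner ℝ a.1 a.2 = 0 := by
    refine tendsto_nhds_unique ((continuous_fst.inner (𝕜 := ℝ) continuous_snd).continuousAt.tendsto.comp
      hlim) ?_
    refine tendsto_const_nhds.congr fun i => ?_
    exact (inner_ambient (s (φ i))).symm
  obtain ⟨p, hp⟩ := exists_ambient_eq h1 h2
  refine ⟨p, φ, hφ, tendsto_of_ambient ?_⟩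
  rw [hp]
  exact hlim

theorem profileMetric_inner_self_nonneg (h : IsProfile n C Λ D P w w₁ m m₁ σ) (p : TS n)
    (ξ : TangentSpace (TI n) p) : 0 ≤ (profileMetric h).inner p ξ ξ := by
  rcases eq_or_ne ξ 0 with h0 | h0
  · exact le_of_eq (by rw [h0]; exact (ContinuousLinearMap.map_zero _).symm)
  · exact ((profileMetric h).pos p ξ h0).le

/-- The proper function is √(1 + |v|²): unlike |v| it is smooth at the zero section, and its slope
is still at most one. -/
theorem isCompleteMetric_profileMetric (h : IsProfile n C Λ D P w w₁ m m₁ σ) :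
    IsCompleteMetric (profileMetric (n := n) h) := by
  have hF : ContDiff ℝ ∞ (fun a : V n × V n => √(1 + ‖a.2‖ ^ 2)) :=
    ContDiff.sqrt (contDiff_const.add (contDiff_snd.norm_sq ℝ)) fun a => by positivity
  have hd : ∀ a : V n × V n, HasFDerivAt (fun a : V n × V n => √(1 + ‖a.2‖ ^ 2))
      ((1 / (2 * √(1 + ‖a.2‖ ^ 2))) • ((2 : ℝ) •
        (innerSL ℝ a.2 ∘L ContinuousLinearMap.snd ℝ (V n) (V n)))) a := fun a =>
    ((hasFDerivAt_norm_sq_snd a).const_add 1).sqrt (by positivity)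
  refine isCompleteMetric_of_proper (profileMetric h)
    (f := (fun a : V n × V n => √(1 + ‖a.2‖ ^ 2)) ∘ ambient)
    (hF.contMDiff.comp contMDiff_ambient |>.of_le (by simp)) (fun p ξ r hr => ?_) fun s R hR => ?_
  · obtain ⟨d, hξ⟩ : ∃ d, mfderiv (TI n) 𝓘(ℝ, V n × V n) ambient p ξ = d := ⟨_, rfl⟩
    have h1 := (hd (ambient p)).hasMFDerivAt.comp p
      (contMDiff_ambient.mdifferentiableAt (x := p) (by simp)).hasMFDerivAt
    have h2 : r = (1 / (2 * √(1 + ‖(ambient p).2‖ ^ 2))) * (2 * inner ℝ (ambient p).2 d.2) := by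
      rw [← hr, ← hξ]
      exact congrArg (fun l => l ξ) h1.mfderiv
    have h3 := inner_sq_le_profileMetric h p ξ d hξ
    have h4 : 0 ≤ (profileMetric h).inner p ξ ξ :=
      profileMetric_inner_self_nonneg h p ξ
    have h5 : √(1 + ‖(ambient p).2‖ ^ 2) ^ 2 = 1 + ‖(ambient p).2‖ ^ 2 :=
      Real.sq_sqrt (by positivity)
    have h6 : r ^ 2 = inner ℝ (ambient p).2 d.2 ^ 2 / (1 + ‖(ambient p).2‖ ^ 2) := by
      have : r = inner ℝ (ambient p).2 d.2 / √(1 + ‖(ambient p).2‖ ^ 2) := by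
        rw [h2]
        field_simp
      rw [this, div_pow, h5]
    rw [h6, div_le_iff₀ (by positivity)]
    generalize (profileMetric h).inner p ξ ξ = G at h3 h4 ⊢
    linarith
  · refine exists_subseq_tendsto s R fun i => le_trans ?_ (hR i)
    refine Real.le_sqrt_of_sq_le ?_
    linarith

end Profile

/-! ### Regularity at the end of a half-open interval -/

section Calculus

theorem contDiffOn_succ_of_hasDerivWithinAt {D : Set ℝ} (hD : UniqueDiffOn ℝ D) {f g : ℝ → ℝ}
    {k : ℕ} (h : ∀ x ∈ D, HasDerivWithinAt f (g x) D x) (hg : ContDiffOn ℝ k g D) :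
    ContDiffOn ℝ (k + 1 : ℕ) f D := by
  push_cast
  rw [contDiffOn_succ_iff_derivWithin hD]
  exact ⟨fun x hx => (h x hx).differentiableWithinAt, by simp,
    hg.congr fun x hx => (h x hx).derivWithin (hD x hx)⟩

/-- Regularity by bootstrapping. -/
theorem contDiffOn_of_bootstrap {D : Set ℝ} (hD : UniqueDiffOn ℝ D) {f g : ℝ → ℝ}
    (h : ∀ x ∈ D, HasDerivWithinAt f (g x) D x)
    (hg : ∀ k : ℕ, ContDiffOn ℝ k f D → ContDiffOn ℝ k g D) : ContDiffOn ℝ ∞ f D := by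
  refine contDiffOn_infty.2 fun k => ?_
  induction k with
  | zero => exact contDiffOn_zero.2 fun x hx => (h x hx).continuousWithinAt
  | succ k ih => exact contDiffOn_succ_of_hasDerivWithinAt hD h (hg k ih)

theorem uniqueDiffOn_of_mem_nhdsWithin {D : Set ℝ} (hD : ∀ x ∈ D, D ∈ 𝓝[Ici 0] x) (hs : D ⊆ Ici 0) :
    UniqueDiffOn ℝ D := fun x hx => by
  have := (uniqueDiffOn_Ici (0 : ℝ) x (hs hx)).inter' (hD x hx)
  exact this.mono inter_subset_right

theorem mem_nhds_of_pos {D : Set ℝ} (hD : ∀ x ∈ D, D ∈ 𝓝[Ici 0] x) {x : ℝ} (hx : x ∈ D)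
    (h0 : 0 < x) : D ∈ 𝓝 x := by
  have := hD x hx
  rwa [nhdsWithin_eq_nhds.2 (Ici_mem_nhds h0)] at this

/-- A derivative formula on x > 0 persists at 0 when both sides are continuous there, since the
one-sided derivative is the limit of the derivatives. -/
theorem hasDerivWithinAt_of_pos {D : Set ℝ} (hs : D ⊆ Ici 0) (hD : ∀ x ∈ D, D ∈ 𝓝[Ici 0] x)
    {f g : ℝ → ℝ} (hf : ContinuousOn f D) (hg : ContinuousOn g D)
    (h : ∀ x ∈ D, 0 < x → HasDerivAt f (g x) x) (x : ℝ) (hx : x ∈ D) :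
    HasDerivWithinAt f (g x) D x := by
  rcases (mem_Ici.1 (hs hx)).eq_or_lt with rfl | h0
  · have hD0 : D ∩ Ioi 0 ∈ 𝓝[>] (0 : ℝ) :=
      inter_mem (nhdsWithin_mono 0 Ioi_subset_Ici_self (hD 0 hx)) self_mem_nhdsWithin
    refine HasDerivWithinAt.mono (hasDerivWithinAt_Ici_of_tendsto_deriv (s := D ∩ Ioi 0)
      (fun y hy => (h y hy.1 hy.2).differentiableAt.differentiableWithinAt)
      ((hf 0 hx).mono inter_subset_left) hD0 ?_) hs
    have h1 : Tendsto g (𝓝[>] 0) (𝓝 (g 0)) := by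
      refine (hg 0 hx).mono_left ?_
      rw [nhdsWithin_le_iff]
      exact mem_of_superset hD0 inter_subset_left
    refine h1.congr' ?_
    filter_upwards [hD0] with y hy
    exact (h y hy.1 hy.2).deriv.symm
  · exact (h x hx h0).hasDerivWithinAt

/-- Bounded solutions of `x y' + ρ y = r` are regular at `0`. -/
theorem contDiffOn_of_singular {D : Set ℝ} (hs : D ⊆ Ici 0) (hD : ∀ x ∈ D, D ∈ 𝓝[Ici 0] x) (k : ℕ) :
    ∀ {ρ : ℝ} {y r : ℝ → ℝ}, 0 < ρ → ContinuousOn y D → ContDiffOn ℝ k r D →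
      (∀ x ∈ D, 0 < x → HasDerivAt y ((r x - ρ * y x) / x) x) → ContDiffOn ℝ k y D := by
  have hu := uniqueDiffOn_of_mem_nhdsWithin hD hs
  induction k with
  | zero => exact fun _ hy _ _ => contDiffOn_zero.2 hy
  | succ k ih =>
    intro ρ y r hρ hy hr h
    push_cast at hr
    rw [contDiffOn_succ_iff_derivWithin hu] at hr
    obtain ⟨hr1, -, hr2⟩ := hr
    set r' := derivWithin r D
    have hr' : ∀ x ∈ D, 0 < x → HasDerivAt r (r' x) x := fun x hx h0 =>
      (hr1 x hx).hasDerivWithinAt.hasDerivAt (mem_nhds_of_pos hD hx h0)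
    -- For x > 0 this is y', and it solves an equation of the same kind, x z' + (ρ + 1) z = r'. The
    -- value at 0 is the one this equation forces.
    set z : ℝ → ℝ := fun x => if x = 0 then r' 0 / (ρ + 1) else (r x - ρ * y x) / x with hz
    have hzpos : ∀ x, 0 < x → z x = (r x - ρ * y x) / x := fun x hx => if_neg hx.ne'
    have hzd : ∀ x ∈ D, 0 < x → HasDerivAt z ((r' x - (ρ + 1) * z x) / x) x := fun x hx h0 => by
      have h1 : HasDerivAt (fun x => (r x - ρ * y x) / x) _ x :=
        ((hr' x hx h0).sub ((h x hx h0).const_mul ρ)).div (hasDerivAt_id x) h0.ne'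
      have h2 : z =ᶠ[𝓝 x] fun x => (r x - ρ * y x) / x := by
        filter_upwards [lt_mem_nhds h0] with t ht using hzpos t ht
      refine (h1.congr_of_eventuallyEq h2).congr_deriv ?_
      rw [hzpos x h0]
      simp only [Pi.sub_apply]
      field_simp
      ring
    have hzc : ContinuousOn z D := by
      intro x hx
      rcases (mem_Ici.1 (hs hx)).eq_or_lt with rfl | h0
      · refine ContinuousWithinAt.mono ?_ hs
        rw [← Ioi_insert, continuousWithinAt_insert_self]
        have hD0 : D ∩ Ioi 0 ∈ 𝓝[>] (0 : ℝ) :=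
          inter_mem (nhdsWithin_mono 0 Ioi_subset_Ici_self (hD 0 hx)) self_mem_nhdsWithin
        have hle : 𝓝[>] (0 : ℝ) ≤ 𝓝[D] 0 := by
          rw [nhdsWithin_le_iff]
          exact mem_of_superset hD0 inter_subset_left
        have hpow : Tendsto (fun x : ℝ => x ^ ρ) (𝓝[>] 0) (𝓝 0) := by
          have := (Real.continuousAt_rpow_const 0 ρ (Or.inr hρ.le)).tendsto
          rw [Real.zero_rpow hρ.ne'] at this
          exact this.mono_left nhdsWithin_le_nhds
        have hpow1 : Tendsto (fun x : ℝ => x ^ (ρ + 1)) (𝓝[>] 0) (𝓝 0) := by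
          have := (Real.continuousAt_rpow_const 0 (ρ + 1) (Or.inr (by positivity))).tendsto
          rw [Real.zero_rpow (by positivity)] at this
          exact this.mono_left nhdsWithin_le_nhds
        -- The integrating factor makes the quotient of derivatives explicit: (x^ρ (r - ρy))' = x^ρ
        -- r'. The quotient of the functions themselves is z.
        have key := HasDerivAt.lhopital_zero_nhdsGT (a := (0 : ℝ)) (l := 𝓝 (r' 0 / (ρ + 1)))
          (f := fun x => x ^ ρ * (r x - ρ * y x)) (g := fun x => x ^ (ρ + 1))
          (f' := fun x => x ^ ρ * r' x) (g' := fun x => (ρ + 1) * x ^ ρ) ?_ ?_ ?_ ?_ hpow1 ?_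
        · have e : z 0 = r' 0 / (ρ + 1) := if_pos rfl
          rw [ContinuousWithinAt, e]
          refine key.congr' ?_
          filter_upwards [self_mem_nhdsWithin] with t ht
          have ht0 : 0 < t := ht
          rw [hzpos t ht0, Real.rpow_add_one ht0.ne']
          have := Real.rpow_pos_of_pos ht0 ρ
          field_simp
        · filter_upwards [hD0] with t ht
          have ht0 : 0 < t := ht.2
          have h1 := (Real.hasDerivAt_rpow_const (x := t) (p := ρ) (Or.inl ht0.ne')).mul
            ((hr' t ht.1 ht0).sub ((h t ht.1 ht0).const_mul ρ))
          refine h1.congr_deriv ?_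
          have : t ^ ρ = t ^ (ρ - 1) * t := by
            rw [← Real.rpow_add_one ht0.ne']
            ring_nf
          simp only [Pi.sub_apply]
          rw [this]
          field_simp
          ring
        · filter_upwards [self_mem_nhdsWithin] with t ht
          have ht0 : 0 < t := ht
          refine (Real.hasDerivAt_rpow_const (x := t) (p := ρ + 1) (Or.inl ht0.ne')).congr_deriv ?_
          simp
        · filter_upwards [self_mem_nhdsWithin] with t ht
          have := Real.rpow_pos_of_pos ht ρ
          positivity
        · have h1 : Tendsto (fun x => r x - ρ * y x) (𝓝[>] 0) (𝓝 (r 0 - ρ * y 0)) :=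
            ((hr1.continuousOn 0 hx).sub ((hy 0 hx).const_mul ρ)).mono_left hle
          simpa using hpow.mul h1
        · have h1 : Tendsto (fun x => r' x / (ρ + 1)) (𝓝[>] 0) (𝓝 (r' 0 / (ρ + 1))) :=
            ((hr2.continuousOn 0 hx).mono_left hle).div_const _
          refine h1.congr' ?_
          filter_upwards [self_mem_nhdsWithin] with t ht
          have := Real.rpow_pos_of_pos ht ρ
          field_simp
      · exact (hzd x hx h0).continuousAt.continuousWithinAt
    refine contDiffOn_succ_of_hasDerivWithinAt hu (g := z) ?_ (ih (by positivity) hzc hr2 hzd)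
    refine hasDerivWithinAt_of_pos hs hD hy hzc fun x hx h0 => ?_
    rw [hzpos x h0]
    exact h x hx h0

section Inverse

variable {f g f' : ℝ → ℝ} {D E : Set ℝ}

theorem monotoneOn_inverse (hf : StrictMonoOn f D) (hg : MapsTo g E D) (hfg : ∀ y ∈ E, f (g y) = y) :
    MonotoneOn g E := fun y hy z hz hyz => by
  by_contra! hlt
  have := hf (hg hz) (hg hy) hlt
  rw [hfg y hy, hfg z hz] at this
  linarith

theorem image_inverse (hf : StrictMonoOn f D) (hfD : MapsTo f D E) (hg : MapsTo g E D)
    (hfg : ∀ y ∈ E, f (g y) = y) : g '' E = D := by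
  refine Subset.antisymm hg.image_subset fun x hx => ⟨f x, hfD hx, ?_⟩
  exact hf.injOn (hg (hfD hx)) hx (hfg _ (hfD hx))

theorem hasDerivAt_inverse (hD : IsOpen D) (hE : IsOpen E) (hf : StrictMonoOn f D)
    (hfD : MapsTo f D E) (hg : MapsTo g E D) (hfg : ∀ y ∈ E, f (g y) = y)
    (hd : ∀ x ∈ D, HasDerivAt f (f' x) x) (h0 : ∀ x ∈ D, f' x ≠ 0) (y : ℝ) (hy : y ∈ E) :
    HasDerivAt g (f' (g y))⁻¹ y := by
  refine HasDerivAt.of_local_left_inverse ?_ (hd _ (hg hy)) (h0 _ (hg hy)) ?_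
  · refine continuousAt_of_monotoneOn_of_image_mem_nhds (monotoneOn_inverse hf hg hfg)
      (hE.mem_nhds hy) ?_
    rw [image_inverse hf hfD hg hfg]
    exact hD.mem_nhds (hg hy)
  · filter_upwards [hE.mem_nhds hy] with z hz using hfg z hz

/-- The inverse of an increasing smooth function on a half-open interval. -/
theorem contDiffOn_inverse (hs : D ⊆ Ici 0) (hD : ∀ x ∈ D, D ∈ 𝓝[Ici 0] x) (h0 : 0 ∈ D)
    (hf : StrictMonoOn f D) (hf0 : f 0 = 0) (hg : MapsTo g (Ici 0) D)
    (hfg : ∀ y ∈ Ici 0, f (g y) = y) (hd : ∀ x ∈ D, HasDerivWithinAt f (f' x) D x)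
    (hf' : ∀ x ∈ D, 0 < f' x) (hsm : ContDiffOn ℝ ∞ f' D) : ContDiffOn ℝ ∞ g (Ici 0) := by
  have hfD : MapsTo f D (Ici 0) := fun x hx => by
    rw [mem_Ici, ← hf0]
    exact hf.monotoneOn h0 hx (hs hx)
  have hg0 : g 0 = 0 := hf.injOn (hg self_mem_Ici) h0 (by rw [hfg 0 self_mem_Ici, hf0])
  have hpos : ∀ x ∈ D, 0 < f x → 0 < x := fun x hx h => by
    refine (mem_Ici.1 (hs hx)).lt_of_ne fun h' => ?_
    rw [← h', hf0] at h
    exact h.false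
  have hgd : ∀ y ∈ Ici (0 : ℝ), 0 < y → HasDerivAt g (f' (g y))⁻¹ y := fun y _ hy => by
    refine hasDerivAt_inverse (f := f) (D := D ∩ Ioi 0) (E := Ioi 0) ?_ isOpen_Ioi
      (hf.mono inter_subset_left) (fun x hx => ?_) (fun y hy => ?_) (fun y hy => ?_) (fun x hx => ?_)
      (fun x hx => (hf' x hx.1).ne') y hy
    · rw [isOpen_iff_mem_nhds]
      exact fun x hx => inter_mem (mem_nhds_of_pos hD hx.1 hx.2) (Ioi_mem_nhds hx.2)
    · rw [mem_Ioi, ← hf0]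
      exact hf h0 hx.1 hx.2
    · have hy' : y ∈ Ici 0 := (mem_Ioi.1 hy).le
      exact ⟨hg hy', hpos _ (hg hy') (by rw [hfg y hy']; exact hy)⟩
    · exact hfg y (mem_Ioi.1 hy).le
    · exact (hd x hx.1).hasDerivAt (mem_nhds_of_pos hD hx.1 hx.2)
  have hgc : ContinuousOn g (Ici 0) := by
    intro y hy
    rcases (mem_Ici.1 hy).eq_or_lt with rfl | hy0
    · refine continuousWithinAt_right_of_monotoneOn_of_image_mem_nhdsWithin
        (monotoneOn_inverse hf hg hfg) self_mem_nhdsWithin ?_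
      rw [image_inverse hf hfD hg hfg, hg0]
      exact hD 0 h0
    · exact (hgd y hy hy0).continuousAt.continuousWithinAt
  refine contDiffOn_of_bootstrap (uniqueDiffOn_Ici 0) (g := fun y => (f' (g y))⁻¹)
    (hasDerivWithinAt_of_pos Subset.rfl (fun x _ => self_mem_nhdsWithin) hgc ?_ hgd) fun k hk => ?_
  · exact (hsm.continuousOn.comp hgc hg).inv₀ fun y hy => (hf' _ (hg hy)).ne'
  · exact ((hsm.of_le (by exact_mod_cast le_top)).comp hk hg).inv fun y hy => (hf' _ (hg hy)).ne'

end Inverse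

end Calculus

/-! ### The Kähler–Einstein equations in the variable q -/

section RadialSystem

theorem hasDerivWithinAt_integral {D : Set ℝ} (hs : D ⊆ Ici 0) (hD : ∀ x ∈ D, D ∈ 𝓝[Ici 0] x)
    (h0 : 0 ∈ D) (ho : D.OrdConnected) {f : ℝ → ℝ} (hf : ContinuousOn f D) (x : ℝ) (hx : x ∈ D) :
    HasDerivWithinAt (fun x => ∫ y in (0 : ℝ)..x, f y) (f x) D x := by
  have hm : ∀ x ∈ D ∩ Ioi 0, StronglyMeasurableAtFilter f (𝓝 x) :=
    (hf.mono inter_subset_left).stronglyMeasurableAtFilter (isOpen_iff_mem_nhds.2 fun x hx =>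
      inter_mem (mem_nhds_of_pos hD hx.1 hx.2) (Ioi_mem_nhds hx.2))
  have hi : IntervalIntegrable f MeasureTheory.volume 0 x :=
    (hf.mono (ho.uIcc_subset h0 hx)).intervalIntegrable
  rcases (mem_Ici.1 (hs hx)).eq_or_lt with rfl | hx0
  · refine HasDerivWithinAt.mono ?_ hs
    refine intervalIntegral.integral_hasDerivWithinAt_right (t := Ioi 0) hi ?_ ?_
    · refine ⟨D ∩ Ioi 0, inter_mem (nhdsWithin_mono 0 Ioi_subset_Ici_self (hD 0 hx))
        self_mem_nhdsWithin, ?_⟩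
      refine (hf.mono inter_subset_left).aestronglyMeasurable ?_
      exact ho.measurableSet.inter measurableSet_Ioi
    · refine (hf 0 hx).mono_of_mem_nhdsWithin ?_
      exact nhdsWithin_mono 0 Ioi_subset_Ici_self (hD 0 hx)
  · exact (intervalIntegral.integral_hasDerivAt_right hi (hm x ⟨hx, hx0⟩)
      (hf.continuousAt (mem_nhds_of_pos hD hx hx0))).hasDerivWithinAt

variable {n : ℕ} {Λ : ℝ} {D : Set ℝ} {w c₂ : ℝ → ℝ}

/-- The coefficients of an invariant Kähler–Einstein metric as functions of `q`, where
`a² = q w`, `b² = (1 + q) w` and `c² = c₂`. -/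
structure IsRadialSolution (n : ℕ) (Λ : ℝ) (D : Set ℝ) (w c₂ : ℝ → ℝ) : Prop where
  subset : D ⊆ Ici 0
  mem_nhds : ∀ q ∈ D, D ∈ 𝓝[Ici 0] q
  zero_mem : 0 ∈ D
  ordConnected : D.OrdConnected
  w_pos : ∀ q ∈ D, 0 < w q
  c_pos : ∀ q ∈ D, 0 < c₂ q
  w_cont : ContinuousOn w D
  c_cont : ContinuousOn c₂ D
  c_zero : c₂ 0 = w 0
  w_deriv : ∀ q ∈ D, 0 < q → HasDerivAt w ((c₂ q - (1 + 2 * q) * w q) / (2 * q * (1 + q))) q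
  c_deriv : ∀ q ∈ D, 0 < q → HasDerivAt c₂ (c₂ q * (n * ((1 + 2 * q) * w q - c₂ q) -
    2 * Λ * q * (1 + q) * w q ^ 2) / (2 * q * (1 + q) * w q)) q

namespace IsRadialSolution

variable (h : IsRadialSolution n Λ D w c₂)

include h

theorem potential_deriv : ∀ q ∈ D, HasDerivWithinAt (fun x => ∫ y in (0 : ℝ)..x, w y) (w q) D q :=
  hasDerivWithinAt_integral h.subset h.mem_nhds h.zero_mem h.ordConnected h.w_cont

/-- By the two equations the logarithmic derivative of w^n c₂ is -Λw. The initial value uses c₂(0) =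
w(0). -/
theorem volume : ∀ q ∈ D,
    w q ^ n * c₂ q = w 0 ^ (n + 1) * Real.exp (-Λ * ∫ y in (0 : ℝ)..q, w y) := by
  intro q hq
  have hP := h.potential_deriv
  set P : ℝ → ℝ := fun x => ∫ y in (0 : ℝ)..x, w y
  have hcont : ContinuousOn (fun q => w q ^ n * c₂ q * Real.exp (Λ * P q)) D :=
    ((h.w_cont.pow n).mul h.c_cont).mul (Real.continuous_exp.comp_continuousOn
      (continuousOn_const.mul fun q hq => (hP q hq).continuousWithinAt))
  have hd : ∀ q ∈ D, 0 < q →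
      HasDerivAt (fun q => w q ^ n * c₂ q * Real.exp (Λ * P q)) 0 q := by
    intro q hq h0
    have hP' := (hP q hq).hasDerivAt (mem_nhds_of_pos h.mem_nhds hq h0)
    refine ((((h.w_deriv q hq h0).pow n).mul (h.c_deriv q hq h0)).mul
      (hP'.const_mul Λ).exp).congr_deriv ?_
    have hw := h.w_pos q hq
    rcases n with _ | n
    · simp
      field_simp
      ring
    · simp only [Nat.add_sub_cancel, Pi.mul_apply, Pi.pow_apply]
      push_cast
      field_simp
      ring
  have hconst : w q ^ n * c₂ q * Real.exp (Λ * P q) = w 0 ^ n * c₂ 0 * Real.exp (Λ * P 0) := by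
    have hsub : Icc 0 q ⊆ D := h.ordConnected.out h.zero_mem hq
    refine constant_of_has_deriv_right_zero (hcont.mono hsub) (fun x hx => ?_) q
      (right_mem_Icc.2 (h.subset hq))
    have hx' := hsub (Ico_subset_Icc_self hx)
    have := hasDerivWithinAt_of_pos (g := fun _ => 0) h.subset h.mem_nhds hcont continuousOn_const hd
      x hx'
    refine this.mono_of_mem_nhdsWithin ?_
    exact nhdsWithin_mono x (Ici_subset_Ici.2 hx.1) (h.mem_nhds x hx')
  have hP0 : P 0 = 0 := intervalIntegral.integral_same
  rw [hP0, mul_zero, Real.exp_zero, mul_one, h.c_zero, ← pow_succ] at hconst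
  rw [← hconst, mul_assoc, ← Real.exp_add]
  simp [P]

/-- Eliminating c₂ by `volume`, the function Y = (w√(1+q))^(n+1) satisfies q Y' + αY = α w(0)^(n+1)
exp(-ΛP) √(1+q)^(n-1) with α = (n+1)/2. The right side involves w only through its primitive P, so
each application of `contDiffOn_of_singular` gains a derivative. -/
theorem w_smooth (hn : 1 ≤ n) : ContDiffOn ℝ ∞ w D := by
  -- From here on `n` is one less than in the statement, so the exponent n + 1 of Y appears as n +
  -- 2.
  obtain ⟨n, rfl⟩ : ∃ k, n = k + 1 := ⟨n - 1, by omega⟩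
  have hP := h.potential_deriv
  have hvol := h.volume
  set P : ℝ → ℝ := fun x => ∫ y in (0 : ℝ)..x, w y
  have hu := uniqueDiffOn_of_mem_nhdsWithin h.mem_nhds h.subset
  have hsq : ContDiffOn ℝ ∞ (fun q : ℝ => √(1 + q)) D :=
    (contDiff_const.add contDiff_id).contDiffOn.sqrt fun q hq => by
      have := mem_Ici.1 (h.subset hq)
      simp only [id]
      positivity
  have hsq0 : ∀ q ∈ D, 0 < √(1 + q) := fun q hq => by
    have := mem_Ici.1 (h.subset hq)
    positivity
  refine contDiffOn_infty.2 fun k => ?_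
  induction k with
  | zero => exact contDiffOn_zero.2 h.w_cont
  | succ k ih =>
    have hP1 := contDiffOn_succ_of_hasDerivWithinAt hu hP ih
    have hk : ContDiffOn ℝ (k + 1 : ℕ) (fun q : ℝ => √(1 + q)) D :=
      hsq.of_le (by exact_mod_cast le_top)
    set ρ : ℝ := (n + 2) / 2 with hρ
    have hR : ContDiffOn ℝ (k + 1 : ℕ)
        (fun q => ρ * (w 0 ^ (n + 2) * Real.exp (-Λ * P q)) * √(1 + q) ^ n) D :=
      (contDiffOn_const.mul (contDiffOn_const.mul (contDiffOn_const.mul hP1).exp)).mul (hk.pow n)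
    have hY : ContDiffOn ℝ (k + 1 : ℕ) (fun q => (w q * √(1 + q)) ^ (n + 2)) D := by
      refine contDiffOn_of_singular (ρ := ρ) h.subset h.mem_nhds (k + 1) (by positivity)
        ((h.w_cont.mul hsq.continuousOn).pow _) hR fun q hq h0 => ?_
      have hq1 : 0 < 1 + q := by positivity
      have hd := ((h.w_deriv q hq h0).mul (((hasDerivAt_id q).const_add 1).sqrt hq1.ne')).pow (n + 2)
      refine hd.congr_deriv ?_
      have hv := hvol q hq
      simp only [P]
      rw [← hv]
      have hs := hsq0 q hq
      have hs2 : √(1 + q) ^ 2 = 1 + q := Real.sq_sqrt hq1.le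
      simp only [Nat.add_succ_sub_one, id, Pi.mul_apply]
      generalize √(1 + q) = s at hs hs2 ⊢
      rw [← hs2, hρ]
      push_cast
      field_simp
      rw [show q = s ^ 2 - 1 by linarith]
      ring
    have hw : ContDiffOn ℝ (k + 1 : ℕ)
        (fun q => ((w q * √(1 + q)) ^ (n + 2)) ^ ((n + 2 : ℝ)⁻¹) / √(1 + q)) D := by
      refine (hY.rpow_const_of_ne fun q hq => ?_).div hk fun q hq => (hsq0 q hq).ne'
      exact (pow_pos (mul_pos (h.w_pos q hq) (hsq0 q hq)) _).ne'
    refine hw.congr fun q hq => ?_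
    have hs := hsq0 q hq
    have := Real.pow_rpow_inv_natCast (mul_pos (h.w_pos q hq) hs).le (show n + 2 ≠ 0 by omega)
    push_cast at this
    rw [this]
    field_simp

theorem csq_eq (hn : 1 ≤ n) (q : ℝ) (hq : q ∈ D) : csq (w q) (derivWithin w D q) q = c₂ q := by
  rcases (mem_Ici.1 (h.subset hq)).eq_or_lt with rfl | h0
  · rw [csq, h.c_zero]
    ring
  · have hd := (h.w_deriv q hq h0).hasDerivWithinAt.derivWithin
      (uniqueDiffOn_of_mem_nhdsWithin h.mem_nhds h.subset q hq)
    rw [csq, hd]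
    field_simp
    ring

theorem isEinsteinPotential (hn : 1 ≤ n) :
    IsEinsteinPotential n (w 0 ^ (n + 1)) Λ D (fun x => ∫ y in (0 : ℝ)..x, w y) w
      (derivWithin w D) where
  subset := h.subset
  mem_nhds := h.mem_nhds
  smooth := contDiffOn_of_bootstrap (uniqueDiffOn_of_mem_nhdsWithin h.mem_nhds h.subset)
    h.potential_deriv fun _ _ => (h.w_smooth hn).of_le (by exact_mod_cast le_top)
  deriv := h.potential_deriv
  deriv₂ q hq := ((h.w_smooth hn).differentiableOn (by simp) q hq).hasDerivWithinAt
  pos := h.w_pos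
  csq_pos q hq := by
    rw [h.csq_eq hn q hq]
    exact h.c_pos q hq
  volume q hq := by
    rw [h.csq_eq hn q hq]
    exact h.volume q hq

end IsRadialSolution

/-- The function `m` with `t = √q m(q)`, for the function `r = dt / d√q` of `q`. -/
def arcFactor (r : ℝ → ℝ) (q : ℝ) : ℝ :=
  if q = 0 then r 0 else (∫ x in (0 : ℝ)..√q, r (x ^ 2)) / √q

/-! ### The arclength as a function of q -/

section ArcFactor

variable {r : ℝ → ℝ} (hs : D ⊆ Ici 0) (hD : ∀ x ∈ D, D ∈ 𝓝[Ici 0] x) (h0 : 0 ∈ D)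
  (ho : D.OrdConnected) (hr : ContDiffOn ℝ ∞ r D)

include hs hD h0 ho hr

theorem hasDerivWithinAt_arc (x : ℝ) (hx : 0 ≤ x) (hxD : x ^ 2 ∈ D) :
    HasDerivWithinAt (fun x => ∫ y in (0 : ℝ)..x, r (y ^ 2)) (r (x ^ 2)) {x | 0 ≤ x ∧ x ^ 2 ∈ D} x := by
  refine hasDerivWithinAt_integral (D := {x | 0 ≤ x ∧ x ^ 2 ∈ D}) (fun x hx => hx.1)
    (fun x hx => ?_) ⟨le_rfl, by simpa using h0⟩ ⟨fun x hx y hy z hz => ?_⟩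
    (f := fun y => r (y ^ 2)) ?_ x ⟨hx, hxD⟩
  · have h1 : ContinuousWithinAt (fun x : ℝ => x ^ 2) (Ici 0) x :=
      (continuous_pow 2).continuousWithinAt
    have h2 := h1.tendsto_nhdsWithin (t := Ici 0) (fun x _ => mem_Ici.2 (sq_nonneg x))
    exact inter_mem self_mem_nhdsWithin (h2 (hD _ hx.2))
  · have hz0 : 0 ≤ z := hx.1.trans hz.1
    exact ⟨hz0, ho.out hx.2 hy.2 ⟨pow_le_pow_left₀ hx.1 hz.1 2, pow_le_pow_left₀ hz0 hz.2 2⟩⟩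
  · exact hr.continuousOn.comp (continuous_pow 2).continuousOn fun x hx => hx.2

/-- √q m is the arclength, with derivative r in √q. Hence q m' + m/2 = r/2, the singular equation
with ρ = 1/2, which yields smoothness at 0. -/
theorem hasDerivAt_arcFactor (q : ℝ) (hq : q ∈ D) (hq0 : 0 < q) :
    HasDerivAt (arcFactor r) ((1 / 2 * r q - 1 / 2 * arcFactor r q) / q) q := by
  have hsq : √q ^ 2 = q := Real.sq_sqrt hq0.le
  have hs0 : 0 < √q := Real.sqrt_pos.2 hq0
  have h1 := hasDerivWithinAt_arc hs hD h0 ho hr (√q) hs0.le (by rwa [hsq])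
  have hnhds : {x | 0 ≤ x ∧ x ^ 2 ∈ D} ∈ 𝓝 (√q) := by
    refine inter_mem (Ici_mem_nhds hs0) ?_
    refine (continuous_pow 2).continuousAt.preimage_mem_nhds ?_
    rw [hsq]
    exact mem_nhds_of_pos hD hq hq0
  have h2 := ((h1.hasDerivAt hnhds).comp q ((hasDerivAt_id q).sqrt hq0.ne')).div
    ((hasDerivAt_id q).sqrt hq0.ne') hs0.ne'
  have heq : arcFactor r =ᶠ[𝓝 q]
      fun q => ((fun x => ∫ y in (0 : ℝ)..x, r (y ^ 2)) ∘ fun y => √(id y)) q / √(id q) := by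
    filter_upwards [lt_mem_nhds hq0] with y hy
    rw [arcFactor, if_neg hy.ne']
    rfl
  refine (h2.congr_of_eventuallyEq heq).congr_deriv ?_
  simp only [arcFactor, if_neg hq0.ne', id, Function.comp, hsq]
  generalize (∫ y in (0 : ℝ)..√q, r (y ^ 2)) = T
  generalize √q = s at hs0 hsq
  subst hsq
  field_simp

theorem continuousOn_arcFactor : ContinuousOn (arcFactor r) D := by
  intro q hq
  rcases (mem_Ici.1 (hs hq)).eq_or_lt with rfl | hq0
  · refine ContinuousWithinAt.mono ?_ hs
    rw [← Ioi_insert, continuousWithinAt_insert_self]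
    have h1 := hasDerivWithinAt_arc hs hD h0 ho hr 0 le_rfl (by simpa using h0)
    rw [hasDerivWithinAt_iff_tendsto_slope] at h1
    have h2 : Tendsto (fun q : ℝ => √q) (𝓝[>] 0) (𝓝[{x | 0 ≤ x ∧ x ^ 2 ∈ D} \ {0}] 0) := by
      refine tendsto_nhdsWithin_iff.2 ⟨?_, ?_⟩
      · have := Real.continuous_sqrt.tendsto 0
        rw [Real.sqrt_zero] at this
        exact this.mono_left nhdsWithin_le_nhds
      · filter_upwards [self_mem_nhdsWithin, nhdsWithin_mono 0 Ioi_subset_Ici_self (hD 0 h0)]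
          with x hx hxD
        have hx0 : 0 < x := hx
        refine ⟨⟨Real.sqrt_nonneg x, ?_⟩, (Real.sqrt_pos.2 hx0).ne'⟩
        rwa [Real.sq_sqrt hx0.le]
    have h3 := h1.comp h2
    rw [ContinuousWithinAt]
    have e : arcFactor r 0 = r (0 ^ 2) := by simp [arcFactor]
    rw [e]
    refine h3.congr' ?_
    filter_upwards [self_mem_nhdsWithin] with x hx
    have hx0 : 0 < x := hx
    simp [arcFactor, hx0.ne', slope_def_field]
  · exact (hasDerivAt_arcFactor hs hD h0 ho hr q hq hq0).continuousAt.continuousWithinAt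

theorem contDiffOn_arcFactor : ContDiffOn ℝ ∞ (arcFactor r) D :=
  contDiffOn_infty.2 fun k => contDiffOn_of_singular (ρ := 1 / 2) hs hD k (by norm_num)
    (continuousOn_arcFactor hs hD h0 ho hr)
    (contDiffOn_const.mul (hr.of_le (by exact_mod_cast le_top)))
    (hasDerivAt_arcFactor hs hD h0 ho hr)

theorem arcFactor_add (q : ℝ) (hq : q ∈ D) :
    arcFactor r q + 2 * q * derivWithin (arcFactor r) D q = r q := by
  rcases (mem_Ici.1 (hs hq)).eq_or_lt with rfl | hq0
  · simp [arcFactor]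
  · have := (hasDerivAt_arcFactor hs hD h0 ho hr q hq hq0).hasDerivWithinAt.derivWithin
      (uniqueDiffOn_of_mem_nhdsWithin hD hs q hq)
    rw [this]
    field_simp
    ring

theorem arcFactor_pos (hpos : ∀ q ∈ D, 0 < r q) (q : ℝ) (hq : q ∈ D) : 0 < arcFactor r q := by
  rcases (mem_Ici.1 (hs hq)).eq_or_lt with rfl | hq0
  · simpa [arcFactor] using hpos 0 h0
  · rw [arcFactor, if_neg hq0.ne']
    have hs0 := Real.sqrt_pos.2 hq0
    have hsub : ∀ x ∈ Icc 0 √q, x ^ 2 ∈ D := fun x hx => by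
      refine ho.out h0 hq ⟨sq_nonneg x, ?_⟩
      rw [← Real.sq_sqrt hq0.le]
      exact pow_le_pow_left₀ hx.1 hx.2 2
    refine div_pos (intervalIntegral.intervalIntegral_pos_of_pos_on ?_ (fun x hx => ?_) hs0) hs0
    · refine ContinuousOn.intervalIntegrable_of_Icc hs0.le ?_
      exact hr.continuousOn.comp (continuous_pow 2).continuousOn hsub
    · exact hpos _ (hsub x (Ioo_subset_Icc_self hx))

end ArcFactor

namespace IsRadialSolution

variable (h : IsRadialSolution n Λ D w c₂)

include h

theorem c_smooth (hn : 1 ≤ n) : ContDiffOn ℝ ∞ c₂ D := by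
  have h1 : ContDiffOn ℝ ∞ (derivWithin w D) D :=
    ((contDiffOn_infty_iff_derivWithin
      (uniqueDiffOn_of_mem_nhdsWithin h.mem_nhds h.subset)).1 (h.w_smooth hn)).2
  have h2 : ContDiffOn ℝ ∞ (fun q => csq (w q) (derivWithin w D q) q) D :=
    ((contDiffOn_const.add (contDiffOn_const.mul contDiffOn_id)).mul (h.w_smooth hn)).add
      (((contDiffOn_const.mul contDiffOn_id).mul (contDiffOn_const.add contDiffOn_id)).mul h1)
  exact h2.congr fun q hq => (h.csq_eq hn q hq).symm

/-- This function is dt/d√q along the curve: dt = |abc| du and d√q = b²√q du, with a² = q w and b² =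
(1 + q) w. -/
theorem speed_smooth (hn : 1 ≤ n) : ContDiffOn ℝ ∞ (fun q => √(c₂ q / (1 + q))) D := by
  have h1 : ∀ q ∈ D, 0 < 1 + q := fun q hq => by
    have := mem_Ici.1 (h.subset hq)
    positivity
  refine ((h.c_smooth hn).div (contDiffOn_const.add contDiffOn_id) fun q hq => (h1 q hq).ne').sqrt
    fun q hq => (div_pos (h.c_pos q hq) (h1 q hq)).ne'

theorem speed_pos : ∀ q ∈ D, 0 < √(c₂ q / (1 + q)) := fun q hq => by
  have h1 := mem_Ici.1 (h.subset hq)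
  have h2 := h.c_pos q hq
  positivity

/-- The square of the arclength is s = q m², a smooth function of q with derivative m r > 0.
Unbounded arclength makes it surjective onto [0, ∞), and σ is its inverse. -/
theorem exists_isProfile (hn : 1 ≤ n)
    (hunb : ∀ R : ℝ, ∃ q ∈ D, R < √q * arcFactor (fun q => √(c₂ q / (1 + q))) q) :
    ∃ σ, IsProfile n (w 0 ^ (n + 1)) Λ D (fun x => ∫ y in (0 : ℝ)..x, w y) w (derivWithin w D)
      (arcFactor fun q => √(c₂ q / (1 + q)))
      (derivWithin (arcFactor fun q => √(c₂ q / (1 + q))) D) σ := by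
  have hrs := h.speed_smooth hn
  have hrp := h.speed_pos
  have hre : ∀ q ∈ D, √(csq (w q) (derivWithin w D q) q / (1 + q)) = √(c₂ q / (1 + q)) :=
    fun q hq => by rw [h.csq_eq hn q hq]
  set r : ℝ → ℝ := fun q => √(c₂ q / (1 + q)) with hrdef
  set m := arcFactor r with hm
  have hmp : ∀ q ∈ D, 0 < m q :=
    arcFactor_pos h.subset h.mem_nhds h.zero_mem h.ordConnected hrs hrp
  have hms : ContDiffOn ℝ ∞ m D :=
    contDiffOn_arcFactor h.subset h.mem_nhds h.zero_mem h.ordConnected hrs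
  have hme : ∀ q ∈ D, m q + 2 * q * derivWithin m D q = r q :=
    arcFactor_add h.subset h.mem_nhds h.zero_mem h.ordConnected hrs
  have hmd : ∀ q ∈ D, HasDerivWithinAt m (derivWithin m D q) D q := fun q hq =>
    (hms.differentiableOn (by simp) q hq).hasDerivWithinAt
  have hfd : ∀ q ∈ D, HasDerivWithinAt (fun q => q * m q ^ 2) (m q * r q) D q := fun q hq => by
    refine ((hasDerivWithinAt_id q D).mul ((hmd q hq).pow 2)).congr_deriv ?_
    rw [← hme q hq]
    simp
    ring
  have hfc : ContinuousOn (fun q => q * m q ^ 2) D := fun q hq => (hfd q hq).continuousWithinAt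
  have hmono : StrictMonoOn (fun q => q * m q ^ 2) D := by
    refine strictMonoOn_of_deriv_pos h.ordConnected.convex hfc fun q hq => ?_
    have hqD := interior_subset hq
    rw [((hfd q hqD).hasDerivAt (mem_interior_iff_mem_nhds.1 hq)).deriv]
    exact mul_pos (hmp q hqD) (hrp q hqD)
  have hf0 : (fun q => q * m q ^ 2) 0 = 0 := by simp
  have hsurj : ∀ s : ℝ, ∃ q, 0 ≤ s → q ∈ D ∧ q * m q ^ 2 = s := by
    intro s
    by_cases hs : 0 ≤ s
    · obtain ⟨q, hq, hlt⟩ := hunb (√s)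
      have hq0 := mem_Ici.1 (h.subset hq)
      have hle : s ≤ q * m q ^ 2 := by
        have h1 : √s ^ 2 ≤ (√q * m q) ^ 2 := pow_le_pow_left₀ (Real.sqrt_nonneg _) hlt.le 2
        rwa [mul_pow, Real.sq_sqrt hs, Real.sq_sqrt hq0] at h1
      have hsub : Icc 0 q ⊆ D := h.ordConnected.out h.zero_mem hq
      obtain ⟨q', hq', he⟩ := intermediate_value_Icc hq0 (hfc.mono hsub)
        (show s ∈ Icc _ _ from ⟨by simpa using hs, hle⟩)
      exact ⟨q', fun _ => ⟨hsub hq', he⟩⟩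
    · exact ⟨0, fun h => absurd h hs⟩
  choose σ hσ using hsurj
  refine ⟨σ, { h.isEinsteinPotential hn with
    m_pos := hmp
    m_smooth := hms
    m_deriv := hmd
    m_eq := fun q hq => (hme q hq).trans (hre q hq).symm
    σ_smooth := ?_
    σ_mem := fun s hs => (hσ s hs).1
    σ_eq := fun s hs => (hσ s hs).2
    σ_inv := fun q hq => ?_ }⟩
  · exact contDiffOn_inverse (f' := fun q => m q * r q) h.subset h.mem_nhds h.zero_mem hmono hf0
      (fun s hs => (hσ s hs).1) (fun s hs => (hσ s hs).2) hfd
      (fun q hq => mul_pos (hmp q hq) (hrp q hq)) (hms.mul hrs)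
  · have h0 : 0 ≤ q * m q ^ 2 := mul_nonneg (h.subset hq) (sq_nonneg _)
    exact hmono.injOn (hσ _ h0).1 hq (hσ _ h0).2

end IsRadialSolution

end RadialSystem

/-! ### Scalar linear equations -/

section LinearEquation

/-- Multiplication by exp(-∫g) makes the solution constant. -/
theorem eq_zero_of_hasDerivAt_mul {U : Set ℝ} (hU : IsOpen U) (ho : U.OrdConnected) {f g : ℝ → ℝ}
    (hg : ContinuousOn g U) (hf : ∀ u ∈ U, HasDerivAt f (f u * g u) u) {u₀ : ℝ} (h₀ : u₀ ∈ U)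
    (hf₀ : f u₀ = 0) : ∀ u ∈ U, f u = 0 := by
  have hG : ∀ u ∈ U, HasDerivAt (fun u => ∫ s in u₀..u, g s) (g u) u := fun u hu =>
    intervalIntegral.integral_hasDerivAt_right
      ((hg.mono (ho.uIcc_subset h₀ hu)).intervalIntegrable)
      (hg.stronglyMeasurableAtFilter hU u hu) (hg.continuousAt (hU.mem_nhds hu))
  set G : ℝ → ℝ := fun u => ∫ s in u₀..u, g s
  have hd : ∀ u ∈ U, HasDerivAt (fun u => f u * Real.exp (-G u)) 0 u := fun u hu => by
    refine ((hf u hu).mul (hG u hu).neg.exp).congr_deriv ?_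
    ring
  intro u hu
  have := hU.is_const_of_deriv_eq_zero ho.isPreconnected
    (fun u hu => (hd u hu).differentiableAt.differentiableWithinAt) (fun u hu => (hd u hu).deriv)
    hu h₀
  simp only [hf₀, zero_mul] at this
  exact (mul_eq_zero.1 this).resolve_right (Real.exp_ne_zero _)

theorem pos_of_hasDerivAt_mul {U : Set ℝ} (hU : IsOpen U) (ho : U.OrdConnected) {f g : ℝ → ℝ}
    (hg : ContinuousOn g U) (hf : ∀ u ∈ U, HasDerivAt f (f u * g u) u) {u₀ : ℝ} (h₀ : u₀ ∈ U)
    (hf₀ : 0 < f u₀) : ∀ u ∈ U, 0 < f u := by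
  intro u hu
  by_contra! hle
  have hc : ContinuousOn f U := fun u hu => (hf u hu).continuousAt.continuousWithinAt
  obtain ⟨z, hz, hz0⟩ := ho.isPreconnected.intermediate_value hu h₀ hc
    (show (0 : ℝ) ∈ Icc (f u) (f u₀) from ⟨hle, hf₀.le⟩)
  exact hf₀.ne' (eq_zero_of_hasDerivAt_mul hU ho hg hf hz hz0 u₀ h₀)

theorem hasDerivAt_abs_of_mul {f : ℝ → ℝ} {g u : ℝ} (hf : HasDerivAt f (f u * g) u)
    (h0 : f u ≠ 0) : HasDerivAt (fun u => |f u|) (|f u| * g) u := by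
  rcases h0.lt_or_gt with h | h
  · refine (hf.neg.congr_of_eventuallyEq ?_).congr_deriv ?_
    · filter_upwards [hf.continuousAt.eventually_lt continuousAt_const h] with x hx
      exact abs_of_neg hx
    · rw [abs_of_neg h]
      ring
  · refine (hf.congr_of_eventuallyEq ?_).congr_deriv ?_
    · filter_upwards [continuousAt_const.eventually_lt hf.continuousAt h] with x hx
      exact abs_of_pos hx
    · rw [abs_of_pos h]

end LinearEquation

/-! ### The interval (-∞, η) -/

section Domain

variable {η : EReal}

theorem isOpen_domain (η : EReal) : IsOpen {u : ℝ | (u : EReal) < η} :=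
  isOpen_Iio.preimage continuous_coe_real_ereal

theorem mem_domain_of_le {u v : ℝ} (hv : (v : EReal) < η) (h : u ≤ v) : (u : EReal) < η :=
  (EReal.coe_le_coe_iff.2 h).trans_lt hv

theorem ordConnected_domain (η : EReal) : {u : ℝ | (u : EReal) < η}.OrdConnected :=
  ⟨fun _ _ _ hy _ hz => mem_domain_of_le hy hz.2⟩

theorem exists_gt_mem_domain {u : ℝ} (hu : (u : EReal) < η) : ∃ v : ℝ, u < v ∧ (v : EReal) < η := by
  obtain ⟨v, hv, hv'⟩ := EReal.lt_iff_exists_real_btwn.1 hu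
  exact ⟨v, EReal.coe_lt_coe_iff.1 hv, hv'⟩

theorem eventually_mem_domain (h : ⊥ < η) : ∀ᶠ u : ℝ in atBot, (u : EReal) < η := by
  obtain ⟨v, -, hv⟩ := EReal.lt_iff_exists_real_btwn.1 h
  filter_upwards [eventually_le_atBot v] with u hu using mem_domain_of_le hv hu

end Domain

/-! ### Signs along an unstable curve and the variable q -/

section Curve

variable {n : ℕ} {Λ K : ℝ} {η : EReal} {a b c : ℝ → ℝ}

namespace IsUnstableCurve

variable (h : IsUnstableCurve n Λ K η a b c)

include h

theorem tendsto_a : Tendsto a atBot (𝓝 0) := (continuous_fst.tendsto _).comp h.tendsto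

theorem tendsto_b : Tendsto b atBot (𝓝 K) :=
  ((continuous_fst.comp continuous_snd).tendsto _).comp h.tendsto

theorem tendsto_c : Tendsto c atBot (𝓝 K) :=
  ((continuous_snd.comp continuous_snd).tendsto _).comp h.tendsto

theorem continuousOn_a : ContinuousOn a {u : ℝ | (u : EReal) < η} := fun u hu =>
  (h.solution u hu).1.continuousAt.continuousWithinAt

theorem continuousOn_b : ContinuousOn b {u : ℝ | (u : EReal) < η} := fun u hu =>
  (h.solution u hu).2.1.continuousAt.continuousWithinAt

theorem continuousOn_c : ContinuousOn c {u : ℝ | (u : EReal) < η} := fun u hu =>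
  (h.solution u hu).2.2.continuousAt.continuousWithinAt

theorem b_ne_zero (hK : K ≠ 0) (u : ℝ) (hu : (u : EReal) < η) : b u ≠ 0 := by
  intro h0
  have hz := eq_zero_of_hasDerivAt_mul (isOpen_domain η) (ordConnected_domain η) (f := b)
    (g := fun u => 1 / 2 * (c u ^ 2 + a u ^ 2 - b u ^ 2))
    (continuousOn_const.mul (((h.continuousOn_c.pow 2).add (h.continuousOn_a.pow 2)).sub
      (h.continuousOn_b.pow 2)))
    (fun u hu => (h.solution u hu).2.1.congr_deriv (by ring)) hu h0
  refine hK (tendsto_nhds_unique h.tendsto_b (tendsto_const_nhds.congr' ?_))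
  filter_upwards [eventually_mem_domain h.bot_lt] with u hu using (hz u hu).symm

theorem c_ne_zero (hK : K ≠ 0) (u : ℝ) (hu : (u : EReal) < η) : c u ≠ 0 := by
  intro h0
  have hz := eq_zero_of_hasDerivAt_mul (isOpen_domain η) (ordConnected_domain η) (f := c)
    (g := fun u => 1 / 2 * n * (a u ^ 2 + b u ^ 2 - c u ^ 2 - 2 * Λ / n * a u ^ 2 * b u ^ 2))
    (continuousOn_const.mul ((((h.continuousOn_a.pow 2).add (h.continuousOn_b.pow 2)).sub
      (h.continuousOn_c.pow 2)).sub ((continuousOn_const.mul (h.continuousOn_a.pow 2)).mul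
      (h.continuousOn_b.pow 2))))
    (fun u hu => (h.solution u hu).2.2.congr_deriv (by ring)) hu h0
  refine hK (tendsto_nhds_unique h.tendsto_c (tendsto_const_nhds.congr' ?_))
  filter_upwards [eventually_mem_domain h.bot_lt] with u hu using (hz u hu).symm

/-- One zero of `a` makes it vanish identically. Then (b² - c²)² is nonincreasing and tends to 0 at
-∞, so it is zero, `b` and `c` are constant, and the curve is the critical point itself. -/
theorem a_ne_zero (u : ℝ) (hu : (u : EReal) < η) : a u ≠ 0 := by
  intro h0
  have hz := eq_zero_of_hasDerivAt_mul (isOpen_domain η) (ordConnected_domain η) (f := a)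
    (g := fun u => 1 / 2 * (b u ^ 2 + c u ^ 2 - a u ^ 2))
    (continuousOn_const.mul (((h.continuousOn_b.pow 2).add (h.continuousOn_c.pow 2)).sub
      (h.continuousOn_a.pow 2)))
    (fun u hu => (h.solution u hu).1.congr_deriv (by ring)) hu h0
  set U := {u : ℝ | (u : EReal) < η} with hUdef
  have hb : ∀ u ∈ U, HasDerivAt b (1 / 2 * b u * (c u ^ 2 - b u ^ 2)) u := fun u hu =>
    (h.solution u hu).2.1.congr_deriv (by rw [hz u hu]; ring)
  have hc : ∀ u ∈ U, HasDerivAt c (1 / 2 * n * c u * (b u ^ 2 - c u ^ 2)) u := fun u hu =>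
    (h.solution u hu).2.2.congr_deriv (by rw [hz u hu]; ring)
  have hvd : ∀ u ∈ U, HasDerivAt (fun u => (b u ^ 2 - c u ^ 2) ^ 2)
      (-(2 * (b u ^ 2 + n * c u ^ 2) * (b u ^ 2 - c u ^ 2) ^ 2)) u := fun u hu => by
    refine ((((hb u hu).pow 2).sub ((hc u hu).pow 2)).pow 2).congr_deriv ?_
    simp
    ring
  have hanti : AntitoneOn (fun u => (b u ^ 2 - c u ^ 2) ^ 2) U := by
    refine antitoneOn_of_deriv_nonpos (ordConnected_domain η).convex
      (fun u hu => (hvd u hu).continuousAt.continuousWithinAt)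
      (fun u hu => (hvd u (interior_subset hu)).differentiableAt.differentiableWithinAt)
      fun u hu => ?_
    rw [(hvd u (interior_subset hu)).deriv, neg_nonpos]
    positivity
  have hbc : ∀ u ∈ U, b u ^ 2 - c u ^ 2 = 0 := fun u hu => by
    have hlim : Tendsto (fun u => (b u ^ 2 - c u ^ 2) ^ 2) atBot (𝓝 ((K ^ 2 - K ^ 2) ^ 2)) :=
      ((h.tendsto_b.pow 2).sub (h.tendsto_c.pow 2)).pow 2
    have hle : (b u ^ 2 - c u ^ 2) ^ 2 ≤ (K ^ 2 - K ^ 2) ^ 2 := by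
      refine ge_of_tendsto hlim ?_
      filter_upwards [eventually_le_atBot u] with v hv
      exact hanti (mem_domain_of_le hu hv) hu hv
    rw [sub_self, zero_pow two_ne_zero] at hle
    exact pow_eq_zero_iff two_ne_zero |>.1 (le_antisymm hle (sq_nonneg _))
  have hconst : ∀ (f : ℝ → ℝ), (∀ u ∈ U, HasDerivAt f 0 u) → Tendsto f atBot (𝓝 K) →
      ∀ u ∈ U, f u = K := fun f hf hlim u hu => by
    refine (tendsto_nhds_unique hlim (tendsto_const_nhds.congr' ?_)).symm
    filter_upwards [eventually_mem_domain h.bot_lt] with v hv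
    exact (isOpen_domain η).is_const_of_deriv_eq_zero (ordConnected_domain η).isPreconnected
      (fun u hu => (hf u hu).differentiableAt.differentiableWithinAt) (fun u hu => (hf u hu).deriv)
      hu hv
  have hbK := hconst b (fun u hu => (hb u hu).congr_deriv (by linear_combination (-1 / 2 * b u) * hbc u hu))
    h.tendsto_b
  have hcK := hconst c (fun u hu => (hc u hu).congr_deriv (by linear_combination (1 / 2 * n * c u) * hbc u hu))
    h.tendsto_c
  obtain ⟨u, hu, hne⟩ := h.nonconstant
  exact hne (by rw [hz u hu, hbK u hu, hcK u hu])

theorem hasDerivAt_sq_a (u : ℝ) (hu : (u : EReal) < η) :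
    HasDerivAt (fun u => a u ^ 2) (a u ^ 2 * (b u ^ 2 + c u ^ 2 - a u ^ 2)) u :=
  ((h.solution u hu).1.pow 2).congr_deriv (by simp; ring)

theorem hasDerivAt_sq_b (u : ℝ) (hu : (u : EReal) < η) :
    HasDerivAt (fun u => b u ^ 2) (b u ^ 2 * (c u ^ 2 + a u ^ 2 - b u ^ 2)) u :=
  ((h.solution u hu).2.1.pow 2).congr_deriv (by simp; ring)

theorem hasDerivAt_sq_c (hn : 1 ≤ n) (u : ℝ) (hu : (u : EReal) < η) :
    HasDerivAt (fun u => c u ^ 2)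
      (c u ^ 2 * (n * (a u ^ 2 + b u ^ 2 - c u ^ 2) - 2 * Λ * a u ^ 2 * b u ^ 2)) u := by
  have : (n : ℝ) ≠ 0 := by positivity
  refine ((h.solution u hu).2.2.pow 2).congr_deriv ?_
  simp
  field_simp

theorem hasDerivAt_sub (u : ℝ) (hu : (u : EReal) < η) :
    HasDerivAt (fun u => b u ^ 2 - a u ^ 2)
      ((b u ^ 2 - a u ^ 2) * (c u ^ 2 - a u ^ 2 - b u ^ 2)) u :=
  ((h.hasDerivAt_sq_b u hu).sub (h.hasDerivAt_sq_a u hu)).congr_deriv (by ring)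

theorem tendsto_sub : Tendsto (fun u => b u ^ 2 - a u ^ 2) atBot (𝓝 (K ^ 2)) := by
  simpa using (h.tendsto_b.pow 2).sub (h.tendsto_a.pow 2)

/-- b² - a² solves a scalar linear equation, so it keeps the sign of its limit K² at -∞. -/
theorem sub_pos (hK : K ≠ 0) (u : ℝ) (hu : (u : EReal) < η) : 0 < b u ^ 2 - a u ^ 2 := by
  have hev := (h.tendsto_sub.eventually (lt_mem_nhds (show 0 < K ^ 2 by positivity))).and
    (eventually_mem_domain h.bot_lt)
  obtain ⟨v, hv, hvU⟩ := hev.exists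
  exact pos_of_hasDerivAt_mul (isOpen_domain η) (ordConnected_domain η)
    (g := fun u => c u ^ 2 - a u ^ 2 - b u ^ 2)
    (((h.continuousOn_c.pow 2).sub (h.continuousOn_a.pow 2)).sub (h.continuousOn_b.pow 2))
    h.hasDerivAt_sub hvU hv u hu

end IsUnstableCurve

/-- The function `q = a² / (b² - a²)`. -/
def ratio (a b : ℝ → ℝ) (u : ℝ) : ℝ := a u ^ 2 / (b u ^ 2 - a u ^ 2)

namespace IsUnstableCurve

variable (h : IsUnstableCurve n Λ K η a b c) (hK : K ≠ 0)

include h hK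

theorem ratio_pos (u : ℝ) (hu : (u : EReal) < η) : 0 < ratio a b u := by
  have := h.a_ne_zero u hu
  have := h.sub_pos hK u hu
  unfold ratio
  positivity

theorem sq_a_eq (u : ℝ) (hu : (u : EReal) < η) :
    a u ^ 2 = ratio a b u * (b u ^ 2 - a u ^ 2) := by
  rw [ratio, div_mul_cancel₀ _ (h.sub_pos hK u hu).ne']

theorem sq_b_eq (u : ℝ) (hu : (u : EReal) < η) :
    b u ^ 2 = (1 + ratio a b u) * (b u ^ 2 - a u ^ 2) := by
  linear_combination h.sq_a_eq hK u hu

theorem hasDerivAt_ratio (u : ℝ) (hu : (u : EReal) < η) :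
    HasDerivAt (ratio a b) (2 * b u ^ 2 * ratio a b u) u := by
  have h0 := (h.sub_pos hK u hu).ne'
  refine ((h.hasDerivAt_sq_a u hu).div (h.hasDerivAt_sub u hu) h0).congr_deriv ?_
  rw [ratio]
  field_simp
  ring

theorem tendsto_ratio : Tendsto (ratio a b) atBot (𝓝 0) := by
  have := (h.tendsto_a.pow 2).div h.tendsto_sub (by positivity)
  rw [zero_pow two_ne_zero, zero_div] at this
  exact this

theorem ratio_deriv_pos (u : ℝ) (hu : (u : EReal) < η) : 0 < 2 * b u ^ 2 * ratio a b u := by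
  have := h.b_ne_zero hK u hu
  have := h.ratio_pos hK u hu
  positivity

theorem strictMonoOn_ratio : StrictMonoOn (ratio a b) {u : ℝ | (u : EReal) < η} := by
  refine strictMonoOn_of_deriv_pos (ordConnected_domain η).convex
    (fun u hu => (h.hasDerivAt_ratio hK u hu).continuousAt.continuousWithinAt) fun u hu => ?_
  have hu' : (u : EReal) < η := interior_subset (s := {u : ℝ | (u : EReal) < η}) hu
  rw [(h.hasDerivAt_ratio hK u hu').deriv]
  exact h.ratio_deriv_pos hK u hu'

theorem exists_ratio_eq {s u : ℝ} (hs : 0 < s) (hu : (u : EReal) < η) (hsu : s < ratio a b u) :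
    ∃ v : ℝ, (v : EReal) < η ∧ ratio a b v = s := by
  obtain ⟨v, hv, hvu⟩ := (((h.tendsto_ratio hK).eventually (gt_mem_nhds hs)).and
    (eventually_le_atBot u)).exists
  have hsub : Icc v u ⊆ {u : ℝ | (u : EReal) < η} := fun x hx => mem_domain_of_le hu hx.2
  obtain ⟨x, hx, he⟩ := intermediate_value_Icc hvu
    (fun x hx => (h.hasDerivAt_ratio hK x (hsub hx)).continuousAt.continuousWithinAt)
    (show s ∈ Icc _ _ from ⟨hv.le, hsu.le⟩)
  exact ⟨x, hsub hx, he⟩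

/-- q increases strictly from the limit 0, so b² - a² and c² become functions of q. At q = 0 they
are extended by their common limit K². -/
theorem exists_isRadialSolution (hn : 1 ≤ n) : ∃ (D : Set ℝ) (w c₂ : ℝ → ℝ),
    IsRadialSolution n Λ D w c₂ ∧ ∀ u : ℝ, (u : EReal) < η → ratio a b u ∈ D ∧
      w (ratio a b u) = b u ^ 2 - a u ^ 2 ∧ c₂ (ratio a b u) = c u ^ 2 := by
  set U := {u : ℝ | (u : EReal) < η} with hU
  set q := ratio a b with hq
  -- The interval from 0 to the supremum of q along the curve; the supremum is not attained, so the
  -- interval is relatively open.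
  set D : Set ℝ := {s | 0 ≤ s ∧ ∃ u ∈ U, s < q u} with hD
  have hex : ∀ s : ℝ, ∃ v, s ∈ D → 0 < s → v ∈ U ∧ q v = s := fun s => by
    by_cases hs : s ∈ D ∧ 0 < s
    · obtain ⟨u, hu, hlt⟩ := hs.1.2
      obtain ⟨v, hv, he⟩ := h.exists_ratio_eq hK hs.2 hu hlt
      exact ⟨v, fun _ _ => ⟨hv, he⟩⟩
    · exact ⟨0, fun h1 h2 => absurd ⟨h1, h2⟩ hs⟩
  choose v hv using hex
  have hmono := h.strictMonoOn_ratio hK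
  have hqpos : ∀ u ∈ U, 0 < q u := h.ratio_pos hK
  have hqD : ∀ u ∈ U, q u ∈ D := fun u hu => by
    obtain ⟨u', hlt, hu'⟩ := exists_gt_mem_domain hu
    exact ⟨(hqpos u hu).le, u', hu', hmono hu hu' hlt⟩
  have hvq : ∀ u ∈ U, v (q u) = u := fun u hu =>
    hmono.injOn (hv _ (hqD u hu) (hqpos u hu)).1 hu (hv _ (hqD u hu) (hqpos u hu)).2
  have hDn : ∀ s ∈ D, D ∈ 𝓝[Ici 0] s := fun s hs => by
    obtain ⟨u, hu, hlt⟩ := hs.2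
    filter_upwards [self_mem_nhdsWithin, mem_nhdsWithin_of_mem_nhds (gt_mem_nhds hlt)] with x hx hx'
    exact ⟨hx, u, hu, hx'⟩
  have hDo : IsOpen (D ∩ Ioi 0) := by
    rw [isOpen_iff_mem_nhds]
    exact fun x hx => inter_mem (mem_nhds_of_pos hDn hx.1 hx.2) (Ioi_mem_nhds hx.2)
  have hvd : ∀ s ∈ D ∩ Ioi 0, HasDerivAt v (2 * b (v s) ^ 2 * q (v s))⁻¹ s :=
    hasDerivAt_inverse (isOpen_domain η) hDo hmono (fun u hu => ⟨hqD u hu, hqpos u hu⟩)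
      (fun s hs => (hv s hs.1 hs.2).1) (fun s hs => (hv s hs.1 hs.2).2) (h.hasDerivAt_ratio hK)
      (fun u hu => (h.ratio_deriv_pos hK u hu).ne')
  obtain ⟨u₁, hu₁⟩ := (eventually_mem_domain h.bot_lt).exists
  have h0D : (0 : ℝ) ∈ D := ⟨le_rfl, u₁, hu₁, hqpos u₁ hu₁⟩
  have hvlim : Tendsto v (𝓝[>] 0) atBot := by
    refine tendsto_atBot.2 fun x => ?_
    have hx' : min x u₁ ∈ U := mem_domain_of_le hu₁ (min_le_right _ _)
    filter_upwards [Ioo_mem_nhdsGT (hqpos _ hx')] with s hs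
    have hsD : s ∈ D := ⟨hs.1.le, _, hx', hs.2⟩
    obtain ⟨hvU, hve⟩ := hv s hsD hs.1
    by_contra! hlt
    have := hmono hx' hvU ((min_le_left _ _).trans_lt hlt)
    exact (this.trans_eq hve).not_gt hs.2
  -- The change of variables, stated once for both b² - a² and c².
  have hext : ∀ (f : ℝ → ℝ) (f' : ℝ → ℝ), (∀ u ∈ U, HasDerivAt f (f' u) u) →
      Tendsto f atBot (𝓝 (K ^ 2)) →
      ContinuousOn (fun s => if s = 0 then K ^ 2 else f (v s)) D ∧ ∀ s ∈ D, 0 < s →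
        HasDerivAt (fun s => if s = 0 then K ^ 2 else f (v s))
          (f' (v s) * (2 * b (v s) ^ 2 * q (v s))⁻¹) s := by
    intro f f' hf hlim
    have hd : ∀ s ∈ D, 0 < s → HasDerivAt (fun s => if s = 0 then K ^ 2 else f (v s))
          (f' (v s) * (2 * b (v s) ^ 2 * q (v s))⁻¹) s := fun s hs h0 => by
      refine ((hf _ (hv s hs h0).1).comp s (hvd s ⟨hs, h0⟩)).congr_of_eventuallyEq ?_
      filter_upwards [lt_mem_nhds h0] with x hx
      rw [if_neg hx.ne']
      rfl
    refine ⟨fun s hs => ?_, hd⟩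
    rcases hs.1.eq_or_lt with rfl | h0
    · refine ContinuousWithinAt.mono (t := Ici 0) ?_ fun s hs => hs.1
      rw [← Ioi_insert, continuousWithinAt_insert_self, ContinuousWithinAt, if_pos rfl]
      refine (hlim.comp hvlim).congr' ?_
      filter_upwards [self_mem_nhdsWithin] with x hx
      rw [if_neg (ne_of_gt hx)]
      rfl
    · exact (hd s hs h0).continuousAt.continuousWithinAt
  have hw := hext (fun u => b u ^ 2 - a u ^ 2) _ h.hasDerivAt_sub h.tendsto_sub
  have hc := hext (fun u => c u ^ 2) _ (h.hasDerivAt_sq_c hn) (h.tendsto_c.pow 2)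
  refine ⟨D, _, _, ⟨fun s hs => hs.1, hDn, h0D, ⟨fun x hx y hy z hz => ?_⟩, fun s hs => ?_,
    fun s hs => ?_, hw.1, hc.1, ?_, fun s hs h0 => ?_, fun s hs h0 => ?_⟩,
    fun u hu => ⟨hqD u hu, ?_, ?_⟩⟩
  · obtain ⟨u, hu, hlt⟩ := hy.2
    exact ⟨hx.1.trans hz.1, u, hu, hz.2.trans_lt hlt⟩
  · split_ifs with h0
    · positivity
    · exact h.sub_pos hK _ (hv s hs (hs.1.lt_of_ne' h0)).1
  · split_ifs with h0
    · positivity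
    · have := h.c_ne_zero hK _ (hv s hs (hs.1.lt_of_ne' h0)).1
      positivity
  · simp
  · refine (hw.2 s hs h0).congr_deriv ?_
    obtain ⟨hvU, hve⟩ := hv s hs h0
    have ha := h.sq_a_eq hK _ hvU
    have hb := h.sq_b_eq hK _ hvU
    have hw0 := h.sub_pos hK _ hvU
    simp only [if_neg h0.ne']
    change ratio a b (v s) = s at hve
    rw [show q (v s) = s from hve]
    rw [hve] at ha hb
    generalize b (v s) ^ 2 - a (v s) ^ 2 = W at ha hb hw0 ⊢
    rw [ha, hb]
    field_simp
    ring
  · refine (hc.2 s hs h0).congr_deriv ?_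
    obtain ⟨hvU, hve⟩ := hv s hs h0
    have ha := h.sq_a_eq hK _ hvU
    have hb := h.sq_b_eq hK _ hvU
    have hw0 := h.sub_pos hK _ hvU
    simp only [if_neg h0.ne']
    change ratio a b (v s) = s at hve
    rw [show q (v s) = s from hve]
    rw [hve] at ha hb
    generalize b (v s) ^ 2 - a (v s) ^ 2 = W at ha hb hw0 ⊢
    rw [ha, hb]
    field_simp
    ring
  · simp only [if_neg (hqpos u hu).ne', hvq u hu]
  · simp only [if_neg (hqpos u hu).ne', hvq u hu]

end IsUnstableCurve

end Curve

/-! ### Continuation of bounded solutions -/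

section Extension

/-- Bounded solutions of an autonomous equation extend. -/
theorem exists_extension {E : Type*} [NormedAddCommGroup E] [NormedSpace ℝ E]
    [FiniteDimensional ℝ E] {F : E → E} (hF : ContDiff ℝ 1 F) {x : ℝ → E} {u₀ u₁ M : ℝ}
    (h01 : u₀ < u₁) (hx : ∀ u < u₁, HasDerivAt x (F (x u)) u)
    (hM : ∀ u, u₀ ≤ u → u < u₁ → ‖x u‖ ≤ M) :
    ∃ ε > (0 : ℝ), ∃ y : ℝ → E, (∀ u < u₁ + ε, HasDerivAt y (F (y u)) u) ∧ ∀ u < u₁, y u = x u := by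
  have : CompleteSpace E := FiniteDimensional.complete ℝ E
  have : ProperSpace E := FiniteDimensional.proper ℝ E
  obtain ⟨L, hL⟩ := ((isCompact_closedBall (0 : E) M).image hF.continuous).isBounded.exists_norm_le
  have hlip : LipschitzOnWith (Real.toNNReal L) x (Ico u₀ u₁) := by
    refine (convex_Ico u₀ u₁).lipschitzOnWith_of_nnnorm_hasDerivWithin_le
      (fun u hu => (hx u hu.2).hasDerivWithinAt) fun u hu => ?_
    rw [← NNReal.coe_le_coe]
    refine le_trans ?_ (Real.le_coe_toNNReal L)
    exact hL _ (mem_image_of_mem F (mem_closedBall_zero_iff.2 (hM u hu.1 hu.2)))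
  have hle : 𝓝[<] u₁ ≤ 𝓟 (Ico u₀ u₁) := le_principal_iff.2 (Ico_mem_nhdsLT h01)
  obtain ⟨z, hz⟩ := CompleteSpace.complete ((cauchy_nhds.mono nhdsWithin_le_nhds).map_of_le
    hlip.uniformContinuousOn hle)
  -- Bounded speed makes `x` Lipschitz, so it has a limit `z` at `u₁`. A local solution through `z`
  -- continues it; at `u₁` both one-sided derivatives equal F z.
  obtain ⟨α, hα, ε, hε, hd⟩ :=
    hF.contDiffAt.exists_forall_mem_closedBall_exists_eq_forall_mem_Ioo_hasDerivAt₀ (x₀ := z) u₁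
  refine ⟨ε, hε, fun u => if u < u₁ then x u else α u, fun u hu => ?_, fun u hu => if_pos hu⟩
  rcases lt_trichotomy u u₁ with h | rfl | h
  · simp only [if_pos h]
    refine (hx u h).congr_of_eventuallyEq ?_
    filter_upwards [gt_mem_nhds h] with v hv using if_pos hv
  · simp only [lt_irrefl, if_false, hα]
    have hl : Tendsto (fun v => if v < u then x v else α v) (𝓝[<] u) (𝓝 z) := by
      refine Tendsto.congr' ?_ hz
      filter_upwards [self_mem_nhdsWithin] with v hv using (if_pos hv).symm
    have heq : ∀ v < u, HasDerivAt (fun v => if v < u then x v else α v) (F (x v)) v := fun v hv =>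
      (hx v hv).congr_of_eventuallyEq (by
        filter_upwards [gt_mem_nhds hv] with y hy using if_pos hy)
    have h1 : HasDerivWithinAt (fun v => if v < u then x v else α v) (F z) (Iic u) u := by
      refine hasDerivWithinAt_Iic_of_tendsto_deriv (s := Iio u)
        (fun v hv => (heq v hv).differentiableAt.differentiableWithinAt) ?_ self_mem_nhdsWithin ?_
      · rw [ContinuousWithinAt, if_neg (lt_irrefl u), hα]
        exact hl
      · refine ((hF.continuous.tendsto z).comp hz).congr' ?_
        filter_upwards [self_mem_nhdsWithin] with v hv using (heq v hv).deriv.symm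
    have h2 : HasDerivWithinAt (fun v => if v < u then x v else α v) (F z) (Ici u) u := by
      have := (hd u ⟨by linarith, by linarith⟩).hasDerivWithinAt (s := Ici u)
      rw [hα] at this
      exact this.congr (fun v hv => if_neg (not_lt.2 hv)) (if_neg (lt_irrefl u))
    have := h1.union h2
    rwa [Iic_union_Ici, hasDerivWithinAt_univ] at this
  · simp only [if_neg h.le.not_gt]
    refine (hd u ⟨by linarith, hu⟩).congr_of_eventuallyEq ?_
    filter_upwards [lt_mem_nhds h] with v hv using if_neg hv.le.not_gt

/-- The right-hand side of the system. -/
def field (n : ℕ) (Λ : ℝ) (x : ℝ × ℝ × ℝ) : ℝ × ℝ × ℝ :=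
  (1 / 2 * x.1 * (x.2.1 ^ 2 + x.2.2 ^ 2 - x.1 ^ 2),
    1 / 2 * x.2.1 * (x.2.2 ^ 2 + x.1 ^ 2 - x.2.1 ^ 2),
    1 / 2 * n * x.2.2 * (x.1 ^ 2 + x.2.1 ^ 2 - x.2.2 ^ 2 - 2 * Λ / n * x.1 ^ 2 * x.2.1 ^ 2))

theorem contDiff_field (n : ℕ) (Λ : ℝ) : ContDiff ℝ 1 (field n Λ) := by
  unfold field
  fun_prop

theorem isSolution_iff {n : ℕ} {Λ : ℝ} {η : EReal} {a b c : ℝ → ℝ} : IsSolution n Λ η a b c ↔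
    ∀ u : ℝ, (u : EReal) < η →
      HasDerivAt (fun u => (a u, b u, c u)) (field n Λ (a u, b u, c u)) u := by
  refine forall₂_congr fun u _ => ⟨fun h => h.1.prodMk (h.2.1.prodMk h.2.2), fun h => ?_⟩
  have h2 := h.snd
  exact ⟨h.fst, h2.fst, h2.snd⟩

end Extension

/-! ### Infinite arclength and the metric of an unstable curve -/

section Unbounded

variable {n : ℕ} {Λ K : ℝ} {η : EReal} {a b c : ℝ → ℝ}

namespace IsUnstableCurve

theorem not_bounded (h : IsUnstableCurve n Λ K η a b c) {u₀ u₁ M : ℝ} (hη : η = (u₁ : EReal))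
    (h01 : u₀ < u₁) (hM : ∀ u, u₀ ≤ u → u < u₁ → |a u| ≤ M ∧ |b u| ≤ M ∧ |c u| ≤ M) : False := by
  subst hη
  have hs := isSolution_iff.1 h.solution
  obtain ⟨ε, hε, y, hy, hyx⟩ := exists_extension (contDiff_field n Λ) (M := M) h01
    (fun u hu => hs u (EReal.coe_lt_coe_iff.2 hu)) fun u hu hu' => by
      obtain ⟨h1, h2, h3⟩ := hM u hu hu'
      exact max_le h1 (max_le h2 h3)
  refine h.maximal ((u₁ + ε : ℝ) : EReal) (fun u => (y u).1) (fun u => (y u).2.1)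
    (fun u => (y u).2.2) (EReal.coe_lt_coe_iff.2 (by linarith))
    (isSolution_iff.2 fun u hu => hy u (EReal.coe_lt_coe_iff.1 hu)) fun u hu => ?_
  have := hyx u (EReal.coe_lt_coe_iff.1 hu)
  simp [this]

variable (h : IsUnstableCurve n Λ K η a b c) (hn : 1 ≤ n) (hΛ : Λ ≤ 0) (hK : K ≠ 0)

include h hn hΛ hK

/-- A Grönwall estimate with the arclength as time: the derivative of |c| + |ab| is at most |abc|
times an affine function of itself, and |abc| du = dt. Bounded arclength thus bounds |c| and |ab|,
and b²/a² is bounded after `u₀`. -/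
theorem exists_bound {t : ℝ → ℝ} {R u₀ : ℝ} (h₀ : (u₀ : EReal) < η)
    (ht : ∀ u : ℝ, (u : EReal) < η → HasDerivAt t |a u * b u * c u| u)
    (hR : ∀ u : ℝ, (u : EReal) < η → t u ≤ R) : ∃ M : ℝ, ∀ u : ℝ, u₀ ≤ u → (u : EReal) < η →
      a u ^ 2 ≤ M ∧ b u ^ 2 ≤ M ∧ c u ^ 2 ≤ M := by
  have hq0 := h.ratio_pos hK u₀ h₀
  set q₀ := ratio a b u₀ with hq0def
  -- The value at `u₀` of b²/a² = (1 + q)/q, which bounds it afterwards because q increases.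
  set A₀ : ℝ := (1 + q₀) / q₀ with hA₀
  have hA₀pos : 0 < A₀ := by positivity
  have hb : ∀ u : ℝ, u₀ ≤ u → (u : EReal) < η → b u ^ 2 ≤ A₀ * a u ^ 2 := by
    intro u hu hu'
    have h1 : q₀ ≤ ratio a b u := (h.strictMonoOn_ratio hK).monotoneOn h₀ hu' hu
    have h2 := h.sq_a_eq hK u hu'
    have h3 := h.sub_pos hK u hu'
    have h4 : q₀ * (b u ^ 2 - a u ^ 2) ≤ a u ^ 2 :=
      (mul_le_mul_of_nonneg_right h1 h3.le).trans_eq h2.symm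
    rw [hA₀, div_mul_eq_mul_div, le_div_iff₀ hq0]
    linarith
  have hab : ∀ u : ℝ, (u : EReal) < η → HasDerivAt (fun u => |a u * b u|) (|a u * b u| * c u ^ 2) u :=
    fun u hu => hasDerivAt_abs_of_mul
      (((h.solution u hu).1.mul (h.solution u hu).2.1).congr_deriv (by simp; ring))
      (mul_ne_zero (h.a_ne_zero u hu) (h.b_ne_zero hK u hu))
  have hc : ∀ u : ℝ, (u : EReal) < η → HasDerivAt (fun u => |c u|)
      (|c u| * (n * (a u ^ 2 + b u ^ 2 - c u ^ 2) / 2 - Λ * a u ^ 2 * b u ^ 2)) u := fun u hu => by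
    refine hasDerivAt_abs_of_mul ((h.solution u hu).2.2.congr_deriv ?_) (h.c_ne_zero hK u hu)
    field_simp
  -- This constant dominates both 1 and -Λ, the coefficients of |ab|c² and of |c|a²b² in the
  -- derivative of |c| + |ab|.
  set ν : ℝ := 1 - Λ with hν
  have hν1 : 1 ≤ ν := by linarith
  set Φ : ℝ → ℝ := fun u => (n * A₀ + ν * (|c u| + |a u * b u|)) * Real.exp (-(ν * t u)) with hΦ
  have hΦd : ∀ u : ℝ, (u : EReal) < η → HasDerivAt Φ
      ((ν * (|c u| * (n * (a u ^ 2 + b u ^ 2 - c u ^ 2) / 2 - Λ * a u ^ 2 * b u ^ 2) +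
        |a u * b u| * c u ^ 2) - ν * |a u * b u * c u| * (n * A₀ + ν * (|c u| + |a u * b u|))) *
        Real.exp (-(ν * t u))) u := fun u hu => by
    refine (((((hc u hu).add (hab u hu)).const_mul ν).const_add (n * A₀)).mul
      ((ht u hu).const_mul ν).neg.exp).congr_deriv ?_
    simp only [Pi.add_apply, Pi.neg_apply]
    ring
  set S : Set ℝ := {u : ℝ | (u : EReal) < η} ∩ Ici u₀ with hS
  have hSc : Convex ℝ S := (ordConnected_domain η).convex.inter (convex_Ici u₀)
  have hanti : AntitoneOn Φ S := by
    refine antitoneOn_of_deriv_nonpos hSc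
      (fun u hu => (hΦd u hu.1).continuousAt.continuousWithinAt)
      (fun u hu => (hΦd u (interior_subset hu).1).differentiableAt.differentiableWithinAt)
      fun u hu => ?_
    obtain ⟨hu1, hu2⟩ : u ∈ S := interior_subset hu
    rw [(hΦd u hu1).deriv]
    refine mul_nonpos_of_nonpos_of_nonneg ?_ (Real.exp_pos _).le
    have hbu := hb u hu2 hu1
    have hlt := h.sub_pos hK u hu1
    have hfa : a u ^ 2 ≤ |a u * b u| := by
      refine abs_le_of_sq_le_sq' ?_ (abs_nonneg _) |>.2
      rw [sq_abs, mul_pow]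
      nlinarith [sq_nonneg (a u)]
    have hf2 : a u ^ 2 * b u ^ 2 = |a u * b u| ^ 2 := by rw [sq_abs, mul_pow]
    have hc2 : c u ^ 2 = |c u| ^ 2 := (sq_abs _).symm
    have hprod : |a u * b u * c u| = |a u * b u| * |c u| := abs_mul _ _
    have hab2 : (a u ^ 2 + b u ^ 2) / 2 ≤ A₀ * |a u * b u| :=
      calc (a u ^ 2 + b u ^ 2) / 2 ≤ b u ^ 2 := by linarith
        _ ≤ A₀ * a u ^ 2 := hbu
        _ ≤ A₀ * |a u * b u| := mul_le_mul_of_nonneg_left hfa hA₀pos.le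
    have hn0 : (0 : ℝ) ≤ n := Nat.cast_nonneg n
    have hf0 := abs_nonneg (a u * b u)
    have hg0 := abs_nonneg (c u)
    rw [hprod, mul_assoc Λ, hf2, hc2]
    generalize |a u * b u| = f at *
    generalize |c u| = g at *
    have e1 : g * (n * ((a u ^ 2 + b u ^ 2) / 2)) ≤ g * (n * (A₀ * f)) :=
      mul_le_mul_of_nonneg_left (mul_le_mul_of_nonneg_left hab2 hn0) hg0
    have e2 : 0 ≤ g * (n * g ^ 2) := by positivity
    have e3 : 0 ≤ g * f * (g * (ν - 1)) := by
      have : 0 ≤ ν - 1 := by linarith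
      positivity
    have e4 : 0 ≤ g * f * f := by positivity
    -- With f = |ab| and g = |c|, the product fg is dt/du. The term -n g³/2 has the favourable sign
    -- and is discarded.
    have : ν * (g * (n * (a u ^ 2 + b u ^ 2 - g ^ 2) / 2 - Λ * f ^ 2) + f * g ^ 2) ≤
        ν * (f * g * (n * A₀ + ν * (g + f))) := by
      refine mul_le_mul_of_nonneg_left ?_ (by linarith)
      have hΛν : Λ = 1 - ν := by rw [hν]; ring
      rw [hΛν]
      nlinarith
    linarith
  obtain ⟨N, hN⟩ : ∃ N : ℝ, N = Φ u₀ * Real.exp (ν * R) := ⟨_, rfl⟩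
  have hE : ∀ u : ℝ, u₀ ≤ u → (u : EReal) < η → |c u| ≤ N ∧ |a u * b u| ≤ N := fun u hu hu' => by
    have h1 : Φ u ≤ Φ u₀ := hanti ⟨h₀, self_mem_Ici⟩ ⟨hu', hu⟩ hu
    have h2 : (n * A₀ + ν * (|c u| + |a u * b u|)) ≤ N := by
      have h3 : n * A₀ + ν * (|c u| + |a u * b u|) = Φ u * Real.exp (ν * t u) := by
        rw [hΦ, mul_assoc, ← Real.exp_add]
        simp
      have hΦ0 : 0 ≤ Φ u₀ := by positivity
      rw [h3, hN]
      refine mul_le_mul h1 (Real.exp_le_exp.2 ?_) (Real.exp_pos _).le hΦ0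
      exact mul_le_mul_of_nonneg_left (hR u hu') (by linarith)
    have h4 : 0 ≤ n * A₀ := by positivity
    have h5 := abs_nonneg (c u)
    have h6 := abs_nonneg (a u * b u)
    constructor <;> nlinarith
  refine ⟨N + A₀ * N + N ^ 2, fun u hu hu' => ?_⟩
  obtain ⟨h1, h2⟩ := hE u hu hu'
  have h3 := h.sub_pos hK u hu'
  have hfa : a u ^ 2 ≤ |a u * b u| := by
    refine abs_le_of_sq_le_sq' ?_ (abs_nonneg _) |>.2
    rw [sq_abs, mul_pow]
    nlinarith [sq_nonneg (a u)]
  have hN0 : 0 ≤ N := (abs_nonneg _).trans h1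
  have h4 : a u ^ 2 ≤ N := hfa.trans h2
  have h5 : b u ^ 2 ≤ A₀ * N := (hb u hu hu').trans (mul_le_mul_of_nonneg_left h4 hA₀pos.le)
  have h6 : c u ^ 2 ≤ N ^ 2 := by
    rw [← sq_abs]
    exact pow_le_pow_left₀ (abs_nonneg _) h1 2
  have h7 : 0 ≤ A₀ * N := by positivity
  have h8 := sq_nonneg N
  exact ⟨by linarith, by linarith, by linarith⟩

/-- Bounded arclength bounds the curve. A finite η then contradicts maximality, and η = ∞ is
excluded by a product of powers of a, b, c that grows at least linearly in u. -/
theorem arclength_unbounded {t : ℝ → ℝ}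
    (ht : ∀ u : ℝ, (u : EReal) < η → HasDerivAt t |a u * b u * c u| u) (R : ℝ) :
    ∃ u : ℝ, (u : EReal) < η ∧ R < t u := by
  by_contra! hR
  obtain ⟨u₀, h₀⟩ := (eventually_mem_domain h.bot_lt).exists
  obtain ⟨M, hM⟩ := h.exists_bound hn hΛ hK h₀ ht hR
  have hM0 : 0 ≤ M := (sq_nonneg _).trans (hM u₀ le_rfl h₀).1
  induction η with
  | bot => exact absurd h.bot_lt (lt_irrefl _)
  | coe u₁ =>
    refine h.not_bounded (u₀ := u₀) (M := √M) rfl (EReal.coe_lt_coe_iff.1 h₀) fun u hu hu' => ?_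
    obtain ⟨h1, h2, h3⟩ := hM u hu (EReal.coe_lt_coe_iff.2 hu')
    exact ⟨Real.abs_le_sqrt h1, Real.abs_le_sqrt h2, Real.abs_le_sqrt h3⟩
  | top =>
    have hall : ∀ u : ℝ, (u : EReal) < ⊤ := EReal.coe_lt_top
    have hpos : ∀ u, 0 < a u ^ 2 ∧ 0 < b u ^ 2 ∧ 0 < c u ^ 2 := fun u => by
      have h1 := h.a_ne_zero u (hall u)
      have h2 := h.b_ne_zero hK u (hall u)
      have h3 := h.c_ne_zero hK u (hall u)
      exact ⟨by positivity, by positivity, by positivity⟩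
    have ha : Monotone (fun u => a u ^ 2) := by
      refine monotone_of_deriv_nonneg
        (fun u => (h.hasDerivAt_sq_a u (hall u)).differentiableAt) fun u => ?_
      rw [(h.hasDerivAt_sq_a u (hall u)).deriv]
      have h1 := h.sub_pos hK u (hall u)
      obtain ⟨h2, h3, h4⟩ := hpos u
      exact mul_nonneg h2.le (by linarith)
    -- The exponents are chosen so that the terms with c² cancel in the logarithmic derivative,
    -- which leaves a positive quantity at least 2a². Since `a` is nondecreasing in square, this
    -- stays away from 0.
    set Q : ℝ → ℝ := fun u => (c u ^ 2) ^ 2 * (a u ^ 2 * b u ^ 2) ^ n with hQ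
    have hQpos : ∀ u, 0 < Q u := fun u => by
      obtain ⟨h2, h3, h4⟩ := hpos u
      positivity
    have hQd : ∀ u, HasDerivAt Q
        (Q u * (2 * n * (a u ^ 2 + b u ^ 2) - 4 * Λ * a u ^ 2 * b u ^ 2)) u := fun u => by
      refine (((h.hasDerivAt_sq_c hn u (hall u)).pow 2).mul
        (((h.hasDerivAt_sq_a u (hall u)).mul (h.hasDerivAt_sq_b u (hall u))).pow n)).congr_deriv ?_
      obtain ⟨k, rfl⟩ : ∃ k, n = k + 1 := ⟨n - 1, by omega⟩
      simp only [hQ, Nat.add_sub_cancel, Pi.mul_apply, Pi.pow_apply]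
      push_cast
      ring
    have hlow : ∀ u, 0 ≤ - 4 * Λ * a u ^ 2 * b u ^ 2 := fun u => by
      obtain ⟨h2, h3, h4⟩ := hpos u
      have : 0 ≤ -Λ := by linarith
      have : 0 ≤ 4 * (-Λ) * a u ^ 2 * b u ^ 2 := by positivity
      linarith
    have hn1 : (1 : ℝ) ≤ n := by exact_mod_cast hn
    have hfac : ∀ u, 2 * a u ^ 2 ≤ 2 * n * (a u ^ 2 + b u ^ 2) - 4 * Λ * a u ^ 2 * b u ^ 2 := by
      intro u
      obtain ⟨h2, h3, h4⟩ := hpos u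
      nlinarith [hlow u]
    have hQm : Monotone Q := by
      refine monotone_of_deriv_nonneg (fun u => (hQd u).differentiableAt) fun u => ?_
      rw [(hQd u).deriv]
      exact mul_nonneg (hQpos u).le (by linarith [hfac u, (hpos u).1])
    set k : ℝ := Q u₀ * (2 * a u₀ ^ 2) with hk
    have hkpos : 0 < k := mul_pos (hQpos _) (by linarith [(hpos u₀).1])
    have hgrow : ∀ u, u₀ ≤ u → k * (u - u₀) ≤ Q u - Q u₀ := fun u hu => by
      refine (convex_Ici u₀).mul_sub_le_image_sub_of_le_deriv
        (fun u _ => (hQd u).continuousAt.continuousWithinAt)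
        (fun u _ => (hQd u).differentiableAt.differentiableWithinAt) (fun v hv => ?_) u₀ self_mem_Ici
        u hu hu
      rw [(hQd v).deriv]
      have hv' : u₀ ≤ v := interior_subset (s := Ici u₀) hv
      refine mul_le_mul (hQm hv') ?_ (by linarith [(hpos u₀).1]) (hQpos v).le
      exact (mul_le_mul_of_nonneg_left (ha hv') zero_le_two).trans (hfac v)
    have hbd : ∀ u, u₀ ≤ u → Q u ≤ M ^ 2 * (M * M) ^ n := fun u hu => by
      obtain ⟨h1, h2, h3⟩ := hM u hu (hall u)
      obtain ⟨h4, h5, h6⟩ := hpos u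
      rw [hQ]
      dsimp only
      gcongr
    -- By this time the linear growth alone reaches the upper bound for `Q`, and Q u₀ > 0 pushes it
    -- beyond.
    have hu : u₀ ≤ u₀ + (M ^ 2 * (M * M) ^ n) / k := by
      have : 0 ≤ (M ^ 2 * (M * M) ^ n) / k := by positivity
      linarith
    have e1 := hgrow _ hu
    have e2 := hbd _ hu
    rw [add_sub_cancel_left, mul_div_cancel₀ _ hkpos.ne'] at e1
    linarith [hQpos u₀]

/-- The arclength and the metric of an unstable curve. -/
theorem exists_metric : ∃ (t : ℝ → ℝ) (g : SmoothMetric (TI n) (TS n)),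
    (∀ u : ℝ, (u : EReal) < η → HasDerivAt t |a u * b u * c u| u) ∧
    Tendsto t atBot (𝓝 0) ∧
    BijOn t {u : ℝ | (u : EReal) < η} (Ioi 0) ∧
    (∀ u : ℝ, (u : EReal) < η → HasOrbitForm g (t u) (a u) (b u) (c u)) ∧
    IsInvariant g ∧ IsCompleteMetric g ∧ IsEinstein g Λ ∧ ∃ J, IsKahler g J := by
  obtain ⟨D, w, c₂, hr, hu⟩ := h.exists_isRadialSolution hK hn
  have hms := contDiffOn_arcFactor hr.subset hr.mem_nhds hr.zero_mem hr.ordConnected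
    (hr.speed_smooth hn)
  have hmd := hasDerivAt_arcFactor hr.subset hr.mem_nhds hr.zero_mem hr.ordConnected
    (hr.speed_smooth hn)
  have hmp := arcFactor_pos hr.subset hr.mem_nhds hr.zero_mem hr.ordConnected
    (hr.speed_smooth hn) hr.speed_pos
  have hex := hr.exists_isProfile hn
  set m := arcFactor fun q => √(c₂ q / (1 + q)) with hm
  set t : ℝ → ℝ := fun u => √(ratio a b u) * m (ratio a b u) with ht
  have htd : ∀ u : ℝ, (u : EReal) < η → HasDerivAt t |a u * b u * c u| u := fun u hu' => by
    obtain ⟨hD, hw, hc⟩ := hu u hu'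
    have hq := h.ratio_pos hK u hu'
    have hqd := h.hasDerivAt_ratio hK u hu'
    have hB := h.sq_b_eq hK u hu'
    have hA := h.sq_a_eq hK u hu'
    refine ((hqd.sqrt hq.ne').mul ((hmd _ hD hq).comp u hqd)).congr_deriv ?_
    -- Here a² = q w and b² = (1 + q) w enter; the right side is d√q/du times dt/d√q.
    have hval : |a u * b u * c u| = b u ^ 2 * √(ratio a b u) * √(c₂ (ratio a b u) /
        (1 + ratio a b u)) := by
      rw [← sq_eq_sq₀ (abs_nonneg _) (by positivity), sq_abs, mul_pow, mul_pow, mul_pow, mul_pow,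
        Real.sq_sqrt hq.le, Real.sq_sqrt (div_pos (hr.c_pos _ hD) (by positivity)).le, hc]
      generalize b u ^ 2 - a u ^ 2 = W at hA hB
      rw [hA, hB]
      field_simp
    rw [hval]
    have hs2 : √(ratio a b u) ^ 2 = ratio a b u := Real.sq_sqrt hq.le
    have hs0 : 0 < √(ratio a b u) := Real.sqrt_pos.2 hq
    simp only [Function.comp]
    generalize √(c₂ (ratio a b u) / (1 + ratio a b u)) = r
    generalize m (ratio a b u) = μ
    generalize √(ratio a b u) = s at hs2 hs0 ⊢
    rw [← hs2]
    field_simp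
    ring
  have htpos : ∀ u : ℝ, (u : EReal) < η → 0 < t u := fun u hu' =>
    mul_pos (Real.sqrt_pos.2 (h.ratio_pos hK u hu')) (hmp _ (hu u hu').1)
  have htlim : Tendsto t atBot (𝓝 0) := by
    have h1 : Tendsto (ratio a b) atBot (𝓝[D] 0) := by
      refine tendsto_nhdsWithin_iff.2 ⟨h.tendsto_ratio hK, ?_⟩
      filter_upwards [eventually_mem_domain h.bot_lt] with u hu' using (hu u hu').1
    have h2 := (hms.continuousOn 0 hr.zero_mem).tendsto.comp h1
    have h3 := ((Real.continuous_sqrt.tendsto 0).comp (h.tendsto_ratio hK)).mul h2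
    rw [Real.sqrt_zero, zero_mul] at h3
    exact h3
  have hunb := h.arclength_unbounded hn hΛ hK htd
  have htc : ContinuousOn t {u : ℝ | (u : EReal) < η} := fun u hu' =>
    (htd u hu').continuousAt.continuousWithinAt
  have hmono : StrictMonoOn t {u : ℝ | (u : EReal) < η} := by
    refine strictMonoOn_of_deriv_pos (ordConnected_domain η).convex htc fun u hu' => ?_
    have hu'' : (u : EReal) < η := interior_subset (s := {u : ℝ | (u : EReal) < η}) hu'
    rw [(htd u hu'').deriv]
    exact abs_pos.2 (mul_ne_zero (mul_ne_zero (h.a_ne_zero u hu'') (h.b_ne_zero hK u hu''))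
      (h.c_ne_zero hK u hu''))
  obtain ⟨σ, hσ⟩ := hex fun R => by
    obtain ⟨u, hu', hlt⟩ := hunb R
    exact ⟨_, (hu u hu').1, hlt⟩
  refine ⟨t, profileMetric hσ, htd, htlim, ⟨htpos, hmono.injOn, fun s hs => ?_⟩, fun u hu' => ?_,
    isInvariant_profileMetric hσ, isCompleteMetric_profileMetric hσ,
    isEinstein_inducedMetric _ _ _, exists_isKahler_inducedMetric _ _ _⟩
  · obtain ⟨u₁, hu₁, hlt⟩ := hunb s
    obtain ⟨u₂, h2, hle⟩ := ((htlim.eventually (gt_mem_nhds hs)).and (eventually_le_atBot u₁)).exists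
    have hsub : Icc u₂ u₁ ⊆ {u : ℝ | (u : EReal) < η} := fun x hx => mem_domain_of_le hu₁ hx.2
    obtain ⟨x, hx, he⟩ := intermediate_value_Icc hle (htc.mono hsub)
      (show s ∈ Icc _ _ from ⟨h2.le, hlt.le⟩)
    exact ⟨x, hsub hx, he⟩
  · obtain ⟨hD, hw, hc⟩ := hu u hu'
    refine hasOrbitForm_profileMetric hσ hD (h.ratio_pos hK u hu') ?_ ?_ ?_
    · rw [hw]
      exact h.sq_a_eq hK u hu'
    · rw [hw]
      exact h.sq_b_eq hK u hu'
    · rw [hr.csq_eq hn _ hD, hc]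

end IsUnstableCurve

end Unbounded

/-! ### Local existence by a monotone fixed point -/

section FixedPoint

/-- The Knaster–Tarski theorem for monotone functions with values in `[0, 1]`. -/
theorem exists_monotone_fixedPoint (T : (ℝ → ℝ) → ℝ → ℝ)
    (hT : ∀ p : ℝ → ℝ, Monotone p → (∀ x, p x ∈ Icc (0 : ℝ) 1) →
      Monotone (T p) ∧ ∀ x, T p x ∈ Icc (0 : ℝ) 1)
    (hmono : ∀ p p' : ℝ → ℝ, Monotone p → (∀ x, p x ∈ Icc (0 : ℝ) 1) → Monotone p' →
      (∀ x, p' x ∈ Icc (0 : ℝ) 1) → p ≤ p' → T p ≤ T p') :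
    ∃ p : ℝ → ℝ, Monotone p ∧ (∀ x, p x ∈ Icc (0 : ℝ) 1) ∧ T p = p := by
  have hle : Fact ((0 : ℝ) ≤ 1) := ⟨zero_le_one⟩
  have hm : ∀ p : ℝ →o Icc (0 : ℝ) 1, Monotone fun x => (p x : ℝ) := fun p x y hxy => p.mono hxy
  have hI : ∀ (p : ℝ →o Icc (0 : ℝ) 1) (x : ℝ), (p x : ℝ) ∈ Icc (0 : ℝ) 1 := fun p x => (p x).2
  let f : (ℝ →o Icc (0 : ℝ) 1) →o (ℝ →o Icc (0 : ℝ) 1) :=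
    ⟨fun p => ⟨fun x => ⟨T (fun x => p x) x, (hT _ (hm p) (hI p)).2 x⟩,
      fun x y hxy => (hT _ (hm p) (hI p)).1 hxy⟩,
      fun p p' hpp x => hmono _ _ (hm p) (hI p) (hm p') (hI p') (fun x => hpp x) x⟩
  refine ⟨fun x => f.lfp x, hm _, hI _, funext fun x => ?_⟩
  have := congrArg (fun p : ℝ →o Icc (0 : ℝ) 1 => (p x : ℝ)) f.map_lfp
  exact this

variable {n : ℕ} {κ μ : ℝ}

/-- The integrand of the volume. -/
def volumeDensity (n : ℕ) (μ : ℝ) (p : ℝ → ℝ) (y : ℝ) : ℝ :=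
  y ^ n * √(1 + y ^ 2) ^ (n - 1) * Real.exp (μ * p y)

/-- The function `ab` of `√q`, for the potential `p`. -/
def prodAB (n : ℕ) (κ μ : ℝ) (p : ℝ → ℝ) (x : ℝ) : ℝ :=
  ((n + 1) * κ * ∫ y in (0 : ℝ)..x, volumeDensity n μ p y) ^ ((n + 1 : ℝ)⁻¹)

/-- The potential as a function of `√q`. -/
def potential (n : ℕ) (κ μ : ℝ) (p : ℝ → ℝ) (x : ℝ) : ℝ :=
  ∫ y in (0 : ℝ)..x, 2 * prodAB n κ μ p y / √(1 + y ^ 2)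

theorem intervalIntegrable_volumeDensity (hμ : 0 ≤ μ) {p : ℝ → ℝ} (hp : Monotone p) (x y : ℝ) :
    IntervalIntegrable (volumeDensity n μ p) MeasureTheory.volume x y := by
  have h1 : Monotone fun y => Real.exp (μ * p y) := fun x y hxy =>
    Real.exp_le_exp.2 (mul_le_mul_of_nonneg_left (hp hxy) hμ)
  exact h1.intervalIntegrable.continuousOn_mul (Continuous.continuousOn (by fun_prop))

theorem volumeDensity_nonneg {p : ℝ → ℝ} {y : ℝ} (hy : 0 ≤ y) : 0 ≤ volumeDensity n μ p y := by
  unfold volumeDensity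
  positivity

theorem integral_volumeDensity_nonneg {p : ℝ → ℝ} {x : ℝ} (hx : 0 ≤ x) :
    0 ≤ ∫ y in (0 : ℝ)..x, volumeDensity n μ p y :=
  intervalIntegral.integral_nonneg hx fun _ hy => volumeDensity_nonneg hy.1

theorem continuous_prodAB (hμ : 0 ≤ μ) {p : ℝ → ℝ} (hp : Monotone p) :
    Continuous (prodAB n κ μ p) := by
  have h1 : Continuous fun x => ∫ y in (0 : ℝ)..x, volumeDensity n μ p y :=
    intervalIntegral.continuous_primitive (intervalIntegrable_volumeDensity hμ hp) 0
  exact (continuous_const.mul h1).rpow_const fun x => Or.inr (by positivity)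

theorem continuous_potential_integrand (hμ : 0 ≤ μ) {p : ℝ → ℝ} (hp : Monotone p) :
    Continuous fun y => 2 * prodAB n κ μ p y / √(1 + y ^ 2) :=
  (continuous_const.mul (continuous_prodAB hμ hp)).div (by fun_prop) fun y => by positivity

theorem prodAB_nonneg (hκ : 0 ≤ κ) {p : ℝ → ℝ} {x : ℝ} (hx : 0 ≤ x) : 0 ≤ prodAB n κ μ p x :=
  Real.rpow_nonneg (mul_nonneg (by positivity) (integral_volumeDensity_nonneg hx)) _

theorem prodAB_mono (hκ : 0 ≤ κ) (hμ : 0 ≤ μ) {p p' : ℝ → ℝ} (hp : Monotone p) (hp' : Monotone p')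
    (hpp : p ≤ p') {x : ℝ} (hx : 0 ≤ x) : prodAB n κ μ p x ≤ prodAB n κ μ p' x := by
  refine Real.rpow_le_rpow (mul_nonneg (by positivity) (integral_volumeDensity_nonneg hx)) ?_
    (by positivity)
  refine mul_le_mul_of_nonneg_left ?_ (by positivity)
  refine intervalIntegral.integral_mono_on hx (intervalIntegrable_volumeDensity hμ hp _ _)
    (intervalIntegrable_volumeDensity hμ hp' _ _) fun y hy => ?_
  have h0 : 0 ≤ y := hy.1
  refine mul_le_mul_of_nonneg_left ?_ (by positivity)
  exact Real.exp_le_exp.2 (mul_le_mul_of_nonneg_left (hpp y) hμ)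

/-- The operator is p ↦ w^n c² = κ exp(μp) ↦ ab ↦ the new potential, and it preserves order because
μ ≥ 0. Truncation at 1 keeps it in the complete lattice of monotone functions with values in [0, 1],
and max x 0 makes it constant on the negative axis. -/
theorem exists_potential (n : ℕ) (hκ : 0 ≤ κ) (hμ : 0 ≤ μ) : ∃ p : ℝ → ℝ, Monotone p ∧
    ∀ x, p x = min 1 (potential n κ μ p (max x 0)) := by
  have hint : ∀ p : ℝ → ℝ, Monotone p → ∀ x y, IntervalIntegrable
      (fun y => 2 * prodAB n κ μ p y / √(1 + y ^ 2)) MeasureTheory.volume x y := fun p hp x y =>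
    (continuous_potential_integrand hμ hp).intervalIntegrable x y
  have hnn : ∀ (p : ℝ → ℝ) (y : ℝ), 0 ≤ y → 0 ≤ 2 * prodAB n κ μ p y / √(1 + y ^ 2) :=
    fun p y hy => div_nonneg (mul_nonneg zero_le_two (prodAB_nonneg hκ hy)) (Real.sqrt_nonneg _)
  have hmono : ∀ p : ℝ → ℝ, Monotone p → Monotone fun x => min 1 (potential n κ μ p (max x 0)) := by
    intro p hp x y hxy
    refine min_le_min le_rfl ?_
    refine intervalIntegral.integral_mono_interval le_rfl (le_max_right x 0)
      (max_le_max hxy le_rfl) ?_ (hint p hp _ _)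
    filter_upwards [MeasureTheory.ae_restrict_mem measurableSet_Ioc] with z hz
    exact hnn p z hz.1.le
  have hnonneg : ∀ (p : ℝ → ℝ) (x : ℝ), 0 ≤ potential n κ μ p (max x 0) := fun p x =>
    intervalIntegral.integral_nonneg (le_max_right x 0) fun y hy => hnn p y hy.1
  obtain ⟨p, hp, -, he⟩ := exists_monotone_fixedPoint
    (fun p x => min 1 (potential n κ μ p (max x 0)))
    (fun p hp _ => ⟨hmono p hp, fun x => ⟨le_min zero_le_one (hnonneg p x), min_le_left _ _⟩⟩)
    (fun p p' hp _ hp' _ hpp x => min_le_min le_rfl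
      (intervalIntegral.integral_mono_on (le_max_right x 0) (hint p hp _ _) (hint p' hp' _ _)
        fun y hy => div_le_div_of_nonneg_right (mul_le_mul_of_nonneg_left
          (prodAB_mono hκ hμ hp hp' hpp hy.1) zero_le_two) (Real.sqrt_nonneg _)))
  exact ⟨p, hp, fun x => (congrFun he x).symm⟩

/-- The local solution in terms of `x = √q`: `V = ab` and `C = c²`. -/
theorem exists_local_radial (n : ℕ) (hn : 1 ≤ n) {k : ℝ} (hk : 0 < k) (hμ : 0 ≤ μ) :
    ∃ ε > (0 : ℝ), ∃ V C : ℝ → ℝ, (∀ x ∈ Ioo 0 ε, 0 < V x ∧ 0 < C x ∧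
      HasDerivAt V (C x / √(1 + x ^ 2)) x ∧
      HasDerivAt C (C x * (n * ((1 + 2 * x ^ 2) * V x / (x * √(1 + x ^ 2)) - C x) +
        2 * μ * V x ^ 2) / (√(1 + x ^ 2) * V x)) x) ∧
      Tendsto (fun x => V x / x) (𝓝[>] 0) (𝓝 k) ∧ Tendsto C (𝓝[>] 0) (𝓝 k) := by
  -- The constant w(0)^(n+1) of the first integral, for w(0) = k.
  set κ := k ^ (n + 1) with hκdef
  have hκ : 0 < κ := by positivity
  obtain ⟨p, hp, hpe⟩ := exists_potential n hκ.le hμ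
  set V := prodAB n κ μ p with hV
  have hVc : Continuous V := continuous_prodAB hμ hp
  have hTd : ∀ x, HasDerivAt (potential n κ μ p) (2 * V x / √(1 + x ^ 2)) x := fun x =>
    intervalIntegral.integral_hasDerivAt_right
      ((continuous_potential_integrand hμ hp).intervalIntegrable _ _)
      ((continuous_potential_integrand hμ hp).stronglyMeasurableAtFilter _ _)
      (continuous_potential_integrand hμ hp).continuousAt
  have hTc : Continuous (potential n κ μ p) :=
    continuous_iff_continuousAt.2 fun x => (hTd x).continuousAt
  have hpc : Continuous p := by
    rw [show p = fun x => min 1 (potential n κ μ p (max x 0)) from funext hpe]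
    exact continuous_const.min (hTc.comp (continuous_id.max continuous_const))
  have hT0 : potential n κ μ p 0 = 0 := intervalIntegral.integral_same
  have hp0 : p 0 = 0 := by
    rw [hpe, max_self, hT0]
    simp
  -- The potential is continuous and vanishes at 0, so the truncation at 1 is inactive on a short
  -- interval and `p` solves the true equation there.
  obtain ⟨ε, hε, hpε⟩ : ∃ ε > (0 : ℝ), ∀ x ∈ Ioo 0 ε, p x < 1 := by
    have : ∀ᶠ x in 𝓝[>] (0 : ℝ), p x < 1 :=
      (hpc.continuousAt.eventually (gt_mem_nhds (by rw [hp0]; exact one_pos))).filter_mono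
        nhdsWithin_le_nhds
    obtain ⟨ε, hε, h⟩ := mem_nhdsGT_iff_exists_Ioo_subset.1 this
    exact ⟨ε, hε, h⟩
  have hpd : ∀ x ∈ Ioo 0 ε, HasDerivAt p (2 * V x / √(1 + x ^ 2)) x := fun x hx => by
    refine (hTd x).congr_of_eventuallyEq ?_
    filter_upwards [Ioo_mem_nhds hx.1 hx.2] with y hy
    have h1 := hpe y
    have h2 := hpε y hy
    rw [max_eq_left hy.1.le] at h1
    rw [h1]
    refine min_eq_right (le_of_lt ?_)
    by_contra! hlt
    rw [min_eq_left hlt] at h1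
    exact h2.ne h1
  have hdc : Continuous (volumeDensity n μ p) := by
    unfold volumeDensity
    fun_prop
  set G : ℝ → ℝ := fun x => (n + 1) * κ * ∫ y in (0 : ℝ)..x, volumeDensity n μ p y with hG
  have hGd : ∀ x, HasDerivAt G ((n + 1) * κ * volumeDensity n μ p x) x := fun x =>
    (intervalIntegral.integral_hasDerivAt_right (hdc.intervalIntegrable _ _)
      (hdc.stronglyMeasurableAtFilter _ _) hdc.continuousAt).const_mul _
  have hG0 : G 0 = 0 := by simp [hG]
  have hdpos : ∀ x, 0 < x → 0 < volumeDensity n μ p x := fun x hx => by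
    unfold volumeDensity
    positivity
  have hGpos : ∀ x, 0 < x → 0 < G x := fun x hx => by
    refine mul_pos (by positivity) ?_
    exact intervalIntegral.intervalIntegral_pos_of_pos_on (hdc.intervalIntegrable _ _)
      (fun y hy => hdpos y hy.1) hx
  have hVG : ∀ x, V x = G x ^ ((n + 1 : ℝ)⁻¹) := fun x => rfl
  have hVpos : ∀ x, 0 < x → 0 < V x := fun x hx => Real.rpow_pos_of_pos (hGpos x hx) _
  have hVpow : ∀ x, 0 < x → V x ^ (n + 1) = G x := fun x hx => by
    have := Real.rpow_inv_natCast_pow (hGpos x hx).le (show n + 1 ≠ 0 by omega)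
    push_cast at this
    rw [hVG, this]
  -- Solved from the first integral w^n c² = κ exp(μp), with w = V/(x√(1+x²)).
  set C : ℝ → ℝ := fun x => κ * (√(1 + x ^ 2) ^ n * x ^ n * Real.exp (μ * p x)) / V x ^ n with hC
  have hCpos : ∀ x, 0 < x → 0 < C x := fun x hx => by
    have := hVpos x hx
    simp only [hC]
    positivity
  have hsd : ∀ x : ℝ, HasDerivAt (fun x => √(1 + x ^ 2)) (x / √(1 + x ^ 2)) x := fun x => by
    refine (((hasDerivAt_id x).pow 2).const_add 1 |>.sqrt (by simp; positivity)).congr_deriv ?_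
    simp
    field_simp
  have hVd : ∀ x, 0 < x → HasDerivAt V (C x / √(1 + x ^ 2)) x := fun x hx => by
    refine ((hGd x).rpow_const (p := (n + 1 : ℝ)⁻¹) (Or.inl (hGpos x hx).ne')).congr_deriv ?_
    have h1 : G x ^ ((n + 1 : ℝ)⁻¹ - 1) = V x / G x := by
      rw [Real.rpow_sub_one (hGpos x hx).ne', hVG]
    rw [h1, ← hVpow x hx]
    have h2 := hVpos x hx
    have h3 : √(1 + x ^ 2) ^ n = √(1 + x ^ 2) ^ (n - 1) * √(1 + x ^ 2) := by
      rw [← pow_succ, Nat.sub_add_cancel hn]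
    simp only [hC, volumeDensity, h3]
    field_simp
    ring
  have hlim : Tendsto (fun x => V x / x) (𝓝[>] 0) (𝓝 k) := by
    -- `G` is V^(n+1), and near 0 its derivative is asymptotic to (n + 1)κx^n.
    have key : Tendsto (fun x => G x / x ^ (n + 1)) (𝓝[>] 0) (𝓝 κ) := by
      refine HasDerivAt.lhopital_zero_nhdsGT (f' := fun x => (n + 1) * κ * volumeDensity n μ p x)
        (g' := fun x => (n + 1) * x ^ n) (Eventually.of_forall hGd) (Eventually.of_forall fun x => ?_)
        ?_ ?_ ?_ ?_
      · refine (hasDerivAt_pow (n + 1) x).congr_deriv (by simp)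
      · filter_upwards [self_mem_nhdsWithin] with x hx
        have : (0 : ℝ) < x := hx
        positivity
      · have := (hGd 0).continuousAt.tendsto
        rw [hG0] at this
        exact this.mono_left nhdsWithin_le_nhds
      · have := (continuous_pow (M := ℝ) (n + 1)).tendsto 0
        rw [zero_pow (by omega)] at this
        exact this.mono_left nhdsWithin_le_nhds
      · have h1 : Continuous fun x => κ * (√(1 + x ^ 2) ^ (n - 1) * Real.exp (μ * p x)) := by
          fun_prop
        have h2 := h1.tendsto 0
        simp only [hp0] at h2
        norm_num at h2
        refine (h2.mono_left nhdsWithin_le_nhds).congr' ?_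
        filter_upwards [self_mem_nhdsWithin] with x hx
        have : (0 : ℝ) < x := hx
        simp only [volumeDensity]
        field_simp
    have h1 := (Real.continuousAt_rpow_const κ ((n + 1 : ℝ)⁻¹) (Or.inl hκ.ne')).tendsto.comp key
    have h2 : κ ^ ((n + 1 : ℝ)⁻¹) = k := by
      have := Real.pow_rpow_inv_natCast hk.le (show n + 1 ≠ 0 by omega)
      push_cast at this
      exact this
    rw [h2] at h1
    refine h1.congr' ?_
    filter_upwards [self_mem_nhdsWithin] with x hx
    have hx0 : (0 : ℝ) < x := hx
    have h3 := Real.pow_rpow_inv_natCast hx0.le (show n + 1 ≠ 0 by omega)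
    push_cast at h3
    simp only [Function.comp]
    rw [Real.div_rpow (hGpos x hx0).le (by positivity), h3, hVG]
  refine ⟨ε, hε, V, C, fun x hx => ⟨hVpos x hx.1, hCpos x hx.1, hVd x hx.1, ?_⟩, hlim, ?_⟩
  · have h1 := hVpos x hx.1
    have h0 := hx.1
    refine (((((hsd x).pow n).mul (hasDerivAt_pow n x)).mul ((hpd x hx).const_mul μ).exp).const_mul
      κ).div ((hVd x hx.1).pow n) (pow_pos h1 n).ne' |>.congr_deriv ?_
    obtain ⟨j, rfl⟩ : ∃ j, n = j + 1 := ⟨n - 1, by omega⟩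
    simp only [Pi.mul_apply, Pi.pow_apply, Nat.add_sub_cancel]
    have hs : 0 < √(1 + x ^ 2) := by positivity
    have hs2 : √(1 + x ^ 2) ^ 2 = 1 + x ^ 2 := Real.sq_sqrt (by positivity)
    have hCx : C x * V x ^ (j + 1) =
        κ * (√(1 + x ^ 2) ^ (j + 1) * x ^ (j + 1) * Real.exp (μ * p x)) :=
      div_mul_cancel₀ _ (by positivity)
    have hE : κ * Real.exp (μ * p x) =
        C x * V x ^ (j + 1) / (√(1 + x ^ 2) ^ (j + 1) * x ^ (j + 1)) := by
      rw [hCx]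
      field_simp
    generalize C x = c at *
    generalize V x = v at *
    generalize √(1 + x ^ 2) = s at *
    generalize Real.exp (μ * p x) = e at *
    have he : e = c * v ^ (j + 1) / (s ^ (j + 1) * x ^ (j + 1)) / κ := by
      rw [← hE]
      field_simp
    rw [he]
    have hx2 : 1 + 2 * x ^ 2 = s ^ 2 + x ^ 2 := by linarith
    rw [hx2]
    field_simp
    push_cast
    ring
  · have h1 : Continuous fun x => κ * (√(1 + x ^ 2) ^ n * Real.exp (μ * p x)) := by fun_prop
    have h2 := h1.tendsto 0
    simp only [hp0] at h2
    norm_num at h2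
    have h3 := (h2.mono_left (nhdsWithin_le_nhds (s := Ioi 0))).div (hlim.pow n) (by positivity)
    have h4 : κ / k ^ n = k := by
      rw [hκdef, pow_succ]
      field_simp
    rw [h4] at h3
    refine h3.congr' ?_
    filter_upwards [self_mem_nhdsWithin] with x hx
    have hx0 : (0 : ℝ) < x := hx
    have := hVpos x hx0
    simp only [hC, Pi.div_apply]
    rw [div_pow]
    field_simp

end FixedPoint

/-! ### Existence of unstable curves -/

section Existence

/-- A trajectory on the line which emanates from the zero `0` of the vector field `ψ`. -/
theorem exists_trajectory {ψ : ℝ → ℝ} {ε L : ℝ} (hε : 0 < ε) (hψ : ContinuousOn ψ (Ioo 0 ε))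
    (hpos : ∀ x ∈ Ioo 0 ε, 0 < ψ x) (hlim : Tendsto (fun x => ψ x / x) (𝓝[>] 0) (𝓝 L)) :
    ∃ x : ℝ → ℝ, (∀ u < 0, x u ∈ Ioo 0 ε ∧ HasDerivAt x (ψ (x u)) u) ∧
      Tendsto x atBot (𝓝[>] 0) := by
  obtain ⟨x₁, hx₁⟩ : ∃ x₁, x₁ ∈ Ioo 0 ε := ⟨ε / 2, by constructor <;> linarith⟩
  have hsub : Ioo 0 x₁ ⊆ Ioo 0 ε := Ioo_subset_Ioo_right hx₁.2.le
  have hc : ContinuousOn (fun x => (ψ x)⁻¹) (Ioo 0 ε) := hψ.inv₀ fun x hx => (hpos x hx).ne'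
  -- The time the flow takes from `x₁` to x; its inverse is the trajectory.
  set Y : ℝ → ℝ := fun x => ∫ s in x₁..x, (ψ s)⁻¹ with hY
  have hYd : ∀ x ∈ Ioo 0 ε, HasDerivAt Y (ψ x)⁻¹ x := fun x hx =>
    intervalIntegral.integral_hasDerivAt_right
      ((hc.mono (ordConnected_Ioo.uIcc_subset hx₁ hx)).intervalIntegrable)
      (hc.stronglyMeasurableAtFilter isOpen_Ioo x hx) (hc.continuousAt (isOpen_Ioo.mem_nhds hx))
  have hYc : ContinuousOn Y (Ioo 0 ε) := fun x hx => (hYd x hx).continuousAt.continuousWithinAt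
  have hYm : StrictMonoOn Y (Ioo 0 ε) := by
    refine strictMonoOn_of_deriv_pos (convex_Ioo 0 ε) hYc fun x hx => ?_
    rw [interior_Ioo] at hx
    rw [(hYd x hx).deriv]
    exact inv_pos.2 (hpos x hx)
  have hY0 : Y x₁ = 0 := intervalIntegral.integral_same
  obtain ⟨δ, hδ, hδψ⟩ : ∃ δ ∈ Ioo 0 ε, ∀ x ∈ Ioc 0 δ, ψ x ≤ (|L| + 1) * x := by
    have h1 : ∀ᶠ x in 𝓝[>] (0 : ℝ), ψ x / x < |L| + 1 :=
      hlim.eventually (gt_mem_nhds (by linarith [le_abs_self L]))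
    obtain ⟨δ, hδ, h⟩ := mem_nhdsGT_iff_exists_Ioc_subset.1 h1
    refine ⟨min δ x₁, ⟨lt_min hδ hx₁.1, (min_le_right _ _).trans_lt hx₁.2⟩, fun x hx => ?_⟩
    have := h ⟨hx.1, hx.2.trans (min_le_left _ _)⟩
    exact ((div_lt_iff₀ hx.1).1 this).le
  set M := |L| + 1 with hM
  have hM0 : 0 < M := by positivity
  -- Since ψ is at most linear near 0, the time to reach 0 backwards diverges at least
  -- logarithmically, so the trajectory reaches back to -∞.
  have hlow : ∀ x ∈ Ioc 0 δ, Y x ≤ Y δ + (Real.log x - Real.log δ) / M := by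
    intro x hx
    have hIcc : Icc x δ ⊆ Ioo 0 ε := fun y hy => ⟨hx.1.trans_le hy.1, hy.2.trans_lt hδ.2⟩
    have hd : ∀ y ∈ Icc x δ, HasDerivAt (fun y => Y y - Real.log y / M) ((ψ y)⁻¹ - y⁻¹ / M) y :=
      fun y hy => (hYd y (hIcc hy)).sub ((Real.hasDerivAt_log (hIcc hy).1.ne').div_const M)
    have hmono : MonotoneOn (fun y => Y y - Real.log y / M) (Icc x δ) := by
      refine monotoneOn_of_deriv_nonneg (convex_Icc x δ)
        (fun y hy => (hd y hy).continuousAt.continuousWithinAt)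
        (fun y hy => (hd y (interior_subset hy)).differentiableAt.differentiableWithinAt)
        fun y hy => ?_
      have hy' := interior_subset hy
      rw [(hd y hy').deriv, sub_nonneg, div_eq_mul_inv, ← mul_inv, mul_comm]
      have hy0 := (hIcc hy').1
      exact inv_anti₀ (hpos y (hIcc hy')) (hδψ y ⟨hy0, hy'.2⟩)
    have := hmono ⟨le_rfl, hx.2⟩ ⟨hx.2, le_rfl⟩ hx.2
    simp only at this
    rw [sub_div]
    linarith
  have hYlim : Tendsto Y (𝓝[>] 0) atBot := by
    have h1 : Tendsto (fun x => Y δ + (Real.log x - Real.log δ) / M) (𝓝[>] 0) atBot := by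
      refine tendsto_atBot_add_const_left _ _ (Tendsto.atBot_div_const hM0 ?_)
      exact tendsto_atBot_add_const_right _ _ Real.tendsto_log_nhdsGT_zero
    refine tendsto_atBot_mono' _ ?_ h1
    filter_upwards [Ioc_mem_nhdsGT hδ.1] with x hx using hlow x hx
  have hsurj : ∀ u : ℝ, ∃ x, u < 0 → x ∈ Ioo 0 x₁ ∧ Y x = u := fun u => by
    by_cases hu : u < 0
    · obtain ⟨x₂, h2, h2'⟩ := ((hYlim.eventually (eventually_lt_atBot u)).and
        (Ioo_mem_nhdsGT hx₁.1)).exists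
      obtain ⟨x, hx, he⟩ := intermediate_value_Ioo h2'.2.le
        (hYc.mono fun y hy => ⟨h2'.1.trans_le hy.1, hy.2.trans_lt hx₁.2⟩)
        (show u ∈ Ioo _ _ from ⟨h2, by rwa [hY0]⟩)
      exact ⟨x, fun _ => ⟨⟨h2'.1.trans hx.1, hx.2⟩, he⟩⟩
    · exact ⟨0, fun h => absurd h hu⟩
  choose x hx using hsurj
  have hmaps : MapsTo Y (Ioo 0 x₁) (Iio 0) := fun y hy => by
    rw [mem_Iio, ← hY0]
    exact hYm (hsub hy) hx₁ hy.2
  refine ⟨x, fun u hu => ⟨hsub (hx u hu).1, ?_⟩, tendsto_nhdsWithin_iff.2 ⟨?_, ?_⟩⟩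
  · have := hasDerivAt_inverse isOpen_Ioo isOpen_Iio (hYm.mono hsub) hmaps
      (fun u hu => (hx u hu).1) (fun u hu => (hx u hu).2) (fun y hy => hYd y (hsub hy))
      (fun y hy => inv_ne_zero (hpos y (hsub hy)).ne') u hu
    rwa [inv_inv] at this
  · refine tendsto_order.2 ⟨fun y hy => ?_, fun y hy => ?_⟩
    · filter_upwards [eventually_lt_atBot 0] with u hu using hy.trans (hx u hu).1.1
    · have hm : min y x₁ / 2 ∈ Ioo 0 x₁ := by
        have h1 := lt_min hy hx₁.1
        exact ⟨by linarith, by linarith [min_le_right y x₁]⟩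
      filter_upwards [eventually_lt_atBot (Y (min y x₁ / 2)), eventually_lt_atBot 0] with u hu hu0
      have h1 : x u < min y x₁ / 2 := by
        by_contra! hle
        have := hYm.monotoneOn (hsub hm) (hsub (hx u hu0).1) hle
        rw [(hx u hu0).2] at this
        exact this.not_gt hu
      linarith [min_le_left y x₁, hm.1]
  · filter_upwards [eventually_lt_atBot 0] with u hu using (hx u hu).1.1

/-- From V = ab and C = c² as functions of x = √q one recovers a² = xV/√(1+x²) and b² = √(1+x²)V/x.
The equation q' = 2b²q becomes x' = √(1+x²)V, whose right side is asymptotic to K²x at 0. -/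
theorem exists_local_solution (n : ℕ) (hn : 1 ≤ n) {Λ K : ℝ} (hΛ : Λ ≤ 0) (hK : K ≠ 0) :
    ∃ a b c : ℝ → ℝ, IsSolution n Λ ((0 : ℝ) : EReal) a b c ∧
      Tendsto (fun u => (a u, b u, c u)) atBot (𝓝 (0, K, K)) ∧ ∀ u < 0, a u ≠ 0 := by
  obtain ⟨ε, hε, V, C, hVC, hV, hC⟩ := exists_local_radial (μ := -Λ) n hn
    (show 0 < K ^ 2 by positivity) (by linarith)
  have hsc : Continuous fun x : ℝ => √(1 + x ^ 2) := by fun_prop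
  have hs1 : Tendsto (fun x : ℝ => √(1 + x ^ 2)) (𝓝[>] 0) (𝓝 1) := by
    have := hsc.tendsto 0
    norm_num at this
    exact this.mono_left nhdsWithin_le_nhds
  have hs0 : ∀ x : ℝ, 0 < √(1 + x ^ 2) := fun x => by positivity
  obtain ⟨x, hx, hxlim⟩ := exists_trajectory (ψ := fun x => √(1 + x ^ 2) * V x) (L := K ^ 2) hε
    (hsc.continuousOn.mul fun x hx => (hVC x hx).2.2.1.continuousAt.continuousWithinAt)
    (fun x hx => mul_pos (hs0 x) (hVC x hx).1)
    (by simpa [mul_div_assoc] using hs1.mul hV)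
  set s : ℝ → ℝ := fun u => √(1 + x u ^ 2) with hs
  have hsq : ∀ u, s u ^ 2 = 1 + x u ^ 2 := fun u => Real.sq_sqrt (by positivity)
  have hsu : ∀ u, 0 < s u := fun u => hs0 _
  have hxd : ∀ u < 0, HasDerivAt x (s u * V (x u)) u := fun u hu => (hx u hu).2
  have hsd : ∀ u < 0, HasDerivAt s (x u * V (x u)) u := fun u hu => by
    refine ((((hxd u hu).pow 2).const_add 1).sqrt (by simp; positivity)).congr_deriv ?_
    have := hsu u
    simp only [hs] at *
    simp
    field_simp
  have hVd : ∀ u < 0, HasDerivAt (fun u => V (x u)) (C (x u) * V (x u)) u := fun u hu => by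
    refine ((hVC _ (hx u hu).1).2.2.1.comp u (hxd u hu)).congr_deriv ?_
    have := hsu u
    simp only [hs] at *
    field_simp
  set A : ℝ → ℝ := fun u => x u * V (x u) / s u with hA
  set B : ℝ → ℝ := fun u => s u * V (x u) / x u with hB
  have hApos : ∀ u < 0, 0 < A u := fun u hu =>
    div_pos (mul_pos (hx u hu).1.1 (hVC _ (hx u hu).1).1) (hsu u)
  have hBpos : ∀ u < 0, 0 < B u := fun u hu =>
    div_pos (mul_pos (hsu u) (hVC _ (hx u hu).1).1) (hx u hu).1.1
  have hAd : ∀ u < 0, HasDerivAt A (A u * (B u + C (x u) - A u)) u := fun u hu => by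
    refine (((hxd u hu).mul (hVd u hu)).div (hsd u hu) (hsu u).ne').congr_deriv ?_
    have h1 := hsu u
    have h2 := (hx u hu).1.1
    simp only [hA, hB, Pi.mul_apply]
    field_simp
  have hBd : ∀ u < 0, HasDerivAt B (B u * (C (x u) + A u - B u)) u := fun u hu => by
    have h2 := (hx u hu).1.1
    refine (((hsd u hu).mul (hVd u hu)).div (hxd u hu) h2.ne').congr_deriv ?_
    have h1 := hsu u
    simp only [hA, hB, Pi.mul_apply]
    field_simp
    ring
  have hCd : ∀ u < 0, HasDerivAt (fun u => C (x u))
      (C (x u) * (n * (A u + B u - C (x u)) - 2 * Λ * A u * B u)) u := fun u hu => by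
    have h2 := (hx u hu).1.1
    have h3 := (hVC _ (hx u hu).1).1
    refine ((hVC _ (hx u hu).1).2.2.2.comp u (hxd u hu)).congr_deriv ?_
    have h1 := hsu u
    have h4 : 1 + 2 * x u ^ 2 = s u ^ 2 + x u ^ 2 := by rw [hsq]; ring
    rw [h4]
    change C (x u) * (n * ((s u ^ 2 + x u ^ 2) * V (x u) / (x u * s u) - C (x u)) +
      2 * -Λ * V (x u) ^ 2) / (s u * V (x u)) * (s u * V (x u)) = _
    simp only [hA, hB]
    field_simp
    ring
  have hn0 : (n : ℝ) ≠ 0 := by positivity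
  have hsqrt : ∀ {f : ℝ → ℝ} {g u : ℝ}, 0 < f u → HasDerivAt f (f u * g) u →
      HasDerivAt (fun u => √(f u)) (1 / 2 * √(f u) * g) u := fun {f g u} h0 hf => by
    refine (hf.sqrt h0.ne').congr_deriv ?_
    have h1 := Real.sqrt_pos.2 h0
    have h2 := Real.sq_sqrt h0.le
    rw [div_eq_iff (by positivity)]
    linear_combination (-g) * h2
  -- The system is invariant under a common change of sign of b and c, which lets them take the sign
  -- of `K`.
  have hKs : ∃ κ : ℝ, κ ^ 2 = 1 ∧ κ * √(K ^ 2) = K := by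
    rw [Real.sqrt_sq_eq_abs]
    rcases abs_choice K with h | h
    · exact ⟨1, by norm_num, by rw [h, one_mul]⟩
    · exact ⟨-1, by norm_num, by rw [h]; ring⟩
  obtain ⟨κ, hκ, hκK⟩ := hKs
  refine ⟨fun u => √(A u), fun u => κ * √(B u), fun u => κ * √(C (x u)), fun u hu => ?_, ?_,
    fun u hu => (Real.sqrt_pos.2 (hApos u hu)).ne'⟩
  · have hu : u < 0 := EReal.coe_lt_coe_iff.1 hu
    have hCpos := (hVC _ (hx u hu).1).2.1
    simp only [mul_pow, hκ, one_mul, Real.sq_sqrt (hApos u hu).le, Real.sq_sqrt (hBpos u hu).le,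
      Real.sq_sqrt hCpos.le]
    refine ⟨hsqrt (hApos u hu) (hAd u hu),
      ((hsqrt (hBpos u hu) (hBd u hu)).const_mul κ).congr_deriv (by ring),
      ((hsqrt (f := fun u => C (x u)) hCpos (hCd u hu)).const_mul κ).congr_deriv ?_⟩
    field_simp
  · have hxl : Tendsto x atBot (𝓝 0) := hxlim.mono_right nhdsWithin_le_nhds
    have hsl : Tendsto s atBot (𝓝 1) := hs1.comp hxlim
    have hVl : Tendsto (fun u => V (x u) / x u) atBot (𝓝 (K ^ 2)) := hV.comp hxlim
    have hev : ∀ᶠ u : ℝ in atBot, 0 < x u := by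
      filter_upwards [eventually_lt_atBot 0] with u hu using (hx u hu).1.1
    have hBl : Tendsto B atBot (𝓝 (K ^ 2)) := by
      have := hsl.mul hVl
      rw [one_mul] at this
      exact this.congr fun u => by simp only [hB, mul_div_assoc]
    have hAl : Tendsto A atBot (𝓝 0) := by
      have := ((hxl.pow 2).mul hVl).div hsl one_ne_zero
      rw [zero_pow two_ne_zero, zero_mul, zero_div] at this
      refine this.congr' ?_
      filter_upwards [hev] with u hu
      simp only [hA, Pi.div_apply]
      field_simp
    have hCl : Tendsto (fun u => C (x u)) atBot (𝓝 (K ^ 2)) := hC.comp hxlim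
    have h1 := (Real.continuous_sqrt.tendsto 0).comp hAl
    rw [Real.sqrt_zero] at h1
    have h2 := ((Real.continuous_sqrt.tendsto _).comp hBl).const_mul κ
    have h3 := ((Real.continuous_sqrt.tendsto _).comp hCl).const_mul κ
    rw [hκK] at h2 h3
    exact h1.prodMk_nhds (h2.prodMk_nhds h3)

/-- Every solution extends to a maximal interval. -/
theorem exists_maximal_solution {n : ℕ} {Λ : ℝ} {η₀ : EReal} {x₀ : ℝ → ℝ × ℝ × ℝ}
    (h₀ : ∀ u : ℝ, (u : EReal) < η₀ → HasDerivAt x₀ (field n Λ (x₀ u)) u) :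
    ∃ (η : EReal) (x : ℝ → ℝ × ℝ × ℝ), η₀ ≤ η ∧ (∀ u : ℝ, (u : EReal) < η₀ → x u = x₀ u) ∧
      (∀ u : ℝ, (u : EReal) < η → HasDerivAt x (field n Λ (x u)) u) ∧
      ∀ (η' : EReal) (x' : ℝ → ℝ × ℝ × ℝ), η < η' →
        (∀ u : ℝ, (u : EReal) < η' → HasDerivAt x' (field n Λ (x' u)) u) →
        ¬ ∀ u : ℝ, (u : EReal) < η → x' u = x u := by
  -- Solutions that extend `x₀`, ordered by extension. Beyond its interval a function is arbitrary,
  -- so the relation is only a preorder, which is enough for Zorn's lemma.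
  let T := {p : EReal × (ℝ → ℝ × ℝ × ℝ) // η₀ ≤ p.1 ∧
    (∀ u : ℝ, (u : EReal) < η₀ → p.2 u = x₀ u) ∧
    ∀ u : ℝ, (u : EReal) < p.1 → HasDerivAt p.2 (field n Λ (p.2 u)) u}
  let r : T → T → Prop := fun p p' => p.1.1 ≤ p'.1.1 ∧
    ∀ u : ℝ, (u : EReal) < p.1.1 → p'.1.2 u = p.1.2 u
  have hchain : ∀ S : Set T, IsChain r S → ∃ ub, ∀ p ∈ S, r p ub := fun S hS => by
    have hagree : ∀ p ∈ S, ∀ p' ∈ S, ∀ u : ℝ, (u : EReal) < p.1.1 → (u : EReal) < p'.1.1 →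
        p.1.2 u = p'.1.2 u := fun p hp p' hp' u hu hu' => by
      rcases eq_or_ne p p' with rfl | hne
      · rfl
      · rcases hS hp hp' hne with h | h
        · exact (h.2 u hu).symm
        · exact h.2 u hu'
    rcases S.eq_empty_or_nonempty with rfl | ⟨p₀, hp₀⟩
    · exact ⟨⟨(η₀, x₀), le_rfl, fun _ _ => rfl, h₀⟩, fun p hp => absurd hp (notMem_empty p)⟩
    -- The members of a chain agree on common intervals, so they glue to a solution up to the
    -- supremum of their end points.
    · set ηs : EReal := sSup ((fun p : T => p.1.1) '' S) with hηs
      have hle : ∀ p ∈ S, p.1.1 ≤ ηs := fun p hp => le_sSup (mem_image_of_mem _ hp)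
      have hex : ∀ u : ℝ, ∃ p ∈ S, (u : EReal) < ηs → (u : EReal) < p.1.1 := fun u => by
        by_cases hu : (u : EReal) < ηs
        · obtain ⟨-, ⟨p, hp, rfl⟩, hlt⟩ := lt_sSup_iff.1 hu
          exact ⟨p, hp, fun _ => hlt⟩
        · exact ⟨p₀, hp₀, fun h => absurd h hu⟩
      choose P hPS hP using hex
      have hag : ∀ p ∈ S, ∀ u : ℝ, (u : EReal) < p.1.1 → (P u).1.2 u = p.1.2 u := fun p hp u hu =>
        hagree _ (hPS u) p hp u (hP u (hu.trans_le (hle p hp))) hu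
      refine ⟨⟨(ηs, fun u => (P u).1.2 u), p₀.2.1.trans (hle p₀ hp₀), fun u hu => ?_,
        fun u hu => ?_⟩, fun p hp => ⟨hle p hp, hag p hp⟩⟩
      · exact (hag p₀ hp₀ u (hu.trans_le p₀.2.1)).trans (p₀.2.2.1 u hu)
      · refine ((P u).2.2.2 u (hP u hu)).congr_of_eventuallyEq ?_
        filter_upwards [(isOpen_domain (P u).1.1).mem_nhds (hP u hu)] with v hv
        exact hag _ (hPS u) v hv
  obtain ⟨m, hm⟩ := exists_maximal_of_chains_bounded hchain fun {p p' p''} h h' =>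
    ⟨h.1.trans h'.1, fun u hu => (h'.2 u (hu.trans_le h.1)).trans (h.2 u hu)⟩
  refine ⟨m.1.1, m.1.2, m.2.1, m.2.2.1, m.2.2.2, fun η' x' hlt hx' hag => ?_⟩
  let p' : T := ⟨(η', x'), m.2.1.trans hlt.le, fun u hu =>
    (hag u (hu.trans_le m.2.1)).trans (m.2.2.1 u hu), hx'⟩
  exact (hm p' ⟨hlt.le, hag⟩).1.not_gt hlt

theorem exists_isUnstableCurve (n : ℕ) (hn : 1 ≤ n) {Λ K : ℝ} (hΛ : Λ ≤ 0) (hK : K ≠ 0) :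
    ∃ (η : EReal) (a b c : ℝ → ℝ), IsUnstableCurve n Λ K η a b c := by
  obtain ⟨a, b, c, hs, hlim, ha⟩ := exists_local_solution n hn hΛ hK
  obtain ⟨η, x, hle, heq, hd, hmax⟩ := exists_maximal_solution (isSolution_iff.1 hs)
  refine ⟨η, fun u => (x u).1, fun u => (x u).2.1, fun u => (x u).2.2,
    (EReal.bot_lt_coe 0).trans_le hle, isSolution_iff.2 hd, ?_, ?_, fun η' a' b' c' hlt hs' hag => ?_⟩
  · refine hlim.congr' ?_
    filter_upwards [eventually_lt_atBot 0] with u hu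
    exact (heq u (EReal.coe_lt_coe_iff.2 hu)).symm
  · have hu : ((-1 : ℝ) : EReal) < ((0 : ℝ) : EReal) := EReal.coe_lt_coe_iff.2 (by norm_num)
    refine ⟨-1, hu.trans_le hle, fun h => ha (-1) (by norm_num) ?_⟩
    exact (congrArg Prod.fst (heq (-1) hu)).symm.trans (congrArg Prod.fst h)
  · refine hmax η' _ hlt (isSolution_iff.1 hs') fun u hu => ?_
    obtain ⟨h1, h2, h3⟩ := hag u hu
    exact Prod.ext h1 (Prod.ext h2 h3)

end Existence
end TSphere

end

theorem theorem1 (n : ℕ) (hn : 1 ≤ n) (Λ K : ℝ) (hΛ : Λ ≤ 0) (hK : K ≠ 0) :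
    (∃ (η : EReal) (a b c : ℝ → ℝ), TSphere.IsUnstableCurve n Λ K η a b c) ∧
    ∀ (η : EReal) (a b c : ℝ → ℝ), TSphere.IsUnstableCurve n Λ K η a b c →
      ∃ (t : ℝ → ℝ) (g : TSphere.SmoothMetric (TSphere.TI n) (TSphere.TS n)),
        (∀ u : ℝ, (u : EReal) < η → HasDerivAt t |a u * b u * c u| u) ∧
        Tendsto t atBot (𝓝 0) ∧
        BijOn t {u : ℝ | (u : EReal) < η} (Ioi 0) ∧
        (∀ u : ℝ, (u : EReal) < η → TSphere.HasOrbitForm g (t u) (a u) (b u) (c u)) ∧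
        TSphere.IsInvariant g ∧
        TSphere.IsCompleteMetric g ∧
        TSphere.IsEinstein g Λ ∧
        ∃ J, TSphere.IsKahler g J :=
  ⟨TSphere.exists_isUnstableCurve n hn hΛ hK, fun _ _ _ _ h => h.exists_metric hn hΛ hK⟩
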